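/- Let $M$ be a smooth $n$-manifold (Hausdorff, second countable) and let $E\to M$ be a Courant algebroid: a smooth real vector bundle of finite rank with a smooth nondegenerate symmetric pairing $\langle\cdot,\cdot\rangle$ (of any signature), a bundle map $\rho:E\to TM$ and an $\mathbb R$-bilinear bracket on $\Gamma(E)$ such that $[e_1,[e_2,e_3]]=[[e_1,e_2],e_3]+[e_2,[e_1,e_3]]$, $\rho([e_1,e_2])=[\rho(e_1),\rho(e_2)]$, $[e_1,fe_2]=f[e_1,e_2]+(\rho(e_1)f)e_2$, $\rho(e_1)\langle e_2,e_3\rangle=\langle[e_1,e_2],e_3\rangle+\langle e_2,[e_1,e_3]\rangle$ and $[e_1,e_2]+[e_2,e_1]=\rho^*d\langle e_1,e_2\rangle$, where $\langle\rho^*df,e\rangle=\rho(e)f$. **Spinors.** A *spinor bundle* of $E$ over an open $U\subseteq M$ is a smooth $\mathbb Z/2$-graded complex vector bundle $S\to U$ with a smooth odd Clifford multiplication $c:E|_U\to\mathrm{End}(S)$, $c(a)c(b)+c(b)c(a)=\langle a,b\rangle$, whose fibres are irreducible graded modules, normalized by a smooth nondegenerate complex bilinear pairing $B$ on $S$ such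 that, for some signs $\varepsilon,\kappa\in\{\pm1\}$, $B(c(a)s,t)=\varepsilon B(s,c(a)t)$ and $B(\gamma s,\gamma t)=\kappa B(s,t)$, where $\gamma$ is the parity operator. A *half-density of spinors* is a smooth section of $S\otimes|\Lambda^nT^*U|^{1/2}$; let $\Gamma_S$ be the space of these. The pairing $B$ turns two of them into a complex density on $U$. An *isomorphism* over an open $W$ of two spinor bundles is a smooth complex linear bundle map which commutes with $c$, commutes with $\gamma$ up to a constant sign, and preserves the Gram determinants of the pairings $B$. A linear operator on $\Gamma_S$ of parity $p$ is said to *supercommute with the commutant* if it commutes up to the sign $(-1)^p$ with every local smooth odd endomorphism $\eta$ of $S$ with $\eta^2=1$ and $\eta c(a)=-c(a)\eta$ (such $\eta$ exist only if the rank of $E$ is odd). All commutators $[\cdot,\cdot]$ of operators are supercommutators. **Functions on the graded symplectic manifold.** Let $\mathcal O^p$ be the space of functions of degree $p$ on the graded symplectic manifold associated to $(E,\langle\cdot,\cdot\rangle)$. It has $\mathcal O^0=C^\infty(M)$, $\mathcal O^1=\Gamma(E)$ and a Poisson bracket of degree $-2$ with $\{e_1,e_2\}=\langle e_1,e_2\rangle$,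 $\{e,f\}=\{f,g\}=0$. An element $\varphi\in\mathcal O^p$ is given by its iterated brackets $\varphi(a_1,\dots,a_k)=\{\dots\{\{\varphi,a_1\},a_2\}\dots,a_k\}\in C^\infty(M)$ with sections (weight 1) and functions (weight 2) $a_i$ of total weight $p$; these are exactly the families which are $C^\infty(M)$-linear in the last entry if it is a section, an $\mathbb R$-linear derivation in the last entry if it is a function, symmetric under exchange of adjacent entries at least one of which is a function, and satisfy $\varphi(\dots,e,e',\dots)+\varphi(\dots,e',e,\dots)=\varphi(\dots,\langle e,e'\rangle,\dots)$. Product and Poisson bracket are computed by $\{\varphi\psi,a\}=\varphi\{\psi,a\}+(-1)^{|\psi||a|}\{\varphi,a\}\psi$ and $\{\{\varphi,\psi\},a\}=\{\varphi,\{\psi,a\}\}+(-1)^{|\psi||a|}\{\{\varphi,a\},\psi\}$. Let $\theta$ be the family with $\theta(e_1,e_2,e_3)=\langle[e_1,e_2],e_3\rangle$ and $\theta(e,f)=\theta(f,e)=\rho(e)f$. **Operators.** For a spinor bundle $S$ let $\mathcal D_p$ be the set of linear operators $A$ on $\Gamma_S$ of parity $p$ mod 2 which supercommute with the commutant and satisfy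 $[A,f]\in\mathcal D_{p-2}$ and $[A,c(e)]\in\mathcal D_{p-1}$ for all $f\in C^\infty(M)$, $e\in\Gamma(E)$ (with $\mathcal D_{p}=0$ for $p<0$). An operator $A\in\mathcal D_p$ has *symbol* $\varphi\in\mathcal O^p$ if $[\dots[[A,a_1],a_2]\dots,a_k]$ is multiplication by $\varphi(a_1,\dots,a_k)$ for all sections and functions $a_i$ of total weight $p$ (a section $e$ acting by $c(e)$). **Theorem.** 1. $\theta\in\mathcal O^3$ and $\{\theta,\theta\}=0$ (so that $\theta$ defines the associated dg symplectic manifold). 2. Every point of $M$ has a neighbourhood over which $E$ has a spinor bundle, and any two spinor bundles of $E$ are isomorphic near every point over which both are defined. 3. For every spinor bundle $S$, the operators $\mathcal D_\bullet$ quantize $\mathcal O^\bullet$: $\mathcal D_0$ consists of the multiplications by smooth complex functions on $U$, $c(e)\in\mathcal D_1$ for all $e\in\Gamma(E)$, $\mathcal D_p\subseteq\mathcal D_{p+2}$, $\mathcal D_p\mathcal D_q\subseteq\mathcal D_{p+q}$ and $[\mathcal D_p,\mathcal D_q]\subseteq\mathcal D_{p+q-2}$; every $\varphi\in\mathcal O^p$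 is the symbol of some $A\in\mathcal D_p$; if all the iterated commutators of weight $p$ of $A\in\mathcal D_p$ vanish, then $A\in\mathcal D_{p-2}$; and if $A$, $B$ have symbols $\varphi$, $\psi$ of degrees $p$, $q$, then $AB$ has symbol $\varphi\psi$ and, if $p+q\ge2$, $[A,B]$ has symbol $\{\varphi,\psi\}$. 4. For every spinor bundle $S$ there is exactly one linear operator $D=D_S$ on $\Gamma_S$ which is odd, supercommutes with the commutant, is of Dirac type, $[D,f]=c(\rho^*df)$, generates the Courant bracket and the anchor as derived brackets, $$[[D,c(e_1)],c(e_2)]=c([e_1,e_2]),\qquad [[D,c(e)],f]=\rho(e)f,$$ and is skew in the sense that $\int_M B(D\psi,\chi)=-\varepsilon\int_M B(\psi,D\chi)$ for all $\psi,\chi\in\Gamma_S$ with support in a common compact subset of $U$ contained in a coordinate chart. This operator lies in $\mathcal D_3$ and has symbol $\theta$. 5. There is a function $f\in C^\infty(M)$ such that $D_S^2=f$ (multiplication by $f$) for every spinor bundle $S$ of $E$. 6. The operators $D_S$ are canonical: they are intertwined by every isomorphism over an open set $W$ of two spinor bundles of $E$. -/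

import Mathlib

open scoped Manifold ContDiff Bundle
open Bundle TopologicalSpace

universe uM uF uE w

noncomputable section

namespace CourantDirac

/-! ## Courant algebroids -/

section Courant

variable {n : ℕ} {M : Type uM} [TopologicalSpace M] [ChartedSpace (EuclideanSpace ℝ (Fin n)) M]
  [IsManifold (𝓡 n) ∞ M]
  {F : Type uF} [NormedAddCommGroup F] [NormedSpace ℝ F]
  {E : M → Type uE} [∀ x, AddCommGroup (E x)] [∀ x, Module ℝ (E x)]
  [∀ x, TopologicalSpace (E x)] [TopologicalSpace (TotalSpace F E)] [FiberBundle F E]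
  [VectorBundle ℝ F E]

/-- The product of a smooth function and a smooth section. -/
def fsmul (f : C^∞⟮𝓡 n, M; ℝ⟯) (e : Cₛ^∞⟮𝓡 n; F, E⟯) : Cₛ^∞⟮𝓡 n; F, E⟯ :=
  ⟨fun x => f x • e x, ContMDiff.smul_section f.contMDiff e.contMDiff⟩

variable (n F E) in
/-- A Courant algebroid structure on the smooth vector bundle `E → M`: a nondegenerate symmetric
pairing, an anchor `E → TM` and a (non-skew) bracket on the smooth sections. -/
structure CourantAlgebroid where
  pairing : ∀ x, E x →ₗ[ℝ] E x →ₗ[ℝ] ℝ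
  pairing_symm : ∀ x a b, pairing x a b = pairing x b a
  pairing_nondegenerate : ∀ x, (pairing x).Nondegenerate
  pairing_smooth : ∀ e₁ e₂ : Cₛ^∞⟮𝓡 n; F, E⟯,
    ContMDiff (𝓡 n) 𝓘(ℝ, ℝ) ∞ (fun x => pairing x (e₁ x) (e₂ x))
  anchor : ∀ x, E x →ₗ[ℝ] TangentSpace (𝓡 n) x
  anchor_smooth : ∀ e : Cₛ^∞⟮𝓡 n; F, E⟯,
    ContMDiff (𝓡 n) ((𝓡 n).prod 𝓘(ℝ, EuclideanSpace ℝ (Fin n))) ∞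
      (fun x => (⟨x, anchor x (e x)⟩ : TangentBundle (𝓡 n) M))
  bracket : Cₛ^∞⟮𝓡 n; F, E⟯ →ₗ[ℝ] Cₛ^∞⟮𝓡 n; F, E⟯ →ₗ[ℝ] Cₛ^∞⟮𝓡 n; F, E⟯
  jacobi : ∀ e₁ e₂ e₃,
    bracket e₁ (bracket e₂ e₃) = bracket (bracket e₁ e₂) e₃ + bracket e₂ (bracket e₁ e₃)
  anchor_bracket : ∀ (e₁ e₂ : Cₛ^∞⟮𝓡 n; F, E⟯) (x : M),
    anchor x (bracket e₁ e₂ x) =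
      VectorField.mlieBracket (𝓡 n) (fun y => anchor y (e₁ y)) (fun y => anchor y (e₂ y)) x
  leibniz : ∀ (e₁ e₂ : Cₛ^∞⟮𝓡 n; F, E⟯) (f : C^∞⟮𝓡 n, M; ℝ⟯) (x : M),
    bracket e₁ (fsmul f e₂) x =
      f x • bracket e₁ e₂ x + mvfderiv (𝓡 n) f x (anchor x (e₁ x)) • e₂ x
  invariance : ∀ (e₁ e₂ e₃ : Cₛ^∞⟮𝓡 n; F, E⟯) (x : M),
    mvfderiv (𝓡 n) (fun y => pairing y (e₂ y) (e₃ y)) x (anchor x (e₁ x)) =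
      pairing x (bracket e₁ e₂ x) (e₃ x) + pairing x (e₂ x) (bracket e₁ e₃ x)
  /-- `[e₁, e₂] + [e₂, e₁] = ρ* d⟨e₁, e₂⟩` -/
  symmetric_part : ∀ (e₁ e₂ e₃ : Cₛ^∞⟮𝓡 n; F, E⟯) (x : M),
    pairing x (bracket e₁ e₂ x + bracket e₂ e₁ x) (e₃ x) =
      mvfderiv (𝓡 n) (fun y => pairing y (e₁ y) (e₂ y)) x (anchor x (e₃ x))

/-- The derivative of a smooth function along a smooth vector field is smooth. -/
theorem contMDiff_derivative (f : C^∞⟮𝓡 n, M; ℝ⟯)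
    (X : ∀ x : M, TangentSpace (𝓡 n) x)
    (hX : ContMDiff (𝓡 n) ((𝓡 n).prod 𝓘(ℝ, EuclideanSpace ℝ (Fin n))) ∞
      (fun x => (⟨x, X x⟩ : TangentBundle (𝓡 n) M))) :
    ContMDiff (𝓡 n) 𝓘(ℝ, ℝ) ∞ (fun x => mvfderiv (𝓡 n) f x (X x)) := by
  have h1 : ContMDiff (𝓡 n).tangent 𝓘(ℝ, ℝ).tangent ∞ (tangentMap (𝓡 n) 𝓘(ℝ, ℝ) f) :=
    f.contMDiff.contMDiff_tangentMap le_rfl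
  have h2 := h1.comp hX
  have h3 := (contMDiff_snd_tangentBundle_modelSpace ℝ 𝓘(ℝ, ℝ) (n := ∞)).comp h2
  exact h3

namespace CourantAlgebroid

variable (𝒞 : CourantAlgebroid n F E)

/-- The function `⟨e₁, e₂⟩`. -/
def inner (e₁ e₂ : Cₛ^∞⟮𝓡 n; F, E⟯) : C^∞⟮𝓡 n, M; ℝ⟯ :=
  ⟨fun x => 𝒞.pairing x (e₁ x) (e₂ x), 𝒞.pairing_smooth e₁ e₂⟩

/-- The function `ρ(e) f`. -/
def lie (e : Cₛ^∞⟮𝓡 n; F, E⟯) (f : C^∞⟮𝓡 n, M; ℝ⟯) :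
    C^∞⟮𝓡 n, M; ℝ⟯ :=
  ⟨fun x => mvfderiv (𝓡 n) f x (𝒞.anchor x (e x)), contMDiff_derivative f _ (𝒞.anchor_smooth e)⟩

end CourantAlgebroid

/-! ## Functions on the associated dg symplectic manifold

The graded symplectic manifold of `(E, ⟨,⟩)` (minimal symplectic realization of `E[1]`) has the
functions `f ∈ C^∞(M)` in degree 0, the sections `e ∈ Γ(E)` in degree 1, and a Poisson bracket of
degree `-2` with `{e₁, e₂} = ⟨e₁, e₂⟩`, `{e, f} = 0`, `{f, g} = 0`. A function `φ` of degree `p` is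
recorded by its iterated brackets `{…{{φ, a₁}, a₂}…, a_k} ∈ C^∞(M)` with sections and functions
`a_i` of total weight `p`, where sections have weight `1` and functions weight `2`. -/

variable (n F E) in
/-- A letter: a section of `E` or a function on `M`. -/
abbrev Letter := Cₛ^∞⟮𝓡 n; F, E⟯ ⊕ C^∞⟮𝓡 n, M; ℝ⟯

/-- The weight of a letter: the amount by which `{·, a}` lowers the degree. -/
def Letter.weight : Letter (M := M) n F E → ℕ
  | Sum.inl _ => 1
  | Sum.inr _ => 2

/-- The weight of a word. -/
def wordWeight (u : List (Letter n F E)) : ℕ := (u.map Letter.weight).sum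

variable (n F E) in
/-- Families of smooth functions indexed by words. -/
abbrev Cochain := List (Letter n F E) → C^∞⟮𝓡 n, M; ℝ⟯

namespace CourantAlgebroid

variable (𝒞 : CourantAlgebroid n F E)

open Sum in
/-- `φ` is (the family of iterated brackets of) a function of degree `p` on the graded symplectic
manifold of `(E, ⟨,⟩)`. -/
structure IsGradedFunction (p : ℕ) (φ : Cochain n F E) : Prop where
  supported : ∀ u, wordWeight u ≠ p → φ u = 0
  add_section : ∀ u e e', φ (u ++ [inl (e + e')]) = φ (u ++ [inl e]) + φ (u ++ [inl e'])
  smul_section : ∀ u (f : C^∞⟮𝓡 n, M; ℝ⟯) (e : Cₛ^∞⟮𝓡 n; F, E⟯),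
    φ (u ++ [inl (fsmul f e)]) = f * φ (u ++ [inl e])
  add_function : ∀ u f g, φ (u ++ [inr (f + g)]) = φ (u ++ [inr f]) + φ (u ++ [inr g])
  const_smul_function : ∀ u (c : ℝ) f, φ (u ++ [inr (c • f)]) = c • φ (u ++ [inr f])
  mul_function : ∀ u f g, φ (u ++ [inr (f * g)]) = f * φ (u ++ [inr g]) + g * φ (u ++ [inr f])
  swap_sections : ∀ u v e e', φ (u ++ inl e :: inl e' :: v) + φ (u ++ inl e' :: inl e :: v) =
    φ (u ++ inr (𝒞.inner e e') :: v)
  swap_section_function : ∀ u v e f, φ (u ++ inl e :: inr f :: v) = φ (u ++ inr f :: inl e :: v)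
  swap_functions : ∀ u v f g, φ (u ++ inr f :: inr g :: v) = φ (u ++ inr g :: inr f :: v)

open Classical in
/-- The section `α` with `φ(e) = ⟨α, e⟩` for all `e` (the degree one part of `φ`). -/
def sharp (φ : Cochain n F E) : Cₛ^∞⟮𝓡 n; F, E⟯ :=
  if h : ∃ α, ∀ e, φ [Sum.inl e] = 𝒞.inner α e then h.choose else 0

end CourantAlgebroid

/-- The product of graded functions `φ` and `ψ`, where `ψ` has degree `q`, computed with
`{φψ, a} = φ {ψ, a} + (-1)^{q|a|} {φ, a} ψ`. -/
def gradedMul : ℕ → Cochain n F E → Cochain n F E → Cochain n F E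
  | _, φ, ψ, [] => φ [] * ψ []
  | q, φ, ψ, a :: u =>
    gradedMul (q + a.weight) φ (fun v => ψ (a :: v)) u +
      (-1) ^ (q * a.weight) * gradedMul q (fun v => φ (a :: v)) ψ u

/-- The Poisson bracket of graded functions `φ` and `ψ`, where `ψ` has degree `q`, computed with
`{{φ, ψ}, a} = {φ, {ψ, a}} + (-1)^{q|a|} {{φ, a}, ψ}`, which reduces it to the brackets
`{φ, f} = φ(f)`, `{f, ψ} = -ψ(f)` and `{α, β} = ⟨α, β⟩`. -/
def CourantAlgebroid.poisson (𝒞 : CourantAlgebroid n F E) :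
    ℕ → Cochain n F E → Cochain n F E → Cochain n F E
  | _, φ, ψ, [] => φ [Sum.inr (ψ [])] - ψ [Sum.inr (φ [])] + 𝒞.inner (𝒞.sharp φ) (𝒞.sharp ψ)
  | q, φ, ψ, a :: u =>
    𝒞.poisson (q + a.weight) φ (fun v => ψ (a :: v)) u +
      (-1) ^ (q * a.weight) * 𝒞.poisson q (fun v => φ (a :: v)) ψ u

/-- The degree 3 function `θ` of the Courant algebroid: `{{{θ, e₁}, e₂}, e₃} = ⟨[e₁, e₂], e₃⟩`
and `{{θ, e}, f} = {{θ, f}, e} = ρ(e) f`. -/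
def CourantAlgebroid.theta (𝒞 : CourantAlgebroid n F E) : Cochain n F E
  | [Sum.inl e₁, Sum.inl e₂, Sum.inl e₃] => 𝒞.inner (𝒞.bracket e₁ e₂) e₃
  | [Sum.inl e, Sum.inr f] => 𝒞.lie e f
  | [Sum.inr f, Sum.inl e] => 𝒞.lie e f
  | _ => 0

end Courant

/-! ## Half-densities of spinors -/

section Spinor

variable {n : ℕ} {M : Type uM} [TopologicalSpace M] [ChartedSpace (EuclideanSpace ℝ (Fin n)) M]
  [IsManifold (𝓡 n) ∞ M]
  {F : Type uF} [NormedAddCommGroup F] [NormedSpace ℝ F]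
  {E : M → Type uE} [∀ x, AddCommGroup (E x)] [∀ x, Module ℝ (E x)]
  [∀ x, TopologicalSpace (E x)] [TopologicalSpace (TotalSpace F E)] [FiberBundle F E]
  [VectorBundle ℝ F E]

/-- A spinor bundle of `E` over an open set `U ⊆ M`: a smooth complex vector bundle `S → U` with
a ℤ/2-grading, fibrewise an irreducible graded module of the Clifford algebra of `E` (with
`c(a) c(b) + c(b) c(a) = ⟨a, b⟩`), normalized by a nondegenerate homogeneous complex bilinear
pairing for which Clifford multiplication is self-adjoint up to a sign. -/
structure SpinorBundle (𝒞 : CourantAlgebroid n F E) where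
  U : Opens M
  V : Type w
  S : U → Type w
  [instV : NormedAddCommGroup V]
  [instVR : NormedSpace ℝ V]
  [instVfin : FiniteDimensional ℝ V]
  [instS : ∀ x, AddCommGroup (S x)]
  [instSC : ∀ x, Module ℂ (S x)]
  [instStop : ∀ x, TopologicalSpace (S x)]
  [instTot : TopologicalSpace (TotalSpace V S)]
  [instFB : FiberBundle V S]
  [instVB : VectorBundle ℝ V S]
  [instSmooth : ContMDiffVectorBundle ∞ V S (𝓡 n)]
  /-- multiplication by `i` is smooth -/
  smooth_I : ∀ (s : ∀ x, S x) (x : U),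
    ContMDiffAt (𝓡 n) ((𝓡 n).prod 𝓘(ℝ, V)) ∞ (fun y => TotalSpace.mk' V y (s y)) x →
    ContMDiffAt (𝓡 n) ((𝓡 n).prod 𝓘(ℝ, V)) ∞ (fun y => TotalSpace.mk' V y (Complex.I • s y)) x
  /-- Clifford multiplication -/
  cliff : ∀ x : U, E x →ₗ[ℝ] S x →ₗ[ℂ] S x
  cliff_sq : ∀ (x : U) (a : E x) (s : S x),
    cliff x a (cliff x a s) = ((𝒞.pairing x a a / 2 : ℝ) : ℂ) • s
  smooth_cliff : ∀ (e : Cₛ^∞⟮𝓡 n; F, E⟯) (s : ∀ x, S x) (x : U),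
    ContMDiffAt (𝓡 n) ((𝓡 n).prod 𝓘(ℝ, V)) ∞ (fun y => TotalSpace.mk' V y (s y)) x →
    ContMDiffAt (𝓡 n) ((𝓡 n).prod 𝓘(ℝ, V)) ∞
      (fun y => TotalSpace.mk' V y (cliff y (e y) (s y))) x
  /-- the parity operator of the grading, `1` on even and `-1` on odd spinors -/
  parity : ∀ x : U, S x →ₗ[ℂ] S x
  parity_sq : ∀ x s, parity x (parity x s) = s
  parity_cliff : ∀ (x : U) (a : E x) (s : S x),
    parity x (cliff x a s) = -cliff x a (parity x s)
  smooth_parity : ∀ (s : ∀ x, S x) (x : U),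
    ContMDiffAt (𝓡 n) ((𝓡 n).prod 𝓘(ℝ, V)) ∞ (fun y => TotalSpace.mk' V y (s y)) x →
    ContMDiffAt (𝓡 n) ((𝓡 n).prod 𝓘(ℝ, V)) ∞ (fun y => TotalSpace.mk' V y (parity y (s y))) x
  nontrivial : ∀ x, Nontrivial (S x)
  irreducible : ∀ (x : U) (W : Submodule ℂ (S x)), (∀ s ∈ W, parity x s ∈ W) →
    (∀ (a : E x), ∀ s ∈ W, cliff x a s ∈ W) → W = ⊥ ∨ W = ⊤
  /-- the normalizing pairing -/
  form : ∀ x : U, S x →ₗ[ℂ] S x →ₗ[ℂ] ℂ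
  form_nondegenerate : ∀ x, (form x).Nondegenerate
  smooth_form : ∀ (s t : ∀ x, S x) (x : U),
    ContMDiffAt (𝓡 n) ((𝓡 n).prod 𝓘(ℝ, V)) ∞ (fun y => TotalSpace.mk' V y (s y)) x →
    ContMDiffAt (𝓡 n) ((𝓡 n).prod 𝓘(ℝ, V)) ∞ (fun y => TotalSpace.mk' V y (t y)) x →
    ContMDiffAt (𝓡 n) 𝓘(ℝ, ℂ) ∞ (fun y => form y (s y) (t y)) x
  sign : ℤˣ
  form_cliff : ∀ (x : U) (a : E x) (s t : S x),
    form x (cliff x a s) t = ((sign : ℤ) : ℂ) * form x s (cliff x a t)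
  formParity : ℤˣ
  form_parity : ∀ (x : U) (s t : S x),
    form x (parity x s) (parity x t) = ((formParity : ℤ) : ℂ) * form x s t

attribute [instance] SpinorBundle.instV SpinorBundle.instVR SpinorBundle.instVfin
  SpinorBundle.instS SpinorBundle.instSC
  SpinorBundle.instStop SpinorBundle.instTot SpinorBundle.instFB SpinorBundle.instVB
  SpinorBundle.instSmooth

/-- The coordinate frame `∂/∂x¹, …, ∂/∂xⁿ` of a chart at `x`. -/
def coordFrame (κ : OpenPartialHomeomorph M (EuclideanSpace ℝ (Fin n))) (x : M) (i : Fin n) :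
    TangentSpace (𝓡 n) x :=
  (mfderiv (𝓡 n) (𝓡 n) κ x).inverse (EuclideanSpace.single i (1 : ℝ))

namespace SpinorBundle

variable {𝒞 : CourantAlgebroid n F E} (P : SpinorBundle.{uM, uF, uE, w} 𝒞)

/-- Smoothness at `x` of a section of the spinor bundle. -/
def SmoothAt (s : ∀ x, P.S x) (x : P.U) : Prop :=
  ContMDiffAt (𝓡 n) ((𝓡 n).prod 𝓘(ℝ, P.V)) ∞ (fun y => TotalSpace.mk' P.V y (s y)) x

variable {P} in
theorem SmoothAt.complex_smul {s : ∀ x, P.S x} {x : P.U} (hs : P.SmoothAt s x) (c : ℂ) :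
    P.SmoothAt (fun y => c • s y) x := by
  have h1 : P.SmoothAt (c.re • s) x := ContMDiffAt.const_smul_section hs
  have h2 : P.SmoothAt (c.im • fun y => Complex.I • s y) x :=
    ContMDiffAt.const_smul_section (P.smooth_I s x hs)
  have h3 : P.SmoothAt ((c.re • s) + (c.im • fun y => Complex.I • s y)) x :=
    ContMDiffAt.add_section h1 h2
  have : (fun y => c • s y) = ((c.re • s) + (c.im • fun y => Complex.I • s y)) := by
    funext y
    simp only [Pi.add_apply, Pi.smul_apply]
    conv_lhs => rw [← Complex.re_add_im c, add_smul, mul_smul]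
    rw [Complex.coe_smul, Complex.coe_smul]
  rw [this]
  exact h3

/-- The half-densities of spinors: smooth half-densities on `U` with values in `S`. At `x` such an
object assigns a spinor `ψ x v` to every `n`-tuple `v` of tangent vectors, with
`ψ x (A v) = |det A|^{1/2} ψ x v`; in local coordinates it is `s |dx|^{1/2}` with `s` a smooth
section of `S`. -/
def HalfDensities : Submodule ℂ (∀ x : P.U, (Fin n → TangentSpace (𝓡 n) (x : M)) → P.S x) where
  carrier := {ψ |
    (∀ (x : P.U) (A : TangentSpace (𝓡 n) (x : M) →ₗ[ℝ] TangentSpace (𝓡 n) (x : M))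
      (v : Fin n → TangentSpace (𝓡 n) (x : M)),
      ψ x (fun i => A (v i)) = ((Real.sqrt |LinearMap.det A| : ℝ) : ℂ) • ψ x v) ∧
    ∀ κ ∈ IsManifold.maximalAtlas (𝓡 n) ∞ M, ∀ x : P.U, (x : M) ∈ κ.source →
      P.SmoothAt (fun y => ψ y (coordFrame κ y)) x}
  zero_mem' := by
    refine ⟨fun x A v => by simp, fun κ _ x _ => ?_⟩
    exact contMDiff_zeroSection ℝ P.S x
  add_mem' := by
    rintro ψ χ ⟨h1, h2⟩ ⟨h1', h2'⟩
    refine ⟨fun x A v => ?_, fun κ hκ x hx => ?_⟩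
    · simp [h1, h1']
    · exact ContMDiffAt.add_section (h2 κ hκ x hx) (h2' κ hκ x hx)
  smul_mem' := by
    rintro c ψ ⟨h1, h2⟩
    refine ⟨fun x A v => ?_, fun κ hκ x hx => ?_⟩
    · simp only [Pi.smul_apply, h1]; rw [smul_comm]
    · exact (h2 κ hκ x hx).complex_smul c

/-- The linear operators on half-densities of spinors. -/
abbrev Op := Module.End ℂ P.HalfDensities

/-- Clifford multiplication by a section of `E`. -/
def c (e : Cₛ^∞⟮𝓡 n; F, E⟯) : P.Op where
  toFun ψ := ⟨fun x v => P.cliff x (e x) (ψ.1 x v),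
    fun x A v => by simp [ψ.2.1 x A v],
    fun κ hκ x hx => P.smooth_cliff e _ x (ψ.2.2 κ hκ x hx)⟩
  map_add' ψ χ := by ext; simp
  map_smul' a ψ := by ext; simp

/-- Multiplication by a smooth function on `M`. -/
def m (f : C^∞⟮𝓡 n, M; ℝ⟯) : P.Op where
  toFun ψ := ⟨fun x v => f x • ψ.1 x v,
    fun x A v => by beta_reduce; rw [ψ.2.1 x A v, smul_comm],
    fun κ hκ x hx => ContMDiffAt.smul_section
      ((f.contMDiff.comp contMDiff_subtype_val) x) (ψ.2.2 κ hκ x hx)⟩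
  map_add' ψ χ := by ext; simp
  map_smul' a ψ := Subtype.ext (funext fun x => funext fun v => smul_comm _ _ _)

/-- The parity operator. -/
def γ : P.Op where
  toFun ψ := ⟨fun x v => P.parity x (ψ.1 x v),
    fun x A v => by simp [ψ.2.1 x A v],
    fun κ hκ x hx => P.smooth_parity _ x (ψ.2.2 κ hκ x hx)⟩
  map_add' ψ χ := by ext; simp
  map_smul' a ψ := by ext; simp

/-- `A` is homogeneous of parity `p` mod 2. -/
def HasParity (p : ℕ) (A : P.Op) : Prop := P.γ * A = (-1) ^ p * (A * P.γ)

/-- A local section `η` over `W` of the supercommutant of the Clifford algebra which is odd and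
normalized by `η² = 1`. (If `E` has even rank there is none over a nonempty open subset of `U`; if
`E` has odd rank it exists locally and is unique up to sign.) -/
structure IsOddCommutant (W : Opens M) (η : ∀ x : P.U, P.S x →ₗ[ℂ] P.S x) : Prop where
  smooth : ∀ s (x : P.U), (x : M) ∈ W → P.SmoothAt s x → P.SmoothAt (fun y => η y (s y)) x
  sq : ∀ x : P.U, (x : M) ∈ W → ∀ s, η x (η x s) = s
  parity : ∀ x : P.U, (x : M) ∈ W → ∀ s, P.parity x (η x s) = -η x (P.parity x s)
  cliff : ∀ x : P.U, (x : M) ∈ W → ∀ a s, η x (P.cliff x a s) = -P.cliff x a (η x s)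

/-- The operator `A` of parity `p` supercommutes with the supercommutant of the Clifford
algebra. -/
def CommutesWithCommutant (p : ℕ) (A : P.Op) : Prop :=
  ∀ (W : Opens M) (η : ∀ x : P.U, P.S x →ₗ[ℂ] P.S x), P.IsOddCommutant W η →
    ∀ ψ χ : P.HalfDensities, (∀ x : P.U, (x : M) ∈ W → ∀ v, χ.1 x v = η x (ψ.1 x v)) →
      ∀ x : P.U, (x : M) ∈ W → ∀ v, (A χ).1 x v = (-1 : ℂ) ^ p • η x ((A ψ).1 x v)

/-- The operator defined by a letter. -/
def letterOp : Letter n F E → P.Op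
  | Sum.inl e => P.c e
  | Sum.inr f => P.m f

/-- The supercommutator of operators of parities `p` and `q`. -/
def sbr (p q : ℕ) (A B : P.Op) : P.Op := A * B - (-1) ^ (p * q) * (B * A)

/-- The differential operators of order at most `p` and parity `p`, in the filtration where
functions have order 0, sections of `E` order 1 and covariant derivatives order 2. -/
def Filt : ℕ → Set P.Op
  | 0 => {A | P.HasParity 0 A ∧ P.CommutesWithCommutant 0 A ∧
      (∀ f, P.sbr 0 0 A (P.m f) = 0) ∧ ∀ e, P.sbr 0 1 A (P.c e) = 0}
  | 1 => {A | P.HasParity 1 A ∧ P.CommutesWithCommutant 1 A ∧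
      (∀ f, P.sbr 1 0 A (P.m f) = 0) ∧ ∀ e, P.sbr 1 1 A (P.c e) ∈ Filt 0}
  | p + 2 => {A | P.HasParity p A ∧ P.CommutesWithCommutant p A ∧
      (∀ f, P.sbr p 0 A (P.m f) ∈ Filt p) ∧ ∀ e, P.sbr p 1 A (P.c e) ∈ Filt (p + 1)}

/-- The iterated supercommutator `[…[[A, a₁], a₂]…, a_k]`, where `A` has parity `p`. -/
def iterSbr : ℕ → P.Op → List (Letter n F E) → P.Op
  | _, A, [] => A
  | p, A, a :: u => iterSbr (p + a.weight) (P.sbr p a.weight A (P.letterOp a)) u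

/-- `A` is an operator of order `p` whose symbol is the graded function `φ`. -/
def HasSymbol (p : ℕ) (A : P.Op) (φ : Cochain n F E) : Prop :=
  A ∈ P.Filt p ∧ 𝒞.IsGradedFunction p φ ∧
    ∀ u, wordWeight u = p → P.iterSbr p A u = P.m (φ u)

open Classical in
/-- The density `⟨ψ, χ⟩` in the coordinates of the chart `κ`, extended by zero outside `U`. -/
def density (κ : OpenPartialHomeomorph M (EuclideanSpace ℝ (Fin n))) (ψ χ : P.HalfDensities)
    (x : M) : ℂ :=
  if h : x ∈ P.U then
    P.form ⟨x, h⟩ (ψ.1 ⟨x, h⟩ (coordFrame κ x)) (χ.1 ⟨x, h⟩ (coordFrame κ x))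
  else 0

/-- `∫ ⟨Aψ, χ⟩ = δ ∫ ⟨ψ, Aχ⟩` for all `ψ`, `χ` with compact support in a coordinate chart. -/
def HasFormalTranspose (δ : ℂ) (A : P.Op) : Prop :=
  ∀ κ ∈ IsManifold.maximalAtlas (𝓡 n) ∞ M, ∀ K : Set M, IsCompact K → K ⊆ κ.source → K ⊆ P.U →
    ∀ ψ χ : P.HalfDensities, (∀ x : P.U, (x : M) ∉ K → ∀ v, ψ.1 x v = 0 ∧ χ.1 x v = 0) →
      ∫ y in κ.target, P.density κ (A ψ) χ (κ.symm y) =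
        δ * ∫ y in κ.target, P.density κ ψ (A χ) (κ.symm y)

/-- The generating Dirac operator: an odd operator of Dirac type (its principal symbol is Clifford
multiplication by `ρ* df`) whose derived brackets are the Courant bracket and the anchor, and
which is skew for the pairing of half-densities (in the graded sense: if Clifford multiplication
is `ε`-self-adjoint, the transpose of the operator is `-ε` times itself). -/
structure IsGeneratingDirac (D : P.Op) : Prop where
  odd : P.HasParity 1 D
  commutant : P.CommutesWithCommutant 1 D
  dirac_type : ∀ f, ∃ α, (∀ e, 𝒞.inner α e = 𝒞.lie e f) ∧ D * P.m f - P.m f * D = P.c α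
  derived_bracket : ∀ e₁ e₂, (D * P.c e₁ + P.c e₁ * D) * P.c e₂ -
    P.c e₂ * (D * P.c e₁ + P.c e₁ * D) = P.c (𝒞.bracket e₁ e₂)
  derived_anchor : ∀ e f, (D * P.c e + P.c e * D) * P.m f -
    P.m f * (D * P.c e + P.c e * D) = P.m (𝒞.lie e f)
  skew : P.HasFormalTranspose (-((P.sign : ℤ) : ℂ)) D

/-- The filtered algebra of differential operators on half-densities of spinors is a quantization
of the graded Poisson algebra of functions on the graded symplectic manifold of `E`. -/
structure IsQuantization : Prop where
  order_zero : ∀ A, A ∈ P.Filt 0 ↔ ∃ h : C^∞⟮𝓡 n, P.U; 𝓘(ℝ, ℂ), ℂ⟯,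
    ∀ (ψ : P.HalfDensities) x v, (A ψ).1 x v = h x • ψ.1 x v
  order_one : ∀ e, P.c e ∈ P.Filt 1
  increasing : ∀ p, P.Filt p ⊆ P.Filt (p + 2)
  mul_mem : ∀ p q, ∀ A ∈ P.Filt p, ∀ B ∈ P.Filt q, A * B ∈ P.Filt (p + q)
  sbr_mem : ∀ p q r, p + q = r + 2 → ∀ A ∈ P.Filt p, ∀ B ∈ P.Filt q, P.sbr p q A B ∈ P.Filt r
  sbr_eq_zero : ∀ p q, p + q < 2 → ∀ A ∈ P.Filt p, ∀ B ∈ P.Filt q, P.sbr p q A B = 0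
  /-- every graded function is the symbol of an operator -/
  symbol_surjective : ∀ p φ, 𝒞.IsGradedFunction p φ → ∃ A, P.HasSymbol p A φ
  /-- operators with zero symbol are of lower order -/
  symbol_injective : ∀ p, ∀ A ∈ P.Filt p, (∀ u, wordWeight u = p → P.iterSbr p A u = 0) →
    (p < 2 → A = 0) ∧ ∀ r, p = r + 2 → A ∈ P.Filt r
  symbol_mul : ∀ p q A B φ ψ, P.HasSymbol p A φ → P.HasSymbol q B ψ →
    P.HasSymbol (p + q) (A * B) (gradedMul q φ ψ)
  symbol_sbr : ∀ p q r A B φ ψ, p + q = r + 2 → P.HasSymbol p A φ → P.HasSymbol q B ψ →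
    P.HasSymbol r (P.sbr p q A B) (𝒞.poisson q φ ψ)

/-- An isomorphism over `W` of two spinor bundles: it intertwines Clifford multiplications,
preserves or reverses the parity, and preserves the normalizations of the determinant lines given
by the Gram determinants of the pairings. -/
structure IsLocalIso (P P' : SpinorBundle.{uM, uF, uE, w} 𝒞) (W : Opens M)
    (g : ∀ (x : M) (h : x ∈ P.U) (h' : x ∈ P'.U), P.S ⟨x, h⟩ →ₗ[ℂ] P'.S ⟨x, h'⟩) : Prop where
  left : W ≤ P.U
  right : W ≤ P'.U
  smooth : ∀ (s : ∀ x, P.S x) (s' : ∀ x, P'.S x),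
    (∀ x (hx : x ∈ W), s' ⟨x, right hx⟩ = g x (left hx) (right hx) (s ⟨x, left hx⟩)) →
    ∀ x (hx : x ∈ W), P.SmoothAt s ⟨x, left hx⟩ → P'.SmoothAt s' ⟨x, right hx⟩
  cliff : ∀ x (hx : x ∈ W) (a : E x) s, g x (left hx) (right hx) (P.cliff ⟨x, left hx⟩ a s) =
    P'.cliff ⟨x, right hx⟩ a (g x (left hx) (right hx) s)
  parity : ∃ τ : ℤˣ, ∀ x (hx : x ∈ W) s,
    g x (left hx) (right hx) (P.parity ⟨x, left hx⟩ s) =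
      ((τ : ℤ) : ℂ) • P'.parity ⟨x, right hx⟩ (g x (left hx) (right hx) s)
  gram : ∀ x (hx : x ∈ W) (N : ℕ) (b : Module.Basis (Fin N) ℂ (P.S ⟨x, left hx⟩)),
    (Matrix.of fun i j => P'.form ⟨x, right hx⟩ (g x (left hx) (right hx) (b i))
      (g x (left hx) (right hx) (b j))).det =
    (Matrix.of fun i j => P.form ⟨x, left hx⟩ (b i) (b j)).det

end SpinorBundle

end Spinor

end CourantDirac

end

open CourantDirac

noncomputable section

set_option linter.unusedSectionVars false

namespace CourantDirac

/-! ### Leibniz and Jacobi rules for supercommutators in a ring. -/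

section SuperRing

variable {R : Type*} [Ring R]

/-! A graded function is a family of iterated Poisson brackets, and an operator is probed by its
iterated supercommutators with Clifford multiplications and functions. Supercommutators obey the
same Leibniz and Jacobi rules by which products and Poisson brackets of graded functions are
computed, so symbols multiply and bracket correctly by induction on the word (`Sym.mul`, `Sym.sbr`).
The inductions end in Schur's lemma: an operator commuting with functions, sections and the parity
is a multiplication (`exists_scalar`), and an odd operator which commutes with functions,
anticommutes with sections and supercommutes with the commutant vanishes (`eq_zero_of_filt_one`).

The local analysis takes place in constant frames. Near every point `E` has an orthonormal frame,
and a spinor bundle has a frame in which Clifford multiplication by the orthonormal frame, the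
parity and the pairing are constant (`exists_spinorFrame_restrict`); it is found by averaging over
the generators and rescaling. Differentiating coefficients in such a frame gives operators of order
two with an explicit transpose (`LocalFrame.transposed_D`). That every graded function is a symbol
rests on Euler's identity `Flat.euler_eq`: a function `φ` of degree `p` satisfies `p φ = ∑ ε_i {φ,
e_i} e_i + 2 ∑ {φ, x_k} p_k`, which expresses it through functions of lower degree and the symbols
of `c(e_i)` and of the derivatives. A partition of unity globalizes (`exists_operator`). The
construction also provides formal transposes, and locally the same formula in all constant frames.

The Courant axioms say that `θ` is a graded function of degree three with `{θ, θ} = 0`; the latter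
combines `ρ ρ* = 0`, the homomorphism property of the anchor and the Jacobi identity. A generating
Dirac operator is the same thing as a skew operator with symbol `θ`. It exists because half the
difference of an operator and its graded transpose is skew with the same symbol (`exists_skew`). It
is unique because two of them differ by a skew operator `X` of order one, and these vanish
(`Skew.eq_zero`): `[X, c(e)]` is a function equal to minus its transpose. The same mechanism makes
`D²` a scalar. As `{θ, θ} = 0`, it has order two, and it is its own transpose, so its commutators
with functions and sections are skew of order zero and one.

By uniqueness `D` is given near a point by a formula common to all constant frames, so it commutes
with constant real linear maps of coefficients that intertwine the Clifford actions
(`dirac_natural`). An isomorphism preserving Gram determinants is such a map near each point, by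
Schur's lemma and the discreteness of roots of unity. Semilinear intertwiners (`exists_intertwiner`)
compare the scalars `D²`: linear ones show that they do not depend on the bundle, conjugate-linear
ones that they are real. -/

theorem superDerivation_mul (p q r : ℕ) (A B C : R) :
    A * B * C - (-1) ^ ((p + q) * r) * (C * (A * B)) =
      A * (B * C - (-1) ^ (q * r) * (C * B)) +
        (-1) ^ (q * r) * ((A * C - (-1) ^ (p * r) * (C * A)) * B) := by
  simp only [add_mul, pow_add]
  -- Only the parities of the exponents matter, so finitely many sign patterns remain, each an
  -- identity in a noncommutative ring.
  rcases neg_one_pow_eq_or R (p * r) with h | h <;>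
  rcases neg_one_pow_eq_or R (q * r) with h' | h' <;> rw [h, h'] <;> noncomm_ring

theorem superJacobi (p q r : ℕ) (A B C : R) :
    (A * B - (-1) ^ (p * q) * (B * A)) * C -
        (-1) ^ ((p + q) * r) * (C * (A * B - (-1) ^ (p * q) * (B * A))) =
      A * (B * C - (-1) ^ (q * r) * (C * B)) -
          (-1) ^ (p * (q + r)) * ((B * C - (-1) ^ (q * r) * (C * B)) * A) +
        (-1) ^ (q * r) * ((A * C - (-1) ^ (p * r) * (C * A)) * B -
          (-1) ^ ((p + r) * q) * (B * (A * C - (-1) ^ (p * r) * (C * A)))) := by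
  simp only [add_mul, mul_add, pow_add, mul_comm r q]
  rcases neg_one_pow_eq_or R (p * r) with h | h <;>
  rcases neg_one_pow_eq_or R (p * q) with h'' | h'' <;>
  rcases neg_one_pow_eq_or R (q * r) with h' | h' <;> rw [h, h', h''] <;> noncomm_ring

end SuperRing

section OperatorAlgebra

variable {n : ℕ} {M : Type uM} [TopologicalSpace M] [ChartedSpace (EuclideanSpace ℝ (Fin n)) M]
  [IsManifold (𝓡 n) ∞ M]
  {F : Type uF} [NormedAddCommGroup F] [NormedSpace ℝ F]
  {E : M → Type uE} [∀ x, AddCommGroup (E x)] [∀ x, Module ℝ (E x)]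
  [∀ x, TopologicalSpace (E x)] [TopologicalSpace (TotalSpace F E)] [FiberBundle F E]
  [VectorBundle ℝ F E]

/-! ## The filtered algebra of operators -/

namespace SpinorBundle

variable {𝒞 : CourantAlgebroid n F E} (P : SpinorBundle.{uM, uF, uE, w} 𝒞)

instance : Ring P.Op := inferInstanceAs (Ring (Module.End ℂ P.HalfDensities))

theorem ext_op {A B : P.Op} (h : ∀ ψ x v, (A ψ).1 x v = (B ψ).1 x v) : A = B :=
  LinearMap.ext fun ψ => Subtype.ext (funext fun x => funext fun v => h ψ x v)

@[simp] theorem add_val (ψ χ : P.HalfDensities) (x v) : (ψ + χ).1 x v = ψ.1 x v + χ.1 x v := rfl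
@[simp] theorem sub_val (ψ χ : P.HalfDensities) (x v) : (ψ - χ).1 x v = ψ.1 x v - χ.1 x v := rfl
@[simp] theorem neg_val (ψ : P.HalfDensities) (x v) : (-ψ).1 x v = -ψ.1 x v := rfl
@[simp] theorem zero_val (x v) : (0 : P.HalfDensities).1 x v = 0 := rfl
@[simp] theorem smul_val (c : ℂ) (ψ : P.HalfDensities) (x v) : (c • ψ).1 x v = c • ψ.1 x v := rfl
@[simp] theorem c_val (e) (ψ : P.HalfDensities) (x v) :
    (P.c e ψ).1 x v = P.cliff x (e x) (ψ.1 x v) := rfl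
@[simp] theorem m_val (f) (ψ : P.HalfDensities) (x v) : (P.m f ψ).1 x v = f x • ψ.1 x v := rfl
@[simp] theorem γ_val (ψ : P.HalfDensities) (x v) : (P.γ ψ).1 x v = P.parity x (ψ.1 x v) := rfl

theorem sum_val {ι : Type*} (s : Finset ι) (ψ : ι → P.HalfDensities) (x v) :
    (∑ i ∈ s, ψ i).1 x v = ∑ i ∈ s, (ψ i).1 x v := by
  classical
  induction s using Finset.induction_on with
  | empty => simp
  | insert a s ha ih => rw [Finset.sum_insert ha, Finset.sum_insert ha, add_val, ih]

theorem m_mul (f g) : P.m (f * g) = P.m f * P.m g :=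
  P.ext_op fun ψ x v => by simp [mul_smul]

theorem m_add (f g) : P.m (f + g) = P.m f + P.m g :=
  P.ext_op fun ψ x v => by simp [add_smul]

@[simp] theorem m_zero : P.m 0 = 0 := P.ext_op fun ψ x v => by simp

theorem m_neg (f) : P.m (-f) = -P.m f := P.ext_op fun ψ x v => by simp

theorem m_smul (r : ℝ) (f) : P.m (r • f) = (r : ℂ) • P.m f :=
  P.ext_op fun ψ x v => by
    rw [LinearMap.smul_apply, smul_val, m_val, m_val, Complex.coe_smul, smul_smul]; rfl

theorem m_sum {ι : Type*} (s : Finset ι) (f : ι → C^∞⟮𝓡 n, M; ℝ⟯) :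
    P.m (∑ i ∈ s, f i) = ∑ i ∈ s, P.m (f i) := by
  classical
  induction s using Finset.induction_on with
  | empty => simp
  | insert a s ha ih => rw [Finset.sum_insert ha, Finset.sum_insert ha, m_add, ih]

theorem m_comm (f g) : P.m f * P.m g = P.m g * P.m f := by
  rw [← m_mul, mul_comm, m_mul]

theorem m_c (f e) : P.m f * P.c e = P.c e * P.m f :=
  P.ext_op fun ψ x v => by simp

theorem c_add (e e') : P.c (e + e') = P.c e + P.c e' := P.ext_op fun ψ x v => by simp

theorem c_fsmul (f e) : P.c (fsmul f e) = P.m f * P.c e :=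
  P.ext_op fun ψ x v => by simp [fsmul]

/-- Polarization of `cliff_sq`. -/
theorem cliff_mul_add (x : P.U) (a b : E x) (s : P.S x) :
    P.cliff x a (P.cliff x b s) + P.cliff x b (P.cliff x a s) =
      ((𝒞.pairing x a b : ℝ) : ℂ) • s := by
  have h := P.cliff_sq x (a + b) s
  simp only [map_add, LinearMap.add_apply, P.cliff_sq, 𝒞.pairing_symm x b a] at h
  have h2 : ((𝒞.pairing x a a + 𝒞.pairing x a b + (𝒞.pairing x a b + 𝒞.pairing x b b)) / 2 : ℝ) =
    𝒞.pairing x a a / 2 + 𝒞.pairing x b b / 2 + 𝒞.pairing x a b := by ring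
  rw [h2] at h
  push_cast at h
  simp only [add_smul] at h
  have h3 : P.cliff x a (P.cliff x b s) + P.cliff x b (P.cliff x a s) -
      ((𝒞.pairing x a b : ℝ) : ℂ) • s = 0 := by
    rw [← sub_eq_zero] at h
    rw [← h]; abel
  exact sub_eq_zero.1 h3

theorem c_mul_add (e e') : P.c e * P.c e' + P.c e' * P.c e = P.m (𝒞.inner e e') :=
  P.ext_op fun ψ x v => by
    simp only [LinearMap.add_apply, Module.End.mul_apply, add_val, c_val, cliff_mul_add, m_val]
    rfl

theorem γ_c (e) : P.γ * P.c e = -(P.c e * P.γ) := P.ext_op fun ψ x v => by simp [P.parity_cliff]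

theorem γ_m (f) : P.γ * P.m f = P.m f * P.γ := P.ext_op fun ψ x v => by simp

/-! ### Supercommutators -/

variable {P}

theorem sbr_congr {p q p' q' : ℕ} (h : (-1 : P.Op) ^ (p * q) = (-1) ^ (p' * q')) (A B : P.Op) :
    P.sbr p q A B = P.sbr p' q' A B := by simp only [sbr, h]

theorem neg_one_pow_congr {R : Type*} [Ring R] {p q : ℕ} (h : p % 2 = q % 2) :
    (-1 : R) ^ p = (-1) ^ q := by
  rw [neg_one_pow_eq_pow_mod_two, h, ← neg_one_pow_eq_pow_mod_two]

/-- Signs see only parities. Degrees are shifted by two below, and `iterSbr` adds the weight of a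
letter where the order drops by it; this lemma makes both conventions harmless. -/
theorem sbr_mod {p q p' q' : ℕ} (h : p % 2 = p' % 2) (h' : q % 2 = q' % 2) (A B : P.Op) :
    P.sbr p q A B = P.sbr p' q' A B :=
  sbr_congr (neg_one_pow_congr (Nat.ModEq.mul (n := 2) h h')) A B

theorem hasParity_mod {p p' : ℕ} (h : p % 2 = p' % 2) {A : P.Op} (hA : P.HasParity p A) :
    P.HasParity p' A := by
  unfold HasParity at *
  rw [hA]
  exact congrArg (· * _) (neg_one_pow_congr h)

theorem commutes_mod {p p' : ℕ} (h : p % 2 = p' % 2) {A : P.Op}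
    (hA : P.CommutesWithCommutant p A) : P.CommutesWithCommutant p' A := by
  intro W η hη ψ χ hχ x hx v
  rw [hA W η hη ψ χ hχ x hx v, neg_one_pow_congr h]

theorem neg_one_pow_mul_comm (k : ℕ) (A : P.Op) : (-1) ^ k * A = A * (-1) ^ k := by
  rcases neg_one_pow_eq_or P.Op k with h | h <;> simp [h]

theorem neg_one_pow_eq_smul (k : ℕ) (A : P.Op) : (-1) ^ k * A = (-1 : ℂ) ^ k • A := by
  rcases Nat.even_or_odd k with h | h <;> simp [h.neg_one_pow]

@[simp] theorem sbr_zero_left (p q) (B : P.Op) : P.sbr p q 0 B = 0 := by simp [sbr]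
@[simp] theorem sbr_zero_right (p q) (A : P.Op) : P.sbr p q A 0 = 0 := by simp [sbr]

theorem sbr_add_left (p q) (A A' B : P.Op) :
    P.sbr p q (A + A') B = P.sbr p q A B + P.sbr p q A' B := by
  simp only [sbr, add_mul, mul_add]; abel

theorem sbr_add_right (p q) (A B B' : P.Op) :
    P.sbr p q A (B + B') = P.sbr p q A B + P.sbr p q A B' := by
  simp only [sbr, add_mul, mul_add]; abel

theorem sbr_smul_left (p q) (z : ℂ) (A B : P.Op) :
    P.sbr p q (z • A) B = z • P.sbr p q A B := by
  simp only [sbr, smul_sub, smul_mul_assoc, mul_smul_comm]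

theorem sbr_neg_left (p q) (A B : P.Op) : P.sbr p q (-A) B = -P.sbr p q A B := by
  simpa using sbr_smul_left p q (-1) A B

theorem sbr_sub_left (p q) (A A' B : P.Op) :
    P.sbr p q (A - A') B = P.sbr p q A B - P.sbr p q A' B := by
  rw [sub_eq_add_neg, sbr_add_left, sbr_neg_left, sub_eq_add_neg]

theorem sbr_smul_right (p q) (z : ℂ) (A B : P.Op) :
    P.sbr p q A (z • B) = z • P.sbr p q A B := by
  simp only [sbr, smul_sub, smul_mul_assoc, mul_smul_comm]

/-- `[AB, C] = A [B, C] ± [A, C] B` -/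
theorem sbr_mul (p q r) (A B C : P.Op) :
    P.sbr (p + q) r (A * B) C = A * P.sbr q r B C + (-1) ^ (q * r) * (P.sbr p r A C * B) :=
  superDerivation_mul p q r A B C

/-- `[[A, B], C] = [A, [B, C]] ± [[A, C], B]` -/
theorem sbr_sbr (p q r) (A B C : P.Op) :
    P.sbr (p + q) r (P.sbr p q A B) C =
      P.sbr p (q + r) A (P.sbr q r B C) + (-1) ^ (q * r) * P.sbr (p + r) q (P.sbr p r A C) B :=
  superJacobi p q r A B C

end SpinorBundle
end OperatorAlgebra
end CourantDirac

namespace CourantDirac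

/-! ## Smooth functions and sections -/

section Bundles

open Filter Topology

variable {n : ℕ} {B : Type*} [TopologicalSpace B] [ChartedSpace (EuclideanSpace ℝ (Fin n)) B]
  [IsManifold (𝓡 n) ∞ B] [T2Space B]

theorem exists_bump (x₀ : B) {O : Set B} (hO : O ∈ 𝓝 x₀) :
    ∃ χ : C^∞⟮𝓡 n, B; ℝ⟯, (∀ᶠ y in 𝓝 x₀, χ y = 1) ∧ IsCompact (tsupport χ) ∧ tsupport χ ⊆ O := by
  obtain ⟨f, -, hf⟩ := (SmoothBumpFunction.nhds_basis_tsupport (I := 𝓡 n) x₀).mem_iff.1 hO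
  exact ⟨⟨f, f.contMDiff⟩, f.eventuallyEq_one, f.hasCompactSupport, hf⟩

/-- A function which is smooth on an open set is globalized by a cutoff. -/
theorem contMDiff_cutoff {G : Type*} [NormedAddCommGroup G] [NormedSpace ℝ G]
    (χ : C^∞⟮𝓡 n, B; ℝ⟯) (g : B → G) (hg : ∀ x ∈ tsupport χ, ContMDiffAt (𝓡 n) 𝓘(ℝ, G) ∞ g x) :
    ContMDiff (𝓡 n) 𝓘(ℝ, G) ∞ (fun x => χ x • g x) := by
  intro x
  by_cases hx : x ∈ tsupport χ
  · exact (χ.contMDiff x).smul (hg x hx)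
  · refine (contMDiffAt_const (c := (0 : G))).congr_of_eventuallyEq ?_
    filter_upwards [(isClosed_tsupport χ).isOpen_compl.mem_nhds hx] with y hy
    rw [image_eq_zero_of_notMem_tsupport hy, zero_smul]

variable {V : Type*} [NormedAddCommGroup V] [NormedSpace ℝ V]
  {S : B → Type*} [∀ x, AddCommGroup (S x)] [∀ x, Module ℝ (S x)]
  [∀ x, TopologicalSpace (S x)] [TopologicalSpace (TotalSpace V S)] [FiberBundle V S]
  [VectorBundle ℝ V S] [ContMDiffVectorBundle ∞ V S (𝓡 n)]

theorem contMDiff_cutoff_section (χ : C^∞⟮𝓡 n, B; ℝ⟯) (s : ∀ x, S x)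
    (hs : ∀ x ∈ tsupport χ,
      ContMDiffAt (𝓡 n) ((𝓡 n).prod 𝓘(ℝ, V)) ∞ (fun y => TotalSpace.mk' V y (s y)) x) :
    ContMDiff (𝓡 n) ((𝓡 n).prod 𝓘(ℝ, V)) ∞ (fun y => TotalSpace.mk' V y (χ y • s y)) := by
  intro x
  by_cases hx : x ∈ tsupport χ
  · exact ContMDiffAt.smul_section (χ.contMDiff x) (hs x hx)
  · refine (contMDiff_zeroSection ℝ S x).congr_of_eventuallyEq ?_
    filter_upwards [(isClosed_tsupport χ).isOpen_compl.mem_nhds hx] with y hy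
    rw [image_eq_zero_of_notMem_tsupport hy, zero_smul]; rfl

theorem exists_section (x₀ : B) (s₀ : S x₀) {O : Set B} (hO : O ∈ 𝓝 x₀) :
    ∃ s : ∀ x, S x, s x₀ = s₀ ∧ (∀ x ∉ O, s x = 0) ∧
      ContMDiff (𝓡 n) ((𝓡 n).prod 𝓘(ℝ, V)) ∞ (fun y => TotalSpace.mk' V y (s y)) := by
  obtain ⟨O', hO', h⟩ := FiberBundle.exists_contMDiffOn_extend (𝓡 n) V (k := ∞) s₀
  obtain ⟨χ, h1, -, h2⟩ := exists_bump (n := n) x₀ (inter_mem hO (interior_mem_nhds.2 hO'))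
  refine ⟨fun x => χ x • FiberBundle.extend V s₀ x, ?_, ?_, contMDiff_cutoff_section χ _ ?_⟩
  · simp [h1.self_of_nhds]
  · intro x hx
    have : χ x = 0 := image_eq_zero_of_notMem_tsupport fun h => hx (h2 h).1
    simp [this]
  · intro x hx
    exact h.contMDiffAt (mem_interior_iff_mem_nhds.1 (h2 hx).2)

variable {Z : Type*} [NormedAddCommGroup Z] [NormedSpace ℝ Z] [FiniteDimensional ℝ Z]

/-- A linear map out of a finite dimensional space is a combination of its values on a basis, with
constant coefficient operators. -/
theorem contMDiffAt_clm {A : B → Z →L[ℝ] V} {x₀ : B}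
    (hA : ∀ z, ContMDiffAt (𝓡 n) 𝓘(ℝ, V) ∞ (fun y => A y z) x₀) :
    ContMDiffAt (𝓡 n) 𝓘(ℝ, Z →L[ℝ] V) ∞ A x₀ := by
  let b := Module.finBasis ℝ Z
  have h : A = fun y => ∑ i, ContinuousLinearMap.smulRightL ℝ Z V
      (LinearMap.toContinuousLinearMap (b.coord i)) (A y (b i)) := by
    funext y
    ext z
    conv_lhs => rw [← b.sum_repr z]
    simp only [map_sum, map_smul]
    simp [sum_apply]
  rw [h]
  refine contMDiffAt_finsetSum fun i _ => ?_
  exact (ContinuousLinearMap.contMDiffAt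
    (ContinuousLinearMap.smulRightL ℝ Z V _)).comp x₀ (hA (b i))

variable [FiniteDimensional ℝ V]

/-- A smooth family of linear maps onto the fibres which is bijective at a point is bijective
nearby, and the coefficients of a smooth section are smooth. -/
theorem frame_bijective_smooth (G : ∀ y, Z →ₗ[ℝ] S y) (x₀ : B)
    (hG : ∀ z, ContMDiffAt (𝓡 n) ((𝓡 n).prod 𝓘(ℝ, V)) ∞ (fun y => TotalSpace.mk' V y (G y z)) x₀)
    (hb : Function.Bijective (G x₀)) :
    (∀ᶠ y in 𝓝 x₀, Function.Bijective (G y)) ∧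
    ∀ (s : ∀ y, S y) (u : B → Z),
      ContMDiffAt (𝓡 n) ((𝓡 n).prod 𝓘(ℝ, V)) ∞ (fun y => TotalSpace.mk' V y (s y)) x₀ →
      (∀ᶠ y in 𝓝 x₀, G y (u y) = s y) → ContMDiffAt (𝓡 n) 𝓘(ℝ, Z) ∞ u x₀ := by
  set t := trivializationAt V S x₀
  have ht : x₀ ∈ t.baseSet := FiberBundle.mem_baseSet_trivializationAt' x₀
  let A : B → Z →L[ℝ] V := fun y =>
    LinearMap.toContinuousLinearMap ((t.linearMapAt ℝ y).comp (G y))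
  have hbase : ∀ᶠ y in 𝓝 x₀, y ∈ t.baseSet := t.open_baseSet.mem_nhds ht
  have hA' : ∀ y ∈ t.baseSet, ∀ w : S y, t.linearMapAt ℝ y w = (t ⟨y, w⟩).2 := fun y hy w => by
    rw [t.linearMapAt_apply, if_pos hy]
  have hlin : ∀ y ∈ t.baseSet, Function.Bijective (t.linearMapAt ℝ y) := fun y hy => by
    have : (t.linearMapAt ℝ y : S y → V) = t.linearEquivAt ℝ y hy := by
      funext w; rw [hA' y hy]; rfl
    rw [this]
    exact (t.linearEquivAt ℝ y hy).bijective
  have hA : ContMDiffAt (𝓡 n) 𝓘(ℝ, Z →L[ℝ] V) ∞ A x₀ := by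
    refine contMDiffAt_clm fun z => ?_
    refine ((contMDiffAt_section x₀).1 (hG z)).congr_of_eventuallyEq ?_
    filter_upwards [hbase] with y hy
    exact hA' y hy _
  have hAb : Function.Bijective (A x₀) := (hlin x₀ ht).comp hb
  let e : Z ≃L[ℝ] V := (LinearEquiv.ofBijective (A x₀ : Z →ₗ[ℝ] V) hAb).toContinuousLinearEquiv
  have he : (e : Z →L[ℝ] V) = A x₀ := by ext; rfl
  -- Both claims are read in the trivialization `t`: the invertible maps form an open set, and
  -- inversion is smooth on it.
  have hinv : ∀ᶠ y in 𝓝 x₀, A y ∈ Set.range ((↑) : (Z ≃L[ℝ] V) → Z →L[ℝ] V) := by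
    refine hA.continuousAt.eventually ?_
    rw [← he]
    exact ContinuousLinearEquiv.nhds e
  refine ⟨?_, fun s u hs hu => ?_⟩
  · filter_upwards [hinv, hbase] with y ⟨e', he'⟩ hy
    have h1 : Function.Bijective (A y) := by rw [← he']; exact e'.bijective
    have h2 : (A y : Z → V) = t.linearMapAt ℝ y ∘ G y := rfl
    rw [h2] at h1
    exact ((hlin y hy).of_comp_iff' _).1 h1
  · have h1 : ContMDiffAt (𝓡 n) 𝓘(ℝ, V →L[ℝ] Z) ∞ (fun y => ContinuousLinearMap.inverse (A y)) x₀ := by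
      have := contDiffAt_map_inverse (n := ∞) e
      rw [he] at this
      exact this.contMDiffAt.comp x₀ hA
    have h2 := (contMDiffAt_section x₀).1 hs
    refine (h1.clm_apply h2).congr_of_eventuallyEq ?_
    filter_upwards [hinv, hbase, hu] with y ⟨e', he'⟩ hy huy
    rw [← huy, ← hA' y hy, ← he', ContinuousLinearMap.inverse_equiv]
    have : e' (u y) = t.linearMapAt ℝ y (G y (u y)) := by
      change (e' : Z →L[ℝ] V) (u y) = _
      rw [he']; rfl
    rw [← this]; simp

end Bundles
end CourantDirac

namespace CourantDirac

/-! ## Orthonormal frames of a Courant algebroid -/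

section OrthonormalFrames

open Filter Topology Module

variable {n : ℕ} {M : Type uM} [TopologicalSpace M] [ChartedSpace (EuclideanSpace ℝ (Fin n)) M]
  [IsManifold (𝓡 n) ∞ M] [T2Space M]
  {F : Type uF} [NormedAddCommGroup F] [NormedSpace ℝ F] [FiniteDimensional ℝ F]
  {E : M → Type uE} [∀ x, AddCommGroup (E x)] [∀ x, Module ℝ (E x)]
  [∀ x, TopologicalSpace (E x)] [TopologicalSpace (TotalSpace F E)] [FiberBundle F E]
  [VectorBundle ℝ F E] [ContMDiffVectorBundle ∞ F E (𝓡 n)]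

@[simp] theorem fsmul_apply (f : C^∞⟮𝓡 n, M; ℝ⟯) (e : Cₛ^∞⟮𝓡 n; F, E⟯) (x : M) :
    fsmul f e x = f x • e x := rfl

@[simp] theorem CourantAlgebroid.inner_apply (𝒞 : CourantAlgebroid n F E) (e e') (x : M) :
    𝒞.inner e e' x = 𝒞.pairing x (e x) (e' x) := rfl

theorem section_sum_apply {ι : Type*} (s : Finset ι) (e : ι → Cₛ^∞⟮𝓡 n; F, E⟯) (x : M) :
    (∑ i ∈ s, e i) x = ∑ i ∈ s, e i x := by
  classical
  induction s using Finset.induction_on with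
  | empty => simp
  | insert a s ha ih => rw [Finset.sum_insert ha, Finset.sum_insert ha, ContMDiffSection.coe_add,
      Pi.add_apply, ih]

theorem function_sum_apply {ι : Type*} (s : Finset ι) (f : ι → C^∞⟮𝓡 n, M; ℝ⟯) (x : M) :
    (∑ i ∈ s, f i) x = ∑ i ∈ s, f i x := by
  classical
  induction s using Finset.induction_on with
  | empty => simp
  | insert a s ha ih => rw [Finset.sum_insert ha, Finset.sum_insert ha, ContMDiffMap.coe_add,
      Pi.add_apply, ih]

theorem exists_global_section (x₀ : M) (a : E x₀) : ∃ e : Cₛ^∞⟮𝓡 n; F, E⟯, e x₀ = a := by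
  obtain ⟨s, h, -, hs⟩ := exists_section (n := n) (V := F) x₀ a (O := Set.univ) univ_mem
  exact ⟨⟨s, hs⟩, h⟩

theorem finite_fibre {B : Type*} [TopologicalSpace B] (V : Type*) [NormedAddCommGroup V]
    [NormedSpace ℝ V] [FiniteDimensional ℝ V] {S : B → Type*} [∀ x, AddCommGroup (S x)]
    [∀ x, Module ℝ (S x)] [∀ x, TopologicalSpace (S x)] [TopologicalSpace (TotalSpace V S)]
    [FiberBundle V S] [VectorBundle ℝ V S] (x : B) : FiniteDimensional ℝ (S x) :=
  ((trivializationAt V S x).continuousLinearEquivAt ℝ x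
    (FiberBundle.mem_baseSet_trivializationAt' x)).symm.toLinearEquiv.finiteDimensional

variable (F) in
theorem finrank_fibre (x : M) : finrank ℝ (E x) = finrank ℝ F :=
  ((trivializationAt F E x).continuousLinearEquivAt ℝ x
    (FiberBundle.mem_baseSet_trivializationAt' x)).toLinearEquiv.finrank_eq

namespace CourantAlgebroid

variable (𝒞 : CourantAlgebroid n F E)

/-- An orthonormal frame of `E` over `W`, consisting of global sections. -/
structure OrthoFrame (W : Opens M) where
  e : Fin (finrank ℝ F) → Cₛ^∞⟮𝓡 n; F, E⟯
  ε : Fin (finrank ℝ F) → ℝ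
  ε_mul : ∀ i, ε i * ε i = 1
  orth : ∀ x ∈ W, ∀ i j, 𝒞.pairing x (e i x) (e j x) = if i = j then ε i else 0

variable {𝒞}

namespace OrthoFrame

variable {W : Opens M} (o : 𝒞.OrthoFrame W)

/-- The restriction to a smaller open set. -/
def restrict {W' : Opens M} (h : W' ≤ W) : 𝒞.OrthoFrame W' :=
  ⟨o.e, o.ε, o.ε_mul, fun x hx => o.orth x (h hx)⟩

/-- Mutually orthogonal vectors with squares `±1` are independent in any signature, and there are as
many of them as the rank. The coefficient carries `ε` because `ε` is its own inverse. -/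
theorem expand {x : M} (hx : x ∈ W) (a : E x) :
    a = ∑ i, (o.ε i * 𝒞.pairing x a (o.e i x)) • o.e i x := by
  have := finite_fibre F (S := E) x
  have hli : LinearIndependent ℝ (fun i => o.e i x) := by
    rw [Fintype.linearIndependent_iff]
    intro g hg i
    have h := congrArg (fun b => 𝒞.pairing x b (o.e i x)) hg
    simp only [map_sum, map_smul, LinearMap.sum_apply, LinearMap.smul_apply, o.orth x hx,
      map_zero, LinearMap.zero_apply, smul_eq_mul, mul_ite, mul_zero, Finset.sum_ite_eq',
      Finset.mem_univ, if_true] at h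
    have := o.ε_mul i
    rcases mul_eq_zero.1 h with h | h
    · exact h
    · rw [h] at this; simp at this
  let b := basisOfLinearIndependentOfCardEqFinrank' _ hli (by
    rw [Fintype.card_fin, finrank_fibre F])
  have hb : ∀ i, b i = o.e i x := fun i => by simp [b]
  have key : ∀ i, b.repr a i = o.ε i * 𝒞.pairing x a (o.e i x) := by
    intro i
    have h : a = ∑ j, b.repr a j • o.e j x := by
      conv_lhs => rw [← b.sum_repr a]
      simp only [hb]
    conv_rhs => rw [h]
    simp only [map_sum, map_smul, LinearMap.sum_apply, LinearMap.smul_apply, o.orth x hx,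
      smul_eq_mul, mul_ite, mul_zero, Finset.sum_ite_eq', Finset.mem_univ, if_true]
    rw [mul_left_comm, o.ε_mul, mul_one]
  conv_lhs => rw [← b.sum_repr a]
  simp only [hb, key]

end OrthoFrame

variable (𝒞)

/-- A diagonalizing basis of a nondegenerate form contains no null vectors, so it can be normalized
by the roots of `|q i|`. -/
theorem exists_orthonormal_basis (x : M) :
    ∃ (v : Fin (finrank ℝ F) → E x) (ε : Fin (finrank ℝ F) → ℝ), (∀ i, ε i * ε i = 1) ∧
      ∀ i j, 𝒞.pairing x (v i) (v j) = if i = j then ε i else 0 := by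
  have := finite_fibre F (S := E) x
  obtain ⟨v, hv⟩ := LinearMap.BilinForm.exists_orthogonal_basis (B := 𝒞.pairing x)
    ⟨fun a b => 𝒞.pairing_symm x a b⟩
  have hne := hv.not_isOrtho_basis_self_of_separatingLeft (𝒞.pairing_nondegenerate x).1
  have hr := finrank_fibre F (E := E) x
  revert v
  rw [hr]
  intro v hv hne
  set q := fun i => 𝒞.pairing x (v i) (v i) with hq
  refine ⟨fun i => (Real.sqrt |q i|)⁻¹ • v i, fun i => q i / |q i|, fun i => ?_, fun i j => ?_⟩
  · have : q i ≠ 0 := hne i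
    field_simp
    rw [sq_abs]
  · have h0 : |q i| ≠ 0 := abs_ne_zero.2 (hne i)
    split_ifs with h
    · subst h
      simp only [map_smul, LinearMap.smul_apply, smul_eq_mul]
      change _ * (_ * q i) = _
      rw [← mul_assoc, ← mul_inv, Real.mul_self_sqrt (abs_nonneg _), inv_mul_eq_div]
    · simp only [map_smul, LinearMap.smul_apply, smul_eq_mul]
      have : 𝒞.pairing x (v i) (v j) = 0 := hv h
      rw [this, mul_zero, mul_zero]

theorem exists_unit_multiple (x₀ : M) (f : Cₛ^∞⟮𝓡 n; F, E⟯) (ε : ℝ) (hε : ε * ε = 1)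
    (hf : 𝒞.pairing x₀ (f x₀) (f x₀) = ε) :
    ∃ a : C^∞⟮𝓡 n, M; ℝ⟯, a x₀ = 1 ∧
      ∀ᶠ y in 𝓝 x₀, a y * a y * 𝒞.pairing y (f y) (f y) = ε := by
  set g := 𝒞.inner f f
  have hpos : ∀ᶠ y in 𝓝 x₀, 0 < ε * g y := by
    have h1 : ContinuousAt (fun y => ε * g y) x₀ :=
      continuousAt_const.mul g.contMDiff.continuous.continuousAt
    refine h1.eventually (lt_mem_nhds ?_)
    change 0 < ε * 𝒞.pairing x₀ (f x₀) (f x₀)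
    rw [hf, hε]; exact one_pos
  obtain ⟨χ, h1, -, h2⟩ := exists_bump (n := n) x₀ hpos
  -- The normalizing factor `(ε ⟨f, f⟩)^{-1/2}` makes sense where `⟨f, f⟩` keeps its sign, and is
  -- cut off there.
  refine ⟨⟨fun y => χ y • (Real.sqrt (ε * g y))⁻¹, contMDiff_cutoff χ _ fun x hx => ?_⟩, ?_, ?_⟩
  · have h3 : (0 : ℝ) < ε * g x := h2 hx
    have h4 : ContDiffAt ℝ ∞ (fun t : ℝ => (Real.sqrt (ε * t))⁻¹) (g x) := by
      refine ContDiffAt.inv (ContDiffAt.sqrt ?_ h3.ne') (Real.sqrt_pos.2 h3).ne'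
      exact contDiffAt_const.mul contDiffAt_id
    exact h4.contMDiffAt.comp x (g.contMDiff x)
  · change χ x₀ • (Real.sqrt (ε * 𝒞.pairing x₀ (f x₀) (f x₀)))⁻¹ = 1
    rw [hf, hε, h1.self_of_nhds]; simp
  · filter_upwards [h1, hpos] with y hy hy'
    change χ y • (Real.sqrt (ε * g y))⁻¹ * (χ y • (Real.sqrt (ε * g y))⁻¹) * g y = ε
    rw [hy, one_smul, ← mul_inv, Real.mul_self_sqrt hy'.le]
    have h5 : g y ≠ 0 := fun h => by rw [h] at hy'; simp at hy'
    have h6 : ε ≠ 0 := fun h => by rw [h] at hε; simp at hε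
    field_simp
    rw [pow_two, hε]

/-- Gram–Schmidt for an indefinite pairing, started at orthonormal values in one fibre. Two
invariants carry the induction: the first `k` sections are already orthogonal to all the others, and
the values at `x₀` never change. The second one keeps the next section away from the null cone near
`x₀`. -/
theorem exists_gramSchmidt (x₀ : M) (v : Fin (finrank ℝ F) → E x₀) (ε : Fin (finrank ℝ F) → ℝ)
    (hε : ∀ i, ε i * ε i = 1)
    (hv : ∀ i j, 𝒞.pairing x₀ (v i) (v j) = if i = j then ε i else 0) (k : ℕ) :
    ∃ f : Fin (finrank ℝ F) → Cₛ^∞⟮𝓡 n; F, E⟯, (∀ i, f i x₀ = v i) ∧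
      ∀ i j : Fin (finrank ℝ F), (i : ℕ) < k → ∀ᶠ y in 𝓝 x₀,
        𝒞.pairing y (f i y) (f j y) = if i = j then ε i else 0 := by
  induction k with
  | zero =>
    choose f hf using fun i => exists_global_section (n := n) (F := F) x₀ (v i)
    exact ⟨f, hf, fun i j h => absurd h (Nat.not_lt_zero _)⟩
  | succ k ih =>
    obtain ⟨f, hf, hk⟩ := ih
    by_cases hkr : k < finrank ℝ F
    swap
    · exact ⟨f, hf, fun i j _ => hk i j (by omega)⟩
    let k' : Fin (finrank ℝ F) := ⟨k, hkr⟩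
    obtain ⟨a, ha, ha'⟩ := 𝒞.exists_unit_multiple x₀ (f k') (ε k') (hε k')
      (by rw [hf, hv, if_pos rfl])
    let g := fsmul a (f k')
    have hg : g x₀ = v k' := by simp [g, ha, hf]
    let f' : Fin (finrank ℝ F) → Cₛ^∞⟮𝓡 n; F, E⟯ := fun j =>
      if (j : ℕ) < k then f j else if j = k' then g else f j - ε k' • fsmul (𝒞.inner (f j) g) g
    have f1 : ∀ j : Fin (finrank ℝ F), (j : ℕ) < k → f' j = f j := fun j hj => if_pos hj
    have f2 : f' k' = g := by simp [f', k']
    have f3 : ∀ j : Fin (finrank ℝ F), k < (j : ℕ) →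
        f' j = f j - ε k' • fsmul (𝒞.inner (f j) g) g := fun j hj => by
      have h1 : ¬ (j : ℕ) < k := by omega
      have h2 : j ≠ k' := fun h => by rw [h] at hj; simp [k'] at hj
      simp [f', h1, h2]
    have tri : ∀ j : Fin (finrank ℝ F), (j : ℕ) < k ∨ j = k' ∨ k < (j : ℕ) := fun j => by
      rcases lt_trichotomy (j : ℕ) k with h | h | h
      · exact Or.inl h
      · exact Or.inr (Or.inl (Fin.ext h))
      · exact Or.inr (Or.inr h)
    refine ⟨f', fun j => ?_, fun i j hi => ?_⟩
    · rcases tri j with h | rfl | h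
      · rw [f1 j h, hf]
      · rw [f2, hg]
      · rw [f3 j h]
        have h2 : j ≠ k' := fun h' => by rw [h'] at h; simp [k'] at h
        have : 𝒞.inner (f j) g x₀ = 0 := by
          rw [inner_apply, hf, hg, hv, if_neg h2]
        simp [this, hf]
    · have hgk : ∀ i : Fin (finrank ℝ F), (i : ℕ) < k →
          ∀ᶠ y in 𝓝 x₀, 𝒞.pairing y (f i y) (g y) = 0 := fun i hi => by
        have hne : i ≠ k' := fun h' => by rw [h'] at hi; simp [k'] at hi
        filter_upwards [hk i k' hi] with y hy
        rw [if_neg hne] at hy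
        simp [g, hy]
      have hgg : ∀ᶠ y in 𝓝 x₀, 𝒞.pairing y (g y) (g y) = ε k' := by
        filter_upwards [ha'] with y hy
        rw [← hy]; simp [g]; ring
      rcases tri i with h | rfl | h
      · rw [f1 i h]
        rcases tri j with h' | rfl | h'
        · rw [f1 j h']; exact hk i j h
        · have hne : i ≠ k' := fun h' => by rw [h'] at h; simp [k'] at h
          rw [f2, if_neg hne]; exact hgk i h
        · rw [f3 j h']
          filter_upwards [hk i j h, hgk i h] with y hy hy'
          simp [hy, hy']
      · rw [f2]
        rcases tri j with h' | rfl | h'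
        · rw [f1 j h', if_neg (fun h'' => by rw [← h''] at h'; simp [k'] at h')]
          filter_upwards [hgk j h'] with y hy
          rw [𝒞.pairing_symm, hy]
        · rw [f2, if_pos rfl]; exact hgg
        · rw [f3 j h', if_neg (fun h'' => by rw [← h''] at h'; simp [k'] at h')]
          filter_upwards [hgg] with y hy
          have := hε k'
          simp only [ContMDiffSection.coe_sub, Pi.sub_apply, ContMDiffSection.coe_smul,
            Pi.smul_apply, fsmul_apply, inner_apply, map_sub, map_smul, smul_eq_mul, hy,
            𝒞.pairing_symm y (g y) (f j y)]
          linear_combination (-𝒞.pairing y (f j y) (g y)) * this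
      · exact absurd hi (by omega)

theorem exists_orthoFrame (x₀ : M) : ∃ W : Opens M, x₀ ∈ W ∧ Nonempty (𝒞.OrthoFrame W) := by
  obtain ⟨v, ε, hε, hv⟩ := 𝒞.exists_orthonormal_basis x₀
  obtain ⟨f, -, h⟩ := 𝒞.exists_gramSchmidt x₀ v ε hε hv (finrank ℝ F)
  have h2 : ∀ᶠ y in 𝓝 x₀, ∀ i j, 𝒞.pairing y (f i y) (f j y) = if i = j then ε i else 0 :=
    eventually_all.2 fun i => eventually_all.2 fun j => h i j i.2
  obtain ⟨W, hW, hWo, hx⟩ := eventually_nhds_iff.1 h2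
  exact ⟨⟨W, hWo⟩, hx, ⟨⟨f, ε, hε, fun x hx => hW x hx⟩⟩⟩

theorem eq_of_pairing_eq {x : M} {a b : E x}
    (h : ∀ e : Cₛ^∞⟮𝓡 n; F, E⟯, 𝒞.pairing x a (e x) = 𝒞.pairing x b (e x)) : a = b := by
  refine sub_eq_zero.1 ((𝒞.pairing_nondegenerate x).1 _ fun c => ?_)
  obtain ⟨e, rfl⟩ := exists_global_section (n := n) (F := F) x c
  rw [map_sub, LinearMap.sub_apply, h e, sub_self]

/-- A `C^∞`-linear functional on the sections of `E` is represented by a section. -/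
theorem exists_section_of_linear (T : Cₛ^∞⟮𝓡 n; F, E⟯ → C^∞⟮𝓡 n, M; ℝ⟯)
    (hadd : ∀ e e', T (e + e') = T e + T e') (hmul : ∀ f e, T (fsmul f e) = f * T e) :
    ∃ α, ∀ e, T e = 𝒞.inner α e := by
  have hsum : ∀ (s : Finset (Fin (finrank ℝ F))) (e : Fin (finrank ℝ F) → Cₛ^∞⟮𝓡 n; F, E⟯),
      T (∑ i ∈ s, e i) = ∑ i ∈ s, T (e i) := by
    classical
    have h0 : T 0 = 0 := by simpa using hadd 0 0
    intro s e
    induction s using Finset.induction_on with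
    | empty => simpa using h0
    | insert a s ha ih => rw [Finset.sum_insert ha, Finset.sum_insert ha, hadd, ih]
  have hloc : ∀ (W : Opens M) (o : 𝒞.OrthoFrame W), ∀ x ∈ W, ∀ e,
      T e x = 𝒞.pairing x (∑ i, (o.ε i * T (o.e i) x) • o.e i x) (e x) := by
    intro W o x hx e
    obtain ⟨χ, h1, -, h2⟩ := exists_bump (n := n) x (W.isOpen.mem_nhds hx)
    -- The cutoff turns the local expansion in the frame into an identity of global sections, to
    -- which `T` can be applied.
    have h3 : fsmul χ e =
        ∑ i, fsmul (χ * (o.ε i • 𝒞.inner e (o.e i))) (o.e i) := by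
      ext y
      rw [section_sum_apply]
      by_cases hy : y ∈ tsupport χ
      · rw [fsmul_apply]
        conv_lhs => rw [o.expand (h2 hy) (e y), Finset.smul_sum]
        refine Finset.sum_congr rfl fun i _ => ?_
        rw [smul_smul]; rfl
      · have : χ y = 0 := image_eq_zero_of_notMem_tsupport hy
        simp [this]
    have h4 := congrArg (fun f => T f x) h3
    simp only [hsum, hmul, function_sum_apply] at h4
    have hχ : χ x = 1 := h1.self_of_nhds
    simp only [ContMDiffMap.coe_mul, Pi.mul_apply, hχ, one_mul, ContMDiffMap.coe_smul,
      Pi.smul_apply, inner_apply, smul_eq_mul] at h4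
    rw [h4]
    simp only [map_sum, LinearMap.sum_apply, map_smul, LinearMap.smul_apply, smul_eq_mul]
    refine Finset.sum_congr rfl fun i _ => ?_
    rw [𝒞.pairing_symm x (e x)]; ring
  choose W hW o using 𝒞.exists_orthoFrame
  have o := fun x => (o x).some
  let α : ∀ x, E x := fun x => ∑ i, ((o x).ε i * T ((o x).e i) x) • (o x).e i x
  have hα : ∀ x e, 𝒞.pairing x (α x) (e x) = T e x := fun x e => (hloc _ (o x) x (hW x) e).symm
  refine ⟨⟨α, fun x₀ => ?_⟩, fun e => by ext x; exact (hα x e).symm⟩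
  -- `α` was defined with a frame depending on the point. The representing vector is unique, so near
  -- `x₀` it can be computed in the single frame chosen at `x₀`.
  have h5 : ContMDiff (𝓡 n) ((𝓡 n).prod 𝓘(ℝ, F)) ∞ (fun y => TotalSpace.mk' F y
      ((∑ i, fsmul ((o x₀).ε i • T ((o x₀).e i)) ((o x₀).e i)) y)) :=
    ContMDiffSection.contMDiff _
  refine (h5 x₀).congr_of_eventuallyEq ?_
  filter_upwards [(W x₀).isOpen.mem_nhds (hW x₀)] with y hy
  have : α y = (∑ i, fsmul ((o x₀).ε i • T ((o x₀).e i)) ((o x₀).e i)) y := by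
    refine 𝒞.eq_of_pairing_eq fun e => ?_
    rw [hα, hloc _ (o x₀) y hy e, section_sum_apply]
    rfl
  rw [this]

theorem eq_of_inner_eq {α β : Cₛ^∞⟮𝓡 n; F, E⟯} (h : ∀ e, 𝒞.inner α e = 𝒞.inner β e) : α = β := by
  ext x
  exact 𝒞.eq_of_pairing_eq fun e => congrArg (fun f : C^∞⟮𝓡 n, M; ℝ⟯ => f x) (h e)

theorem sharp_eq {φ : Cochain n F E} {α} (h : ∀ e, φ [Sum.inl e] = 𝒞.inner α e) :
    𝒞.sharp φ = α := by
  have h' : ∃ α, ∀ e, φ [Sum.inl e] = 𝒞.inner α e := ⟨α, h⟩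
  rw [sharp, dif_pos h']
  exact 𝒞.eq_of_inner_eq fun e => by rw [← h'.choose_spec, h]

theorem inner_sharp {p : ℕ} {φ : Cochain n F E} (hφ : 𝒞.IsGradedFunction p φ) (e) :
    φ [Sum.inl e] = 𝒞.inner (𝒞.sharp φ) e := by
  have h : ∃ α, ∀ e, φ [Sum.inl e] = 𝒞.inner α e :=
    𝒞.exists_section_of_linear (fun e => φ [Sum.inl e]) (hφ.add_section []) (hφ.smul_section [])
  rw [sharp, dif_pos h]
  exact h.choose_spec e

end CourantAlgebroid
end OrthonormalFrames
end CourantDirac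

namespace CourantDirac

/-! ## Graded representations of Clifford algebras -/

section CliffordRepresentations

open Module

/-- A graded representation on `V` of the Clifford algebra with orthonormal generators. -/
structure CliffRep {ι : Type*} (ε : ι → ℝ) (V : Type*) [AddCommGroup V] [Module ℂ V] where
  c : ι → V →ₗ[ℂ] V
  γ : V →ₗ[ℂ] V
  c_sq : ∀ i v, c i (c i v) = ((ε i / 2 : ℝ) : ℂ) • v
  c_c : ∀ i j, i ≠ j → ∀ v, c i (c j v) = -c j (c i v)
  γ_sq : ∀ v, γ (γ v) = v
  γ_c : ∀ i v, γ (c i v) = -c i (γ v)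

namespace CliffRep

variable {ι : Type*} {ε : ι → ℝ} {V V' : Type*} [AddCommGroup V] [Module ℂ V]
  [AddCommGroup V'] [Module ℂ V']

/-- Irreducibility of a graded representation. -/
def Irr (R : CliffRep ε V) : Prop :=
  ∀ W : Submodule ℂ V, (∀ s ∈ W, R.γ s ∈ W) → (∀ i, ∀ s ∈ W, R.c i s ∈ W) → W = ⊥ ∨ W = ⊤

/-- An eigenspace of `T` is a nonzero graded submodule. -/
theorem schur [FiniteDimensional ℂ V] [Nontrivial V] {R : CliffRep ε V} (hR : R.Irr)
    (T : V →ₗ[ℂ] V) (h : ∀ i v, T (R.c i v) = R.c i (T v)) (h' : ∀ v, T (R.γ v) = R.γ (T v)) :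
    ∃ z : ℂ, ∀ v, T v = z • v := by
  obtain ⟨z, hz⟩ := Module.End.exists_eigenvalue T
  refine ⟨z, fun v => ?_⟩
  have := hR (Module.End.eigenspace T z)
    (fun s hs => by rw [Module.End.mem_eigenspace_iff] at *; rw [h', hs, map_smul])
    (fun i s hs => by rw [Module.End.mem_eigenspace_iff] at *; rw [h, hs, map_smul])
  rcases this with h | h
  · exact absurd h hz
  · have : v ∈ Module.End.eigenspace T z := by rw [h]; trivial
    exact Module.End.mem_eigenspace_iff.1 this

variable {σ : ℂ →+* ℂ}

/-- Kernel and range are graded submodules, even for a semilinear map which respects the parity only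
up to the factor `τ`. -/
theorem bijective_of_ne_zero [RingHomSurjective σ] {R : CliffRep ε V} {R' : CliffRep ε V'}
    (hR : R.Irr) (hR' : R'.Irr)
    (X : V →ₛₗ[σ] V') (hX : X ≠ 0) (h : ∀ i v, X (R.c i v) = R'.c i (X v))
    (τ : ℂ) (hτ : τ ≠ 0) (h' : ∀ v, X (R.γ v) = τ • R'.γ (X v)) : Function.Bijective X := by
  constructor
  · rw [← LinearMap.ker_eq_bot]
    refine (hR (LinearMap.ker X) (fun s hs => ?_) (fun i s hs => ?_)).resolve_right fun ht => ?_
    · rw [LinearMap.mem_ker] at *; rw [h', hs, map_zero, smul_zero]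
    · rw [LinearMap.mem_ker] at *; rw [h, hs, map_zero]
    · exact hX (LinearMap.ker_eq_top.1 ht)
  · rw [← LinearMap.range_eq_top]
    refine (hR' (LinearMap.range X) ?_ ?_).resolve_left fun ht => ?_
    · rintro _ ⟨v, rfl⟩
      have : R'.γ (X v) = τ⁻¹ • X (R.γ v) := by rw [h', smul_smul, inv_mul_cancel₀ hτ, one_smul]
      rw [this]
      exact Submodule.smul_mem _ _ ⟨_, rfl⟩
    · rintro i _ ⟨v, rfl⟩
      rw [← h]; exact ⟨_, rfl⟩
    · exact hX (LinearMap.range_eq_bot.1 ht)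

theorem c_ne_zero (R : CliffRep ε V) (hε : ∀ i, ε i * ε i = 1) (i : ι) {v : V} (hv : v ≠ 0) :
    R.c i v ≠ 0 := fun h => by
  have h2 := R.c_sq i v
  rw [h, map_zero] at h2
  rcases smul_eq_zero.1 h2.symm with h3 | h3
  · have := hε i
    have h4 : ε i = 0 := by simpa using h3
    rw [h4] at this; simp at this
  · exact hv h3

/-- Two nonzero graded representations of a Clifford algebra have a nonzero intertwiner, which
respects the parity up to a sign. -/
theorem exists_intertwiner [Finite ι] [Nontrivial V] [Nontrivial V'] (hε : ∀ i, ε i * ε i = 1)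
    (R : CliffRep ε V) (R' : CliffRep ε V') (σ : ℂ →+* ℂ) :
    ∃ X : V →ₛₗ[σ] V', X ≠ 0 ∧ (∀ i v, X (R.c i v) = R'.c i (X v)) ∧
      ∃ τ : ℤˣ, ∀ v, X (R.γ v) = ((τ : ℤ) : ℂ) • R'.γ (X v) := by
  classical
  have hε' : ∀ i, ε i = 1 ∨ ε i = -1 := fun i => mul_self_eq_one_iff.1 (hε i)
  -- The squares of the generators are the rational numbers `±1/2`, fixed by every ring endomorphism
  -- of `ℂ`. Complex conjugation is therefore admissible for `σ`.
  have hσ : ∀ i, σ ((ε i / 2 : ℝ) : ℂ) = ((ε i / 2 : ℝ) : ℂ) := fun i => by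
    have h2 : σ 2 = 2 := map_ofNat σ 2
    rcases hε' i with h | h <;> rw [h] <;> simp [h2]
  have hu : ∀ i, ((ε i / 2 : ℝ) : ℂ) ≠ 0 := fun i => by
    rcases hε' i with h | h <;> rw [h] <;> simp
  -- reformulate with finite sets of generators
  have key : ∀ s : Finset ι, ∃ X : V →ₛₗ[σ] V', X ≠ 0 ∧ (∀ i ∈ s, ∀ v, X (R.c i v) = R'.c i (X v)) ∧
      ∃ τ : ℤˣ, ∀ v, X (R.γ v) = ((τ : ℤ) : ℂ) • R'.γ (X v) := by
    intro s
    induction s using Finset.induction_on with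
    | empty =>
      obtain ⟨X, hX⟩ : ∃ X : V →ₛₗ[σ] V', X ≠ 0 := by
        obtain ⟨v, hv⟩ := exists_ne (0 : V)
        obtain ⟨w, hw⟩ := exists_ne (0 : V')
        obtain ⟨f, hf⟩ : ∃ f : Dual ℂ V, f v ≠ 0 := by
          by_contra! h
          exact hv ((Module.forall_dual_apply_eq_zero_iff ℂ v).1 h)
        refine ⟨{ toFun := fun u => σ (f u) • w
                  map_add' := fun a b => by rw [map_add, map_add, add_smul]
                  map_smul' := fun a b => by rw [map_smul, smul_eq_mul, map_mul, mul_smul] },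
          fun h => ?_⟩
        have h' : σ (f v) • w = 0 := LinearMap.congr_fun h v
        rcases smul_eq_zero.1 h' with h' | h'
        · exact hf (σ.injective (by rw [h', map_zero]))
        · exact hw h'
      -- Averaging over the parity: either the average is a nonzero map commuting with it, or it
      -- vanishes and `X` anticommutes. This is the origin of `τ`.
      by_cases hY : X + R'.γ.comp (X.comp R.γ) = 0
      · refine ⟨X, hX, by simp, -1, fun v => ?_⟩
        have h := LinearMap.congr_fun hY (R.γ v)
        simp only [LinearMap.add_apply, LinearMap.comp_apply, R.γ_sq, LinearMap.zero_apply] at h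
        rw [eq_neg_of_add_eq_zero_left h]; simp
      · refine ⟨_, hY, by simp, 1, fun v => ?_⟩
        simp only [LinearMap.add_apply, LinearMap.comp_apply, R.γ_sq, map_add, R'.γ_sq]
        simp [add_comm]
    | insert a s ha ih =>
      obtain ⟨X, hX, hs, τ, hτ⟩ := ih
      -- Since `(ε_a/2)⁻¹ c_a` is the inverse of `c_a`, this is `X` plus its conjugate by `c_a`. It
      -- commutes with `c_a`, and still with the earlier generators because two signs cancel.
      let Q : V →ₛₗ[σ] V' := X + (((ε a / 2 : ℝ) : ℂ)⁻¹) • (R'.c a).comp (X.comp (R.c a))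
      have hQ : ∀ v, Q v = X v + (((ε a / 2 : ℝ) : ℂ)⁻¹) • R'.c a (X (R.c a v)) := fun v => rfl
      have hne : ∀ i ∈ s, i ≠ a := fun i hi h => ha (h ▸ hi)
      by_cases hY : Q = 0
      · have hm : ∀ v, R'.c a (X (R.c a v)) = -(((ε a / 2 : ℝ) : ℂ) • X v) := fun v => by
          have h := LinearMap.congr_fun hY v
          rw [hQ, LinearMap.zero_apply] at h
          have h2 := congrArg (fun w => ((ε a / 2 : ℝ) : ℂ) • w) h
          simp only [smul_add, smul_smul, mul_inv_cancel₀ (hu a), one_smul, smul_zero] at h2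
          exact eq_neg_of_add_eq_zero_right h2
        have hm' : ∀ v, X (R.c a v) = -R'.c a (X v) := fun v => by
          have h := congrArg (R'.c a) (hm v)
          rw [R'.c_sq, map_neg, map_smul, ← smul_neg] at h
          exact smul_right_injective _ (hu a) h
        -- If `Q` vanishes, then `X` anticommutes with `c_a`. The product `c_a γ` anticommutes with
        -- `c_a` and commutes with the other generators, so composing with it repairs the sign; the
        -- price is the opposite parity of the intertwiner.
        refine ⟨X.comp ((R.c a).comp R.γ), ?_, ?_, -τ, fun v => ?_⟩
        · obtain ⟨v, hv⟩ : ∃ v, X v ≠ 0 := by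
            by_contra! h; exact hX (LinearMap.ext h)
          intro h
          have h := LinearMap.congr_fun h (R.γ v)
          simp only [LinearMap.comp_apply, R.γ_sq, LinearMap.zero_apply, hm'] at h
          exact R'.c_ne_zero hε a hv (neg_eq_zero.1 h)
        · intro i hi v
          simp only [LinearMap.comp_apply]
          rcases Finset.mem_insert.1 hi with rfl | hi
          · rw [R.γ_c, map_neg, map_neg, hm']; simp
          · rw [R.γ_c, map_neg, R.c_c a i (hne i hi).symm, neg_neg, hs i hi]
        · simp only [LinearMap.comp_apply, R.γ_sq]
          have h2 : X (R.c a v) = X (R.γ (R.γ (R.c a v))) := by rw [R.γ_sq]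
          rw [h2, hτ, R.γ_c, map_neg, map_neg]; simp
      · refine ⟨Q, hY, ?_, τ, fun v => ?_⟩
        · intro i hi v
          rcases Finset.mem_insert.1 hi with rfl | hi
          · simp only [hQ, R.c_sq, map_add, map_smul, R'.c_sq, map_smulₛₗ, hσ, smul_smul,
              inv_mul_cancel₀ (hu i), one_smul]
            rw [add_comm]
          · simp only [hQ, map_add, map_smul, hs i hi, R.c_c a i (hne i hi).symm,
              R'.c_c a i (hne i hi).symm, map_neg, neg_neg]
        · simp only [hQ, hτ, map_add, map_smul, smul_add]
          have : R.c a (R.γ v) = - R.γ (R.c a v) := by rw [R.γ_c, neg_neg]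
          rw [this, map_neg, hτ, map_neg, map_smul]
          have h3 : ∀ w, R'.c a (R'.γ w) = -R'.γ (R'.c a w) := fun w => by rw [R'.γ_c, neg_neg]
          simp only [h3, smul_neg, neg_neg]
          rw [smul_comm]
  cases nonempty_fintype ι
  obtain ⟨X, h1, h2, h3⟩ := key Finset.univ
  exact ⟨X, h1, fun i => h2 i (Finset.mem_univ i), h3⟩

/-- The transposed representation on the dual space. -/
def dual (R : CliffRep ε V) : CliffRep ε (Dual ℂ V) where
  c i := (R.c i).dualMap
  γ := R.γ.dualMap
  c_sq i f := by ext v; simp [R.c_sq]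
  c_c i j h f := by ext v; simp [R.c_c j i h.symm]
  γ_sq f := by ext v; simp [R.γ_sq]
  γ_c i f := by ext v; simp [R.γ_c]

/-- Transport of a representation along a linear isomorphism. -/
def conj (R : CliffRep ε V) (e : V ≃ₗ[ℂ] V') : CliffRep ε V' where
  c i := e.toLinearMap.comp ((R.c i).comp e.symm.toLinearMap)
  γ := e.toLinearMap.comp (R.γ.comp e.symm.toLinearMap)
  c_sq i f := by simp [R.c_sq]
  c_c i j h f := by simp [R.c_c i j h]
  γ_sq f := by simp [R.γ_sq]
  γ_c i f := by simp [R.γ_c]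

theorem Irr.conj {R : CliffRep ε V} (hR : R.Irr) (e : V ≃ₗ[ℂ] V') : (R.conj e).Irr := by
  intro W h1 h2
  have := hR (W.comap e.toLinearMap) (fun s hs => ?_) (fun i s hs => ?_)
  · rcases this with h | h
    · left
      rw [eq_bot_iff]
      intro w hw
      have h3 : e.symm w ∈ W.comap e.toLinearMap := by simpa using hw
      rw [h, Submodule.mem_bot] at h3
      simpa using h3
    · right
      rw [eq_top_iff]
      intro w _
      have h3 : e.symm w ∈ W.comap e.toLinearMap := by rw [h]; trivial
      simpa using h3
  · have := h1 (e s) hs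
    simpa [CliffRep.conj] using this
  · have := h2 i (e s) hs
    simpa [CliffRep.conj] using this

/-- The restriction of a representation to an invariant subspace. -/
def restrict (R : CliffRep ε V) (W : Submodule ℂ V) (h1 : ∀ s ∈ W, R.γ s ∈ W)
    (h2 : ∀ i, ∀ s ∈ W, R.c i s ∈ W) : CliffRep ε W where
  c i := (R.c i).restrict (h2 i)
  γ := R.γ.restrict h1
  c_sq i f := Subtype.ext (R.c_sq i f)
  c_c i j h f := Subtype.ext (R.c_c i j h f)
  γ_sq f := Subtype.ext (R.γ_sq f)
  γ_c i f := Subtype.ext (R.γ_c i f)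

/-- Doubling: on `V × V` the old involutions act by `g` and `-g` on the two factors, and the
exchange of the factors anticommutes with all of them. -/
theorem exists_anticommuting (m : ℕ) :
    ∃ (V : Type) (_ : AddCommGroup V) (_ : Module ℂ V) (g : ℕ → V →ₗ[ℂ] V),
      FiniteDimensional ℂ V ∧ Nontrivial V ∧ (∀ i < m, ∀ v, g i (g i v) = v) ∧
      ∀ i < m, ∀ j < m, i ≠ j → ∀ v, g i (g j v) = -g j (g i v) := by
  induction m with
  | zero => exact ⟨ℂ, inferInstance, inferInstance, fun _ => 0, inferInstance, inferInstance,
      by simp, by simp⟩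
  | succ m ih =>
    obtain ⟨V, _, _, g, hfin, hnt, h1, h2⟩ := ih
    let G : ℕ → (V × V) →ₗ[ℂ] (V × V) := fun i =>
      if i < m then LinearMap.prodMap (g i) (-(g i)) else
        (LinearMap.snd ℂ V V).prod (LinearMap.fst ℂ V V)
    have hG : ∀ i < m, ∀ v, G i v = (g i v.1, -g i v.2) := fun i hi v => by simp [G, hi]
    have hm : ∀ i, ¬ i < m → ∀ v, G i v = (v.2, v.1) := fun i hi v => by
      simp only [G, hi, if_false]; rfl
    refine ⟨V × V, inferInstance, inferInstance, G, inferInstance, inferInstance, ?_, ?_⟩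
    · intro i hi v
      by_cases h : i < m
      · simp [hG i h, h1 i h]
      · simp [hm i h]
    · intro i hi j hj hij v
      by_cases h : i < m <;> by_cases h' : j < m
      · simp [hG i h, hG j h', h2 i h j h' hij]
      · simp [hG i h, hm j h']
      · simp [hm i h, hG j h']
      · omega

/-- Of `r + 1` anticommuting involutions the last one serves as parity, and the others are scaled by
complex square roots of `ε/2`. A minimal nonzero graded submodule is irreducible. -/
theorem exists_irr (r : ℕ) (ε : Fin r → ℝ) :
    ∃ (N : ℕ) (R : CliffRep ε (Fin N → ℂ)), R.Irr ∧ Nontrivial (Fin N → ℂ) := by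
  obtain ⟨V, _, _, g, hfin, hnt, h1, h2⟩ := exists_anticommuting (r + 1)
  choose z hz using fun i => IsAlgClosed.exists_pow_nat_eq ((ε i / 2 : ℝ) : ℂ) (n := 2) two_pos
  let R : CliffRep ε V :=
    { c := fun i => z i • g i
      γ := g r
      c_sq := fun i v => by
        simp only [LinearMap.smul_apply, map_smul, h1 i (by omega), smul_smul]
        rw [← hz, pow_two]
      c_c := fun i j hij v => by
        simp only [LinearMap.smul_apply, map_smul]
        rw [h2 i (by omega) j (by omega) (fun h => hij (Fin.ext h)), smul_neg, smul_neg,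
          smul_comm]
      γ_sq := h1 r (by omega)
      γ_c := fun i v => by
        simp only [LinearMap.smul_apply, map_smul]
        rw [h2 r (by omega) i (by omega) (by omega), smul_neg] }
  let 𝒲 : Set (Submodule ℂ V) :=
    {W | W ≠ ⊥ ∧ (∀ s ∈ W, R.γ s ∈ W) ∧ ∀ i, ∀ s ∈ W, R.c i s ∈ W}
  obtain ⟨W, ⟨hW, hγ, hc⟩, hmin⟩ := (wellFounded_lt (α := Submodule ℂ V)).has_min 𝒲
    ⟨⊤, top_ne_bot, by simp, by simp⟩
  have hirr : (R.restrict W hγ hc).Irr := by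
    intro W' h1 h2
    by_cases hb : W' = ⊥
    · exact Or.inl hb
    right
    have hlt : ¬ W'.map W.subtype < W := hmin _ ⟨fun h => hb ?_, ?_, ?_⟩
    · have hle : W'.map W.subtype ≤ W := Submodule.map_subtype_le W W'
      have heq := hle.eq_of_not_lt hlt
      rw [eq_top_iff]
      intro w _
      have : (w : V) ∈ W'.map W.subtype := by rw [heq]; exact w.2
      obtain ⟨w', hw', h⟩ := this
      rwa [← Subtype.ext h]
    · exact (Submodule.map_injective_of_injective W.injective_subtype) (h.trans (Submodule.map_bot _).symm)
    · rintro _ ⟨w, hw, rfl⟩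
      exact ⟨_, h1 w hw, rfl⟩
    · rintro i _ ⟨w, hw, rfl⟩
      exact ⟨_, h2 i w hw, rfl⟩
  let e := (finBasis ℂ W).equivFun
  have : Nontrivial W := (Submodule.nontrivial_iff_ne_bot).2 hW
  exact ⟨_, _, hirr.conj e, e.symm.toEquiv.nontrivial⟩

/-- An irreducible graded representation has a nondegenerate invariant form. -/
theorem exists_form [Finite ι] [FiniteDimensional ℂ V] [Nontrivial V] (hε : ∀ i, ε i * ε i = 1)
    {R : CliffRep ε V} (hR : R.Irr) :
    ∃ B : V →ₗ[ℂ] V →ₗ[ℂ] ℂ, B.Nondegenerate ∧ (∀ i s t, B (R.c i s) t = B s (R.c i t)) ∧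
      ∃ τ : ℤˣ, ∀ s t, B (R.γ s) (R.γ t) = ((τ : ℤ) : ℂ) * B s t := by
  -- An intertwiner into the transposed representation is an invariant form. Its kernel is a graded
  -- submodule, so it is injective, and a dimension count gives nondegeneracy on the other side.
  obtain ⟨X, hX, h1, τ, hτ⟩ := exists_intertwiner hε R R.dual (RingHom.id ℂ)
  have hinj : Function.Injective X := by
    rw [← LinearMap.ker_eq_bot]
    refine (hR (LinearMap.ker X) (fun s hs => ?_) (fun i s hs => ?_)).resolve_right fun ht => ?_
    · rw [LinearMap.mem_ker] at *; rw [hτ, hs, map_zero, smul_zero]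
    · rw [LinearMap.mem_ker] at *; rw [h1, hs, map_zero]
    · exact hX (LinearMap.ker_eq_top.1 ht)
  have hnd : LinearMap.SeparatingLeft X := fun s hs => by
    refine hinj ?_
    rw [map_zero]
    exact LinearMap.ext hs
  refine ⟨X, ⟨hnd, ?_⟩, fun i s t => ?_, τ, fun s t => ?_⟩
  · intro t ht
    have hsurj : Function.Surjective X :=
      (LinearMap.injective_iff_surjective_of_finrank_eq_finrank
        (Subspace.dual_finrank_eq (K := ℂ) (V := V)).symm).1 hinj
    refine (Module.forall_dual_apply_eq_zero_iff ℂ t).1 fun f => ?_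
    obtain ⟨s, rfl⟩ := hsurj f
    exact ht s
  · rw [h1]; rfl
  · rw [hτ]
    change ((τ : ℤ) : ℂ) * X s (R.γ (R.γ t)) = _
    rw [R.γ_sq]

end CliffRep
end CliffordRepresentations
end CourantDirac

namespace CourantDirac

/-! ## Constant frames of spinor bundles -/

section SpinorFrames

open Filter Topology Module

variable {n : ℕ} {M : Type uM} [TopologicalSpace M] [ChartedSpace (EuclideanSpace ℝ (Fin n)) M]
  [IsManifold (𝓡 n) ∞ M] [T2Space M]
  {F : Type uF} [NormedAddCommGroup F] [NormedSpace ℝ F] [FiniteDimensional ℝ F]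
  {E : M → Type uE} [∀ x, AddCommGroup (E x)] [∀ x, Module ℝ (E x)]
  [∀ x, TopologicalSpace (E x)] [TopologicalSpace (TotalSpace F E)] [FiberBundle F E]
  [VectorBundle ℝ F E] [ContMDiffVectorBundle ∞ F E (𝓡 n)]

namespace SpinorBundle

variable {𝒞 : CourantAlgebroid n F E} {P : SpinorBundle.{uM, uF, uE, w} 𝒞}

namespace SmoothAt

variable {s t : ∀ x, P.S x} {x : P.U}

theorem congr (hs : P.SmoothAt s x) (h : ∀ᶠ y in 𝓝 x, t y = s y) : P.SmoothAt t x :=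
  ContMDiffAt.congr_of_eventuallyEq hs (by filter_upwards [h] with y hy; rw [hy])

theorem add (hs : P.SmoothAt s x) (ht : P.SmoothAt t x) : P.SmoothAt (fun y => s y + t y) x :=
  ContMDiffAt.add_section hs ht

theorem zero (x : P.U) : P.SmoothAt (fun _ => 0) x := contMDiff_zeroSection ℝ P.S x

theorem sum {ι : Type*} (S : Finset ι) {s : ι → ∀ x, P.S x} (h : ∀ i ∈ S, P.SmoothAt (s i) x) :
    P.SmoothAt (fun y => ∑ i ∈ S, s i y) x := by
  classical
  induction S using Finset.induction_on with
  | empty => simpa using zero x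
  | insert a S ha ih =>
    simp only [Finset.sum_insert ha]
    exact (h a (Finset.mem_insert_self a S)).add (ih fun i hi => h i (Finset.mem_insert_of_mem hi))

theorem real_smul {f : P.U → ℝ} (hf : ContMDiffAt (𝓡 n) 𝓘(ℝ, ℝ) ∞ f x) (hs : P.SmoothAt s x) :
    P.SmoothAt (fun y => f y • s y) x := ContMDiffAt.smul_section hf hs

theorem complex_fun_smul {f : P.U → ℂ} (hf : ContMDiffAt (𝓡 n) 𝓘(ℝ, ℂ) ∞ f x)
    (hs : P.SmoothAt s x) : P.SmoothAt (fun y => f y • s y) x := by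
  have h1 : ContMDiffAt (𝓡 n) 𝓘(ℝ, ℝ) ∞ (fun y => (f y).re) x :=
    Complex.reCLM.contMDiff.contMDiffAt.comp x hf
  have h2 : ContMDiffAt (𝓡 n) 𝓘(ℝ, ℝ) ∞ (fun y => (f y).im) x :=
    Complex.imCLM.contMDiff.contMDiffAt.comp x hf
  refine ((hs.real_smul h1).add ((hs.complex_smul Complex.I).real_smul h2)).congr
    (Eventually.of_forall fun y => ?_)
  conv_lhs => rw [← Complex.re_add_im (f y), add_smul, mul_smul]
  rw [Complex.coe_smul, Complex.coe_smul]

theorem cliff (e : Cₛ^∞⟮𝓡 n; F, E⟯) (hs : P.SmoothAt s x) : P.SmoothAt (fun y => P.cliff y (e y) (s y)) x :=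
  P.smooth_cliff e s x hs

theorem parity (hs : P.SmoothAt s x) : P.SmoothAt (fun y => P.parity y (s y)) x :=
  P.smooth_parity s x hs

end SmoothAt

variable (P)

theorem exists_spinor_section (x₀ : P.U) (s₀ : P.S x₀) :
    ∃ s : ∀ x, P.S x, s x₀ = s₀ ∧ ∀ x, P.SmoothAt s x := by
  obtain ⟨s, h1, -, h2⟩ := exists_section (n := n) (V := P.V) (S := P.S) x₀ s₀
    (O := Set.univ) univ_mem
  exact ⟨s, h1, fun x => h2 x⟩

theorem finite_spinors (x : P.U) : FiniteDimensional ℂ (P.S x) :=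
  have := finite_fibre P.V (S := P.S) x
  FiniteDimensional.right ℝ ℂ (P.S x)

variable {W : Opens M}

/-- The Clifford representation on a fibre. -/
def cliffRep (o : 𝒞.OrthoFrame W) (x : P.U) (hx : (x : M) ∈ W) : CliffRep o.ε (P.S x) where
  c i := P.cliff x (o.e i x)
  γ := P.parity x
  c_sq i v := by rw [P.cliff_sq, o.orth x hx, if_pos rfl]
  c_c i j h v := by
    have := P.cliff_mul_add x (o.e i x) (o.e j x) v
    rw [o.orth x hx, if_neg h] at this
    exact eq_neg_of_add_eq_zero_left (by simpa using this)
  γ_sq := P.parity_sq x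
  γ_c i := P.parity_cliff x _

theorem cliffRep_irr (o : 𝒞.OrthoFrame W) (x : P.U) (hx : (x : M) ∈ W) :
    (P.cliffRep o x hx).Irr := by
  intro W' h1 h2
  refine P.irreducible x W' h1 fun a s hs => ?_
  rw [o.expand hx a, map_sum, LinearMap.sum_apply]
  refine Submodule.sum_mem _ fun i _ => ?_
  rw [map_smul, LinearMap.smul_apply, ← Complex.coe_smul]
  exact Submodule.smul_mem _ _ (h2 i s hs)

/-- A local frame of a spinor bundle in which Clifford multiplication by an orthonormal frame,
the parity and the pairing are constant. -/
structure SpinorFrame (o : 𝒞.OrthoFrame W) where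
  le : W ≤ P.U
  N : ℕ
  R : CliffRep o.ε (Fin N → ℂ)
  irr : R.Irr
  nontrivial : Nontrivial (Fin N → ℂ)
  G : ∀ x : P.U, (Fin N → ℂ) →ₗ[ℂ] P.S x
  smooth : ∀ z (x : P.U), (x : M) ∈ W → P.SmoothAt (fun y => G y z) x
  bijective : ∀ x : P.U, (x : M) ∈ W → Function.Bijective (G x)
  cliff : ∀ x : P.U, (x : M) ∈ W → ∀ i z, P.cliff x (o.e i x) (G x z) = G x (R.c i z)
  parity : ∀ x : P.U, (x : M) ∈ W → ∀ z, P.parity x (G x z) = G x (R.γ z)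
  B : (Fin N → ℂ) →ₗ[ℂ] (Fin N → ℂ) →ₗ[ℂ] ℂ
  form : ∀ x : P.U, (x : M) ∈ W → ∀ z z', P.form x (G x z) (G x z') = B z z'

namespace SpinorFrame

variable {P}
variable {o : 𝒞.OrthoFrame W} (fr : P.SpinorFrame o)

/-- The restriction to a smaller open set. -/
def restrict {W' : Opens M} (h : W' ≤ W) : P.SpinorFrame (o.restrict h) where
  le := h.trans fr.le
  N := fr.N
  R := fr.R
  irr := fr.irr
  nontrivial := fr.nontrivial
  G := fr.G
  smooth z x hx := fr.smooth z x (h hx)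
  bijective x hx := fr.bijective x (h hx)
  cliff x hx := fr.cliff x (h hx)
  parity x hx := fr.parity x (h hx)
  B := fr.B
  form x hx := fr.form x (h hx)

theorem coefficients_smooth {x : P.U} (hx : (x : M) ∈ W) {s : ∀ y, P.S y} {u : P.U → Fin fr.N → ℂ}
    (hs : P.SmoothAt s x) (hu : ∀ᶠ y in 𝓝 x, fr.G y (u y) = s y) :
    ContMDiffAt (𝓡 n) 𝓘(ℝ, Fin fr.N → ℂ) ∞ u x :=
  (frame_bijective_smooth (n := n) (V := P.V) (S := P.S) (fun y => (fr.G y).restrictScalars ℝ) x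
    (fun z => fr.smooth z x hx) (fr.bijective x hx)).2 s u hs hu

theorem smooth_apply {x : P.U} (hx : (x : M) ∈ W) {u : P.U → Fin fr.N → ℂ}
    (hu : ContMDiffAt (𝓡 n) 𝓘(ℝ, Fin fr.N → ℂ) ∞ u x) : P.SmoothAt (fun y => fr.G y (u y)) x := by
  have h : ∀ y, fr.G y (u y) = ∑ i, u y i • fr.G y (Pi.single i 1) := fun y => by
    conv_lhs => rw [pi_eq_sum_univ' (u y)]
    simp only [map_sum, map_smul]
  simp only [h]
  refine SmoothAt.sum _ fun i _ => (fr.smooth _ x hx).complex_fun_smul ?_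
  exact (ContinuousLinearMap.proj (R := ℝ) (φ := fun _ : Fin fr.N => ℂ) i).contMDiff.contMDiffAt.comp
    x hu

/-- The coefficients of a spinor in a frame. -/
def coeff (x : P.U) (hx : (x : M) ∈ W) : P.S x ≃ₗ[ℂ] (Fin fr.N → ℂ) :=
  (LinearEquiv.ofBijective (fr.G x) (fr.bijective x hx)).symm

@[simp] theorem G_coeff (x : P.U) (hx : (x : M) ∈ W) (s : P.S x) : fr.G x (fr.coeff x hx s) = s :=
  (LinearEquiv.ofBijective (fr.G x) (fr.bijective x hx)).apply_symm_apply s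

@[simp] theorem coeff_G (x : P.U) (hx : (x : M) ∈ W) (z) : fr.coeff x hx (fr.G x z) = z :=
  (LinearEquiv.ofBijective (fr.G x) (fr.bijective x hx)).symm_apply_apply z

end SpinorFrame

/-- The representation on the fibre at `x₀` is the constant model. A basis at `x₀` is extended to
smooth sections and the resulting map is averaged over the generators one after another. At `x₀` it
is equivariant from the beginning, so averaging does not change it there and it stays bijective. -/
theorem exists_equivariant_frame (o : 𝒞.OrthoFrame W) (x₀ : P.U) (hx₀ : (x₀ : M) ∈ W) :
    ∃ (N : ℕ) (R : CliffRep o.ε (Fin N → ℂ)) (G : ∀ x : P.U, (Fin N → ℂ) →ₗ[ℂ] P.S x),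
      R.Irr ∧ Nontrivial (Fin N → ℂ) ∧ (∀ z x, P.SmoothAt (fun y => G y z) x) ∧
      Function.Bijective (G x₀) ∧
      (∀ x : P.U, (x : M) ∈ W → ∀ i z, P.cliff x (o.e i x) (G x z) = G x (R.c i z)) ∧
      (∀ x : P.U, (x : M) ∈ W → ∀ z, P.parity x (G x z) = G x (R.γ z)) := by
  have := P.finite_spinors x₀
  let b := finBasis ℂ (P.S x₀)
  set N := finrank ℂ (P.S x₀)
  let e : P.S x₀ ≃ₗ[ℂ] (Fin N → ℂ) := b.equivFun
  let R := (P.cliffRep o x₀ hx₀).conj e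
  choose s hs hss using fun i => P.exists_spinor_section x₀ (b i)
  have step : ∀ I : Finset (Fin (finrank ℝ F)), ∃ G : ∀ x : P.U, (Fin N → ℂ) →ₗ[ℂ] P.S x,
      (∀ z x, P.SmoothAt (fun y => G y z) x) ∧ (∀ z, G x₀ z = e.symm z) ∧
      ∀ x : P.U, (x : M) ∈ W → ∀ i ∈ I, ∀ z, P.cliff x (o.e i x) (G x z) = G x (R.c i z) := by
    intro I
    induction I using Finset.induction_on with
    | empty =>
      refine ⟨fun x => Fintype.linearCombination ℂ fun i => s i x, fun z x => ?_, fun z => ?_,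
        by simp⟩
      · simp only [Fintype.linearCombination_apply]
        exact SmoothAt.sum _ fun i _ => (hss i x).complex_smul (z i)
      · simp only [Fintype.linearCombination_apply, hs]
        exact (b.equivFun_symm_apply z).symm
    | insert a I ha ih =>
      obtain ⟨G, h1, h2, h3⟩ := ih
      -- As `2 ε_a c(e_a)` is the inverse of `c(e_a)`, this is the mean of `G` and `c(e_a)⁻¹ G
      -- R(c_a)`.
      refine ⟨fun x => (1 / 2 : ℂ) • (G x + (2 * o.ε a : ℂ) •
        (P.cliff x (o.e a x)).comp ((G x).comp (R.c a))), fun z x => ?_, fun z => ?_, ?_⟩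
      · exact ((h1 z x).add (((h1 (R.c a z) x).cliff _).complex_smul _)).complex_smul _
      · simp only [LinearMap.smul_apply, LinearMap.add_apply, LinearMap.comp_apply, h2]
        have h4 : e.symm (R.c a z) = P.cliff x₀ (o.e a x₀) (e.symm z) := by
          simp [R, CliffRep.conj, cliffRep]
        rw [h4, P.cliff_sq, o.orth _ hx₀, if_pos rfl, smul_smul]
        have h5 : (2 * o.ε a : ℂ) * ((o.ε a / 2 : ℝ) : ℂ) = 1 := by
          have := o.ε_mul a
          have h6 : ((o.ε a : ℂ)) * o.ε a = 1 := by exact_mod_cast this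
          push_cast; linear_combination h6
        rw [h5, one_smul, ← two_smul ℂ, smul_smul]; norm_num
      · intro x hx i hi z
        have hR := (P.cliffRep o x hx)
        simp only [LinearMap.smul_apply, LinearMap.add_apply, LinearMap.comp_apply, map_smul,
          map_add]
        have h6 : ((o.ε a : ℂ)) * o.ε a = 1 := by exact_mod_cast o.ε_mul a
        rcases Finset.mem_insert.1 hi with rfl | hi
        · rw [P.cliff_sq, o.orth _ hx, if_pos rfl, R.c_sq, map_smul, map_smul, smul_smul, smul_smul]
          have h5 : (2 * o.ε i : ℂ) * ((o.ε i / 2 : ℝ) : ℂ) = 1 := by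
            push_cast; linear_combination h6
          rw [h5, one_smul, one_smul, add_comm]
        · have hia : i ≠ a := fun h => ha (h ▸ hi)
          have h7 := (P.cliffRep o x hx).c_c i a hia (G x (R.c a z))
          change P.cliff x (o.e i x) (P.cliff x (o.e a x) _) =
            -P.cliff x (o.e a x) (P.cliff x (o.e i x) _) at h7
          rw [h3 x hx i hi, h7, h3 x hx i hi, R.c_c i a hia, map_neg, map_neg, neg_neg]
  obtain ⟨G, h1, h2, h3⟩ := step Finset.univ
  -- A last average over the parity. It anticommutes with the generators on both sides, so the
  -- equivariance already achieved survives.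
  refine ⟨N, R, fun x => (1 / 2 : ℂ) • (G x + (P.parity x).comp ((G x).comp R.γ)),
    (P.cliffRep_irr o x₀ hx₀).conj e, ?_, fun z x => ?_, ?_, fun x hx i z => ?_, fun x hx z => ?_⟩
  · have := P.nontrivial x₀
    exact e.symm.toEquiv.nontrivial
  · exact ((h1 z x).add (h1 (R.γ z) x).parity).complex_smul _
  · convert e.symm.bijective using 1
    funext z
    simp only [LinearMap.smul_apply, LinearMap.add_apply, LinearMap.comp_apply, h2]
    have h4 : e.symm (R.γ z) = P.parity x₀ (e.symm z) := by
      simp [R, CliffRep.conj, cliffRep]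
    rw [h4, P.parity_sq, ← two_smul ℂ, smul_smul]; norm_num
  · simp only [LinearMap.smul_apply, LinearMap.add_apply, LinearMap.comp_apply, map_smul,
      map_add]
    have h5 : ∀ s, P.cliff x (o.e i x) (P.parity x s) = -P.parity x (P.cliff x (o.e i x) s) :=
      fun s => by rw [P.parity_cliff, neg_neg]
    rw [h5, h3 x hx i (Finset.mem_univ i), h3 x hx i (Finset.mem_univ i), R.γ_c, map_neg, map_neg]
  · simp only [LinearMap.smul_apply, LinearMap.add_apply, LinearMap.comp_apply, map_smul,
      map_add, P.parity_sq, R.γ_sq]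
    rw [add_comm]

theorem contDiffAt_inv_sqrt {z : ℂ} (hz : z ∈ Complex.slitPlane) :
    ContDiffAt ℝ ∞ (fun z : ℂ => Complex.exp (-Complex.log z / 2)) z :=
  (((Complex.contDiffAt_log hz).neg.div_const 2).cexp).restrict_scalars ℝ

/-- Around every point there is a frame in which the whole structure is constant. -/
theorem exists_spinorFrame_restrict {W₀ : Opens M} (o : 𝒞.OrthoFrame W₀) (x₀ : P.U)
    (hx₀ : (x₀ : M) ∈ W₀) : ∃ (W : Opens M) (hW : W ≤ W₀),
      (x₀ : M) ∈ W ∧ Nonempty (P.SpinorFrame (o.restrict hW)) := by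
  obtain ⟨N, R, G, hirr, hnt, h1, h2, h3, h4⟩ := P.exists_equivariant_frame o x₀ hx₀
  let B : P.U → (Fin N → ℂ) →ₗ[ℂ] (Fin N → ℂ) →ₗ[ℂ] ℂ :=
    fun x => (P.form x).compl₁₂ (G x) (G x)
  have hB : ∀ x z z', B x z z' = P.form x (G x z) (G x z') := fun x z z' => rfl
  have hcliff : ∀ x : P.U, (x : M) ∈ W₀ → ∀ i z z',
      B x (R.c i z) z' = ((P.sign : ℤ) : ℂ) * B x z (R.c i z') := fun x hx i z z' => by
    rw [hB, hB, ← h3 x hx, ← h3 x hx, P.form_cliff]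
  have hpar : ∀ x : P.U, (x : M) ∈ W₀ → ∀ z z',
      B x (R.γ z) (R.γ z') = ((P.formParity : ℤ) : ℂ) * B x z z' := fun x hx z z' => by
    rw [hB, hB, ← h4 x hx, ← h4 x hx, P.form_parity]
  have hpar' : ∀ x : P.U, (x : M) ∈ W₀ → ∀ z z',
      B x (R.γ z) z' = ((P.formParity : ℤ) : ℂ) * B x z (R.γ z') := fun x hx z z' => by
    rw [← hpar x hx, R.γ_sq]
  have hnd : (B x₀).SeparatingLeft := fun z hz => by
    refine h2.1 ?_
    rw [map_zero]
    refine (P.form_nondegenerate x₀).1 _ fun t => ?_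
    obtain ⟨z', rfl⟩ := h2.2 t
    exact hz z'
  have hinj : Function.Injective (B x₀) := by
    rw [← LinearMap.ker_eq_bot, LinearMap.ker_eq_bot']
    exact fun z hz => hnd z fun z' => by rw [hz]; rfl
  let e : (Fin N → ℂ) ≃ₗ[ℂ] Dual ℂ (Fin N → ℂ) := LinearEquiv.ofInjectiveOfFinrankEq (B x₀) hinj
    (Subspace.dual_finrank_eq (K := ℂ) (V := Fin N → ℂ)).symm
  have he : ∀ z z', e z z' = B x₀ z z' := fun z z' => rfl
  -- Two forms with the same invariance signs: the endomorphism comparing them commutes with the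
  -- generators and with the parity, so it is a scalar.
  have hlam : ∀ x : P.U, (x : M) ∈ W₀ → ∃ l : ℂ, ∀ z z', B x z z' = l * B x₀ z z' := by
    intro x hx
    let T : (Fin N → ℂ) →ₗ[ℂ] (Fin N → ℂ) := e.symm.toLinearMap.comp (B x)
    have hT : ∀ z z', B x₀ (T z) z' = B x z z' := fun z z' => by
      rw [← he]; simp [T]
    obtain ⟨l, hl⟩ := CliffRep.schur hirr T (fun i v => hinj <| LinearMap.ext fun z' => by
        rw [hT, hcliff x hx, hcliff _ hx₀, hT]) (fun v => hinj <| LinearMap.ext fun z' => by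
        rw [hT, hpar' x hx, hpar' _ hx₀, hT])
    exact ⟨l, fun z z' => by rw [← hT, hl]; simp⟩
  obtain ⟨z₁, hz₁⟩ := exists_ne (0 : Fin N → ℂ)
  obtain ⟨z₂, hz₂⟩ : ∃ z₂, B x₀ z₁ z₂ ≠ 0 := by
    by_contra! h
    exact hz₁ (hnd z₁ h)
  -- The scalar is read off from one pair of vectors. This shows that it is smooth; its value at
  -- `x₀` is one, so it stays off the cut of the logarithm nearby.
  let l : P.U → ℂ := fun x => (B x₀ z₁ z₂)⁻¹ * B x z₁ z₂
  have hl : ∀ x : P.U, (x : M) ∈ W₀ → ∀ z z', B x z z' = l x * B x₀ z z' := fun x hx z z' => by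
    obtain ⟨k, hk⟩ := hlam x hx
    simp only [l, hk]
    field_simp
  have hls : ∀ x, ContMDiffAt (𝓡 n) 𝓘(ℝ, ℂ) ∞ l x := fun x =>
    (ContinuousLinearMap.mul ℝ ℂ (B x₀ z₁ z₂)⁻¹).contMDiff.contMDiffAt.comp x
      (P.smooth_form _ _ x (h1 z₁ x) (h1 z₂ x))
  have hev : ∀ᶠ x : P.U in 𝓝 x₀, Function.Bijective (G x) ∧ (x : M) ∈ W₀ ∧
      l x ∈ Complex.slitPlane := by
    refine ((frame_bijective_smooth (n := n) (V := P.V) (S := P.S)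
      (fun y => (G y).restrictScalars ℝ) x₀ (fun z => h1 z x₀) h2).1).and (Eventually.and ?_ ?_)
    · exact continuous_subtype_val.continuousAt.eventually (W₀.isOpen.mem_nhds hx₀)
    · refine (hls x₀).continuousAt.eventually (Complex.isOpen_slitPlane.mem_nhds ?_)
      simp only [l, inv_mul_cancel₀ hz₂, Complex.one_mem_slitPlane]
  obtain ⟨O, hO, hOo, hxO⟩ := eventually_nhds_iff.1 hev
  let W : Opens M := ⟨Subtype.val '' O, P.U.isOpen.isOpenMap_subtype_val O hOo⟩
  have hW : ∀ x : P.U, (x : M) ∈ W → x ∈ O := by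
    rintro x ⟨y, hy, h⟩
    rwa [← Subtype.ext h]
  have hWW : W ≤ W₀ := by
    rintro _ ⟨y, hy, rfl⟩
    exact (hO y hy).2.1
  -- Rescaling the frame by `l^{-1/2}` makes the pairing constant and leaves the matrices of
  -- Clifford multiplication and parity unchanged.
  let k : P.U → ℂ := fun x => Complex.exp (-Complex.log (l x) / 2)
  have hk : ∀ x ∈ O, k x * k x * l x = 1 := fun x hx => by
    have h := Complex.slitPlane_ne_zero (hO x hx).2.2
    have h2 : k x * k x = (l x)⁻¹ := by
      simp only [k]
      rw [← Complex.exp_add]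
      have : -Complex.log (l x) / 2 + -Complex.log (l x) / 2 = -Complex.log (l x) := by ring
      rw [this, Complex.exp_neg, Complex.exp_log h]
    rw [h2, inv_mul_cancel₀ h]
  refine ⟨W, hWW, ⟨x₀, hxO, rfl⟩, ⟨?_⟩⟩
  exact
    { le := by rintro _ ⟨y, hy, rfl⟩; exact y.2
      N := N
      R := R
      irr := hirr
      nontrivial := hnt
      G := fun x => k x • G x
      smooth := fun z x hx => (h1 z x).complex_fun_smul
        ((contDiffAt_inv_sqrt (hO x (hW x hx)).2.2).contMDiffAt.comp x (hls x))
      bijective := fun x hx => by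
        have hne : k x ≠ 0 := Complex.exp_ne_zero _
        have h := (hO x (hW x hx)).1
        refine ⟨fun a b hab => h.1 (smul_right_injective _ hne hab), fun s => ?_⟩
        obtain ⟨a, ha⟩ := h.2 ((k x)⁻¹ • s)
        exact ⟨a, by rw [LinearMap.smul_apply, ha, smul_smul, mul_inv_cancel₀ hne, one_smul]⟩
      cliff := fun x hx i z => by
        simp only [LinearMap.smul_apply, map_smul]
        rw [← h3 x (hWW hx)]; rfl
      parity := fun x hx z => by
        simp only [LinearMap.smul_apply, map_smul]
        rw [← h4 x (hWW hx)]
      B := B x₀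
      form := fun x hx z z' => by
        have h5 := hl x (hWW hx) z z'
        rw [hB] at h5
        simp only [LinearMap.smul_apply, map_smul, smul_eq_mul, h5]
        rw [← mul_assoc, ← mul_assoc, hk x (hW x hx), one_mul] }

theorem exists_spinorFrame (x₀ : P.U) : ∃ (W : Opens M) (o : 𝒞.OrthoFrame W),
    (x₀ : M) ∈ W ∧ Nonempty (P.SpinorFrame o) := by
  obtain ⟨W₀, hx₀, ⟨o⟩⟩ := 𝒞.exists_orthoFrame (x₀ : M)
  obtain ⟨W, hW, hx, hfr⟩ := P.exists_spinorFrame_restrict o x₀ hx₀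
  exact ⟨W, o.restrict hW, hx, hfr⟩

end SpinorBundle
end SpinorFrames
end CourantDirac

namespace CourantDirac

/-! ## Half-densities in coordinates -/

section HalfDensitiesInCoordinates

open Filter Topology Module

variable {n : ℕ} {M : Type uM} [TopologicalSpace M] [ChartedSpace (EuclideanSpace ℝ (Fin n)) M]
  [IsManifold (𝓡 n) ∞ M]

section Charts

variable {κ κ' : OpenPartialHomeomorph M (EuclideanSpace ℝ (Fin n))}

theorem chart_mdifferentiable (hκ : κ ∈ IsManifold.maximalAtlas (𝓡 n) ∞ M) :
    κ.MDifferentiable (𝓡 n) (𝓡 n) :=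
  ⟨(contMDiffOn_of_mem_maximalAtlas hκ).mdifferentiableOn (by simp),
    (contMDiffOn_symm_of_mem_maximalAtlas hκ).mdifferentiableOn (by simp)⟩

/-- The standard basis of the model space. -/
abbrev stdBasis (n : ℕ) : Basis (Fin n) ℝ (EuclideanSpace ℝ (Fin n)) :=
  (EuclideanSpace.basisFun (Fin n) ℝ).toBasis

/-- The volume of a tuple of tangent vectors in a chart. -/
def detAt (κ : OpenPartialHomeomorph M (EuclideanSpace ℝ (Fin n))) (x : M)
    (v : Fin n → TangentSpace (𝓡 n) x) : ℝ :=
  (stdBasis n).det fun j => mfderiv (𝓡 n) (𝓡 n) κ x (v j)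

/-- The basis of a tangent space given by a chart. -/
def coordBasis (hκ : κ ∈ IsManifold.maximalAtlas (𝓡 n) ∞ M) {x : M} (hx : x ∈ κ.source) :
    Basis (Fin n) ℝ (TangentSpace (𝓡 n) x) :=
  (stdBasis n).map ((chart_mdifferentiable hκ).mfderiv hx).symm.toLinearEquiv

theorem coordFrame_eq (hκ : κ ∈ IsManifold.maximalAtlas (𝓡 n) ∞ M) {x : M} (hx : x ∈ κ.source)
    (i : Fin n) : coordFrame κ x i = ((chart_mdifferentiable hκ).mfderiv hx).symm
      (stdBasis n i) := by
  have h : ((chart_mdifferentiable hκ).mfderiv hx : TangentSpace (𝓡 n) x →L[ℝ] _) =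
    mfderiv (𝓡 n) (𝓡 n) κ x := rfl
  rw [coordFrame, ← h, ContinuousLinearMap.inverse_equiv]
  simp

theorem coordBasis_apply (hκ : κ ∈ IsManifold.maximalAtlas (𝓡 n) ∞ M) {x : M} (hx : x ∈ κ.source) :
    ⇑(coordBasis hκ hx) = coordFrame κ x := by
  funext i
  rw [coordFrame_eq hκ hx]; rfl

theorem mfderiv_coordFrame (hκ : κ ∈ IsManifold.maximalAtlas (𝓡 n) ∞ M) {x : M}
    (hx : x ∈ κ.source) (i : Fin n) :
    mfderiv (𝓡 n) (𝓡 n) κ x (coordFrame κ x i) = stdBasis n i := by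
  rw [coordFrame_eq hκ hx]
  exact ((chart_mdifferentiable hκ).mfderiv hx).apply_symm_apply _

theorem detAt_coordFrame (hκ : κ ∈ IsManifold.maximalAtlas (𝓡 n) ∞ M) {x : M}
    (hx : x ∈ κ.source) : detAt κ x (coordFrame κ x) = 1 := by
  simp only [detAt, mfderiv_coordFrame hκ hx]
  exact (stdBasis n).det_self

theorem detAt_comp (hκ : κ ∈ IsManifold.maximalAtlas (𝓡 n) ∞ M) {x : M} (hx : x ∈ κ.source)
    (A : TangentSpace (𝓡 n) x →ₗ[ℝ] TangentSpace (𝓡 n) x) (v : Fin n → TangentSpace (𝓡 n) x) :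
    detAt κ x (fun i => A (v i)) = LinearMap.det A * detAt κ x v := by
  let e := ((chart_mdifferentiable hκ).mfderiv hx).toLinearEquiv
  have h := (stdBasis n).det_comp (e.toLinearMap ∘ₗ A ∘ₗ e.symm.toLinearMap) (fun i => e (v i))
  rw [← LinearMap.det_conj A e]
  refine Eq.trans ?_ h
  refine congrArg (stdBasis n).det (funext fun i => ?_)
  change e (A (v i)) = e (A (e.symm (e (v i))))
  rw [e.symm_apply_apply]

/-- Together with the transformation law this reduces a half-density to its value on the coordinate
frame. -/
theorem exists_map_coordFrame (hκ : κ ∈ IsManifold.maximalAtlas (𝓡 n) ∞ M) {x : M}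
    (hx : x ∈ κ.source) (v : Fin n → TangentSpace (𝓡 n) x) :
    ∃ A : TangentSpace (𝓡 n) x →ₗ[ℝ] TangentSpace (𝓡 n) x,
      v = (fun i => A (coordFrame κ x i)) ∧ LinearMap.det A = detAt κ x v := by
  let A := (coordBasis hκ hx).constr ℝ v
  have hA : v = fun i => A (coordFrame κ x i) := by
    funext i
    rw [← coordBasis_apply hκ hx, Basis.constr_basis]
  refine ⟨A, hA, ?_⟩
  conv_rhs => rw [hA, detAt_comp hκ hx, detAt_coordFrame hκ hx, mul_one]

theorem fderiv_transition (hκ : κ ∈ IsManifold.maximalAtlas (𝓡 n) ∞ M)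
    (hκ' : κ' ∈ IsManifold.maximalAtlas (𝓡 n) ∞ M) {x : M} (hx : x ∈ κ.source)
    (hx' : x ∈ κ'.source) (i : Fin n) :
    fderiv ℝ (κ ∘ κ'.symm) (κ' x) (stdBasis n i) =
      mfderiv (𝓡 n) (𝓡 n) κ x (coordFrame κ' x i) := by
  have hz := κ'.map_source hx'
  have h1 : MDifferentiableAt (𝓡 n) (𝓡 n) κ'.symm (κ' x) :=
    (chart_mdifferentiable hκ').mdifferentiableAt_symm hz
  have h2 : MDifferentiableAt (𝓡 n) (𝓡 n) κ (κ'.symm (κ' x)) := by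
    rw [κ'.left_inv hx']
    exact (chart_mdifferentiable hκ).mdifferentiableAt hx
  have h3 := mfderiv_comp (κ' x) h2 h1
  rw [← mfderiv_eq_fderiv, h3]
  have h5 : mfderiv (𝓡 n) (𝓡 n) κ'.symm (κ' x) (stdBasis n i) = coordFrame κ' x i := by
    rw [coordFrame_eq hκ' hx']; rfl
  change mfderiv (𝓡 n) (𝓡 n) κ (κ'.symm (κ' x))
    (mfderiv (𝓡 n) (𝓡 n) κ'.symm (κ' x) (stdBasis n i)) = _
  rw [h5]
  congr 2
  exact κ'.left_inv hx'

theorem detAt_transition (hκ : κ ∈ IsManifold.maximalAtlas (𝓡 n) ∞ M)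
    (hκ' : κ' ∈ IsManifold.maximalAtlas (𝓡 n) ∞ M) {x : M} (hx : x ∈ κ.source)
    (hx' : x ∈ κ'.source) :
    detAt κ x (coordFrame κ' x) = (fderiv ℝ (κ ∘ κ'.symm) (κ' x)).det := by
  have h := (stdBasis n).det_comp (fderiv ℝ (κ ∘ κ'.symm) (κ' x)).toLinearMap (stdBasis n)
  rw [(stdBasis n).det_self, mul_one] at h
  refine Eq.trans ?_ h
  rw [detAt]
  congr 1
  funext i
  exact (fderiv_transition hκ hκ' hx hx' i).symm

theorem contDiffAt_det {X : Type*} [NormedAddCommGroup X] [NormedSpace ℝ X]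
    {A : X → EuclideanSpace ℝ (Fin n) →L[ℝ] EuclideanSpace ℝ (Fin n)} {x : X}
    (hA : ContDiffAt ℝ ∞ A x) : ContDiffAt ℝ ∞ (fun y => (A y).det) x := by
  have h : ∀ y, (A y).det = (Matrix.of fun i j => A y (stdBasis n j) i).det := fun y => by
    rw [ContinuousLinearMap.det, ← LinearMap.det_toMatrix (stdBasis n)]
    congr 1
    ext i j
    simp [LinearMap.toMatrix_apply]
  simp only [h, Matrix.det_apply]
  refine ContDiffAt.sum fun σ _ => ?_
  refine ContDiffAt.const_smul _ (contDiffAt_prod fun i _ => ?_)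
  exact (EuclideanSpace.proj (σ i) : EuclideanSpace ℝ (Fin n) →L[ℝ] ℝ).contDiff.contDiffAt.comp x
    (hA.clm_apply contDiffAt_const)

theorem contDiffAt_transition (hκ : κ ∈ IsManifold.maximalAtlas (𝓡 n) ∞ M)
    (hκ' : κ' ∈ IsManifold.maximalAtlas (𝓡 n) ∞ M) {x : M} (hx : x ∈ κ.source)
    (hx' : x ∈ κ'.source) : ContDiffAt ℝ ∞ (κ ∘ κ'.symm) (κ' x) := by
  have h1 := contMDiffAt_symm_of_mem_maximalAtlas hκ' (κ'.map_source hx')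
  have h2 := contMDiffAt_of_mem_maximalAtlas hκ hx
  rw [← κ'.left_inv hx'] at h2
  exact (h2.comp (κ' x) h1).contDiffAt

/-- Half-densities transform smoothly. -/
theorem contMDiffAt_detAt (hκ : κ ∈ IsManifold.maximalAtlas (𝓡 n) ∞ M)
    (hκ' : κ' ∈ IsManifold.maximalAtlas (𝓡 n) ∞ M) {x : M} (hx : x ∈ κ.source)
    (hx' : x ∈ κ'.source) :
    ContMDiffAt (𝓡 n) 𝓘(ℝ, ℝ) ∞ (fun y => Real.sqrt |detAt κ y (coordFrame κ' y)|) x := by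
  have h1 : ContDiffAt ℝ ∞ (fun z => (fderiv ℝ (κ ∘ κ'.symm) z).det) (κ' x) :=
    contDiffAt_det ((contDiffAt_transition hκ hκ' hx hx').fderiv_right (by simp))
  -- Absolute value and square root are smooth only away from zero, so invertibility of the
  -- transition map is needed.
  have hne : (fderiv ℝ (κ ∘ κ'.symm) (κ' x)).det ≠ 0 := by
    intro h0
    rw [← detAt_transition hκ hκ' hx hx'] at h0
    obtain ⟨A, hA, hdet⟩ := exists_map_coordFrame hκ' hx' (coordFrame κ x)
    have := detAt_comp hκ hx A (coordFrame κ' x)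
    rw [← hA, detAt_coordFrame hκ hx, h0, mul_zero] at this
    exact one_ne_zero this
  have h2 := (h1.abs hne).sqrt (abs_ne_zero.2 hne)
  refine (h2.contMDiffAt.comp x (contMDiffAt_of_mem_maximalAtlas hκ' hx')).congr_of_eventuallyEq ?_
  filter_upwards [κ.open_source.mem_nhds hx, κ'.open_source.mem_nhds hx'] with y hy hy'
  rw [detAt_transition hκ hκ' hy hy']; rfl

end Charts

variable [T2Space M]
  {F : Type uF} [NormedAddCommGroup F] [NormedSpace ℝ F] [FiniteDimensional ℝ F]
  {E : M → Type uE} [∀ x, AddCommGroup (E x)] [∀ x, Module ℝ (E x)]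
  [∀ x, TopologicalSpace (E x)] [TopologicalSpace (TotalSpace F E)] [FiberBundle F E]
  [VectorBundle ℝ F E] [ContMDiffVectorBundle ∞ F E (𝓡 n)]

namespace SpinorBundle

variable {𝒞 : CourantAlgebroid n F E} (P : SpinorBundle.{uM, uF, uE, w} 𝒞)
  {κ κ' : OpenPartialHomeomorph M (EuclideanSpace ℝ (Fin n))}

theorem halfDensity_eq (hκ : κ ∈ IsManifold.maximalAtlas (𝓡 n) ∞ M) (ψ : P.HalfDensities)
    (x : P.U) (hx : (x : M) ∈ κ.source) (v) :
    ψ.1 x v = ((Real.sqrt |detAt κ x v| : ℝ) : ℂ) • ψ.1 x (coordFrame κ x) := by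
  obtain ⟨A, hA, hdet⟩ := exists_map_coordFrame hκ hx v
  rw [← hdet, ← ψ.2.1 x A, ← hA]

theorem halfDensity_ext {ψ χ : P.HalfDensities} {x : P.U}
    (hκ : κ ∈ IsManifold.maximalAtlas (𝓡 n) ∞ M) (hx : (x : M) ∈ κ.source)
    (h : ψ.1 x (coordFrame κ x) = χ.1 x (coordFrame κ x)) (v) : ψ.1 x v = χ.1 x v := by
  rw [P.halfDensity_eq hκ ψ x hx, h, ← P.halfDensity_eq hκ χ x hx]

variable {P} in
/-- The half-density `s |dx|^{1/2}`. -/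
def ofSection (hκ : κ ∈ IsManifold.maximalAtlas (𝓡 n) ∞ M) (s : ∀ x, P.S x)
    (hs : ∀ x : P.U, (x : M) ∈ κ.source → P.SmoothAt s x)
    (hs' : ∀ x : P.U, (x : M) ∉ κ.source → ∀ᶠ y in 𝓝 x, s y = 0) : P.HalfDensities :=
  ⟨fun x v => Real.sqrt |detAt κ x v| • s x, fun x A v => by
    beta_reduce
    by_cases hx : (x : M) ∈ κ.source
    · rw [detAt_comp hκ hx, abs_mul, Real.sqrt_mul (abs_nonneg _), mul_smul, Complex.coe_smul]
    · rw [(hs' x hx).self_of_nhds, smul_zero, smul_zero, smul_zero], fun κ' hκ' x hx' => by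
    by_cases hx : (x : M) ∈ κ.source
    · exact (hs x hx).real_smul ((contMDiffAt_subtype_iff).2 (contMDiffAt_detAt hκ hκ' hx hx'))
    · refine (SmoothAt.zero x).congr ?_
      filter_upwards [hs' x hx] with y hy
      rw [hy, smul_zero]⟩

@[simp] theorem ofSection_apply (hκ : κ ∈ IsManifold.maximalAtlas (𝓡 n) ∞ M) (s : ∀ x, P.S x)
    (hs hs') (x v) : (ofSection (P := P) hκ s hs hs').1 x v = Real.sqrt |detAt κ x v| • s x := rfl

theorem ofSection_coordFrame (hκ : κ ∈ IsManifold.maximalAtlas (𝓡 n) ∞ M) (s : ∀ x, P.S x)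
    (hs hs') (x : P.U) (hx : (x : M) ∈ κ.source) :
    (ofSection (P := P) hκ s hs hs').1 x (coordFrame κ x) = s x := by
  rw [ofSection_apply, detAt_coordFrame hκ hx]; simp

end SpinorBundle
end HalfDensitiesInCoordinates
end CourantDirac

namespace CourantDirac

/-! ## Local and fibrewise operators -/

section LocalOperators

open Filter Topology Module

variable {n : ℕ} {M : Type uM} [TopologicalSpace M] [ChartedSpace (EuclideanSpace ℝ (Fin n)) M]
  [IsManifold (𝓡 n) ∞ M] [T2Space M]
  {F : Type uF} [NormedAddCommGroup F] [NormedSpace ℝ F] [FiniteDimensional ℝ F]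
  {E : M → Type uE} [∀ x, AddCommGroup (E x)] [∀ x, Module ℝ (E x)]
  [∀ x, TopologicalSpace (E x)] [TopologicalSpace (TotalSpace F E)] [FiberBundle F E]
  [VectorBundle ℝ F E] [ContMDiffVectorBundle ∞ F E (𝓡 n)]

namespace SpinorBundle

variable {𝒞 : CourantAlgebroid n F E} {P : SpinorBundle.{uM, uF, uE, w} 𝒞}
  {κ κ' : OpenPartialHomeomorph M (EuclideanSpace ℝ (Fin n))}

theorem eventually_of_eventually_val {x : P.U} {p : P.U → Prop} (h : ∀ᶠ y in 𝓝 x, p y) :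
    ∃ O : Opens M, (x : M) ∈ O ∧ O ≤ P.U ∧ ∀ y : P.U, (y : M) ∈ O → p y := by
  obtain ⟨O, hO, hOo, hx⟩ := eventually_nhds_iff.1 h
  refine ⟨⟨_, P.U.isOpen.isOpenMap_subtype_val O hOo⟩, ⟨x, hx, rfl⟩, ?_, ?_⟩
  · rintro _ ⟨y, -, rfl⟩; exact y.2
  · rintro y ⟨z, hz, h⟩
    exact hO y (Subtype.ext h ▸ hz)

theorem val_eventually {x : P.U} {p : M → Prop} (h : ∀ᶠ y in 𝓝 (x : M), p y) :
    ∀ᶠ y : P.U in 𝓝 x, p y := continuous_subtype_val.continuousAt.eventually h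

/-- The half-density `χ s |dx|^{1/2}` with a cutoff function `χ`. -/
def cutoffSection (hκ : κ ∈ IsManifold.maximalAtlas (𝓡 n) ∞ M) (χ : C^∞⟮𝓡 n, M; ℝ⟯)
    (hχ : tsupport χ ⊆ κ.source) (s : ∀ x, P.S x)
    (hs : ∀ x : P.U, (x : M) ∈ tsupport χ → P.SmoothAt s x) : P.HalfDensities :=
  ofSection hκ (fun x => χ x • s x) (fun x _ => by
    by_cases h : (x : M) ∈ tsupport χ
    · exact (hs x h).real_smul ((χ.contMDiff.comp contMDiff_subtype_val) x)
    · refine (SmoothAt.zero x).congr ?_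
      filter_upwards [val_eventually ((isClosed_tsupport χ).isOpen_compl.mem_nhds h)] with y hy
      rw [image_eq_zero_of_notMem_tsupport hy, zero_smul]) (fun x hx => by
    filter_upwards [val_eventually ((isClosed_tsupport χ).isOpen_compl.mem_nhds
      fun h => hx (hχ h))] with y hy
    rw [image_eq_zero_of_notMem_tsupport hy, zero_smul])

theorem cutoffSection_apply (hκ : κ ∈ IsManifold.maximalAtlas (𝓡 n) ∞ M) (χ : C^∞⟮𝓡 n, M; ℝ⟯)
    (hχ : tsupport χ ⊆ κ.source) (s : ∀ x, P.S x) (hs) (x : P.U) (v) :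
    (cutoffSection hκ χ hχ s hs).1 x v = Real.sqrt |detAt κ x v| • χ x • s x := rfl

theorem cutoffSection_coordFrame (hκ : κ ∈ IsManifold.maximalAtlas (𝓡 n) ∞ M)
    (χ : C^∞⟮𝓡 n, M; ℝ⟯) (hχ : tsupport χ ⊆ κ.source) (s : ∀ x, P.S x) (hs) (x : P.U)
    (hx : (x : M) ∈ κ.source) :
    (cutoffSection hκ χ hχ s hs).1 x (coordFrame κ x) = χ x • s x :=
  ofSection_coordFrame P hκ _ _ _ x hx

theorem exists_halfDensity (x₀ : P.U) (hκ : κ ∈ IsManifold.maximalAtlas (𝓡 n) ∞ M)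
    (hx : (x₀ : M) ∈ κ.source) (s₀ : P.S x₀) :
    ∃ ψ : P.HalfDensities, ψ.1 x₀ (coordFrame κ x₀) = s₀ := by
  obtain ⟨s, h1, h2⟩ := P.exists_spinor_section x₀ s₀
  obtain ⟨χ, h3, -, h4⟩ := exists_bump (n := n) (x₀ : M) (κ.open_source.mem_nhds hx)
  refine ⟨cutoffSection hκ χ h4 s fun x _ => h2 x, ?_⟩
  rw [cutoffSection_coordFrame _ _ _ _ _ _ hx, h3.self_of_nhds, one_smul, h1]

theorem SpinorFrame.exists_halfDensities {W : Opens M} {o : 𝒞.OrthoFrame W} (fr : P.SpinorFrame o)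
    (hκ : κ ∈ IsManifold.maximalAtlas (𝓡 n) ∞ M) (x₀ : P.U) (hx : (x₀ : M) ∈ κ.source)
    (hxW : (x₀ : M) ∈ W) :
    ∃ Ψ : (Fin fr.N → ℂ) → P.HalfDensities, ∀ᶠ y in 𝓝 x₀, ∀ z,
      (Ψ z).1 y (coordFrame κ y) = fr.G y z := by
  obtain ⟨χ, h3, -, h4⟩ := exists_bump (n := n) (x₀ : M)
    (inter_mem (κ.open_source.mem_nhds hx) (W.isOpen.mem_nhds hxW))
  refine ⟨fun z => cutoffSection hκ χ (fun y hy => (h4 hy).1) (fun y => fr.G y z)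
    fun x hx => fr.smooth z x (h4 hx).2, ?_⟩
  filter_upwards [val_eventually h3, val_eventually (κ.open_source.mem_nhds hx)] with y hy hy' z
  refine (cutoffSection_coordFrame _ _ _ _ _ _ hy').trans ?_
  rw [hy, one_smul]

/-- The filtration tests operators against functions on all of `M`, whereas coefficients of spinors
live on `P.U`. Agreement near a point is enough because the operators concerned are local. -/
theorem exists_global_function {x₀ : P.U} (u : P.U → ℝ)
    (hu : ∀ᶠ y in 𝓝 x₀, ContMDiffAt (𝓡 n) 𝓘(ℝ, ℝ) ∞ u y) :
    ∃ f : C^∞⟮𝓡 n, M; ℝ⟯, ∀ᶠ y : P.U in 𝓝 x₀, f y = u y := by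
  classical
  obtain ⟨O, hx, hO, h⟩ := eventually_of_eventually_val hu
  obtain ⟨χ, h3, -, h4⟩ := exists_bump (n := n) (x₀ : M) (O.isOpen.mem_nhds hx)
  let g : M → ℝ := fun y => if hy : y ∈ P.U then u ⟨y, hy⟩ else 0
  have hg : ∀ y : P.U, g y = u y := fun y => by simp [g]
  refine ⟨⟨fun y => χ y • g y, contMDiff_cutoff χ g fun y hy => ?_⟩, ?_⟩
  · have h1 := h ⟨y, hO (h4 hy)⟩ (h4 hy)
    refine (contMDiffAt_subtype_iff (U := P.U) (x := ⟨y, hO (h4 hy)⟩)).1 ?_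
    exact h1.congr_of_eventuallyEq (Eventually.of_forall hg)
  · filter_upwards [val_eventually h3] with y hy
    change χ y • g y = u y
    rw [hy, one_smul, hg]

/-- `Aψ` near a point is determined by `ψ` near the point. -/
def IsLocal (A : P.Op) : Prop :=
  ∀ (ψ : P.HalfDensities) (x : P.U), (∀ᶠ y in 𝓝 x, ∀ v, ψ.1 y v = 0) → ∀ v, (A ψ).1 x v = 0

theorem IsLocal.congr {A : P.Op} (hA : IsLocal A) {ψ χ : P.HalfDensities} {x : P.U}
    (h : ∀ᶠ y in 𝓝 x, ∀ v, ψ.1 y v = χ.1 y v) (v) : (A ψ).1 x v = (A χ).1 x v := by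
  have := hA (ψ - χ) x (by filter_upwards [h] with y hy v; simp [hy]) v
  rw [map_sub, sub_val] at this
  exact sub_eq_zero.1 this

theorem isLocal_zero : IsLocal (0 : P.Op) := fun _ _ _ _ => rfl

theorem IsLocal.mul {A B : P.Op} (hA : IsLocal A) (hB : IsLocal B) : IsLocal (A * B) :=
  fun ψ x h v => hA _ x (by
    filter_upwards [eventually_eventually_nhds.2 h] with y hy v
    exact hB ψ y hy v) v

theorem IsLocal.add {A B : P.Op} (hA : IsLocal A) (hB : IsLocal B) : IsLocal (A + B) :=
  fun ψ x h v => by rw [LinearMap.add_apply, add_val, hA ψ x h, hB ψ x h, add_zero]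

/-- If `χ = 1` near `x` and `χ ψ = 0`, then `Aψ` at `x` is, up to sign, the value of `[A, χ] ψ`,
which vanishes by locality of the commutator. -/
theorem isLocal_of_commutator {A : P.Op} (h : ∀ f, IsLocal (A * P.m f - P.m f * A)) :
    IsLocal A := by
  intro ψ x hψ v
  obtain ⟨O, hx, hO, hψO⟩ := eventually_of_eventually_val hψ
  obtain ⟨χ, h3, -, h4⟩ := exists_bump (n := n) (x : M) (O.isOpen.mem_nhds hx)
  have h0 : P.m χ ψ = 0 := by
    refine Subtype.ext (funext fun y => funext fun v => ?_)
    rw [m_val]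
    by_cases hy : (y : M) ∈ tsupport χ
    · rw [hψO y (h4 hy), smul_zero]; rfl
    · rw [image_eq_zero_of_notMem_tsupport hy, zero_smul]; rfl
  have h1 := h χ ψ x hψ v
  rw [LinearMap.sub_apply, Module.End.mul_apply, Module.End.mul_apply, h0, map_zero, zero_sub,
    neg_val, m_val, h3.self_of_nhds, one_smul, neg_eq_zero] at h1
  exact h1

/-- An operator commuting with the functions is fibrewise. -/
theorem apply_eq_zero_of_commutes {A : P.Op} (hA : ∀ f, A * P.m f = P.m f * A)
    (ψ : P.HalfDensities) (x : P.U) (h : ∀ v, ψ.1 x v = 0) (v) : (A ψ).1 x v = 0 := by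
  have hloc : IsLocal A := isLocal_of_commutator fun f => by
    rw [hA, sub_self]; exact isLocal_zero
  have hκ := IsManifold.chart_mem_maximalAtlas (I := 𝓡 n) (n := ∞) (x : M)
  set κ := chartAt (EuclideanSpace ℝ (Fin n)) (x : M)
  have hx : (x : M) ∈ κ.source := mem_chart_source _ _
  obtain ⟨W, o, hxW, ⟨fr⟩⟩ := P.exists_spinorFrame x
  obtain ⟨Ψ, hΨ⟩ := fr.exists_halfDensities hκ x hx hxW
  classical
  let u : P.U → Fin fr.N → ℂ := fun y =>
    if hy : (y : M) ∈ W then fr.coeff y hy (ψ.1 y (coordFrame κ y)) else 0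
  have hu : ∀ y : P.U, (y : M) ∈ W → fr.G y (u y) = ψ.1 y (coordFrame κ y) := fun y hy => by
    simp [u, hy]
  have hus : ∀ᶠ y in 𝓝 x, ContMDiffAt (𝓡 n) 𝓘(ℝ, Fin fr.N → ℂ) ∞ u y := by
    filter_upwards [val_eventually (W.isOpen.mem_nhds hxW),
      val_eventually (κ.open_source.mem_nhds hx)] with y hy hy'
    refine fr.coefficients_smooth hy (ψ.2.2 κ hκ y hy') ?_
    filter_upwards [val_eventually (W.isOpen.mem_nhds hy)] with z hz
    exact hu z hz
  have hux : u x = 0 := (fr.bijective x hxW).1 (by rw [hu x hxW, h, map_zero])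
  let p (i : Fin fr.N) := ContinuousLinearMap.proj (R := ℝ) (φ := fun _ : Fin fr.N => ℂ) i
  have hre : ∀ i, ∃ f : C^∞⟮𝓡 n, M; ℝ⟯, ∀ᶠ y : P.U in 𝓝 x, f y = (u y i).re := fun i => by
    refine exists_global_function _ ?_
    filter_upwards [hus] with y hy
    exact (Complex.reCLM.comp (p i)).contMDiff.contMDiffAt.comp y hy
  have him : ∀ i, ∃ f : C^∞⟮𝓡 n, M; ℝ⟯, ∀ᶠ y : P.U in 𝓝 x, f y = (u y i).im := fun i => by
    refine exists_global_function _ ?_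
    filter_upwards [hus] with y hy
    exact (Complex.imCLM.comp (p i)).contMDiff.contMDiffAt.comp y hy
  choose f hf using hre
  choose g hg using him
  -- Near `x` the half-density is a combination of fixed ones with coefficients vanishing at `x`,
  -- and `A` passes through the coefficients. Real and imaginary parts are separated since `A` is
  -- known to commute with real functions only.
  have hdec : ∀ᶠ y in 𝓝 x, ∀ v, ψ.1 y v = (∑ i, (P.m (f i) (Ψ (Pi.single i 1)) +
      Complex.I • P.m (g i) (Ψ (Pi.single i 1)))).1 y v := by
    filter_upwards [val_eventually (W.isOpen.mem_nhds hxW),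
      val_eventually (κ.open_source.mem_nhds hx), eventually_all.2 hf, eventually_all.2 hg, hΨ]
      with y hy hy' hfy hgy hΨy
    refine P.halfDensity_ext hκ hy' ?_
    rw [sum_val]
    simp only [add_val, smul_val, m_val, hΨy, hfy, hgy]
    rw [← hu y hy]
    conv_lhs => rw [pi_eq_sum_univ' (u y), map_sum]
    refine Finset.sum_congr rfl fun i _ => ?_
    rw [map_smul]
    conv_lhs => rw [← Complex.re_add_im (u y i), add_smul, mul_comm, mul_smul, Complex.coe_smul,
      Complex.coe_smul]
  rw [hloc.congr hdec, map_sum, sum_val]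
  refine Finset.sum_eq_zero fun i _ => ?_
  have h1 : ∀ f ψ, A (P.m f ψ) = P.m f (A ψ) := fun f ψ => LinearMap.congr_fun (hA f) ψ
  rw [map_add, map_smul, h1, h1, add_val, smul_val, m_val, m_val, (hf i).self_of_nhds,
    (hg i).self_of_nhds, hux]
  simp

/-- The endomorphisms of the fibres defined by an operator commuting with the functions. -/
theorem exists_fibre_maps {A : P.Op} (hA : ∀ f, A * P.m f = P.m f * A) :
    ∃ T : ∀ x, P.S x →ₗ[ℂ] P.S x, (∀ ψ x v, (A ψ).1 x v = T x (ψ.1 x v)) ∧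
      ∀ s x, P.SmoothAt s x → P.SmoothAt (fun y => T y (s y)) x := by
  have hκ := fun x : P.U => IsManifold.chart_mem_maximalAtlas (I := 𝓡 n) (n := ∞) (x : M)
  let κ := fun x : P.U => chartAt (EuclideanSpace ℝ (Fin n)) (x : M)
  have hx : ∀ x : P.U, (x : M) ∈ (κ x).source := fun x => mem_chart_source _ _
  choose ψ hψ using fun (x : P.U) (s : P.S x) =>
    show ∃ ψ : P.HalfDensities, ψ.1 x (coordFrame (κ x) x) = s from
      exists_halfDensity x (hκ x) (hx x) s
  have key : ∀ x (χ χ' : P.HalfDensities), χ.1 x (coordFrame (κ x) x) =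
      χ'.1 x (coordFrame (κ x) x) → ∀ v, (A χ).1 x v = (A χ').1 x v := fun x χ χ' h v => by
    have := apply_eq_zero_of_commutes hA (χ - χ') x (fun v => by
      rw [sub_val, P.halfDensity_ext (hκ x) (hx x) h, sub_self]) v
    rw [map_sub, sub_val] at this
    exact sub_eq_zero.1 this
  let T : ∀ x, P.S x →ₗ[ℂ] P.S x := fun x =>
    { toFun := fun s => (A (ψ x s)).1 x (coordFrame (κ x) x)
      map_add' := fun s t => by
        rw [key x (ψ x (s + t)) (ψ x s + ψ x t) (by simp [hψ]), map_add, add_val]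
      map_smul' := fun z s => by
        rw [key x (ψ x (z • s)) (z • ψ x s) (by simp [hψ]), map_smul, smul_val]; rfl }
  have hT : ∀ χ x v, (A χ).1 x v = T x (χ.1 x v) := fun χ x v => by
    rw [P.halfDensity_eq (hκ x) (A χ) x (hx x), P.halfDensity_eq (hκ x) χ x (hx x), map_smul]
    congr 1
    exact key x _ _ (by rw [hψ]) _
  refine ⟨T, hT, fun s x hs => ?_⟩
  obtain ⟨W, o, hxW, ⟨fr⟩⟩ := P.exists_spinorFrame x
  obtain ⟨Ψ, hΨ⟩ := fr.exists_halfDensities (hκ x) x (hx x) hxW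
  classical
  let u : P.U → Fin fr.N → ℂ := fun y => if hy : (y : M) ∈ W then fr.coeff y hy (s y) else 0
  have hu' : ∀ y : P.U, (y : M) ∈ W → fr.G y (u y) = s y := fun y hy => by simp [u, hy]
  have hu : ∀ᶠ y : P.U in 𝓝 x, fr.G y (u y) = s y := by
    filter_upwards [val_eventually (W.isOpen.mem_nhds hxW)] with y hy
    exact hu' y hy
  have hus := fr.coefficients_smooth hxW hs hu
  have h2 : ∀ i, P.SmoothAt (fun y => T y (fr.G y (Pi.single i 1))) x := fun i => by
    refine ((A (Ψ (Pi.single i 1))).2.2 (κ x) (hκ x) x (hx x)).congr ?_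
    filter_upwards [hΨ] with y hy
    rw [← hy, ← hT]
  refine (SmoothAt.sum Finset.univ fun i _ => (h2 i).complex_fun_smul (f := fun y => u y i)
    ((ContinuousLinearMap.proj (R := ℝ) (φ := fun _ : Fin fr.N => ℂ) i).contMDiff.contMDiffAt.comp
      x hus)).congr ?_
  filter_upwards [hu] with y hy
  rw [← hy]
  conv_lhs => rw [pi_eq_sum_univ' (u y)]
  simp only [map_sum, map_smul]

end SpinorBundle
end LocalOperators
end CourantDirac

namespace CourantDirac

/-! ## Operators of order zero and one -/

section LowOrder

open Filter Topology Module

variable {n : ℕ} {M : Type uM} [TopologicalSpace M] [ChartedSpace (EuclideanSpace ℝ (Fin n)) M]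
  [IsManifold (𝓡 n) ∞ M] [T2Space M]
  {F : Type uF} [NormedAddCommGroup F] [NormedSpace ℝ F] [FiniteDimensional ℝ F]
  {E : M → Type uE} [∀ x, AddCommGroup (E x)] [∀ x, Module ℝ (E x)]
  [∀ x, TopologicalSpace (E x)] [TopologicalSpace (TotalSpace F E)] [FiberBundle F E]
  [VectorBundle ℝ F E] [ContMDiffVectorBundle ∞ F E (𝓡 n)]

theorem eq_zero_of_eq_neg {V : Type*} [AddCommGroup V] [Module ℂ V] {s : V} (h : s = -s) :
    s = 0 := by
  have h2 : (2 : ℂ) • s = 0 := by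
    rw [two_smul]; nth_rewrite 2 [h]; exact add_neg_cancel s
  exact (smul_eq_zero.1 h2).resolve_left two_ne_zero

namespace SpinorBundle

variable {𝒞 : CourantAlgebroid n F E} {P : SpinorBundle.{uM, uF, uE, w} 𝒞}

variable (P) in
/-- Multiplication by a smooth complex function. -/
def mc (h : C^∞⟮𝓡 n, P.U; 𝓘(ℝ, ℂ), ℂ⟯) : P.Op where
  toFun ψ := ⟨fun x v => h x • ψ.1 x v,
    fun x A v => by beta_reduce; rw [ψ.2.1 x A v, smul_comm],
    fun κ hκ x hx => (ψ.2.2 κ hκ x hx).complex_fun_smul (h.contMDiff x)⟩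
  map_add' ψ χ := by ext; simp
  map_smul' a ψ := Subtype.ext (funext fun x => funext fun v => smul_comm _ _ _)

@[simp] theorem mc_val (h) (ψ : P.HalfDensities) (x v) : (P.mc h ψ).1 x v = h x • ψ.1 x v := rfl

theorem exists_val_eq (x : P.U) (s : P.S x) : ∃ (ψ : P.HalfDensities) (v : _), ψ.1 x v = s :=
  have ⟨ψ, h⟩ := exists_halfDensity x (IsManifold.chart_mem_maximalAtlas (I := 𝓡 n) (n := ∞)
    (x : M)) (mem_chart_source _ _) s
  ⟨ψ, _, h⟩

theorem fibre_ext {A B : P.Op} {T T' : ∀ x, P.S x →ₗ[ℂ] P.S x}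
    (hA : ∀ ψ x v, (A ψ).1 x v = T x (ψ.1 x v)) (hB : ∀ ψ x v, (B ψ).1 x v = T' x (ψ.1 x v))
    (h : A = B) (x : P.U) (s : P.S x) : T x s = T' x s := by
  obtain ⟨ψ, v, rfl⟩ := exists_val_eq x s
  rw [← hA, ← hB, h]

theorem m_injective {f g : C^∞⟮𝓡 n, M; ℝ⟯} (h : P.m f = P.m g) (x : P.U) : f x = g x := by
  have := P.nontrivial x
  obtain ⟨s, hs⟩ := exists_ne (0 : P.S x)
  obtain ⟨ψ, v, hψ⟩ := exists_val_eq x s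
  have h1 : f x • ψ.1 x v = g x • ψ.1 x v := by rw [← m_val, h, m_val]
  rw [hψ, ← sub_eq_zero, ← sub_smul] at h1
  exact sub_eq_zero.1 ((smul_eq_zero.1 h1).resolve_right hs)

/-- A smooth family of scalars is a smooth function. -/
theorem contMDiffAt_of_smul {h : P.U → ℂ} {x : P.U}
    (hs : ∀ s, P.SmoothAt s x → P.SmoothAt (fun y => h y • s y) x) :
    ContMDiffAt (𝓡 n) 𝓘(ℝ, ℂ) ∞ h x := by
  obtain ⟨W, o, hxW, ⟨fr⟩⟩ := P.exists_spinorFrame x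
  have := fr.nontrivial
  obtain ⟨z, hz⟩ := exists_ne (0 : Fin fr.N → ℂ)
  obtain ⟨i, hi⟩ := Function.ne_iff.1 hz
  have h1 := fr.coefficients_smooth hxW (u := fun y => h y • z) (hs _ (fr.smooth z x hxW))
    (Eventually.of_forall fun y => by rw [map_smul])
  have h2 := ((ContinuousLinearMap.mul ℝ ℂ (z i)⁻¹).comp
    (ContinuousLinearMap.proj (R := ℝ) (φ := fun _ : Fin fr.N => ℂ) i)).contMDiff.contMDiffAt.comp
    x h1
  refine h2.congr_of_eventuallyEq (Eventually.of_forall fun y => ?_)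
  have hi' : z i ≠ 0 := hi
  simp only [Function.comp_apply, ContinuousLinearMap.comp_apply, ContinuousLinearMap.proj_apply,
    Pi.smul_apply, smul_eq_mul, ContinuousLinearMap.mul_apply']
  field_simp

theorem exists_fibre_scalar (x : P.U) (T : P.S x →ₗ[ℂ] P.S x)
    (hc : ∀ a s, T (P.cliff x a s) = P.cliff x a (T s))
    (hp : ∀ s, T (P.parity x s) = P.parity x (T s)) : ∃ z : ℂ, ∀ s, T s = z • s := by
  have := P.finite_spinors x
  have := P.nontrivial x
  obtain ⟨W, hx, ⟨o⟩⟩ := 𝒞.exists_orthoFrame (x : M)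
  exact CliffRep.schur (P.cliffRep_irr o x hx) T (fun i v => hc _ v) hp

/-- An operator commuting with functions, sections and the parity is a multiplication. -/
theorem exists_scalar {A : P.Op} (hm : ∀ f, A * P.m f = P.m f * A)
    (hc : ∀ e, A * P.c e = P.c e * A) (hp : A * P.γ = P.γ * A) : ∃ h, A = P.mc h := by
  obtain ⟨T, hT, hTs⟩ := exists_fibre_maps hm
  choose z hz using fun x => exists_fibre_scalar x (T x) (fun a s => by
    obtain ⟨e, rfl⟩ := exists_global_section (n := n) (F := F) (x : M) a
    exact fibre_ext (A := A * P.c e) (B := P.c e * A) (T := fun x => T x ∘ₗ P.cliff x (e x))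
      (T' := fun x => P.cliff x (e x) ∘ₗ T x) (fun ψ x v => by simp [hT]) (fun ψ x v => by simp [hT])
      (hc e) x s) (fun s =>
    fibre_ext (A := A * P.γ) (B := P.γ * A) (T := fun x => T x ∘ₗ P.parity x)
      (T' := fun x => P.parity x ∘ₗ T x) (fun ψ x v => by simp [hT]) (fun ψ x v => by simp [hT])
      hp x s)
  refine ⟨⟨z, fun x => contMDiffAt_of_smul fun s hs => ?_⟩, P.ext_op fun ψ x v => ?_⟩
  · simpa only [← hz] using hTs s x hs
  · rw [hT, hz]; rfl

theorem mc_commutes (h) : P.CommutesWithCommutant 0 (P.mc h) := by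
  intro W η hη ψ χ hχ x hx v
  rw [mc_val, mc_val, hχ x hx, map_smul, pow_zero, one_smul]

theorem mc_c (h) (e) : P.mc h * P.c e = P.c e * P.mc h := P.ext_op fun ψ x v => by simp

theorem mc_m (h) (f) : P.mc h * P.m f = P.m f * P.mc h :=
  P.ext_op fun _ _ _ => smul_comm _ _ _

theorem mc_γ (h) : P.mc h * P.γ = P.γ * P.mc h := P.ext_op fun ψ x v => by simp

theorem mc_mem (h) : P.mc h ∈ P.Filt 0 := by
  refine ⟨by simp [HasParity, mc_γ], mc_commutes h, fun f => ?_, fun e => ?_⟩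
  · simp [sbr, mc_m]
  · simp [sbr, mc_c]

theorem mem_filt_zero_iff (A : P.Op) : A ∈ P.Filt 0 ↔ ∃ h, A = P.mc h := by
  constructor
  · rintro ⟨h1, -, h3, h4⟩
    refine exists_scalar (fun f => ?_) (fun e => ?_) ?_
    · simpa [sbr, sub_eq_zero] using h3 f
    · simpa [sbr, sub_eq_zero] using h4 e
    · simpa [HasParity] using h1.symm
  · rintro ⟨h, rfl⟩
    exact mc_mem h

/-- Operators commuting with functions commute with complex functions. -/
theorem mc_comm {A : P.Op} (hm : ∀ f, A * P.m f = P.m f * A) (h) : A * P.mc h = P.mc h * A := by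
  obtain ⟨T, hT, -⟩ := exists_fibre_maps hm
  exact P.ext_op fun ψ x v => by simp [hT]

theorem exists_local_inv_sqrt (x₀ : P.U) {l : P.U → ℂ} (hl : ∀ x, ContMDiffAt (𝓡 n) 𝓘(ℝ, ℂ) ∞ l x)
    (h0 : l x₀ ≠ 0) : ∃ (k : C^∞⟮𝓡 n, P.U; 𝓘(ℝ, ℂ), ℂ⟯),
      ∀ᶠ x in 𝓝 x₀, k x * k x * l x = 1 := by
  obtain ⟨c, hc⟩ := IsAlgClosed.exists_pow_nat_eq (l x₀)⁻¹ (n := 2) two_pos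
  -- Normalizing the value at `x₀` to one moves the function off the cut of the logarithm; the
  -- constant `c` restores the factor.
  let l' : P.U → ℂ := fun x => (l x₀)⁻¹ * l x
  have hl' : ∀ x, ContMDiffAt (𝓡 n) 𝓘(ℝ, ℂ) ∞ l' x := fun x =>
    (ContinuousLinearMap.mul ℝ ℂ (l x₀)⁻¹).contMDiff.contMDiffAt.comp x (hl x)
  have hev : ∀ᶠ x in 𝓝 x₀, l' x ∈ Complex.slitPlane := by
    refine (hl' x₀).continuousAt.eventually (Complex.isOpen_slitPlane.mem_nhds ?_)
    simp only [l', inv_mul_cancel₀ h0, Complex.one_mem_slitPlane]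
  obtain ⟨χ, h3, -, h4⟩ := exists_bump (n := n) x₀ hev
  let k₀ : P.U → ℂ := fun x => c * Complex.exp (-Complex.log (l' x) / 2)
  have hk₀ : ∀ x, l' x ∈ Complex.slitPlane → ContMDiffAt (𝓡 n) 𝓘(ℝ, ℂ) ∞ k₀ x := fun x hx =>
    (ContinuousLinearMap.mul ℝ ℂ c).contMDiff.contMDiffAt.comp x
      ((contDiffAt_inv_sqrt hx).contMDiffAt.comp x (hl' x))
  refine ⟨⟨_, contMDiff_cutoff χ k₀ fun x hx => hk₀ x (h4 hx)⟩, ?_⟩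
  filter_upwards [hev, h3] with x hx hχ
  change χ x • k₀ x * χ x • k₀ x * l x = 1
  rw [hχ, one_smul]
  have hk : Complex.exp (-Complex.log (l' x) / 2) * Complex.exp (-Complex.log (l' x) / 2) =
      (l' x)⁻¹ := by
    rw [← Complex.exp_add]
    have : -Complex.log (l' x) / 2 + -Complex.log (l' x) / 2 = -Complex.log (l' x) := by ring
    rw [this, Complex.exp_neg, Complex.exp_log (Complex.slitPlane_ne_zero hx)]
  have hne := Complex.slitPlane_ne_zero hx
  have h5 : l x = l x₀ * l' x := by simp only [l']; field_simp
  calc k₀ x * k₀ x * l x = c ^ 2 * (Complex.exp (-Complex.log (l' x) / 2) *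
        Complex.exp (-Complex.log (l' x) / 2)) * l x := by simp only [k₀]; ring
    _ = 1 := by rw [hk, hc, h5]; field_simp

/-- An operator of order one is determined by its commutators with sections. -/
theorem eq_zero_of_filt_one {A : P.Op} (hA : A ∈ P.Filt 1) (h : ∀ e, P.sbr 1 1 A (P.c e) = 0) :
    A = 0 := by
  obtain ⟨h1, h2, h3, -⟩ := hA
  have hm : ∀ f, A * P.m f = P.m f * A := fun f => by
    simpa [sbr, sub_eq_zero] using h3 f
  have hc : ∀ e, A * P.c e = -(P.c e * A) := fun e => by
    have := h e
    simp only [sbr, mul_one, pow_one, neg_one_mul, sub_neg_eq_add] at this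
    exact eq_neg_of_add_eq_zero_left this
  have hp : A * P.γ = -(P.γ * A) := by
    have := h1
    simp only [HasParity, pow_one, neg_one_mul] at this
    rw [this, neg_neg]
  -- `A` anticommutes with the sections and with the parity, so `A²` commutes with both.
  obtain ⟨l, hl⟩ := exists_scalar (A := A * A) (fun f => by
      rw [mul_assoc, hm, ← mul_assoc, hm, mul_assoc]) (fun e => by
      rw [mul_assoc, hc, mul_neg, ← mul_assoc, hc, neg_mul, neg_neg, mul_assoc])
      (by rw [mul_assoc, hp, mul_neg, ← mul_assoc, hp, neg_mul, neg_neg, mul_assoc])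
  obtain ⟨T, hT, hTs⟩ := exists_fibre_maps hm
  have hTT : ∀ x s, T x (T x s) = l x • s := fun x s =>
    fibre_ext (A := A * A) (B := P.mc l) (T := fun x => T x ∘ₗ T x)
      (T' := fun x => l x • LinearMap.id) (fun ψ x v => by simp [hT]) (fun ψ x v => by simp)
      hl x s
  have hTc : ∀ (x : P.U) (a : E x) s, T x (P.cliff x a s) = -P.cliff x a (T x s) := fun x a s => by
    obtain ⟨e, rfl⟩ := exists_global_section (n := n) (F := F) (x : M) a
    exact fibre_ext (A := A * P.c e) (B := -(P.c e * A)) (T := fun x => T x ∘ₗ P.cliff x (e x))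
      (T' := fun x => -(P.cliff x (e x) ∘ₗ T x)) (fun ψ x v => by simp [hT])
      (fun ψ x v => by simp [hT]) (hc e) x s
  have hTp : ∀ x s, T x (P.parity x s) = -P.parity x (T x s) := fun x s =>
    fibre_ext (A := A * P.γ) (B := -(P.γ * A)) (T := fun x => T x ∘ₗ P.parity x)
      (T' := fun x => -(P.parity x ∘ₗ T x)) (fun ψ x v => by simp [hT]) (fun ψ x v => by simp [hT])
      hp x s
  -- Where `l` does not vanish, `η = l^{-1/2} A` is an odd section of the commutant. Then `A` has to
  -- anticommute with `η`, but it commutes with it because `η` is a multiple of `A`.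
  have hl0 : ∀ x, l x = 0 := by
    intro x₀
    by_contra hne
    obtain ⟨k, hk⟩ := exists_local_inv_sqrt x₀ (fun x => l.contMDiff x) hne
    obtain ⟨W, hxW, hW, hkW⟩ := eventually_of_eventually_val hk
    let η : ∀ x : P.U, P.S x →ₗ[ℂ] P.S x := fun x => k x • T x
    have hη : P.IsOddCommutant W η :=
      { smooth := fun s x _ hs => (hTs s x hs).complex_fun_smul (k.contMDiff x)
        sq := fun x hx s => by
          simp only [η, LinearMap.smul_apply, map_smul, hTT, smul_smul]
          rw [← mul_assoc, hkW x hx, one_smul]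
        parity := fun x hx s => by simp [η, hTp]
        cliff := fun x hx a s => by simp [η, hTc] }
    have := P.nontrivial x₀
    obtain ⟨s, hs⟩ := exists_ne (0 : P.S x₀)
    obtain ⟨ψ, v, hψ⟩ := exists_val_eq x₀ s
    have h5 := h2 W η hη ψ ((P.mc k * A) ψ) (fun x _ v => by simp [η, hT]) x₀ hxW v
    have h6 : k x₀ • l x₀ • s = -(k x₀ • l x₀ • s) := by
      simpa [η, hT, hTT, hψ] using h5
    have h7 : k x₀ • l x₀ • s = 0 := eq_zero_of_eq_neg h6
    have h8 : k x₀ * k x₀ * l x₀ = 1 := hkW x₀ hxW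
    have h9 : k x₀ • k x₀ • l x₀ • s = s := by rw [smul_smul, smul_smul, h8, one_smul]
    rw [h7, smul_zero] at h9
    exact hs h9.symm
  refine P.ext_op fun ψ x v => ?_
  -- From `A² = 0` the kernel in each fibre is nonzero, and it is a graded submodule.
  have hker : LinearMap.ker (T x) = ⊤ := by
    refine (P.irreducible x (LinearMap.ker (T x)) (fun s hs => ?_) (fun a s hs => ?_)).resolve_left
      fun hbot => ?_
    · rw [LinearMap.mem_ker] at *; rw [hTp, hs, map_zero, neg_zero]
    · rw [LinearMap.mem_ker] at *; rw [hTc, hs, map_zero, neg_zero]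
    · have := P.nontrivial x
      obtain ⟨s, hs⟩ := exists_ne (0 : P.S x)
      have h6 : T x (T x s) = 0 := by rw [hTT, hl0, zero_smul]
      have hinj := LinearMap.ker_eq_bot.1 hbot
      exact hs (hinj ((hinj (h6.trans (map_zero _).symm)).trans (map_zero _).symm))
  rw [hT, LinearMap.ker_eq_top.1 hker]; rfl

end SpinorBundle
end LowOrder
end CourantDirac

namespace CourantDirac

/-! ## The filtration -/

section Filtration

open Filter Topology Module

variable {n : ℕ} {M : Type uM} [TopologicalSpace M] [ChartedSpace (EuclideanSpace ℝ (Fin n)) M]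
  [IsManifold (𝓡 n) ∞ M]
  {F : Type uF} [NormedAddCommGroup F] [NormedSpace ℝ F]
  {E : M → Type uE} [∀ x, AddCommGroup (E x)] [∀ x, Module ℝ (E x)]
  [∀ x, TopologicalSpace (E x)] [TopologicalSpace (TotalSpace F E)] [FiberBundle F E]
  [VectorBundle ℝ F E]

namespace SpinorBundle

variable {𝒞 : CourantAlgebroid n F E} {P : SpinorBundle.{uM, uF, uE, w} 𝒞}

namespace CommutesWithCommutant

variable {p q : ℕ} {A B : P.Op}

theorem add (hA : P.CommutesWithCommutant p A) (hB : P.CommutesWithCommutant p B) :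
    P.CommutesWithCommutant p (A + B) := fun W η hη ψ χ h x hx v => by
  simp only [LinearMap.add_apply, add_val, hA W η hη ψ χ h x hx, hB W η hη ψ χ h x hx, map_add,
    smul_add]

theorem smul (z : ℂ) (hA : P.CommutesWithCommutant p A) :
    P.CommutesWithCommutant p (z • A) := fun W η hη ψ χ h x hx v => by
  simp only [LinearMap.smul_apply, smul_val, hA W η hη ψ χ h x hx, map_smul]
  rw [smul_comm]

theorem zero : P.CommutesWithCommutant p 0 := fun W η hη ψ χ h x hx v => by simp

theorem mul (hA : P.CommutesWithCommutant p A) (hB : P.CommutesWithCommutant q B) :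
    P.CommutesWithCommutant (p + q) (A * B) := fun W η hη ψ χ h x hx v => by
  -- `Bχ` equals `η Bψ` only up to the sign `(-1)^q`, which is moved into the argument of `A`.
  have h1 := hA W η hη (B ψ) ((-1 : ℂ) ^ q • B χ) (fun x hx v => by
    rw [smul_val, hB W η hη ψ χ h x hx, smul_smul, ← mul_pow]; simp) x hx v
  have h2 : (A * B) χ = (-1 : ℂ) ^ q • A ((-1 : ℂ) ^ q • B χ) := by
    rw [map_smul, smul_smul, ← mul_pow]; simp
  rw [h2, smul_val, h1, smul_smul, pow_add, mul_comm]; rfl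

theorem sbr (hA : P.CommutesWithCommutant p A) (hB : P.CommutesWithCommutant q B) :
    P.CommutesWithCommutant (p + q) (P.sbr p q A B) := by
  rw [SpinorBundle.sbr, sub_eq_add_neg, ← neg_one_smul ℂ, neg_one_pow_eq_smul]
  have h := hB.mul hA
  rw [add_comm q p] at h
  exact (hA.mul hB).add ((h.smul _).smul _)

end CommutesWithCommutant

theorem c_commutes (e) : P.CommutesWithCommutant 1 (P.c e) := fun W η hη ψ χ h x hx v => by
  simp [h x hx, hη.cliff x hx]

theorem m_commutes (f) : P.CommutesWithCommutant 0 (P.m f) := fun W η hη ψ χ h x hx v => by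
  have h1 : P.m f χ = P.m f χ := rfl
  rw [m_val, m_val, h x hx, ← Complex.coe_smul, ← Complex.coe_smul, map_smul, pow_zero, one_smul]

namespace HasParity

variable {p q : ℕ} {A B : P.Op}

theorem add (hA : P.HasParity p A) (hB : P.HasParity p B) : P.HasParity p (A + B) := by
  simp only [HasParity, mul_add, add_mul] at *
  rw [hA, hB]

theorem smul (z : ℂ) (hA : P.HasParity p A) : P.HasParity p (z • A) := by
  simp only [HasParity, mul_smul_comm, smul_mul_assoc] at *
  rw [hA]

theorem zero : P.HasParity p 0 := by simp [HasParity]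

theorem mul (hA : P.HasParity p A) (hB : P.HasParity q B) : P.HasParity (p + q) (A * B) := by
  unfold HasParity at *
  calc P.γ * (A * B) = P.γ * A * B := (mul_assoc _ _ _).symm
    _ = (-1) ^ p * (A * (P.γ * B)) := by rw [hA, mul_assoc, mul_assoc]
    _ = (-1) ^ p * ((-1) ^ q * (A * (B * P.γ))) := by
        rw [hB, ← mul_assoc A, ← neg_one_pow_mul_comm q A, mul_assoc]
    _ = _ := by rw [pow_add, mul_assoc, mul_assoc]

theorem sbr (hA : P.HasParity p A) (hB : P.HasParity q B) :
    P.HasParity (p + q) (P.sbr p q A B) := by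
  rw [SpinorBundle.sbr, sub_eq_add_neg, ← neg_one_smul ℂ, neg_one_pow_eq_smul]
  have h := hB.mul hA
  rw [add_comm q p] at h
  exact (hA.mul hB).add ((h.smul _).smul _)

end HasParity

theorem c_parity (e) : P.HasParity 1 (P.c e) := by
  simp only [HasParity, pow_one, neg_one_mul, γ_c]

theorem m_parity (f) : P.HasParity 0 (P.m f) := by
  simp only [HasParity, pow_zero, one_mul, γ_m]

variable (P) in
/-- The filtration by order, with index shifted by two. -/
def GF : ℕ → Submodule ℂ P.Op
  | 0 => ⊥
  | 1 => ⊥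
  | k + 2 =>
    { carrier := {A | P.HasParity k A ∧ P.CommutesWithCommutant k A ∧
        (∀ f, P.sbr k 0 A (P.m f) ∈ GF k) ∧ ∀ e, P.sbr k 1 A (P.c e) ∈ GF (k + 1)}
      zero_mem' := ⟨.zero, .zero, fun f => by rw [sbr_zero_left]; exact zero_mem _,
        fun e => by rw [sbr_zero_left]; exact zero_mem _⟩
      add_mem' := fun hA hB => ⟨hA.1.add hB.1, hA.2.1.add hB.2.1,
        fun f => by rw [sbr_add_left]; exact add_mem (hA.2.2.1 f) (hB.2.2.1 f),
        fun e => by rw [sbr_add_left]; exact add_mem (hA.2.2.2 e) (hB.2.2.2 e)⟩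
      smul_mem' := fun z A hA => ⟨hA.1.smul z, hA.2.1.smul z,
        fun f => by rw [sbr_smul_left]; exact Submodule.smul_mem _ _ (hA.2.2.1 f),
        fun e => by rw [sbr_smul_left]; exact Submodule.smul_mem _ _ (hA.2.2.2 e)⟩ }

theorem mem_GF_iff {k : ℕ} {A : P.Op} : A ∈ P.GF (k + 2) ↔ P.HasParity k A ∧
    P.CommutesWithCommutant k A ∧ (∀ f, P.sbr k 0 A (P.m f) ∈ P.GF k) ∧
    ∀ e, P.sbr k 1 A (P.c e) ∈ P.GF (k + 1) := by
  rw [GF]; rfl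

theorem mem_GF_zero {A : P.Op} : A ∈ P.GF 0 ↔ A = 0 := by rw [GF, Submodule.mem_bot]
theorem mem_GF_one {A : P.Op} : A ∈ P.GF 1 ↔ A = 0 := by rw [GF, Submodule.mem_bot]

theorem eq_zero_of_mem_GF {k : ℕ} (hk : k < 2) {A : P.Op} (hA : A ∈ P.GF k) : A = 0 := by
  interval_cases k
  · exact mem_GF_zero.1 hA
  · exact mem_GF_one.1 hA

/-- The three clauses of `Filt` become one recursion in `GF`, in which the orders `-2` and `-1` are
present and zero. Inductions on the order then need no separate treatment of low degrees. -/
theorem mem_filt_iff : ∀ {p : ℕ} {A : P.Op}, A ∈ P.Filt p ↔ A ∈ P.GF (p + 2)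
  | 0, A => by simp only [mem_GF_iff, mem_GF_zero]; rfl
  | 1, A => by
    have h : ∀ A, A ∈ P.Filt 0 ↔ A ∈ P.GF 2 := fun A => mem_filt_iff
    have h2 : P.GF (1 + 1) = P.GF 2 := rfl
    simp only [mem_GF_iff (k := 1), mem_GF_one, h2, ← h]; rfl
  | p + 2, A => by
    have h : ∀ A, A ∈ P.Filt p ↔ A ∈ P.GF (p + 2) := fun A => mem_filt_iff
    have h' : ∀ A, A ∈ P.Filt (p + 1) ↔ A ∈ P.GF (p + 2 + 1) := fun A => mem_filt_iff
    rw [mem_GF_iff]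
    simp only [← h, ← h']
    have h2 : ∀ A : P.Op, P.HasParity (p + 2) A ↔ P.HasParity p A := fun A =>
      ⟨hasParity_mod (by omega), hasParity_mod (by omega)⟩
    have h3 : ∀ A : P.Op, P.CommutesWithCommutant (p + 2) A ↔ P.CommutesWithCommutant p A :=
      fun A => ⟨commutes_mod (by omega), commutes_mod (by omega)⟩
    have h4 : ∀ q (A B : P.Op), P.sbr (p + 2) q A B = P.sbr p q A B :=
      fun q A B => sbr_mod (by omega) rfl A B
    rw [h2, h3]
    simp only [h4]
    rfl

theorem GF_le : ∀ k, P.GF k ≤ P.GF (k + 2)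
  | 0 => by rw [GF]; exact bot_le
  | 1 => by rw [GF]; exact bot_le
  | k + 2 => fun A hA => by
    rw [mem_GF_iff] at hA ⊢
    refine ⟨hasParity_mod (by omega) hA.1, commutes_mod (by omega) hA.2.1, fun f => ?_, fun e => ?_⟩
    · rw [sbr_mod (p' := k) (q' := 0) (by omega) rfl]; exact GF_le k (hA.2.2.1 f)
    · rw [sbr_mod (p' := k) (q' := 1) (by omega) rfl]; exact GF_le (k + 1) (hA.2.2.2 e)

theorem mem_GF_mod {k l : ℕ} (h : k % 2 = l % 2) (hkl : k ≤ l) {A : P.Op} (hA : A ∈ P.GF k) :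
    A ∈ P.GF l := by
  obtain ⟨j, rfl⟩ : ∃ j, l = k + 2 * j := ⟨(l - k) / 2, by omega⟩
  clear h hkl
  induction j with
  | zero => exact hA
  | succ j ih => exact GF_le _ ih

/-- Leibniz rule and induction on the total index. The shift by two occurs in both factors and only
once in the product; the subtraction truncates only if a factor is zero. -/
theorem GF_mul {i j : ℕ} {A B : P.Op} (hA : A ∈ P.GF i) (hB : B ∈ P.GF j) :
    A * B ∈ P.GF (i + j - 2) := by
  induction hs : i + j using Nat.strong_induction_on generalizing i j A B with
  | _ s ih =>
    subst hs
    by_cases hi : i < 2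
    · rw [eq_zero_of_mem_GF hi hA, zero_mul]; exact zero_mem _
    by_cases hj : j < 2
    · rw [eq_zero_of_mem_GF hj hB, mul_zero]; exact zero_mem _
    obtain ⟨p, rfl⟩ : ∃ p, i = p + 2 := ⟨i - 2, by omega⟩
    obtain ⟨q, rfl⟩ : ∃ q, j = q + 2 := ⟨j - 2, by omega⟩
    have : p + 2 + (q + 2) - 2 = p + q + 2 := by omega
    rw [this, mem_GF_iff]
    have hA' := mem_GF_iff.1 hA
    have hB' := mem_GF_iff.1 hB
    refine ⟨hA'.1.mul hB'.1, hA'.2.1.mul hB'.2.1, fun f => ?_, fun e => ?_⟩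
    · rw [sbr_mul, neg_one_pow_eq_smul]
      refine add_mem ?_ (Submodule.smul_mem _ _ ?_)
      · have := ih _ (by omega) hA (hB'.2.2.1 f) rfl
        convert this using 2; omega
      · have := ih _ (by omega) (hA'.2.2.1 f) hB rfl
        convert this using 2; omega
    · rw [sbr_mul, neg_one_pow_eq_smul]
      refine add_mem ?_ (Submodule.smul_mem _ _ ?_)
      · have := ih _ (by omega) hA (hB'.2.2.2 e) rfl
        convert this using 2; omega
      · have := ih _ (by omega) (hA'.2.2.2 e) hB rfl
        convert this using 2; omega

theorem c_mem (e) : P.c e ∈ P.GF 3 := by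
  rw [mem_GF_iff]
  refine ⟨c_parity e, c_commutes e, fun f => ?_, fun e' => ?_⟩
  · rw [mem_GF_one]; simp [sbr, m_c]
  · have h : P.sbr 1 1 (P.c e) (P.c e') = P.m (𝒞.inner e e') := by
      simp [sbr, ← c_mul_add]
    rw [h, mem_GF_iff]
    refine ⟨m_parity _, m_commutes _, fun f => ?_, fun e => ?_⟩
    · rw [mem_GF_zero]; simp [sbr, P.m_comm f]
    · rw [mem_GF_one]; simp [sbr, m_c]

theorem m_mem (f) : P.m f ∈ P.GF 2 := by
  rw [mem_GF_iff]
  refine ⟨m_parity _, m_commutes _, fun g => ?_, fun e => ?_⟩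
  · rw [mem_GF_zero]; simp [sbr, P.m_comm f]
  · rw [mem_GF_one]; simp [sbr, m_c]

theorem m_mul_mem {k : ℕ} (f) {A : P.Op} (hA : A ∈ P.GF k) : P.m f * A ∈ P.GF k := by
  have := GF_mul (m_mem f) hA
  rwa [Nat.add_sub_cancel_left] at this

/-- The truncated difference does no harm: operators of index below two are zero. -/
theorem letter_sbr_mem {i : ℕ} {A : P.Op} (hA : A ∈ P.GF i) (a : Letter n F E) :
    P.sbr i a.weight A (P.letterOp a) ∈ P.GF (i - a.weight) := by
  by_cases hi : i < 2
  · rw [eq_zero_of_mem_GF hi hA, sbr_zero_left]; exact zero_mem _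
  obtain ⟨k, rfl⟩ : ∃ k, i = k + 2 := ⟨i - 2, by omega⟩
  rw [mem_GF_iff] at hA
  rcases a with e | f
  · change P.sbr (k + 2) 1 A (P.c e) ∈ P.GF (k + 1)
    rw [sbr_mod (p' := k) (q' := 1) (by omega) rfl]; exact hA.2.2.2 e
  · change P.sbr (k + 2) 2 A (P.m f) ∈ P.GF k
    rw [sbr_mod (p' := k) (q' := 0) (by omega) (show 2 % 2 = 0 % 2 from rfl)]; exact hA.2.2.1 f

theorem letterOp_mem (a : Letter n F E) : P.letterOp a ∈ P.GF (4 - a.weight) := by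
  rcases a with e | f
  · exact c_mem e
  · exact m_mem f

/-! ### Iterated commutators -/

theorem iterSbr_mod {p q : ℕ} (h : p % 2 = q % 2) (A : P.Op) (u : List (Letter n F E)) :
    P.iterSbr p A u = P.iterSbr q A u := by
  induction u generalizing p q A with
  | nil => rfl
  | cons a u ih => rw [iterSbr, iterSbr, sbr_mod h rfl, ih (p := p + a.weight)]; omega

@[simp] theorem iterSbr_zero (p : ℕ) (u : List (Letter n F E)) : P.iterSbr p 0 u = 0 := by
  induction u generalizing p with
  | nil => rfl
  | cons a u ih => rw [iterSbr, sbr_zero_left, ih]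

theorem iterSbr_add (p : ℕ) (A B : P.Op) (u : List (Letter n F E)) :
    P.iterSbr p (A + B) u = P.iterSbr p A u + P.iterSbr p B u := by
  induction u generalizing p A B with
  | nil => rfl
  | cons a u ih => rw [iterSbr, sbr_add_left, ih]; rfl

theorem iterSbr_smul (p : ℕ) (z : ℂ) (A : P.Op) (u : List (Letter n F E)) :
    P.iterSbr p (z • A) u = z • P.iterSbr p A u := by
  induction u generalizing p A with
  | nil => rfl
  | cons a u ih => rw [iterSbr, sbr_smul_left, ih]; rfl

theorem iterSbr_sub (p : ℕ) (A B : P.Op) (u : List (Letter n F E)) :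
    P.iterSbr p (A - B) u = P.iterSbr p A u - P.iterSbr p B u := by
  rw [sub_eq_add_neg, ← neg_one_smul ℂ, iterSbr_add, iterSbr_smul, neg_one_smul, sub_eq_add_neg]

theorem iterSbr_append (p : ℕ) (A : P.Op) (u v : List (Letter n F E)) :
    P.iterSbr p A (u ++ v) = P.iterSbr (p + wordWeight u) (P.iterSbr p A u) v := by
  induction u generalizing p A with
  | nil => rfl
  | cons a u ih =>
    rw [List.cons_append, iterSbr, iterSbr, ih]
    congr 1
    simp only [wordWeight, List.map_cons, List.sum_cons]; omega

@[simp] theorem wordWeight_cons (a : Letter n F E) (u) :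
    wordWeight (a :: u) = a.weight + wordWeight u := by simp [wordWeight]

@[simp] theorem wordWeight_nil : wordWeight ([] : List (Letter n F E)) = 0 := rfl

@[simp] theorem wordWeight_append (u v : List (Letter n F E)) :
    wordWeight (u ++ v) = wordWeight u + wordWeight v := by simp [wordWeight]

@[simp] theorem weight_inl (e : Cₛ^∞⟮𝓡 n; F, E⟯) :
    Letter.weight (Sum.inl e : Letter n F E) = 1 := rfl
@[simp] theorem weight_inr (f : C^∞⟮𝓡 n, M; ℝ⟯) :
    Letter.weight (Sum.inr f : Letter n F E) = 2 := rfl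

theorem weight_pos (a : Letter n F E) : 0 < a.weight := by rcases a with e | f <;> simp

theorem weight_le (a : Letter n F E) : a.weight ≤ 2 := by rcases a with e | f <;> simp

theorem iterSbr_mem {i : ℕ} {A : P.Op} (hA : A ∈ P.GF i) (u : List (Letter n F E)) :
    P.iterSbr i A u ∈ P.GF (i - wordWeight u) := by
  induction u generalizing i A with
  | nil => exact hA
  | cons a u ih =>
    by_cases hi : a.weight ≤ i
    · rw [iterSbr, iterSbr_mod (q := i - a.weight) (by omega), wordWeight_cons, ← Nat.sub_sub]
      exact ih (letter_sbr_mem hA a)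
    · rw [eq_zero_of_mem_GF (by have := weight_le a; omega) hA, iterSbr_zero]; exact zero_mem _

theorem iterSbr_eq_zero {i : ℕ} {A : P.Op} (hA : A ∈ P.GF i) {u : List (Letter n F E)}
    (h : i < wordWeight u + 2) : P.iterSbr i A u = 0 :=
  eq_zero_of_mem_GF (by omega) (iterSbr_mem hA u)

end SpinorBundle
end Filtration

/-! ### Order of supercommutators, and operators with zero symbol. -/

section Filtration

variable {n : ℕ} {M : Type uM} [TopologicalSpace M] [ChartedSpace (EuclideanSpace ℝ (Fin n)) M]
  [IsManifold (𝓡 n) ∞ M] [T2Space M]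
  {F : Type uF} [NormedAddCommGroup F] [NormedSpace ℝ F] [FiniteDimensional ℝ F]
  {E : M → Type uE} [∀ x, AddCommGroup (E x)] [∀ x, Module ℝ (E x)]
  [∀ x, TopologicalSpace (E x)] [TopologicalSpace (TotalSpace F E)] [FiberBundle F E]
  [VectorBundle ℝ F E] [ContMDiffVectorBundle ∞ F E (𝓡 n)]

namespace SpinorBundle

variable {𝒞 : CourantAlgebroid n F E} {P : SpinorBundle.{uM, uF, uE, w} 𝒞}

theorem commutes_m_of_mem {k : ℕ} (hk : k < 4) {A : P.Op} (hA : A ∈ P.GF k) (f) :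
    A * P.m f = P.m f * A := by
  have := eq_zero_of_mem_GF (show k - 2 < 2 by omega) (letter_sbr_mem hA (Sum.inr f))
  simpa [sbr, letterOp, sub_eq_zero] using this

/-- Commutators with functions have lower order, so they are local by induction, and
`isLocal_of_commutator` applies. -/
theorem isLocal_of_mem {k : ℕ} {A : P.Op} (hA : A ∈ P.GF k) : IsLocal A := by
  induction k using Nat.strong_induction_on generalizing A with
  | _ k ih =>
    by_cases hk : k < 2
    · rw [eq_zero_of_mem_GF hk hA]; exact isLocal_zero
    refine isLocal_of_commutator fun f => ?_
    have h := ih (k - 2) (by omega) (letter_sbr_mem hA (Sum.inr f))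
    simpa [sbr, letterOp, pow_mul'] using h

/-- The brackets whose order would be negative. One operator is multiplication by a complex function
and the other acts fibrewise, having order at most one. -/
theorem sbr_eq_zero_of_low {p q : ℕ} (hpq : p + q < 2) {A B : P.Op} (hA : A ∈ P.GF (p + 2))
    (hB : B ∈ P.GF (q + 2)) : P.sbr p q A B = 0 := by
  have h : (p = 0 ∧ q = 0) ∨ (p = 0 ∧ q = 1) ∨ (p = 1 ∧ q = 0) := by omega
  have key : ∀ {k} {A B : P.Op}, A ∈ P.GF 2 → k < 4 → B ∈ P.GF k → A * B = B * A := by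
    intro k A B hA hk hB
    obtain ⟨h, rfl⟩ := (mem_filt_zero_iff A).1 (mem_filt_iff.2 hA)
    exact (mc_comm (commutes_m_of_mem hk hB) h).symm
  rcases h with ⟨rfl, rfl⟩ | ⟨rfl, rfl⟩ | ⟨rfl, rfl⟩
  · simp [sbr, key hA (by omega) hB]
  · simp [sbr, key hA (by omega) hB]
  · simp [sbr, key hB (by omega) hA]

/-- The definition of the filtration controls commutators with letters only. The Jacobi identity
carries the drop of the order by two over to arbitrary pairs, starting from `sbr_eq_zero_of_low`. -/
theorem GF_sbr {p q : ℕ} {A B : P.Op} (hA : A ∈ P.GF (p + 2)) (hB : B ∈ P.GF (q + 2)) :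
    P.sbr p q A B ∈ P.GF (p + q) := by
  induction hs : p + q using Nat.strong_induction_on generalizing p q A B with
  | _ s ih =>
    subst hs
    by_cases hpq : p + q < 2
    · rw [sbr_eq_zero_of_low hpq hA hB]; exact zero_mem _
    obtain ⟨r, hr⟩ : ∃ r, p + q = r + 2 := ⟨p + q - 2, by omega⟩
    have hA' := mem_GF_iff.1 hA
    have hB' := mem_GF_iff.1 hB
    have key : ∀ (k i j : ℕ) (A B : P.Op), A ∈ P.GF i → B ∈ P.GF j → i + j = k + 4 → k < p + q →
        P.sbr i j A B ∈ P.GF k := by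
      intro k i j A B hA hB hij hk
      by_cases hi : i < 2
      · rw [eq_zero_of_mem_GF hi hA, sbr_zero_left]; exact zero_mem _
      by_cases hj : j < 2
      · rw [eq_zero_of_mem_GF hj hB, sbr_zero_right]; exact zero_mem _
      obtain ⟨i, rfl⟩ : ∃ p, i = p + 2 := ⟨i - 2, by omega⟩
      obtain ⟨j, rfl⟩ : ∃ q, j = q + 2 := ⟨j - 2, by omega⟩
      rw [sbr_mod (p' := i) (q' := j) (by omega) (by omega)]
      have : k = i + j := by omega
      rw [this]
      exact ih _ (by omega) hA hB rfl
    rw [hr, mem_GF_iff]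
    refine ⟨hasParity_mod (by omega) (hA'.1.sbr hB'.1),
      commutes_mod (by omega) (hA'.2.1.sbr hB'.2.1), fun f => ?_, fun e => ?_⟩
    · rw [sbr_mod (p' := p + q) (q' := 0) (by omega) rfl, sbr_sbr, neg_one_pow_eq_smul]
      refine add_mem ?_ (Submodule.smul_mem _ _ ?_)
      · rw [sbr_mod (p' := p + 2) (q' := q) (by omega) (by omega)]
        exact key _ _ _ _ _ hA (hB'.2.2.1 f) (by omega) (by omega)
      · rw [sbr_mod (p' := p) (q' := q + 2) (by omega) (by omega)]
        exact key _ _ _ _ _ (hA'.2.2.1 f) hB (by omega) (by omega)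
    · rw [sbr_mod (p' := p + q) (q' := 1) (by omega) rfl, sbr_sbr, neg_one_pow_eq_smul]
      refine add_mem ?_ (Submodule.smul_mem _ _ ?_)
      · rw [sbr_mod (p' := p + 2) (q' := q + 1) (by omega) (by omega)]
        exact key _ _ _ _ _ hA (hB'.2.2.2 e) (by omega) (by omega)
      · rw [sbr_mod (p' := p + 1) (q' := q + 2) (by omega) (by omega)]
        exact key _ _ _ _ _ (hA'.2.2.2 e) hB (by omega) (by omega)

/-- An operator with vanishing symbol is of lower order. -/
theorem mem_GF_of_symbol_eq_zero {p : ℕ} {A : P.Op} (hA : A ∈ P.GF (p + 2))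
    (h : ∀ u, wordWeight u = p → P.iterSbr p A u = 0) : A ∈ P.GF p := by
  induction p using Nat.strong_induction_on generalizing A with
  | _ p ih =>
    match p with
    | 0 => rw [mem_GF_zero]; exact h [] rfl
    | 1 =>
      rw [mem_GF_one]
      -- In order one the condition on the commutant enters.
      exact eq_zero_of_filt_one (mem_filt_iff.2 hA) fun e => h [Sum.inl e] rfl
    | r + 2 =>
      have hA' := mem_GF_iff.1 hA
      rw [mem_GF_iff]
      refine ⟨hasParity_mod (by omega) hA'.1, commutes_mod (by omega) hA'.2.1, fun f => ?_,
        fun e => ?_⟩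
      · rw [sbr_mod (p' := r + 2) (q' := 0) (by omega) rfl]
        refine ih r (by omega) (hA'.2.2.1 f) fun u hu => ?_
        have := h (Sum.inr f :: u) (by simp [hu]; omega)
        rw [iterSbr, iterSbr_mod (q := r) (by simp)] at this
        rwa [sbr_mod (p' := r + 2) (q' := Letter.weight (Sum.inr f : Letter n F E)) rfl
          (by simp)]
      · rw [sbr_mod (p' := r + 2) (q' := 1) (by omega) rfl]
        refine ih (r + 1) (by omega) (hA'.2.2.2 e) fun u hu => ?_
        have := h (Sum.inl e :: u) (by simp [hu]; omega)
        rwa [iterSbr, iterSbr_mod (q := r + 1) (by simp; omega)] at this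

end SpinorBundle
end Filtration
end CourantDirac

namespace CourantDirac

/-! ## Symbols -/

section Symbols

open Filter Topology Module

variable {n : ℕ} {M : Type uM} [TopologicalSpace M] [ChartedSpace (EuclideanSpace ℝ (Fin n)) M]
  [IsManifold (𝓡 n) ∞ M] [T2Space M]
  {F : Type uF} [NormedAddCommGroup F] [NormedSpace ℝ F] [FiniteDimensional ℝ F]
  {E : M → Type uE} [∀ x, AddCommGroup (E x)] [∀ x, Module ℝ (E x)]
  [∀ x, TopologicalSpace (E x)] [TopologicalSpace (TotalSpace F E)] [FiberBundle F E]
  [VectorBundle ℝ F E] [ContMDiffVectorBundle ∞ F E (𝓡 n)]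

variable {𝒞 : CourantAlgebroid n F E}

namespace CourantAlgebroid

theorem IsGradedFunction.cons {p : ℕ} {φ : Cochain n F E} (h : 𝒞.IsGradedFunction p φ)
    (a : Letter n F E) : 𝒞.IsGradedFunction (p - a.weight) (fun u => φ (a :: u)) where
  supported u hu := h.supported _ fun h' => hu (by rw [← h']; simp)
  add_section u := h.add_section (a :: u)
  smul_section u := h.smul_section (a :: u)
  add_function u := h.add_function (a :: u)
  const_smul_function u := h.const_smul_function (a :: u)
  mul_function u := h.mul_function (a :: u)
  swap_sections u := h.swap_sections (a :: u)
  swap_section_function u := h.swap_section_function (a :: u)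
  swap_functions u := h.swap_functions (a :: u)

theorem IsGradedFunction.apply_zero {p : ℕ} {φ : Cochain n F E} (h : 𝒞.IsGradedFunction p φ)
    (u) : φ (u ++ [Sum.inr 0]) = 0 := by
  have := h.add_function u 0 0
  rw [add_zero] at this
  simpa using this

theorem sharp_eq_zero {φ : Cochain n F E} (h : ∀ e, φ [Sum.inl e] = 0) : 𝒞.sharp φ = 0 :=
  𝒞.sharp_eq fun e => by rw [h]; ext x; simp [inner]

@[simp] theorem inner_zero_left (e : Cₛ^∞⟮𝓡 n; F, E⟯) : 𝒞.inner 0 e = 0 := by ext x; simp [inner]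
@[simp] theorem inner_zero_right (e : Cₛ^∞⟮𝓡 n; F, E⟯) : 𝒞.inner e 0 = 0 := by ext x; simp [inner]

end CourantAlgebroid

theorem gradedMul_mod {q q' : ℕ} (h : q % 2 = q' % 2) (φ ψ : Cochain n F E) (u) :
    gradedMul q φ ψ u = gradedMul q' φ ψ u := by
  induction u generalizing q q' φ ψ with
  | nil => rfl
  | cons a u ih =>
    rw [gradedMul, gradedMul, ih (q := q + a.weight) (q' := q' + a.weight) (by omega), ih h,
      SpinorBundle.neg_one_pow_congr (p := q * a.weight) (q := q' * a.weight)
        (Nat.ModEq.mul (n := 2) h rfl)]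

theorem gradedMul_zero_left (q : ℕ) (ψ : Cochain n F E) (u) :
    gradedMul q (fun _ => 0) ψ u = 0 := by
  induction u generalizing q ψ with
  | nil => simp [gradedMul]
  | cons a u ih => rw [gradedMul, ih, ih]; simp

theorem gradedMul_zero_right (q : ℕ) (φ : Cochain n F E) (u) :
    gradedMul q φ (fun _ => 0) u = 0 := by
  induction u generalizing q φ with
  | nil => simp [gradedMul]
  | cons a u ih => rw [gradedMul, ih, ih]; simp

variable (𝒞) in
theorem poisson_mod {q q' : ℕ} (h : q % 2 = q' % 2) (φ ψ : Cochain n F E) (u) :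
    𝒞.poisson q φ ψ u = 𝒞.poisson q' φ ψ u := by
  induction u generalizing q q' φ ψ with
  | nil => rfl
  | cons a u ih =>
    rw [CourantAlgebroid.poisson, CourantAlgebroid.poisson,
      ih (q := q + a.weight) (q' := q' + a.weight) (by omega), ih h,
      SpinorBundle.neg_one_pow_congr (p := q * a.weight) (q := q' * a.weight)
        (Nat.ModEq.mul (n := 2) h rfl)]

theorem poisson_zero_left (q : ℕ) {p : ℕ} {ψ : Cochain n F E} (h : 𝒞.IsGradedFunction p ψ) (u) :
    𝒞.poisson q (fun _ => 0) ψ u = 0 := by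
  induction u generalizing q p ψ with
  | nil =>
    have h0 : ψ [Sum.inr 0] = 0 := h.apply_zero []
    simp [CourantAlgebroid.poisson, h0, 𝒞.sharp_eq_zero (φ := fun _ => 0)]
  | cons a u ih => rw [CourantAlgebroid.poisson, ih _ (h.cons a), ih _ h]; simp

theorem poisson_zero_right (q : ℕ) {p : ℕ} {φ : Cochain n F E} (h : 𝒞.IsGradedFunction p φ) (u) :
    𝒞.poisson q φ (fun _ => 0) u = 0 := by
  induction u generalizing q p φ with
  | nil =>
    have h0 : φ [Sum.inr 0] = 0 := h.apply_zero []
    simp [CourantAlgebroid.poisson, h0, 𝒞.sharp_eq_zero (φ := fun _ => 0)]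
  | cons a u ih => rw [CourantAlgebroid.poisson, ih _ h, ih _ (h.cons a)]; simp

theorem gradedMul_supported {p q : ℕ} (k : ℕ) {φ ψ : Cochain n F E} {u}
    (hφ : ∀ u, wordWeight u ≠ p → φ u = 0) (hψ : ∀ u, wordWeight u ≠ q → ψ u = 0)
    (hu : wordWeight u ≠ p + q) : gradedMul k φ ψ u = 0 := by
  induction u generalizing k p q φ ψ with
  | nil =>
    rw [gradedMul]
    by_cases hp : p = 0
    · rw [hψ [] (by simpa [hp] using hu), mul_zero]
    · rw [hφ [] (by simpa using Ne.symm hp), zero_mul]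
  | cons a u ih =>
    rw [SpinorBundle.wordWeight_cons] at hu
    -- A letter heavier than the degree annihilates the family; otherwise `r - a.weight` is an
    -- honest difference.
    have key : ∀ {r} {χ : Cochain n F E}, (∀ u, wordWeight u ≠ r → χ u = 0) →
        (fun u => χ (a :: u)) = (fun _ => 0) ∨
        (a.weight ≤ r ∧ ∀ u, wordWeight u ≠ r - a.weight → χ (a :: u) = 0) := by
      intro r χ h
      by_cases hr : a.weight ≤ r
      · exact Or.inr ⟨hr, fun u hu => h _ (by rw [SpinorBundle.wordWeight_cons]; omega)⟩
      · exact Or.inl (funext fun u => h _ (by rw [SpinorBundle.wordWeight_cons]; omega))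
    have h1 : gradedMul (k + a.weight) φ (fun v => ψ (a :: v)) u = 0 := by
      rcases key hψ with h | ⟨h, h'⟩
      · rw [h, gradedMul_zero_right]
      · exact ih _ hφ h' (by omega)
    have h2 : gradedMul k (fun v => φ (a :: v)) ψ u = 0 := by
      rcases key hφ with h | ⟨h, h'⟩
      · rw [h, gradedMul_zero_left]
      · exact ih _ h' hψ (by omega)
    rw [gradedMul, h1, h2]; simp

theorem poisson_supported {p q : ℕ} (k : ℕ) {φ ψ : Cochain n F E} {u}
    (hφ : 𝒞.IsGradedFunction p φ) (hψ : 𝒞.IsGradedFunction q ψ)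
    (hu : wordWeight u + 2 ≠ p + q) : 𝒞.poisson k φ ψ u = 0 := by
  induction u generalizing k p q φ ψ with
  | nil =>
    rw [SpinorBundle.wordWeight_nil] at hu
    have hφ0 : φ [Sum.inr 0] = 0 := hφ.apply_zero []
    have hψ0 : ψ [Sum.inr 0] = 0 := hψ.apply_zero []
    have h1 : φ [Sum.inr (ψ [])] = 0 := by
      by_cases hq : q = 0
      · exact hφ.supported _ (by simp; omega)
      · rw [hψ.supported [] (by simpa using Ne.symm hq), hφ0]
    have h2 : ψ [Sum.inr (φ [])] = 0 := by
      by_cases hp : p = 0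
      · exact hψ.supported _ (by simp; omega)
      · rw [hφ.supported [] (by simpa using Ne.symm hp), hψ0]
    rw [CourantAlgebroid.poisson, h1, h2]
    by_cases hp : p = 1
    · rw [𝒞.sharp_eq_zero (φ := ψ) fun e => hψ.supported _ (by simp; omega)]; simp
    · rw [𝒞.sharp_eq_zero (φ := φ) fun e => hφ.supported _ (by simp; omega)]; simp
  | cons a u ih =>
    rw [SpinorBundle.wordWeight_cons] at hu
    have key : ∀ {r} {χ : Cochain n F E}, 𝒞.IsGradedFunction r χ →
        (fun u => χ (a :: u)) = (fun _ => 0) ∨ a.weight ≤ r := by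
      intro r χ h
      by_cases hr : a.weight ≤ r
      · exact Or.inr hr
      · exact Or.inl (funext fun u => h.supported _ (by rw [SpinorBundle.wordWeight_cons]; omega))
    have h1 : 𝒞.poisson (k + a.weight) φ (fun v => ψ (a :: v)) u = 0 := by
      rcases key hψ with h | h
      · rw [h, poisson_zero_right _ hφ]
      · exact ih _ hφ (hψ.cons a) (by omega)
    have h2 : 𝒞.poisson k (fun v => φ (a :: v)) ψ u = 0 := by
      rcases key hφ with h | h
      · rw [h, poisson_zero_left _ hψ]
      · exact ih _ (hφ.cons a) hψ (by omega)
    rw [CourantAlgebroid.poisson, h1, h2]; simp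

namespace SpinorBundle

variable {P : SpinorBundle.{uM, uF, uE, w} 𝒞}

/-- Index below four means order at most one, so `A` commutes with `f`. This gives linearity of
symbols over functions in a final section. -/
theorem sbr_c_fsmul {k p : ℕ} (hk : k < 4) {A : P.Op} (hA : A ∈ P.GF k) (f e) :
    P.sbr p 1 A (P.c (fsmul f e)) = P.m f * P.sbr p 1 A (P.c e) := by
  have h := commutes_m_of_mem hk hA f
  rw [sbr, sbr, c_fsmul, ← mul_assoc, h, mul_assoc, mul_sub, mul_assoc (P.m f) (P.c e),
    neg_one_pow_mul_comm, neg_one_pow_mul_comm]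
  simp only [mul_assoc]

/-- `[A, f]` has order zero and commutes with `g`; hence symbols are derivations in a final
function. -/
theorem sbr_m_mul {p : ℕ} {A : P.Op} (hA : A ∈ P.GF 4) (f g) :
    P.sbr p 2 A (P.m (f * g)) = P.m f * P.sbr p 2 A (P.m g) + P.m g * P.sbr p 2 A (P.m f) := by
  have h := commutes_m_of_mem (k := 2) (by omega) (letter_sbr_mem hA (Sum.inr f)) g
  simp only [weight_inr, letterOp, sbr, Even.neg_one_pow (even_two.mul_left _), one_mul] at h ⊢
  rw [m_mul]
  calc A * (P.m f * P.m g) - P.m f * P.m g * A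
      = P.m f * (A * P.m g - P.m g * A) + (A * P.m f - P.m f * A) * P.m g := by
        simp only [mul_sub, sub_mul, mul_assoc]; abel
    _ = _ := by rw [h]

/-- By the Jacobi identity, the exchange relations of graded functions reflect the brackets of
letters: `[c(e), c(e')] = ⟨e, e'⟩` here, `[c(e), f] = 0` and `[f, g] = 0` in the next two lemmas. -/
theorem sbr_sections (k : ℕ) (A : P.Op) (e e') :
    P.sbr (k + 1) 1 (P.sbr k 1 A (P.c e)) (P.c e') + P.sbr (k + 1) 1 (P.sbr k 1 A (P.c e')) (P.c e) =
      P.sbr k 2 A (P.m (𝒞.inner e e')) := by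
  have h : P.sbr 1 1 (P.c e) (P.c e') = P.m (𝒞.inner e e') := by simp [sbr, ← c_mul_add]
  rw [sbr_sbr k 1 1, h]; simp

theorem sbr_section_function (k : ℕ) (A : P.Op) (e f) :
    P.sbr (k + 1) 2 (P.sbr k 1 A (P.c e)) (P.m f) =
      P.sbr (k + 2) 1 (P.sbr k 2 A (P.m f)) (P.c e) := by
  have h : P.sbr 1 2 (P.c e) (P.m f) = 0 := by simp [sbr, m_c]
  rw [sbr_sbr k 1 2, h]; simp

theorem sbr_functions (k : ℕ) (A : P.Op) (f g) :
    P.sbr (k + 2) 2 (P.sbr k 2 A (P.m f)) (P.m g) =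
      P.sbr (k + 2) 2 (P.sbr k 2 A (P.m g)) (P.m f) := by
  have h : P.sbr 2 2 (P.m f) (P.m g) = 0 := by
    simp [sbr, P.m_comm g, Even.neg_one_pow (show Even 4 by decide)]
  rw [sbr_sbr k 2 2, h]; simp [Even.neg_one_pow (show Even 4 by decide)]

theorem iterSbr_append_singleton (p : ℕ) (A : P.Op) (u : List (Letter n F E)) (a) :
    P.iterSbr p A (u ++ [a]) = P.sbr (p + wordWeight u) a.weight (P.iterSbr p A u)
      (P.letterOp a) := by
  rw [iterSbr_append]; rfl

end SpinorBundle

/-! ### Symbols of products and of supercommutators. -/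

namespace SpinorBundle

variable {P : SpinorBundle.{uM, uF, uE, w} 𝒞}

/-- The symbol relation, with degree shifted by two. -/
structure Sym (i : ℕ) (A : P.Op) (φ : Cochain n F E) : Prop where
  mem : A ∈ P.GF i
  graded : ∃ p, 𝒞.IsGradedFunction p φ
  supported : ∀ u, wordWeight u + 2 ≠ i → φ u = 0
  symbol : ∀ u, wordWeight u + 2 = i → P.iterSbr i A u = P.m (φ u)

theorem Sym.of_hasSymbol {p : ℕ} {A : P.Op} {φ : Cochain n F E} (h : P.HasSymbol p A φ) :
    Sym (p + 2) A φ where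
  mem := mem_filt_iff.1 h.1
  graded := ⟨p, h.2.1⟩
  supported u hu := h.2.1.supported u (by omega)
  symbol u hu := by
    rw [iterSbr_mod (q := p) (by omega)]
    exact h.2.2 u (by omega)

theorem Sym.cons {i : ℕ} {A : P.Op} {φ : Cochain n F E} (h : Sym i A φ) (a : Letter n F E) :
    Sym (i - a.weight) (P.sbr i a.weight A (P.letterOp a)) (fun u => φ (a :: u)) where
  mem := letter_sbr_mem h.mem a
  graded := have ⟨p, hp⟩ := h.graded; ⟨_, hp.cons a⟩
  supported u hu := h.supported _ (by rw [wordWeight_cons]; omega)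
  symbol u hu := by
    rw [← h.symbol (a :: u) (by rw [wordWeight_cons]; omega), iterSbr]
    exact iterSbr_mod (by omega) _ _

theorem Sym.low {i : ℕ} (hi : i < 2) {A : P.Op} {φ : Cochain n F E} (h : Sym i A φ) :
    A = 0 ∧ φ = fun _ => 0 :=
  ⟨eq_zero_of_mem_GF hi h.mem, funext fun u => h.supported u (by omega)⟩

theorem iterSbr_letter_mul (k l : ℕ) (A B : P.Op) (u : List (Letter n F E)) :
    P.iterSbr k (A + (-1) ^ l * B) u = P.iterSbr k A u + (-1) ^ l * P.iterSbr k B u := by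
  rw [neg_one_pow_eq_smul, neg_one_pow_eq_smul, iterSbr_add, iterSbr_smul]

theorem m_neg_one_pow_mul (l : ℕ) (f) : P.m ((-1) ^ l * f) = (-1) ^ l * P.m f := by
  rcases Nat.even_or_odd l with h | h <;> simp [h.neg_one_pow, m_neg]

/-- Both sides satisfy the same recursion: `sbr_mul` for the operators and the definition of
`gradedMul` for the families. The shifted degrees give the correct signs because the shift is even.
-/
theorem Sym.mul {i j : ℕ} {A B : P.Op} {φ ψ : Cochain n F E} (hA : Sym i A φ) (hB : Sym j B ψ)
    {u : List (Letter n F E)} (hu : wordWeight u + 4 = i + j) :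
    P.iterSbr (i + j) (A * B) u = P.m (gradedMul j φ ψ u) := by
  induction u generalizing i j A B φ ψ with
  | nil =>
    -- Here `i + j = 4`: a factor is zero, or both have order zero and are functions.
    by_cases hi : i < 2
    · rw [(hA.low hi).1, (hA.low hi).2, gradedMul_zero_left]; simp
    by_cases hj : j < 2
    · rw [(hB.low hj).1, (hB.low hj).2, gradedMul_zero_right]; simp
    have h1 : A = P.m (φ []) := hA.symbol [] (by simp at hu ⊢; omega)
    have h2 : B = P.m (ψ []) := hB.symbol [] (by simp at hu ⊢; omega)
    rw [gradedMul, m_mul, ← h1, ← h2]; rfl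
  | cons a u ih =>
    by_cases hi : i < 2
    · rw [(hA.low hi).1, (hA.low hi).2, gradedMul_zero_left]; simp
    by_cases hj : j < 2
    · rw [(hB.low hj).1, (hB.low hj).2, gradedMul_zero_right]; simp
    rw [wordWeight_cons] at hu
    have hw := weight_le a
    rw [iterSbr, sbr_mul, iterSbr_letter_mul, gradedMul, m_add, m_neg_one_pow_mul,
      iterSbr_mod (q := i + (j - a.weight)) (by omega), ih hA (hB.cons a) (by omega),
      iterSbr_mod (q := i - a.weight + j) (by omega), ih (hA.cons a) hB (by omega),
      gradedMul_mod (q := j - a.weight) (q' := j + a.weight) (by omega)]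

/-- The two operators of order one have equal commutators with all sections, so
`eq_zero_of_filt_one` identifies them. -/
theorem Sym.eq_c {A : P.Op} {φ : Cochain n F E} (h : Sym 3 A φ) : A = P.c (𝒞.sharp φ) := by
  obtain ⟨p, hp⟩ := h.graded
  have h1 : A - P.c (𝒞.sharp φ) ∈ P.GF 3 := sub_mem h.mem (c_mem _)
  refine sub_eq_zero.1 (eq_zero_of_filt_one (mem_filt_iff.2 h1) fun e => ?_)
  have h2 : P.sbr 1 1 A (P.c e) = P.m (φ [Sum.inl e]) := by
    rw [← h.symbol [Sum.inl e] rfl, iterSbr_mod (p := 3) (q := 1) rfl]; rfl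
  rw [sbr_sub_left, h2, 𝒞.inner_sharp hp]
  simp [sbr, ← c_mul_add]

/-- As for products, with the Jacobi identity `sbr_sbr` as the recursion. The empty word leaves the
degrees `(0, 2)`, `(1, 1)` and `(2, 0)`, which account for the three terms of `poisson` on the empty
word. -/
theorem Sym.sbr {i j : ℕ} {A B : P.Op} {φ ψ : Cochain n F E} (hA : Sym i A φ) (hB : Sym j B ψ)
    {u : List (Letter n F E)} (hu : wordWeight u + 6 = i + j) :
    P.iterSbr (i + j) (P.sbr i j A B) u = P.m (𝒞.poisson j φ ψ u) := by
  obtain ⟨p, hp⟩ := hA.graded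
  obtain ⟨q, hq⟩ := hB.graded
  induction u generalizing i j A B φ ψ p q with
  | nil =>
    by_cases hi : i < 2
    · rw [(hA.low hi).1, (hA.low hi).2, poisson_zero_left _ hq]; simp
    by_cases hj : j < 2
    · rw [(hB.low hj).1, (hB.low hj).2, poisson_zero_right _ hp]; simp
    have h0 : φ [Sum.inr 0] = 0 := hp.apply_zero []
    have h0' : ψ [Sum.inr 0] = 0 := hq.apply_zero []
    rw [wordWeight_nil] at hu
    have h : (i = 2 ∧ j = 4) ∨ (i = 3 ∧ j = 3) ∨ (i = 4 ∧ j = 2) := by omega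
    rw [CourantAlgebroid.poisson, iterSbr]
    rcases h with ⟨rfl, rfl⟩ | ⟨rfl, rfl⟩ | ⟨rfl, rfl⟩
    · rw [hB.supported [] (by simp), h0, 𝒞.sharp_eq_zero (φ := ψ) fun e => hB.supported _ (by simp),
        CourantAlgebroid.inner_zero_right, zero_sub, add_zero, m_neg, ← hB.symbol _ (by simp)]
      have h1 : A = P.m (φ []) := hA.symbol [] (by simp)
      nth_rewrite 1 [h1]
      simp [iterSbr, SpinorBundle.sbr, letterOp, Even.neg_one_pow (show Even 8 by decide)]
    · rw [hB.supported [] (by simp), h0, hA.supported [] (by simp), h0', hA.eq_c, hB.eq_c]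
      simp [SpinorBundle.sbr, ← c_mul_add, Odd.neg_one_pow (show Odd 9 by decide)]
    · rw [hA.supported [] (by simp), h0', 𝒞.sharp_eq_zero (φ := φ) fun e => hA.supported _ (by simp),
        CourantAlgebroid.inner_zero_left, sub_zero, add_zero, ← hA.symbol _ (by simp)]
      have h1 : B = P.m (ψ []) := hB.symbol [] (by simp)
      nth_rewrite 1 [h1]
      simp [iterSbr, SpinorBundle.sbr, letterOp, Even.neg_one_pow (show Even 8 by decide)]
  | cons a u ih =>
    by_cases hi : i < 2
    · rw [(hA.low hi).1, (hA.low hi).2, poisson_zero_left _ hq]; simp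
    by_cases hj : j < 2
    · rw [(hB.low hj).1, (hB.low hj).2, poisson_zero_right _ hp]; simp
    rw [wordWeight_cons] at hu
    have hw := weight_le a
    rw [iterSbr, sbr_sbr, iterSbr_letter_mul, CourantAlgebroid.poisson, m_add, m_neg_one_pow_mul,
      iterSbr_mod (q := i + (j - a.weight)) (by omega),
      sbr_mod (p := i) (q := j + a.weight) (p' := i) (q' := j - a.weight) rfl (by omega),
      ih hA (hB.cons a) (by omega) _ hp _ (hq.cons a),
      iterSbr_mod (q := i - a.weight + j) (by omega),
      sbr_mod (p := i + a.weight) (p' := i - a.weight) (by omega) rfl,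
      ih (hA.cons a) hB (by omega) _ (hp.cons a) _ hq,
      poisson_mod 𝒞 (q := j - a.weight) (q' := j + a.weight) (by omega)]

end SpinorBundle
end Symbols
end CourantDirac

namespace CourantDirac

/-! ## Partial derivatives in a constant frame -/

section PartialDerivatives

open Filter Topology Module

variable {n : ℕ} {M : Type uM} [TopologicalSpace M] [ChartedSpace (EuclideanSpace ℝ (Fin n)) M]
  [IsManifold (𝓡 n) ∞ M]

section Functions

variable {Z : Type*} [NormedAddCommGroup Z] [NormedSpace ℝ Z]
  {κ : OpenPartialHomeomorph M (EuclideanSpace ℝ (Fin n))}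

/-- The partial derivatives of a function in a chart. -/
def pd (κ : OpenPartialHomeomorph M (EuclideanSpace ℝ (Fin n))) (k : Fin n) (g : M → Z) (x : M) :
    Z :=
  fderiv ℝ (g ∘ κ.symm) (κ x) (stdBasis n k)

theorem contDiffAt_comp_symm (hκ : κ ∈ IsManifold.maximalAtlas (𝓡 n) ∞ M) {g : M → Z} {x : M}
    (hx : x ∈ κ.source) (hg : ContMDiffAt (𝓡 n) 𝓘(ℝ, Z) ∞ g x) :
    ContDiffAt ℝ ∞ (g ∘ κ.symm) (κ x) := by
  have h1 := contMDiffAt_symm_of_mem_maximalAtlas hκ (κ.map_source hx)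
  rw [← κ.left_inv hx] at hg
  exact (hg.comp (κ x) h1).contDiffAt

theorem differentiableAt_comp_symm (hκ : κ ∈ IsManifold.maximalAtlas (𝓡 n) ∞ M) {g : M → Z} {x : M}
    (hx : x ∈ κ.source) (hg : ContMDiffAt (𝓡 n) 𝓘(ℝ, Z) ∞ g x) :
    DifferentiableAt ℝ (g ∘ κ.symm) (κ x) :=
  (contDiffAt_comp_symm hκ hx hg).differentiableAt (by simp)

theorem contMDiffAt_pd (hκ : κ ∈ IsManifold.maximalAtlas (𝓡 n) ∞ M) {g : M → Z} {x : M}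
    (hx : x ∈ κ.source) (hg : ContMDiffAt (𝓡 n) 𝓘(ℝ, Z) ∞ g x) (k : Fin n) :
    ContMDiffAt (𝓡 n) 𝓘(ℝ, Z) ∞ (pd κ k g) x := by
  have h1 : ContDiffAt ℝ ∞ (fun z => fderiv ℝ (g ∘ κ.symm) z (stdBasis n k)) (κ x) :=
    ((contDiffAt_comp_symm hκ hx hg).fderiv_right (by simp)).clm_apply contDiffAt_const
  exact h1.contMDiffAt.comp x (contMDiffAt_of_mem_maximalAtlas hκ hx)

theorem comp_symm_eventuallyEq {Z : Type*} {g g' : M → Z} {x : M} (hx : x ∈ κ.source)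
    (h : g =ᶠ[𝓝 x] g') : g ∘ κ.symm =ᶠ[𝓝 (κ x)] g' ∘ κ.symm := by
  have h1 : Tendsto κ.symm (𝓝 (κ x)) (𝓝 x) := by
    have := (κ.continuousAt_symm (κ.map_source hx)).tendsto
    rwa [κ.left_inv hx] at this
  exact h1.eventually h

theorem pd_congr {g g' : M → Z} {x : M} (hx : x ∈ κ.source) (h : g =ᶠ[𝓝 x] g') (k : Fin n) :
    pd κ k g x = pd κ k g' x := by
  rw [pd, pd, (comp_symm_eventuallyEq hx h).fderiv_eq]

theorem pd_add (hκ : κ ∈ IsManifold.maximalAtlas (𝓡 n) ∞ M) {g g' : M → Z} {x : M}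
    (hx : x ∈ κ.source) (hg : ContMDiffAt (𝓡 n) 𝓘(ℝ, Z) ∞ g x)
    (hg' : ContMDiffAt (𝓡 n) 𝓘(ℝ, Z) ∞ g' x) (k : Fin n) :
    pd κ k (fun y => g y + g' y) x = pd κ k g x + pd κ k g' x :=
  congrArg (· (stdBasis n k)) (fderiv_add (differentiableAt_comp_symm hκ hx hg)
    (differentiableAt_comp_symm hκ hx hg'))

theorem pd_sum (hκ : κ ∈ IsManifold.maximalAtlas (𝓡 n) ∞ M) {ι : Type*} (s : Finset ι)
    {g : ι → M → Z} {x : M} (hx : x ∈ κ.source)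
    (hg : ∀ i ∈ s, ContMDiffAt (𝓡 n) 𝓘(ℝ, Z) ∞ (g i) x) (k : Fin n) :
    pd κ k (fun y => ∑ i ∈ s, g i y) x = ∑ i ∈ s, pd κ k (g i) x := by
  have h := fderiv_fun_sum (𝕜 := ℝ) (u := s) (A := fun i => g i ∘ κ.symm) (x := κ x)
    fun i hi => differentiableAt_comp_symm hκ hx (hg i hi)
  refine (congrArg (· (stdBasis n k)) h).trans ?_
  simp [pd, sum_apply]

theorem pd_smul (hκ : κ ∈ IsManifold.maximalAtlas (𝓡 n) ∞ M) {f : M → ℝ} {g : M → Z} {x : M}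
    (hx : x ∈ κ.source) (hf : ContMDiffAt (𝓡 n) 𝓘(ℝ, ℝ) ∞ f x)
    (hg : ContMDiffAt (𝓡 n) 𝓘(ℝ, Z) ∞ g x) (k : Fin n) :
    pd κ k (fun y => f y • g y) x = f x • pd κ k g x + pd κ k f x • g x := by
  have h := congrArg (· (stdBasis n k)) (fderiv_smul (differentiableAt_comp_symm hκ hx hf)
    (differentiableAt_comp_symm hκ hx hg))
  refine h.trans ?_
  simp [pd, κ.left_inv hx]

theorem pd_linear (hκ : κ ∈ IsManifold.maximalAtlas (𝓡 n) ∞ M) {Z' : Type*}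
    [NormedAddCommGroup Z'] [NormedSpace ℝ Z'] (T : Z →L[ℝ] Z') {g : M → Z} {x : M}
    (hx : x ∈ κ.source) (hg : ContMDiffAt (𝓡 n) 𝓘(ℝ, Z) ∞ g x) (k : Fin n) :
    pd κ k (fun y => T (g y)) x = T (pd κ k g x) :=
  congrArg (· (stdBasis n k)) (T.hasFDerivAt.comp (κ x)
    (differentiableAt_comp_symm hκ hx hg).hasFDerivAt).fderiv

theorem pd_bilinear (hκ : κ ∈ IsManifold.maximalAtlas (𝓡 n) ∞ M) {Z' Z'' : Type*}
    [NormedAddCommGroup Z'] [NormedSpace ℝ Z'] [NormedAddCommGroup Z''] [NormedSpace ℝ Z'']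
    (T : Z →L[ℝ] Z' →L[ℝ] Z'') {g : M → Z} {g' : M → Z'} {x : M}
    (hx : x ∈ κ.source) (hg : ContMDiffAt (𝓡 n) 𝓘(ℝ, Z) ∞ g x)
    (hg' : ContMDiffAt (𝓡 n) 𝓘(ℝ, Z') ∞ g' x) (k : Fin n) :
    pd κ k (fun y => T (g y) (g' y)) x = T (pd κ k g x) (g' x) + T (g x) (pd κ k g' x) := by
  have h := congrArg (· (stdBasis n k)) (T.hasFDerivAt_of_bilinear
    (differentiableAt_comp_symm hκ hx hg).hasFDerivAt
    (differentiableAt_comp_symm hκ hx hg').hasFDerivAt).fderiv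
  refine h.trans ?_
  rw [add_comm]
  simp [pd, κ.left_inv hx]

@[simp] theorem pd_const (z : Z) (k : Fin n) (x : M) : pd κ k (fun _ => z) x = 0 := by
  have : (fun _ : M => z) ∘ κ.symm = fun _ => z := rfl
  rw [pd, this]; simp

theorem pd_coord {x : M} (hx : x ∈ κ.source) (k l : Fin n) :
    pd κ k (fun y => κ y l) x = if k = l then 1 else 0 := by
  have h : (fun y => κ y l) ∘ κ.symm =ᶠ[𝓝 (κ x)]
      (EuclideanSpace.proj l : EuclideanSpace ℝ (Fin n) →L[ℝ] ℝ) := by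
    filter_upwards [κ.open_target.mem_nhds (κ.map_source hx)] with z hz
    simp [κ.right_inv hz]
  rw [pd, h.fderiv_eq, ContinuousLinearMap.fderiv]
  simp [eq_comm]

end Functions

variable [T2Space M]
  {F : Type uF} [NormedAddCommGroup F] [NormedSpace ℝ F] [FiniteDimensional ℝ F]
  {E : M → Type uE} [∀ x, AddCommGroup (E x)] [∀ x, Module ℝ (E x)]
  [∀ x, TopologicalSpace (E x)] [TopologicalSpace (TotalSpace F E)] [FiberBundle F E]
  [VectorBundle ℝ F E] [ContMDiffVectorBundle ∞ F E (𝓡 n)]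

variable {𝒞 : CourantAlgebroid n F E}

theorem map_real_smul {V V' : Type*} [AddCommGroup V] [Module ℂ V] [AddCommGroup V'] [Module ℂ V']
    (T : V →ₗ[ℂ] V') (r : ℝ) (v : V) : T (r • v) = r • T v := by
  rw [← Complex.coe_smul, map_smul, Complex.coe_smul]

/-- A chart with an orthonormal frame and a cutoff function. -/
structure CourantAlgebroid.FrameChart (𝒞 : CourantAlgebroid n F E) where
  κ : OpenPartialHomeomorph M (EuclideanSpace ℝ (Fin n))
  hκ : κ ∈ IsManifold.maximalAtlas (𝓡 n) ∞ M
  W : Opens M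
  o : 𝒞.OrthoFrame W
  le : W ≤ κ.source
  cut : C^∞⟮𝓡 n, M; ℝ⟯
  compact : IsCompact (tsupport cut)
  tsupport_subset : tsupport cut ⊆ W

namespace CourantAlgebroid.FrameChart

variable (L : 𝒞.FrameChart)

theorem cut_eq_zero {x : M} (hx : x ∉ L.W) : L.cut x = 0 :=
  image_eq_zero_of_notMem_tsupport fun h => hx (L.tsupport_subset h)

theorem eventually_mem {x : M} (hx : x ∈ L.W) : ∀ᶠ y in 𝓝 x, y ∈ L.W := L.W.isOpen.mem_nhds hx

/-- The partial derivative of a function, cut off. -/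
def dfun (k : Fin n) (f : C^∞⟮𝓡 n, M; ℝ⟯) : C^∞⟮𝓡 n, M; ℝ⟯ :=
  ⟨fun x => L.cut x • pd L.κ k f x, contMDiff_cutoff L.cut _ fun x hx =>
    contMDiffAt_pd L.hκ (L.le (L.tsupport_subset hx)) (f.contMDiff x) k⟩

theorem dfun_apply (k : Fin n) (f : C^∞⟮𝓡 n, M; ℝ⟯) (x : M) :
    L.dfun k f x = L.cut x * pd L.κ k f x := rfl

/-- The coefficients of a section. -/
def comp (e : Cₛ^∞⟮𝓡 n; F, E⟯) (i : Fin (finrank ℝ F)) : C^∞⟮𝓡 n, M; ℝ⟯ :=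
  L.o.ε i • 𝒞.inner e (L.o.e i)

theorem expand (e : Cₛ^∞⟮𝓡 n; F, E⟯) {x : M} (hx : x ∈ L.W) :
    e x = ∑ i, L.comp e i x • L.o.e i x := L.o.expand hx (e x)

/-- The covariant derivative of a section. -/
def nabla (k : Fin n) (e : Cₛ^∞⟮𝓡 n; F, E⟯) : Cₛ^∞⟮𝓡 n; F, E⟯ :=
  ∑ i, fsmul (L.dfun k (L.comp e i)) (L.o.e i)

theorem nabla_of_notMem (k : Fin n) (e : Cₛ^∞⟮𝓡 n; F, E⟯) {x : M} (hx : x ∉ L.W) :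
    L.nabla k e x = 0 := by
  rw [nabla, section_sum_apply]
  refine Finset.sum_eq_zero fun i _ => ?_
  rw [fsmul_apply, dfun_apply, L.cut_eq_zero hx, zero_mul, zero_smul]

/-- The partial derivatives of the cutoff function. -/
def dcut (k : Fin n) : C^∞⟮𝓡 n, M; ℝ⟯ := by
  classical
  exact ⟨fun x => if x ∈ L.W then pd L.κ k L.cut x else 0, fun x => by
    by_cases hx : x ∈ L.W
    · refine (contMDiffAt_pd L.hκ (L.le hx) (L.cut.contMDiff x) k).congr_of_eventuallyEq ?_
      filter_upwards [L.eventually_mem hx] with y hy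
      rw [if_pos hy]
    · refine (contMDiffAt_const (c := (0 : ℝ))).congr_of_eventuallyEq ?_
      filter_upwards [(isClosed_tsupport L.cut).isOpen_compl.mem_nhds
        fun h => hx (L.tsupport_subset h)] with y hy
      split_ifs with h
      · have h0 : L.cut =ᶠ[𝓝 y] fun _ => (0 : ℝ) := by
          filter_upwards [(isClosed_tsupport L.cut).isOpen_compl.mem_nhds hy] with z hz
          exact image_eq_zero_of_notMem_tsupport hz
        rw [pd_congr (L.le h) h0, pd_const]
      · rfl⟩

theorem dcut_apply (k : Fin n) {x : M} (hx : x ∈ L.W) : L.dcut k x = pd L.κ k L.cut x := if_pos hx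

theorem dcut_of_notMem (k : Fin n) {x : M} (hx : x ∉ L.W) : L.dcut k x = 0 := if_neg hx

end CourantAlgebroid.FrameChart

namespace SpinorBundle

variable (P : SpinorBundle.{uM, uF, uE, w} 𝒞)

/-- A chart with a constant spinor frame and a cutoff function. -/
structure LocalFrame extends 𝒞.FrameChart where
  fr : P.SpinorFrame o

variable {P}

namespace LocalFrame

variable (L : P.LocalFrame)

open Classical in
/-- The coefficients of a half-density. -/
def coef (ψ : P.HalfDensities) (x : M) : Fin L.fr.N → ℂ :=
  if h : x ∈ L.W then
    L.fr.coeff ⟨x, L.fr.le h⟩ h (ψ.1 ⟨x, L.fr.le h⟩ (coordFrame L.κ x))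
  else 0

theorem G_coef (ψ : P.HalfDensities) (x : P.U) (hx : (x : M) ∈ L.W) :
    L.fr.G x (L.coef ψ x) = ψ.1 x (coordFrame L.κ x) := by
  simp [coef, hx]

theorem coef_eq {ψ : P.HalfDensities} {x : P.U} (hx : (x : M) ∈ L.W) {z}
    (h : L.fr.G x z = ψ.1 x (coordFrame L.κ x)) : L.coef ψ x = z :=
  (L.fr.bijective x hx).1 (by rw [h, G_coef _ _ _ hx])

theorem coef_smooth (ψ : P.HalfDensities) {x : M} (hx : x ∈ L.W) :
    ContMDiffAt (𝓡 n) 𝓘(ℝ, Fin L.fr.N → ℂ) ∞ (L.coef ψ) x := by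
  refine (contMDiffAt_subtype_iff (U := P.U) (x := ⟨x, L.fr.le hx⟩)).1 ?_
  refine L.fr.coefficients_smooth hx (ψ.2.2 L.κ L.hκ ⟨x, L.fr.le hx⟩ (L.le hx)) ?_
  filter_upwards [val_eventually (x := ⟨x, L.fr.le hx⟩) (L.W.isOpen.mem_nhds hx)] with y hy
  exact L.G_coef ψ y hy

theorem coef_add (ψ χ : P.HalfDensities) (x : M) : L.coef (ψ + χ) x = L.coef ψ x + L.coef χ x := by
  by_cases h : x ∈ L.W <;> simp [coef, h]

theorem coef_smul (z : ℂ) (ψ : P.HalfDensities) (x : M) : L.coef (z • ψ) x = z • L.coef ψ x := by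
  by_cases h : x ∈ L.W <;> simp [coef, h]

theorem smooth_G_pd (k : Fin n) (ψ : P.HalfDensities) (x : P.U) (hx : (x : M) ∈ L.W) :
    P.SmoothAt (fun y => L.fr.G y (pd L.κ k (L.coef ψ) y)) x :=
  L.fr.smooth_apply hx ((contMDiffAt_subtype_iff).2
    (contMDiffAt_pd L.hκ (L.le hx) (L.coef_smooth ψ hx) k))

/-- The operator of differentiation of coefficients. -/
def D (k : Fin n) : P.Op where
  toFun ψ := cutoffSection L.hκ L.cut (L.tsupport_subset.trans L.le)
    (fun x => L.fr.G x (pd L.κ k (L.coef ψ) x))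
    fun x hx => L.smooth_G_pd k ψ x (L.tsupport_subset hx)
  map_add' ψ χ := Subtype.ext (funext fun x => funext fun v => by
    rw [add_val, cutoffSection_apply, cutoffSection_apply, cutoffSection_apply]
    by_cases hx : (x : M) ∈ L.W
    · have h : L.coef (ψ + χ) = fun y => L.coef ψ y + L.coef χ y := funext (L.coef_add ψ χ)
      rw [h, pd_add L.hκ (L.le hx) (L.coef_smooth ψ hx) (L.coef_smooth χ hx), map_add, smul_add,
        smul_add]
    · rw [image_eq_zero_of_notMem_tsupport fun h => hx (L.tsupport_subset h)]; simp)
  map_smul' z ψ := Subtype.ext (funext fun x => funext fun v => by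
    rw [RingHom.id_apply, smul_val, cutoffSection_apply, cutoffSection_apply]
    by_cases hx : (x : M) ∈ L.W
    · have h : L.coef (z • ψ) = fun y => (z • ContinuousLinearMap.id ℝ (Fin L.fr.N → ℂ))
          (L.coef ψ y) := funext (L.coef_smul z ψ)
      rw [h, pd_linear L.hκ _ (L.le hx) (L.coef_smooth ψ hx)]
      simp only [smul_apply, ContinuousLinearMap.id_apply, map_smul]
      rw [smul_comm _ z, smul_comm _ z]
    · rw [image_eq_zero_of_notMem_tsupport fun h => hx (L.tsupport_subset h)]; simp)

theorem D_of_notMem (k : Fin n) (ψ : P.HalfDensities) (x : P.U) (hx : (x : M) ∉ L.W) (v) :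
    (L.D k ψ).1 x v = 0 := by
  change Real.sqrt _ • L.cut x • _ = _
  rw [L.cut_eq_zero hx, zero_smul, smul_zero]

theorem D_coordFrame (k : Fin n) (ψ : P.HalfDensities) (x : P.U) (hx : (x : M) ∈ L.W) :
    (L.D k ψ).1 x (coordFrame L.κ x) = L.cut x • L.fr.G x (pd L.κ k (L.coef ψ) x) :=
  cutoffSection_coordFrame L.hκ L.cut (L.tsupport_subset.trans L.le) _
    (fun x hx => L.smooth_G_pd k ψ x (L.tsupport_subset hx)) x (L.le hx)

theorem ext_op {A B : P.Op} (h : ∀ ψ (x : P.U), (x : M) ∈ L.W →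
      (A ψ).1 x (coordFrame L.κ x) = (B ψ).1 x (coordFrame L.κ x))
    (h' : ∀ ψ (x : P.U), (x : M) ∉ L.W → ∀ v, (A ψ).1 x v = (B ψ).1 x v) : A = B :=
  P.ext_op fun ψ x v => by
    by_cases hx : (x : M) ∈ L.W
    · exact P.halfDensity_ext L.hκ (L.le hx) (h ψ x hx) v
    · exact h' ψ x hx v

theorem coef_c (e : Cₛ^∞⟮𝓡 n; F, E⟯) (ψ : P.HalfDensities) {x : M} (hx : x ∈ L.W) :
    L.coef (P.c e ψ) x = ∑ i, L.comp e i x • L.fr.R.c i (L.coef ψ x) := by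
  refine L.coef_eq (x := ⟨x, L.fr.le hx⟩) hx ?_
  rw [c_val, L.expand e hx, map_sum, map_sum, LinearMap.sum_apply]
  refine Finset.sum_congr rfl fun i _ => ?_
  rw [← L.G_coef ψ ⟨x, L.fr.le hx⟩ hx, map_real_smul, map_smul, LinearMap.smul_apply]
  exact congrArg _ (L.fr.cliff ⟨x, L.fr.le hx⟩ hx i _).symm

theorem coef_m (f : C^∞⟮𝓡 n, M; ℝ⟯) (ψ : P.HalfDensities) {x : M} (hx : x ∈ L.W) :
    L.coef (P.m f ψ) x = f x • L.coef ψ x := by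
  refine L.coef_eq (x := ⟨x, L.fr.le hx⟩) hx ?_
  rw [m_val, ← L.G_coef ψ ⟨x, L.fr.le hx⟩ hx, ← Complex.coe_smul, map_smul, Complex.coe_smul]

theorem coef_γ (ψ : P.HalfDensities) {x : M} (hx : x ∈ L.W) :
    L.coef (P.γ ψ) x = L.fr.R.γ (L.coef ψ x) := by
  refine L.coef_eq (x := ⟨x, L.fr.le hx⟩) hx ?_
  rw [γ_val, ← L.G_coef ψ ⟨x, L.fr.le hx⟩ hx, L.fr.parity _ hx]

/-- A complex linear map as a real continuous map. -/
abbrev realCLM {N : ℕ} (T : (Fin N → ℂ) →ₗ[ℂ] (Fin N → ℂ)) : (Fin N → ℂ) →L[ℝ] (Fin N → ℂ) :=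
  LinearMap.toContinuousLinearMap (T.restrictScalars ℝ)

theorem D_m (k : Fin n) (f : C^∞⟮𝓡 n, M; ℝ⟯) :
    L.D k * P.m f = P.m f * L.D k + P.m (L.dfun k f) := by
  refine L.ext_op (fun ψ x hx => ?_) fun ψ x hx v => ?_
  · rw [LinearMap.add_apply, Module.End.mul_apply, Module.End.mul_apply, add_val, m_val, m_val,
      L.D_coordFrame _ _ _ hx, L.D_coordFrame _ _ _ hx, CourantAlgebroid.FrameChart.dfun_apply,
      pd_congr (L.le hx) ((L.eventually_mem hx).mono fun y hy => L.coef_m f ψ hy),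
      pd_smul L.hκ (L.le hx) (f.contMDiff x) (L.coef_smooth ψ hx), map_add,
      ← L.G_coef ψ x hx]
    simp only [← Complex.coe_smul, map_smul, mul_smul, smul_add]
    rw [smul_comm]
  · rw [LinearMap.add_apply, Module.End.mul_apply, Module.End.mul_apply, add_val, m_val, m_val,
      L.D_of_notMem _ _ _ hx, L.D_of_notMem _ _ _ hx, CourantAlgebroid.FrameChart.dfun_apply, L.cut_eq_zero hx]
    simp

/-- The generators have constant matrices in the frame, so differentiation of coefficients is a
connection for which Clifford multiplication is parallel. -/
theorem D_c (k : Fin n) (e : Cₛ^∞⟮𝓡 n; F, E⟯) :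
    L.D k * P.c e = P.c e * L.D k + P.c (L.nabla k e) := by
  refine L.ext_op (fun ψ x hx => ?_) fun ψ x hx v => ?_
  · have h1 : pd L.κ k (L.coef (P.c e ψ)) x = ∑ i, (L.comp e i x • L.fr.R.c i
        (pd L.κ k (L.coef ψ) x) + pd L.κ k (L.comp e i) x • L.fr.R.c i (L.coef ψ x)) := by
      rw [pd_congr (L.le hx) ((L.eventually_mem hx).mono fun y hy => L.coef_c e ψ hy),
        pd_sum L.hκ _ (L.le hx) fun i _ => ?_]
      · refine Finset.sum_congr rfl fun i _ => ?_
        rw [pd_smul L.hκ (L.le hx) ((L.comp e i).contMDiff x)]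
        · congr 2
          exact pd_linear L.hκ (realCLM (L.fr.R.c i)) (L.le hx) (L.coef_smooth ψ hx) k
        · exact (realCLM (L.fr.R.c i)).contMDiff.contMDiffAt.comp _ (L.coef_smooth ψ hx)
      · exact ((L.comp e i).contMDiff x).smul
          ((realCLM (L.fr.R.c i)).contMDiff.contMDiffAt.comp _ (L.coef_smooth ψ hx))
    rw [LinearMap.add_apply, Module.End.mul_apply, Module.End.mul_apply, add_val, c_val, c_val,
      L.D_coordFrame _ _ _ hx, L.D_coordFrame _ _ _ hx, h1, L.expand e hx, CourantAlgebroid.FrameChart.nabla,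
      section_sum_apply, ← L.G_coef ψ x hx]
    simp only [map_sum, LinearMap.sum_apply, map_add, map_smul, LinearMap.smul_apply, fsmul_apply,
      CourantAlgebroid.FrameChart.dfun_apply, Finset.smul_sum, ← Finset.sum_add_distrib, ← Complex.coe_smul, L.fr.cliff x hx,
      mul_smul, smul_add]
  · have h0 := L.nabla_of_notMem k e hx
    rw [LinearMap.add_apply, Module.End.mul_apply, Module.End.mul_apply, add_val, c_val, c_val,
      L.D_of_notMem _ _ _ hx, L.D_of_notMem _ _ _ hx, h0]
    simp

theorem D_γ (k : Fin n) : P.γ * L.D k = L.D k * P.γ := by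
  refine L.ext_op (fun ψ x hx => ?_) fun ψ x hx v => ?_
  · rw [Module.End.mul_apply, Module.End.mul_apply, γ_val, L.D_coordFrame _ _ _ hx,
      L.D_coordFrame _ _ _ hx,
      pd_congr (L.le hx) ((L.eventually_mem hx).mono fun y hy => L.coef_γ ψ hy)]
    have h := pd_linear L.hκ (realCLM L.fr.R.γ) (L.le hx) (L.coef_smooth ψ hx) k
    have h' : pd L.κ k (fun y => L.fr.R.γ (L.coef ψ y)) x = L.fr.R.γ (pd L.κ k (L.coef ψ) x) := h
    rw [h', ← L.fr.parity x hx, ← Complex.coe_smul, map_smul, Complex.coe_smul]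
  · rw [Module.End.mul_apply, Module.End.mul_apply, γ_val, L.D_of_notMem _ _ _ hx,
      L.D_of_notMem _ _ _ hx, map_zero]

/-- Odd sections of the commutant are locally constant in a constant frame. -/
theorem commutant_const {W' : Opens M} {η : ∀ x : P.U, P.S x →ₗ[ℂ] P.S x}
    (hη : P.IsOddCommutant W' η) {x : P.U} (hx : (x : M) ∈ L.W) (hx' : (x : M) ∈ W') :
    ∃ J : (Fin L.fr.N → ℂ) →ₗ[ℂ] (Fin L.fr.N → ℂ),
      ∀ᶠ y in 𝓝 x, ∀ z, η y (L.fr.G y z) = L.fr.G y (J z) := by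
  let η' (y : P.U) (hy : (y : M) ∈ L.W) : (Fin L.fr.N → ℂ) →ₗ[ℂ] (Fin L.fr.N → ℂ) :=
    (L.fr.coeff y hy).toLinearMap ∘ₗ η y ∘ₗ L.fr.G y
  have hG : ∀ y hy z, L.fr.G y (η' y hy z) = η y (L.fr.G y z) := fun y hy z => by simp [η']
  have hinj := fun (y : P.U) hy => (L.fr.bijective y hy).1
  have hsq : ∀ (y : P.U) hy, (y : M) ∈ W' → ∀ z, η' y hy (η' y hy z) = z := fun y hy hy' z =>
    hinj y hy (by rw [hG, hG, hη.sq y hy'])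
  have hc : ∀ (y : P.U) hy, (y : M) ∈ W' → ∀ i z, η' y hy (L.fr.R.c i z) = -L.fr.R.c i (η' y hy z) :=
    fun y hy hy' i z => hinj y hy (by
      rw [hG, ← L.fr.cliff y hy, hη.cliff y hy', ← hG y hy, L.fr.cliff y hy, map_neg])
  have hp : ∀ (y : P.U) hy, (y : M) ∈ W' → ∀ z, η' y hy (L.fr.R.γ z) = -L.fr.R.γ (η' y hy z) :=
    fun y hy hy' z => hinj y hy (by
      have := hη.parity y hy' (L.fr.G y z)
      rw [hG, ← L.fr.parity y hy, ← neg_eq_iff_eq_neg.2 this, ← hG y hy, L.fr.parity y hy, map_neg])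
  set J := η' x hx
  have := L.fr.nontrivial
  -- The composite of two odd elements of the commutant commutes with the irreducible representation
  -- and is a scalar; as `J² = 1`, the one at `y` is a multiple of `J`.
  have hlam : ∀ (y : P.U) hy, (y : M) ∈ W' → ∃ l : ℂ, ∀ z, η' y hy z = l • J z := fun y hy hy' => by
    obtain ⟨l, hl⟩ := CliffRep.schur L.fr.irr (η' y hy ∘ₗ J) (fun i v => by
      simp only [LinearMap.comp_apply]
      rw [hc x hx hx', map_neg, hc y hy hy', neg_neg]) (fun v => by
      simp only [LinearMap.comp_apply]
      rw [hp x hx hx', map_neg, hp y hy hy', neg_neg])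
    refine ⟨l, fun z => ?_⟩
    rw [← hl]
    simp only [LinearMap.comp_apply, J, hsq x hx hx']
  obtain ⟨z₀, hz₀⟩ := exists_ne (0 : Fin L.fr.N → ℂ)
  obtain ⟨i, hi⟩ := Function.ne_iff.1 hz₀
  classical
  let u : P.U → Fin L.fr.N → ℂ := fun y => if hy : (y : M) ∈ L.W then η' y hy (J z₀) else 0
  have hu : ContMDiffAt (𝓡 n) 𝓘(ℝ, Fin L.fr.N → ℂ) ∞ u x := by
    refine L.fr.coefficients_smooth hx (hη.smooth _ x hx' (L.fr.smooth (J z₀) x hx)) ?_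
    filter_upwards [val_eventually (L.eventually_mem hx)] with y hy
    simp only [u, dif_pos (show (y : M) ∈ L.W from hy), hG]
  have hux : u x = z₀ := by simp only [u, dif_pos hx]; exact hsq x hx hx' z₀
  have hcont : ContinuousAt (fun y => u y i) x := (continuous_apply i).continuousAt.comp hu.continuousAt
  -- The multiple is `±1`, both squares being one. Continuity of a single coefficient excludes `-1`
  -- near `x`.
  have hne : ∀ᶠ y in 𝓝 x, u y i ≠ -z₀ i := by
    refine hcont.eventually_ne ?_
    rw [hux]
    intro h
    exact hi (eq_zero_of_eq_neg h)
  refine ⟨J, ?_⟩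
  filter_upwards [hne, val_eventually (L.eventually_mem hx), val_eventually (W'.isOpen.mem_nhds hx')]
    with y hy1 hy hy' z
  obtain ⟨l, hl⟩ := hlam y hy hy'
  have huy : u y = l • z₀ := by
    simp only [u, dif_pos (show (y : M) ∈ L.W from hy), hl, J, hsq x hx hx']
  have hl2 : l * l = 1 := by
    have h1 := congrFun (hsq y hy hy' z₀) i
    rw [hl, hl, map_smul, hsq x hx hx', smul_smul, Pi.smul_apply, smul_eq_mul] at h1
    exact mul_right_cancel₀ hi (h1.trans (one_mul _).symm)
  have hl1 : l = 1 := by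
    rcases mul_self_eq_one_iff.1 hl2 with h | h
    · exact h
    · exact absurd (by rw [huy, h]; simp) hy1
  rw [← hG y hy, hl, hl1, one_smul]

/-- Near a point `η` is a constant matrix, through which the derivative passes. -/
theorem D_commutes (k : Fin n) : P.CommutesWithCommutant 0 (L.D k) := by
  intro W' η hη ψ χ hχ x hx' v
  rw [pow_zero, one_smul]
  by_cases hx : (x : M) ∈ L.W
  · rw [P.halfDensity_eq L.hκ (L.D k χ) x (L.le hx), P.halfDensity_eq L.hκ (L.D k ψ) x (L.le hx),
      map_smul, L.D_coordFrame _ _ _ hx, L.D_coordFrame _ _ _ hx]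
    obtain ⟨J, hJ⟩ := L.commutant_const hη hx hx'
    have hev : ∀ᶠ y in 𝓝 (x : M), L.coef χ y = realCLM J (L.coef ψ y) := by
      obtain ⟨O, hxO, hO, h⟩ := eventually_of_eventually_val hJ
      filter_upwards [O.isOpen.mem_nhds hxO, L.eventually_mem hx, W'.isOpen.mem_nhds hx']
        with y hy hyW hy'
      refine L.coef_eq (x := ⟨y, hO hy⟩) hyW ?_
      rw [hχ ⟨y, hO hy⟩ hy', ← L.G_coef ψ ⟨y, hO hy⟩ hyW]
      exact (h ⟨y, hO hy⟩ hy _).symm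
    rw [pd_congr (L.le hx) hev, pd_linear L.hκ _ (L.le hx) (L.coef_smooth ψ hx), ← Complex.coe_smul,
      ← Complex.coe_smul (L.cut x), map_smul, hJ.self_of_nhds]
    rfl
  · rw [L.D_of_notMem _ _ _ hx, L.D_of_notMem _ _ _ hx, map_zero]

theorem sbr_D_m (k : Fin n) (p : ℕ) (f) : P.sbr p 2 (L.D k) (P.m f) = P.m (L.dfun k f) := by
  rw [sbr, Even.neg_one_pow (even_two.mul_left p), one_mul, L.D_m, add_sub_cancel_left]

theorem sbr_D_c (k : Fin n) (e) : P.sbr 2 1 (L.D k) (P.c e) = P.c (L.nabla k e) := by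
  rw [sbr, Even.neg_one_pow (even_two.mul_right 1), one_mul, L.D_c, add_sub_cancel_left]

theorem D_mem (k : Fin n) : L.D k ∈ P.GF 4 := by
  rw [mem_GF_iff]
  refine ⟨?_, commutes_mod (p := 0) (p' := 2) rfl (L.D_commutes k), fun f => ?_, fun e => ?_⟩
  · simp [HasParity, L.D_γ]
  · rw [sbr_mod (p := 2) (q := 0) (p' := 2) (q' := 2) rfl rfl, L.sbr_D_m]; exact m_mem _
  · rw [L.sbr_D_c]; exact c_mem _

end LocalFrame
end SpinorBundle
end PartialDerivatives
end CourantDirac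

namespace CourantDirac

/-! ## Integration and transposed operators -/

section Transposes

open Filter Topology Module MeasureTheory

variable {n : ℕ} {M : Type uM} [TopologicalSpace M] [ChartedSpace (EuclideanSpace ℝ (Fin n)) M]
  [IsManifold (𝓡 n) ∞ M] {κ κ' : OpenPartialHomeomorph M (EuclideanSpace ℝ (Fin n))} {K : Set M}

/-- Extension by zero carries the integrals from the chart to the whole model space, where
integration by parts is available. -/
theorem contDiff_indicator {Z : Type*} [NormedAddCommGroup Z] [NormedSpace ℝ Z]
    (hκ : κ ∈ IsManifold.maximalAtlas (𝓡 n) ∞ M) (hK : IsCompact K) (hKs : K ⊆ κ.source)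
    {g : M → Z} (hg : ∀ x ∈ K, ContMDiffAt (𝓡 n) 𝓘(ℝ, Z) ∞ g x) (h0 : ∀ x ∉ K, g x = 0) :
    ContDiff ℝ ∞ (κ.target.indicator (g ∘ κ.symm)) ∧
      HasCompactSupport (κ.target.indicator (g ∘ κ.symm)) := by
  have hc : IsCompact (κ '' K) := hK.image_of_continuousOn (κ.continuousOn.mono hKs)
  have hz : ∀ y ∉ κ '' K, κ.target.indicator (g ∘ κ.symm) y = 0 := fun y hy => by
    by_cases hyt : y ∈ κ.target
    · rw [Set.indicator_of_mem hyt]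
      exact h0 _ fun h => hy ⟨_, h, κ.right_inv hyt⟩
    · rw [Set.indicator_of_notMem hyt]
  refine ⟨contDiff_iff_contDiffAt.2 fun y => ?_, HasCompactSupport.intro hc hz⟩
  by_cases hy : y ∈ κ '' K
  · obtain ⟨x, hx, rfl⟩ := hy
    refine (contDiffAt_comp_symm hκ (hKs hx) (hg x hx)).congr_of_eventuallyEq ?_
    filter_upwards [κ.open_target.mem_nhds (κ.map_source (hKs hx))] with z hz
    rw [Set.indicator_of_mem hz]
  · refine (contDiffAt_const (c := (0 : Z))).congr_of_eventuallyEq ?_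
    filter_upwards [hc.isClosed.isOpen_compl.mem_nhds hy] with z hz'
    exact hz z hz'

theorem integral_pd_eq_zero (hκ : κ ∈ IsManifold.maximalAtlas (𝓡 n) ∞ M) (hK : IsCompact K)
    (hKs : K ⊆ κ.source) {g : M → ℂ} (hg : ∀ x ∈ K, ContMDiffAt (𝓡 n) 𝓘(ℝ, ℂ) ∞ g x)
    (h0 : ∀ x ∉ K, g x = 0) (k : Fin n) :
    ∫ y in κ.target, pd κ k g (κ.symm y) = 0 := by
  obtain ⟨h1, h2⟩ := contDiff_indicator hκ hK hKs hg h0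
  set f := κ.target.indicator (g ∘ κ.symm) with hf
  have h3 : ∀ y ∈ κ.target, pd κ k g (κ.symm y) = fderiv ℝ f y (stdBasis n k) := fun y hy => by
    have : f =ᶠ[𝓝 y] g ∘ κ.symm := by
      filter_upwards [κ.open_target.mem_nhds hy] with z hz
      rw [hf, Set.indicator_of_mem hz]
    rw [pd, κ.right_inv hy, this.fderiv_eq]
  have hc : IsCompact (κ '' K) := hK.image_of_continuousOn (κ.continuousOn.mono hKs)
  have h4 : ∀ y ∉ κ.target, fderiv ℝ f y (stdBasis n k) = 0 := fun y hy => by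
    have hy' : y ∉ κ '' K := fun ⟨x, hx, h⟩ => hy (h ▸ κ.map_source (hKs hx))
    have : f =ᶠ[𝓝 y] fun _ => (0 : ℂ) := by
      filter_upwards [hc.isClosed.isOpen_compl.mem_nhds hy'] with z hz
      by_cases hzt : z ∈ κ.target
      · rw [hf, Set.indicator_of_mem hzt]
        exact h0 _ fun h => hz ⟨_, h, κ.right_inv hzt⟩
      · rw [hf, Set.indicator_of_notMem hzt]
    rw [this.fderiv_eq]; simp
  rw [setIntegral_congr_fun κ.open_target.measurableSet h3,
    setIntegral_eq_integral_of_forall_compl_eq_zero h4]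
  have h5 : Integrable fun y => fderiv ℝ f y (stdBasis n k) :=
    (((h1.continuous_fderiv (by simp)).clm_apply continuous_const)).integrable_of_hasCompactSupport
      ((h2.fderiv ℝ).comp_left (g := fun T : EuclideanSpace ℝ (Fin n) →L[ℝ] ℂ => T (stdBasis n k))
        rfl)
  -- Integration by parts against the constant function one.
  have h6 := integral_smul_fderiv_eq_neg_fderiv_smul_of_integrable (μ := volume)
    (f := fun _ : EuclideanSpace ℝ (Fin n) => (1 : ℝ)) (g := f) (v := stdBasis n k)
    (by simp) (by simpa using h5)
    (by simpa using h1.continuous.integrable_of_hasCompactSupport h2)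
    (fun x _ => differentiableAt_const _) (fun x _ => (h1.differentiable (by simp)).differentiableAt)
  simpa using h6

variable [T2Space M]
  {F : Type uF} [NormedAddCommGroup F] [NormedSpace ℝ F] [FiniteDimensional ℝ F]
  {E : M → Type uE} [∀ x, AddCommGroup (E x)] [∀ x, Module ℝ (E x)]
  [∀ x, TopologicalSpace (E x)] [TopologicalSpace (TotalSpace F E)] [FiberBundle F E]
  [VectorBundle ℝ F E] [ContMDiffVectorBundle ∞ F E (𝓡 n)]

namespace SpinorBundle

variable {𝒞 : CourantAlgebroid n F E} {P : SpinorBundle.{uM, uF, uE, w} 𝒞}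

theorem density_eq (κ : OpenPartialHomeomorph M (EuclideanSpace ℝ (Fin n)))
    (ψ χ : P.HalfDensities) (x : P.U) :
    P.density κ ψ χ x = P.form x (ψ.1 x (coordFrame κ x)) (χ.1 x (coordFrame κ x)) :=
  dif_pos x.2

theorem density_of_notMem {ψ χ : P.HalfDensities} {x : M} (hx : x ∉ P.U) :
    P.density κ ψ χ x = 0 := dif_neg hx

theorem density_smooth (hκ : κ ∈ IsManifold.maximalAtlas (𝓡 n) ∞ M) (ψ χ : P.HalfDensities)
    (x : P.U) (hx : (x : M) ∈ κ.source) : ContMDiffAt (𝓡 n) 𝓘(ℝ, ℂ) ∞ (P.density κ ψ χ) x := by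
  refine (contMDiffAt_subtype_iff (U := P.U)).1 ?_
  refine (P.smooth_form _ _ x (ψ.2.2 κ hκ x hx) (χ.2.2 κ hκ x hx)).congr_of_eventuallyEq ?_
  exact Eventually.of_forall fun y => density_eq κ ψ χ y

/-- Each half-density contributes a factor `|det|^{1/2}`, so their pairing changes by the Jacobian
of the substitution rule. -/
theorem density_change (hκ : κ ∈ IsManifold.maximalAtlas (𝓡 n) ∞ M)
    (hκ' : κ' ∈ IsManifold.maximalAtlas (𝓡 n) ∞ M) (ψ χ : P.HalfDensities) {x : M}
    (hx : x ∈ κ.source) (hx' : x ∈ κ'.source) :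
    P.density κ' ψ χ x = |(fderiv ℝ (κ ∘ κ'.symm) (κ' x)).det| • P.density κ ψ χ x := by
  by_cases hU : x ∈ P.U
  · rw [density_eq κ' ψ χ ⟨x, hU⟩, density_eq κ ψ χ ⟨x, hU⟩,
      P.halfDensity_eq hκ ψ ⟨x, hU⟩ hx (coordFrame κ' x),
      P.halfDensity_eq hκ χ ⟨x, hU⟩ hx (coordFrame κ' x), map_smul, map_smul, LinearMap.smul_apply,
      smul_smul, detAt_transition hκ hκ' hx hx', ← Complex.ofReal_mul,
      Real.mul_self_sqrt (abs_nonneg _), Complex.coe_smul]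
  · rw [density_of_notMem hU, density_of_notMem hU, smul_zero]

theorem integral_density_change (hκ : κ ∈ IsManifold.maximalAtlas (𝓡 n) ∞ M)
    (hκ' : κ' ∈ IsManifold.maximalAtlas (𝓡 n) ∞ M) (ψ χ : P.HalfDensities)
    (h : ∀ x : P.U, ¬ ((x : M) ∈ κ.source ∧ (x : M) ∈ κ'.source) → ∀ v,
      P.form x (ψ.1 x v) (χ.1 x v) = 0) :
    ∫ y in κ.target, P.density κ ψ χ (κ.symm y) =
      ∫ y in κ'.target, P.density κ' ψ χ (κ'.symm y) := by
  have h0 : ∀ (κ₀ : OpenPartialHomeomorph M (EuclideanSpace ℝ (Fin n))) (x : M),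
      ¬ (x ∈ κ.source ∧ x ∈ κ'.source) → P.density κ₀ ψ χ x = 0 := fun κ₀ x hx => by
    by_cases hU : x ∈ P.U
    · exact (density_eq κ₀ ψ χ ⟨x, hU⟩).trans (h ⟨x, hU⟩ hx _)
    · exact density_of_notMem hU
  let τ := κ'.symm.trans κ
  have hs : τ.source ⊆ κ'.target := fun y hy => hy.1
  have ht : τ.target ⊆ κ.target := fun y hy => hy.1
  have e1 : ∫ y in κ.target, P.density κ ψ χ (κ.symm y) =
      ∫ y in τ.target, P.density κ ψ χ (κ.symm y) := by
    refine (setIntegral_eq_of_subset_of_forall_sdiff_eq_zero κ.open_target.measurableSet ht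
      fun y hy => h0 _ _ fun hx => hy.2 ⟨hy.1, hx.2⟩)
  have e2 : ∫ y in κ'.target, P.density κ' ψ χ (κ'.symm y) =
      ∫ y in τ.source, P.density κ' ψ χ (κ'.symm y) := by
    refine (setIntegral_eq_of_subset_of_forall_sdiff_eq_zero κ'.open_target.measurableSet hs
      fun y hy => h0 _ _ fun hx => hy.2 ⟨hy.1, hx.1⟩)
  rw [e1, e2, ← τ.image_source_eq_target]
  have h3 : ∀ y ∈ τ.source, HasFDerivWithinAt τ (fderiv ℝ (κ ∘ κ'.symm) y) τ.source y :=
    fun y hy => by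
      have h4 := contDiffAt_transition hκ hκ' (x := κ'.symm y) hy.2 (κ'.map_target hy.1)
      rw [κ'.right_inv hy.1] at h4
      exact ((h4.differentiableAt (by simp)).hasFDerivAt).hasFDerivWithinAt
  rw [integral_image_eq_integral_abs_det_fderiv_smul volume τ.open_source.measurableSet h3 τ.injOn]
  refine setIntegral_congr_fun τ.open_source.measurableSet fun y hy => ?_
  have h5 : κ.symm (τ y) = κ'.symm y := κ.left_inv hy.2
  have h6 := density_change hκ hκ' ψ χ (x := κ'.symm y) hy.2 (κ'.map_target hy.1)
  rw [κ'.right_inv hy.1] at h6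
  beta_reduce
  rw [h5, h6]

/-- The two half-densities vanish outside `K`. -/
def SupportedIn (K : Set M) (ψ : P.HalfDensities) : Prop := ∀ x : P.U, (x : M) ∉ K → ∀ v, ψ.1 x v = 0

theorem IsLocal.supportedIn {A : P.Op} (hA : IsLocal A) (hK : IsCompact K) {ψ : P.HalfDensities}
    (hψ : SupportedIn K ψ) : SupportedIn K (A ψ) := fun x hx v =>
  hA ψ x ((val_eventually (hK.isClosed.isOpen_compl.mem_nhds hx)).mono fun y hy => hψ y hy) v

theorem density_smooth_and_zero (hκ : κ ∈ IsManifold.maximalAtlas (𝓡 n) ∞ M)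
    (hKs : K ⊆ κ.source) (hKU : K ⊆ P.U) {ψ χ : P.HalfDensities} (hψ : SupportedIn K ψ) :
    (∀ x ∈ K, ContMDiffAt (𝓡 n) 𝓘(ℝ, ℂ) ∞ (P.density κ ψ χ) x) ∧
      ∀ x ∉ K, P.density κ ψ χ x = 0 := by
  refine ⟨fun x hx => density_smooth hκ ψ χ ⟨x, hKU hx⟩ (hKs hx), fun x hx => ?_⟩
  by_cases hU : x ∈ P.U
  · rw [density_eq κ ψ χ ⟨x, hU⟩, hψ ⟨x, hU⟩ hx, map_zero, LinearMap.zero_apply]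
  · exact density_of_notMem hU

theorem integrableOn_density (hκ : κ ∈ IsManifold.maximalAtlas (𝓡 n) ∞ M) (hK : IsCompact K)
    (hKs : K ⊆ κ.source) (hKU : K ⊆ P.U) {ψ χ : P.HalfDensities} (hψ : SupportedIn K ψ) :
    IntegrableOn (fun y => P.density κ ψ χ (κ.symm y)) κ.target := by
  obtain ⟨h1, h2⟩ := density_smooth_and_zero (χ := χ) hκ hKs hKU hψ
  obtain ⟨h3, h4⟩ := contDiff_indicator hκ hK hKs h1 h2
  exact (integrable_indicator_iff κ.open_target.measurableSet).1
    (h3.continuous.integrable_of_hasCompactSupport h4)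

/-- `A'` is the formal transpose of `A`. -/
def Transposed (A A' : P.Op) : Prop :=
  ∀ κ ∈ IsManifold.maximalAtlas (𝓡 n) ∞ M, ∀ K : Set M, IsCompact K → K ⊆ κ.source → K ⊆ P.U →
    ∀ ψ χ : P.HalfDensities, SupportedIn K ψ → SupportedIn K χ →
      ∫ y in κ.target, P.density κ (A ψ) χ (κ.symm y) =
        ∫ y in κ.target, P.density κ ψ (A' χ) (κ.symm y)

theorem density_add_left (ψ ψ' χ : P.HalfDensities) (x : M) :
    P.density κ (ψ + ψ') χ x = P.density κ ψ χ x + P.density κ ψ' χ x := by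
  by_cases hU : x ∈ P.U
  · simp only [density_eq κ _ _ ⟨x, hU⟩, add_val, map_add, LinearMap.add_apply]
  · simp only [density_of_notMem hU, add_zero]

theorem density_add_right (ψ χ χ' : P.HalfDensities) (x : M) :
    P.density κ ψ (χ + χ') x = P.density κ ψ χ x + P.density κ ψ χ' x := by
  by_cases hU : x ∈ P.U
  · simp only [density_eq κ _ _ ⟨x, hU⟩, add_val, map_add]
  · simp only [density_of_notMem hU, add_zero]

theorem density_smul_left (z : ℂ) (ψ χ : P.HalfDensities) (x : M) :
    P.density κ (z • ψ) χ x = z * P.density κ ψ χ x := by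
  by_cases hU : x ∈ P.U
  · simp only [density_eq κ _ _ ⟨x, hU⟩, smul_val, map_smul, LinearMap.smul_apply, smul_eq_mul]
  · simp only [density_of_notMem hU, mul_zero]

theorem density_smul_right (z : ℂ) (ψ χ : P.HalfDensities) (x : M) :
    P.density κ ψ (z • χ) x = z * P.density κ ψ χ x := by
  by_cases hU : x ∈ P.U
  · simp only [density_eq κ _ _ ⟨x, hU⟩, smul_val, map_smul, smul_eq_mul]
  · simp only [density_of_notMem hU, mul_zero]

theorem hasFormalTranspose_iff (δ : ℂ) (A : P.Op) :
    P.HasFormalTranspose δ A ↔ Transposed A (δ • A) := by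
  have key : ∀ κ (ψ χ : P.HalfDensities),
      ∫ y in κ.target, P.density κ ψ ((δ • A) χ) (κ.symm y) =
        δ * ∫ y in κ.target, P.density κ ψ (A χ) (κ.symm y) := fun κ ψ χ => by
    rw [← integral_const_mul]
    exact integral_congr_ae (Eventually.of_forall fun y =>
      density_smul_right _ _ _ _)
  constructor
  · intro h κ hκ K hK hKs hKU ψ χ hψ hχ
    rw [key]
    exact h κ hκ K hK hKs hKU ψ χ fun x hx v => ⟨hψ x hx v, hχ x hx v⟩
  · intro h κ hκ K hK hKs hKU ψ χ hψ
    rw [← key]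
    exact h κ hκ K hK hKs hKU ψ χ (fun x hx v => (hψ x hx v).1) fun x hx v => (hψ x hx v).2

/-- An operator which is transposed to another one at every point. -/
theorem transposed_of_pointwise {A A' : P.Op}
    (h : ∀ (ψ χ : P.HalfDensities) x v, P.form x ((A ψ).1 x v) (χ.1 x v) =
      P.form x (ψ.1 x v) ((A' χ).1 x v)) : Transposed A A' := by
  intro κ _ K _ _ _ ψ χ _ _
  refine integral_congr_ae (Eventually.of_forall fun y => ?_)
  by_cases hU : κ.symm y ∈ P.U
  · exact (density_eq κ _ _ ⟨_, hU⟩).trans ((h ψ χ _ _).trans (density_eq κ _ _ ⟨_, hU⟩).symm)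
  · beta_reduce
    rw [density_of_notMem hU, density_of_notMem hU]

theorem transposed_c (e : Cₛ^∞⟮𝓡 n; F, E⟯) : Transposed (P.c e) (((P.sign : ℤ) : ℂ) • P.c e) :=
  transposed_of_pointwise fun ψ χ x v => by
    rw [c_val, P.form_cliff, LinearMap.smul_apply, smul_val, map_smul, c_val, smul_eq_mul]

theorem transposed_m (f : C^∞⟮𝓡 n, M; ℝ⟯) : Transposed (P.m f) (P.m f) :=
  transposed_of_pointwise fun ψ χ x v => by
    rw [m_val, m_val, ← Complex.coe_smul, ← Complex.coe_smul, map_smul, map_smul,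
      LinearMap.smul_apply]

theorem transposed_mc (h) : Transposed (P.mc h) (P.mc h) :=
  transposed_of_pointwise fun ψ χ x v => by
    rw [mc_val, mc_val, map_smul, map_smul, LinearMap.smul_apply]

/-- Locality keeps the supports in `K`, which provides the integrability needed to split the
integrals. -/
theorem Transposed.add {A A' B B' : P.Op} (hA : Transposed A A') (hB : Transposed B B')
    (h : IsLocal A) (h' : IsLocal B) : Transposed (A + B) (A' + B') := by
  intro κ hκ K hK hKs hKU ψ χ hψ hχ
  simp only [LinearMap.add_apply, density_add_left, density_add_right]
  rw [integral_add (integrableOn_density hκ hK hKs hKU (h.supportedIn hK hψ))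
      (integrableOn_density hκ hK hKs hKU (h'.supportedIn hK hψ)),
    integral_add (integrableOn_density hκ hK hKs hKU hψ)
      (integrableOn_density hκ hK hKs hKU hψ), hA κ hκ K hK hKs hKU ψ χ hψ hχ,
    hB κ hκ K hK hKs hKU ψ χ hψ hχ]

theorem Transposed.smul {A A' : P.Op} (hA : Transposed A A') (z : ℂ) :
    Transposed (z • A) (z • A') := by
  intro κ hκ K hK hKs hKU ψ χ hψ hχ
  simp only [LinearMap.smul_apply, density_smul_left, density_smul_right]
  rw [integral_const_mul, integral_const_mul, hA κ hκ K hK hKs hKU ψ χ hψ hχ]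

theorem Transposed.mul {A A' B B' : P.Op} (hA : Transposed A A') (hB : Transposed B B')
    (hB₀ : IsLocal B) (hA₀ : IsLocal A') : Transposed (A * B) (B' * A') := by
  intro κ hκ K hK hKs hKU ψ χ hψ hχ
  exact (hA κ hκ K hK hKs hKU (B ψ) χ (hB₀.supportedIn hK hψ) hχ).trans
    (hB κ hκ K hK hKs hKU ψ (A' χ) hψ (hA₀.supportedIn hK hχ))

theorem transposed_zero : Transposed (0 : P.Op) 0 := by
  simpa using (transposed_m (P := P) 0)

theorem isLocal_m (f : C^∞⟮𝓡 n, M; ℝ⟯) : IsLocal (P.m f) := isLocal_of_mem (m_mem f)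

theorem isLocal_mc (h : C^∞⟮𝓡 n, P.U; 𝓘(ℝ, ℂ), ℂ⟯) : IsLocal (P.mc h) :=
  isLocal_of_mem ((mem_filt_iff (p := 0)).1 (mc_mem h))

/-- A function is determined by its transpose. -/
theorem eq_of_transposed_mc {h h' : C^∞⟮𝓡 n, P.U; 𝓘(ℝ, ℂ), ℂ⟯}
    (hh : Transposed (P.mc h) (P.mc h')) : P.mc h = P.mc h' := by
  by_contra hne
  have hne' : ∃ x : P.U, h x - h' x ≠ 0 := by
    by_contra! hx
    exact hne (P.ext_op fun ψ x v => by rw [mc_val, mc_val, sub_eq_zero.1 (hx x)])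
  obtain ⟨x₀, hx₀⟩ := hne'
  set κ := chartAt (EuclideanSpace ℝ (Fin n)) (x₀ : M) with hκe
  have hκ : κ ∈ IsManifold.maximalAtlas (𝓡 n) ∞ M := IsManifold.chart_mem_maximalAtlas _
  have hxs : (x₀ : M) ∈ κ.source := mem_chart_source _ _
  have hform : ∃ s t, P.form x₀ s t ≠ 0 := by
    obtain ⟨s, hs⟩ := @exists_ne _ (P.nontrivial x₀) (0 : P.S x₀)
    by_contra! h0
    exact hs ((P.form_nondegenerate x₀).1 s fun t => h0 s t)
  obtain ⟨s, t, hst⟩ := hform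
  obtain ⟨ψ, hψ⟩ := exists_halfDensity x₀ hκ hxs s
  -- The scaling makes `(h - h') ⟨ψ, χ⟩` equal to one at `x₀`, so its real part is positive nearby.
  obtain ⟨χ, hχ⟩ := exists_halfDensity x₀ hκ hxs (((h x₀ - h' x₀) * P.form x₀ s t)⁻¹ • t)
  let q : P.U → ℂ := fun x => (h x - h' x) * P.density κ ψ χ x
  have hq : q x₀ = 1 := by
    simp only [q]
    rw [density_eq, hψ, hχ, map_smul, smul_eq_mul]
    field_simp
  have hqc : ContinuousAt q x₀ := by
    refine ContinuousAt.mul (by fun_prop) ?_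
    exact ((density_smooth hκ ψ χ x₀ hxs).continuousAt).comp continuous_subtype_val.continuousAt
  have hev : ∀ᶠ x in 𝓝 x₀, 0 < (q x).re := by
    have := (Complex.continuous_re.continuousAt.comp hqc).eventually (lt_mem_nhds
      (show (0 : ℝ) < (Complex.re ∘ q) x₀ by simp [hq]))
    exact this
  obtain ⟨O, hxO, hO, hOq⟩ := eventually_of_eventually_val hev
  obtain ⟨a, ha1, hac, has⟩ := exists_bump (n := n) (x₀ : M)
    (inter_mem (κ.open_source.mem_nhds hxs) (O.isOpen.mem_nhds hxO))
  have haψ : ∀ φ : P.HalfDensities, SupportedIn (tsupport a) (P.m a φ) := fun φ x hx v => by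
    rw [m_val, image_eq_zero_of_notMem_tsupport hx, zero_smul]
  have hKs : tsupport a ⊆ κ.source := fun x hx => (has hx).1
  have hKU : tsupport a ⊆ P.U := fun x hx => hO (has hx).2
  have h1 := hh κ hκ _ hac hKs hKU _ _ (haψ ψ) (haψ χ)
  obtain ⟨g1, g2⟩ := density_smooth_and_zero (χ := P.m a χ) hκ hKs hKU
    ((isLocal_mc (h - h')).supportedIn hac (haψ ψ))
  obtain ⟨g3, g4⟩ := contDiff_indicator hκ hac hKs g1 g2
  set f := κ.target.indicator (P.density κ (P.mc (h - h') (P.m a ψ)) (P.m a χ) ∘ κ.symm) with hf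
  have hfq : ∀ x : P.U, P.density κ (P.mc (h - h') (P.m a ψ)) (P.m a χ) x = (a x * a x : ℝ) * q x := by
    intro x
    rw [density_eq, mc_val, m_val, m_val, ← Complex.coe_smul, ← Complex.coe_smul, map_smul, map_smul,
      map_smul]
    simp only [LinearMap.smul_apply, smul_eq_mul, q, density_eq]
    push_cast
    have : (h - h') x = h x - h' x := rfl
    rw [this]
    ring
  -- After multiplication of both half-densities by the bump function `a` the integrand is `a² q`.
  -- Its real part has a positive integral, while the hypothesis makes the integral zero.
  have hpos : 0 < ∫ y, (f y).re := by
    refine (Complex.continuous_re.comp g3.continuous).integral_pos_of_hasCompactSupport_nonneg_nonzero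
      (x := κ x₀) (g4.comp_left Complex.zero_re) (fun y => ?_) ?_
    · change 0 ≤ (f y).re
      by_cases hy : y ∈ κ.target
      · rw [hf, Set.indicator_of_mem hy, Function.comp_apply]
        by_cases hyK : κ.symm y ∈ tsupport a
        · rw [hfq ⟨_, hKU hyK⟩, Complex.re_ofReal_mul]
          exact mul_nonneg (mul_self_nonneg _) (hOq ⟨_, hKU hyK⟩ (has hyK).2).le
        · rw [g2 _ hyK]; simp
      · rw [hf, Set.indicator_of_notMem hy]; simp
    · rw [hf, Set.indicator_of_mem (κ.map_source hxs), Function.comp_apply, κ.left_inv hxs, hfq, hq,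
        ha1.self_of_nhds]
      simp
  have hzero : ∫ y, f y = 0 := by
    rw [hf, integral_indicator κ.open_target.measurableSet]
    have h2 : ∀ y, P.density κ (P.mc (h - h') (P.m a ψ)) (P.m a χ) (κ.symm y) =
        P.density κ (P.mc h (P.m a ψ)) (P.m a χ) (κ.symm y) -
          P.density κ (P.m a ψ) (P.mc h' (P.m a χ)) (κ.symm y) := fun y => by
      by_cases hU : κ.symm y ∈ P.U
      · simp only [density_eq κ _ _ ⟨_, hU⟩, mc_val, map_smul, LinearMap.smul_apply, smul_eq_mul]
        have : (h - h') ⟨_, hU⟩ = h ⟨_, hU⟩ - h' ⟨_, hU⟩ := rfl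
        rw [this, sub_mul]
      · simp only [density_of_notMem hU, sub_zero]
    have h3 := integral_sub (μ := volume.restrict κ.target)
      (integrableOn_density (χ := P.m a χ) hκ hac hKs hKU
        ((isLocal_mc h).supportedIn hac (haψ ψ)))
      (integrableOn_density (χ := P.mc h' (P.m a χ)) hκ hac hKs hKU (haψ ψ))
    rw [h1, sub_self] at h3
    rw [← h3]
    exact integral_congr_ae (Eventually.of_forall h2)
  have h4 : ∫ y, (f y).re = (∫ y, f y).re :=
    integral_re (g3.continuous.integrable_of_hasCompactSupport g4)
  rw [h4, hzero] at hpos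
  simp at hpos

/-- The pairing is constant in the frame, so the densities add up to the derivative of `cut · B(coef
ψ, coef χ)`, whose integral vanishes. The zeroth order term comes from differentiating the cutoff.
-/
theorem LocalFrame.transposed_D (L : P.LocalFrame) (k : Fin n) :
    Transposed (L.D k) (-L.D k - P.m (L.dcut k)) := by
  intro κ hκ K hK hKs hKU ψ χ hψ hχ
  set C := tsupport L.cut with hC
  have hCW : C ⊆ L.W := L.tsupport_subset
  have hCU : C ⊆ P.U := hCW.trans L.fr.le
  have hDz : ∀ φ, SupportedIn C (L.D k φ) := fun φ x hx v => by
    change Real.sqrt _ • L.cut x • _ = _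
    rw [image_eq_zero_of_notMem_tsupport hx, zero_smul, smul_zero]
  have hmz : ∀ φ, SupportedIn C (P.m (L.dcut k) φ) := fun φ x hx v => by
    rw [m_val]
    by_cases hW : (x : M) ∈ L.W
    · have h0 : L.cut =ᶠ[𝓝 (x : M)] fun _ => (0 : ℝ) := by
        filter_upwards [(isClosed_tsupport L.cut).isOpen_compl.mem_nhds hx] with z hz
        exact image_eq_zero_of_notMem_tsupport hz
      rw [L.dcut_apply k hW, pd_congr (L.le hW) h0, pd_const, zero_smul]
    · rw [L.dcut_of_notMem k hW, zero_smul]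
  have hKC : IsCompact (K ∩ C) := hK.inter L.compact
  have hKCs : K ∩ C ⊆ κ.source := fun x hx => hKs hx.1
  have hKCU : K ∩ C ⊆ P.U := fun x hx => hKU hx.1
  have hKCL : K ∩ C ⊆ L.κ.source := fun x hx => L.le (hCW hx.2)
  have hloc : IsLocal (L.D k) := isLocal_of_mem (L.D_mem k)
  have s1 : SupportedIn (K ∩ C) (L.D k ψ) := fun x hx v => by
    by_cases h : (x : M) ∈ K
    · exact hDz ψ x (fun h' => hx ⟨h, h'⟩) v
    · exact hloc.supportedIn hK hψ x h v
  have s2 : SupportedIn (K ∩ C) (L.D k χ + P.m (L.dcut k) χ) := fun x hx v => by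
    rw [add_val]
    by_cases h : (x : M) ∈ K
    · rw [hDz χ x (fun h' => hx ⟨h, h'⟩) v, hmz χ x (fun h' => hx ⟨h, h'⟩) v, add_zero]
    · rw [hloc.supportedIn hK hχ x h v, m_val, hχ x h, smul_zero, add_zero]
  have hneg : (-L.D k - P.m (L.dcut k)) χ = (-1 : ℂ) • (L.D k χ + P.m (L.dcut k) χ) := by
    rw [LinearMap.sub_apply, LinearMap.neg_apply]; module
  rw [hneg]
  simp only [density_smul_right]
  -- The supports lie in `K ∩ C`, inside both charts, so the integrals may be evaluated in the chart
  -- of the frame.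
  rw [integral_const_mul,
    integral_density_change hκ L.hκ (L.D k ψ) χ fun x hx v => by
      rw [s1 x (fun h => hx ⟨hKCs h, hKCL h⟩), map_zero, LinearMap.zero_apply],
    integral_density_change hκ L.hκ ψ _ fun x hx v => by
      rw [s2 x (fun h => hx ⟨hKCs h, hKCL h⟩), map_zero], neg_one_mul, ← add_eq_zero_iff_eq_neg]
  have s3 : IntegrableOn (fun y => P.density L.κ ψ (L.D k χ + P.m (L.dcut k) χ) (L.κ.symm y))
      L.κ.target := by
    have h1 := fun x (hx : x ∈ K ∩ C) => density_smooth L.hκ ψ (L.D k χ + P.m (L.dcut k) χ)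
      ⟨x, hKCU hx⟩ (hKCL hx)
    have h2 : ∀ x ∉ K ∩ C, P.density L.κ ψ (L.D k χ + P.m (L.dcut k) χ) x = 0 := fun x hx => by
      by_cases hU : x ∈ P.U
      · rw [density_eq L.κ _ _ ⟨x, hU⟩, s2 ⟨x, hU⟩ hx, map_zero]
      · exact density_of_notMem hU
    obtain ⟨h3, h4⟩ := contDiff_indicator L.hκ hKC hKCL h1 h2
    exact (integrable_indicator_iff L.κ.open_target.measurableSet).1
      (h3.continuous.integrable_of_hasCompactSupport h4)
  rw [← integral_add (integrableOn_density L.hκ hKC hKCL hKCU s1) s3]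
  let T := (LinearMap.restrictScalars₁₂ ℝ ℝ L.fr.B).toContinuousBilinearMap
  have hT : ∀ z w, T z w = L.fr.B z w := fun _ _ => rfl
  let g : M → ℂ := fun x => L.cut x • T (L.coef ψ x) (L.coef χ x)
  have hg : ∀ x ∈ L.W, ContMDiffAt (𝓡 n) 𝓘(ℝ, ℂ) ∞ (fun x => T (L.coef ψ x) (L.coef χ x)) x :=
    fun x hx => ContMDiffAt.clm_apply (T.contMDiff.contMDiffAt.comp x (L.coef_smooth ψ hx))
      (L.coef_smooth χ hx)
  refine Eq.trans (setIntegral_congr_fun L.κ.open_target.measurableSet fun y hy => ?_)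
    (integral_pd_eq_zero L.hκ hKC hKCL (g := g)
      (fun x hx => ((L.cut.contMDiff x).smul (hg x (hCW hx.2)))) (fun x hx => ?_) k)
  · obtain ⟨x, hx, rfl⟩ : ∃ x, x ∈ L.κ.source ∧ L.κ x = y :=
      ⟨_, L.κ.map_target hy, L.κ.right_inv hy⟩
    beta_reduce
    rw [L.κ.left_inv hx]
    by_cases hW : x ∈ L.W
    · rw [density_eq L.κ _ _ ⟨x, L.fr.le hW⟩, density_eq L.κ _ _ ⟨x, L.fr.le hW⟩, add_val, m_val,
        L.D_coordFrame k ψ ⟨x, L.fr.le hW⟩ hW, L.D_coordFrame k χ ⟨x, L.fr.le hW⟩ hW,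
        ← L.G_coef ψ ⟨x, L.fr.le hW⟩ hW, ← L.G_coef χ ⟨x, L.fr.le hW⟩ hW,
        pd_smul L.hκ hx (L.cut.contMDiff x) (hg x hW),
        pd_bilinear L.hκ T hx (L.coef_smooth ψ hW) (L.coef_smooth χ hW)]
      simp only [← Complex.coe_smul, map_smul, LinearMap.smul_apply, map_add,
        L.fr.form ⟨x, L.fr.le hW⟩ hW, L.dcut_apply k hW, hT, smul_eq_mul]
      ring
    · have h0 : g =ᶠ[𝓝 x] fun _ => (0 : ℂ) := by
        filter_upwards [(isClosed_tsupport L.cut).isOpen_compl.mem_nhds fun h => hW (hCW h)]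
          with z hz
        change L.cut z • _ = _
        rw [image_eq_zero_of_notMem_tsupport hz, zero_smul]
      rw [pd_congr hx h0, pd_const]
      by_cases hU : x ∈ P.U
      · rw [density_eq L.κ _ _ ⟨x, hU⟩, density_eq L.κ _ _ ⟨x, hU⟩, s1 ⟨x, hU⟩ fun h => hW (hCW h.2),
          s2 ⟨x, hU⟩ fun h => hW (hCW h.2), map_zero, map_zero, LinearMap.zero_apply, add_zero]
      · rw [density_of_notMem hU, density_of_notMem hU, add_zero]
  · change L.cut x • T (L.coef ψ x) (L.coef χ x) = 0
    by_cases hxC : x ∈ C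
    · have hxK : x ∉ K := fun h => hx ⟨h, hxC⟩
      have : L.coef ψ x = 0 := L.coef_eq (x := ⟨x, hCU hxC⟩) (hCW hxC)
        (by rw [map_zero, hψ ⟨x, hCU hxC⟩ hxK])
      rw [this, map_zero]; simp
    · rw [image_eq_zero_of_notMem_tsupport hxC, zero_smul]

end SpinorBundle
end Transposes
end CourantDirac

namespace CourantDirac

/-! ## Graded functions at a point -/

section GradedFunctions

open Filter Topology Module MeasureTheory

/-- The integral is the value at zero of the convolution of the indicator of `(-1, 0]` with `G z`,
and convolutions depend smoothly on parameters. The bump `ρ`, equal to one on `[0, 1]`, makes the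
support in `s` compact without changing the integral. -/
theorem contDiff_integral_zero_one {X Y : Type*} [NormedAddCommGroup X] [NormedSpace ℝ X]
    [NormedAddCommGroup Y] [NormedSpace ℝ Y] {G : X → ℝ → Y} (hG : ContDiff ℝ ∞ ↿G) :
    ContDiff ℝ ∞ fun z => ∫ s in (0 : ℝ)..1, G z s := by
  let ρ : ContDiffBump (0 : ℝ) := ⟨1, 2, one_pos, one_lt_two⟩
  have hρ : ∀ s ∈ Set.Icc (0 : ℝ) 1, ρ s = 1 := fun s hs =>
    ρ.one_of_mem_closedBall (by simpa [ρ, abs_le] using ⟨by linarith [hs.1], hs.2⟩)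
  let g : X → ℝ → Y := fun z s => ρ s • G z s
  let f : ℝ → ℝ := (Set.Ioc (-1 : ℝ) 0).indicator 1
  have hf : LocallyIntegrable f :=
    ((integrable_indicator_iff measurableSet_Ioc).2
      (continuous_const (y := (1 : ℝ))).integrableOn_Ioc).locallyIntegrable
  have hg : ContDiff ℝ ∞ ↿g := (ρ.contDiff.comp contDiff_snd).smul hG
  have h1 := contDiffOn_convolution_right_with_param (μ := volume) (n := ⊤)
    (ContinuousLinearMap.lsmul ℝ ℝ : ℝ →L[ℝ] Y →L[ℝ] Y) (g := g) (s := Set.univ)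
    (k := tsupport ρ) isOpen_univ ρ.hasCompactSupport
    (fun z s _ hs => by simp only [g, image_eq_zero_of_notMem_tsupport hs, zero_smul]) hf
    hg.contDiffOn
  rw [Set.univ_prod_univ, contDiffOn_univ] at h1
  have h2 := h1.comp (contDiff_id.prodMk (contDiff_const (c := (0 : ℝ))))
  convert h2 using 1
  funext z
  have h3 : convolution f (g z) (ContinuousLinearMap.lsmul ℝ ℝ) volume 0 =
      ∫ t, (Set.Ioc (-1 : ℝ) 0).indicator (fun t => g z (-t)) t := by
    refine integral_congr_ae (Eventually.of_forall fun t => ?_)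
    change f t • g z (0 - t) = _
    rw [zero_sub]
    by_cases ht : t ∈ Set.Ioc (-1 : ℝ) 0
    · simp only [f, Set.indicator_of_mem ht, Pi.one_apply, one_smul]
    · simp only [f, Set.indicator_of_notMem ht, zero_smul]
  refine Eq.trans ?_ h3.symm
  rw [integral_indicator measurableSet_Ioc, ← intervalIntegral.integral_of_le (by norm_num),
    intervalIntegral.integral_comp_neg (f := g z), neg_zero, neg_neg]
  refine intervalIntegral.integral_congr fun s hs => ?_
  rw [Set.uIcc_of_le zero_le_one] at hs
  simp only [g, hρ s hs, one_smul]

/-- **Hadamard's lemma** -/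
theorem exists_hadamard {X : Type*} [NormedAddCommGroup X] [NormedSpace ℝ X]
    {φ : X → ℝ} (hφ : ContDiff ℝ ∞ φ) (a : X) :
    ∃ H : X → X →L[ℝ] ℝ, ContDiff ℝ ∞ H ∧ ∀ z, φ z = φ a + H z (z - a) := by
  have h1 : ContDiff ℝ ∞ (fderiv ℝ φ) := hφ.fderiv_right (by simp)
  -- The mean of the derivative over the segment from `a` to `z`.
  refine ⟨fun z => ∫ s in (0 : ℝ)..1, fderiv ℝ φ (a + s • (z - a)),
    contDiff_integral_zero_one (h1.comp (contDiff_const.add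
      (contDiff_snd.smul (contDiff_fst.sub contDiff_const)))), fun z => ?_⟩
  have hc : Continuous fun s : ℝ => fderiv ℝ φ (a + s • (z - a)) :=
    h1.continuous.comp (by fun_prop)
  have h3 : ∫ s in (0 : ℝ)..1, fderiv ℝ φ (a + s • (z - a)) (z - a) =
      φ (a + (1 : ℝ) • (z - a)) - φ (a + (0 : ℝ) • (z - a)) := by
    refine intervalIntegral.integral_eq_sub_of_hasDerivAt (f := fun s : ℝ => φ (a + s • (z - a)))
      (fun s _ => ?_) ((hc.clm_apply continuous_const).intervalIntegrable _ _)
    have h4 : HasDerivAt (fun s : ℝ => a + s • (z - a)) (z - a) s := by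
      simpa using ((hasDerivAt_id s).smul_const (z - a)).const_add a
    exact ((hφ.differentiable (by simp)).differentiableAt.hasFDerivAt).comp_hasDerivAt s h4
  rw [ContinuousLinearMap.intervalIntegral_apply (hc.intervalIntegrable _ _), h3]
  simp

variable {n : ℕ} {M : Type uM} [TopologicalSpace M] [ChartedSpace (EuclideanSpace ℝ (Fin n)) M]
  [IsManifold (𝓡 n) ∞ M] [T2Space M]

/-- Derivations at a point are determined by their values on coordinates. -/
theorem derivation_eq_zero {κ : OpenPartialHomeomorph M (EuclideanSpace ℝ (Fin n))}
    (hκ : κ ∈ IsManifold.maximalAtlas (𝓡 n) ∞ M) {x : M} (hx : x ∈ κ.source)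
    {X : Fin n → C^∞⟮𝓡 n, M; ℝ⟯} (hX : ∀ᶠ y in 𝓝 x, ∀ k, X k y = κ y k)
    {δ : C^∞⟮𝓡 n, M; ℝ⟯ → ℝ} (hadd : ∀ f g, δ (f + g) = δ f + δ g)
    (hsmul : ∀ (c : ℝ) f, δ (c • f) = c * δ f) (hmul : ∀ f g, δ (f * g) = f x * δ g + g x * δ f)
    (hδ : ∀ k, δ (X k) = 0) (f : C^∞⟮𝓡 n, M; ℝ⟯) : δ f = 0 := by
  have h1 : δ 1 = 0 := by
    have := hmul 1 1
    rw [mul_one] at this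
    have h : (1 : C^∞⟮𝓡 n, M; ℝ⟯) x = 1 := rfl
    rw [h] at this
    linarith
  have hc : ∀ c : ℝ, δ (c • 1) = 0 := fun c => by rw [hsmul, h1, mul_zero]
  have hsub : ∀ f g, δ (f - g) = δ f - δ g := fun f g => by
    rw [sub_eq_add_neg, hadd, ← neg_one_smul ℝ g, hsmul]; ring
  have hloc : ∀ f : C^∞⟮𝓡 n, M; ℝ⟯, (∀ᶠ y in 𝓝 x, f y = 0) → δ f = 0 := fun f hf => by
    obtain ⟨χ, h2, -, h3⟩ := exists_bump (n := n) x hf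
    have h4 : f = f - χ * f := by
      ext y
      change f y = f y - χ y * f y
      by_cases hy : y ∈ tsupport χ
      · rw [h3 hy]; simp
      · rw [image_eq_zero_of_notMem_tsupport hy]; simp
    rw [h4, hsub, hmul, h2.self_of_nhds, hf.self_of_nhds]
    ring
  obtain ⟨χ, h2, h3, h4⟩ := exists_bump (n := n) x (κ.open_source.mem_nhds hx)
  obtain ⟨h5, -⟩ := contDiff_indicator hκ h3 h4 (g := fun y => χ y * f y)
    (fun y _ => (χ.contMDiff y).mul (f.contMDiff y))
    (fun y hy => by rw [image_eq_zero_of_notMem_tsupport hy, zero_mul])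
  obtain ⟨H, hH, hH'⟩ := exists_hadamard h5 (κ x)
  let h (k : Fin n) : C^∞⟮𝓡 n, M; ℝ⟯ := ⟨fun y => χ y • H (κ y) (stdBasis n k),
    contMDiff_cutoff χ _ fun y hy => ContMDiffAt.clm_apply
      ((hH.contMDiff (κ y)).comp y (contMDiffAt_of_mem_maximalAtlas hκ (h4 hy))) contMDiffAt_const⟩
  have hsum : ∀ (s : Finset (Fin n)) (u : Fin n → C^∞⟮𝓡 n, M; ℝ⟯),
      δ (∑ k ∈ s, u k) = ∑ k ∈ s, δ (u k) := fun s u => by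
    classical
    induction s using Finset.induction_on with
    | empty => simpa using hc 0
    | insert a s ha ih => rw [Finset.sum_insert ha, Finset.sum_insert ha, hadd, ih]
  -- By Hadamard's lemma `f` is near `x` its value plus a sum of products `(x_k - x_k(x)) h_k`, and
  -- `δ` sees only germs. It kills constants, and it kills the products because their first factors
  -- vanish at `x` and `δ` vanishes on coordinates.
  have h6 : δ (f - (f x • 1 + ∑ k, (X k - X k x • 1) * h k)) = 0 := by
    refine hloc _ ?_
    filter_upwards [h2, hX, κ.open_source.mem_nhds hx] with y hy hy' hys
    have e1 := hH' (κ y)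
    rw [Set.indicator_of_mem (κ.map_source hys), Set.indicator_of_mem (κ.map_source hx),
      Function.comp_apply, Function.comp_apply, κ.left_inv hys, κ.left_inv hx, hy,
      h2.self_of_nhds, one_mul, one_mul] at e1
    have e2 : (∑ k, (X k - X k x • 1) * h k : C^∞⟮𝓡 n, M; ℝ⟯) y =
        ∑ k, (X k y - X k x) * h k y := by
      rw [function_sum_apply]
      refine Finset.sum_congr rfl fun k _ => ?_
      change (X k y - X k x * 1) * h k y = _
      rw [mul_one]
    change f y - (f x * 1 + (∑ k, (X k - X k x • 1) * h k : C^∞⟮𝓡 n, M; ℝ⟯) y) = 0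
    rw [e2, e1, mul_one, add_sub_add_left_eq_sub, sub_eq_zero]
    have e3 : κ y - κ x = ∑ k, (κ y k - κ x k) • stdBasis n k := by
      rw [← (stdBasis n).sum_repr (κ y - κ x)]
      simp
    conv_lhs => rw [e3]
    rw [map_sum]
    refine Finset.sum_congr rfl fun k _ => ?_
    rw [map_smul, hy', hX.self_of_nhds, smul_eq_mul]
    change _ = _ * (χ y • H (κ y) (stdBasis n k))
    rw [hy, one_smul]
  rw [hsub, hadd, hc, hsum, zero_add, sub_eq_zero] at h6
  rw [h6]
  refine Finset.sum_eq_zero fun k _ => ?_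
  rw [hmul, hsub, hc, hδ]
  change (X k x - X k x * 1) * _ + _ = 0
  ring

variable {F : Type uF} [NormedAddCommGroup F] [NormedSpace ℝ F] [FiniteDimensional ℝ F]
  {E : M → Type uE} [∀ x, AddCommGroup (E x)] [∀ x, Module ℝ (E x)]
  [∀ x, TopologicalSpace (E x)] [TopologicalSpace (TotalSpace F E)] [FiberBundle F E]
  [VectorBundle ℝ F E] [ContMDiffVectorBundle ∞ F E (𝓡 n)]

namespace CourantAlgebroid

variable (𝒞 : CourantAlgebroid n F E)

open Sum in
/-- The relations of a graded function at the point `x`. -/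
structure GradedAt (x : M) (Φ : List (Letter n F E) → ℝ) : Prop where
  add_section : ∀ u e e', Φ (u ++ [inl (e + e')]) = Φ (u ++ [inl e]) + Φ (u ++ [inl e'])
  smul_section : ∀ u (f : C^∞⟮𝓡 n, M; ℝ⟯) (e : Cₛ^∞⟮𝓡 n; F, E⟯),
    Φ (u ++ [inl (fsmul f e)]) = f x * Φ (u ++ [inl e])
  add_function : ∀ u f g, Φ (u ++ [inr (f + g)]) = Φ (u ++ [inr f]) + Φ (u ++ [inr g])
  const_smul_function : ∀ u (c : ℝ) f, Φ (u ++ [inr (c • f)]) = c * Φ (u ++ [inr f])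
  mul_function : ∀ u f g, Φ (u ++ [inr (f * g)]) = f x * Φ (u ++ [inr g]) + g x * Φ (u ++ [inr f])
  swap_sections : ∀ u v e e', Φ (u ++ inl e :: inl e' :: v) + Φ (u ++ inl e' :: inl e :: v) =
    Φ (u ++ inr (𝒞.inner e e') :: v)
  swap_section_function : ∀ u v e f, Φ (u ++ inl e :: inr f :: v) = Φ (u ++ inr f :: inl e :: v)
  swap_functions : ∀ u v f g, Φ (u ++ inr f :: inr g :: v) = Φ (u ++ inr g :: inr f :: v)

variable {𝒞}

/-- Allows the relations to be verified one point at a time, with whichever frame or spinor bundle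
is available there. -/
theorem isGradedFunction_iff {p : ℕ} {φ : Cochain n F E} : 𝒞.IsGradedFunction p φ ↔
    (∀ u, wordWeight u ≠ p → φ u = 0) ∧ ∀ x, 𝒞.GradedAt x (fun u => φ u x) := by
  constructor
  · rintro ⟨h0, h1, h2, h3, h4, h5, h6, h7, h8⟩
    refine ⟨h0, fun x => ⟨fun u e e' => ?_, fun u f e => ?_, fun u f g => ?_, fun u c f => ?_,
      fun u f g => ?_, fun u v e e' => ?_, fun u v e f => ?_, fun u v f g => ?_⟩⟩
    · rw [h1]; rfl
    · rw [h2]; rfl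
    · rw [h3]; rfl
    · rw [h4]; rfl
    · rw [h5]; rfl
    · rw [← h6]; rfl
    · rw [h7]
    · rw [h8]
  · rintro ⟨h0, h⟩
    exact ⟨h0, fun u e e' => by ext x; exact (h x).add_section u e e',
      fun u f e => by ext x; exact (h x).smul_section u f e,
      fun u f g => by ext x; exact (h x).add_function u f g,
      fun u c f => by ext x; exact (h x).const_smul_function u c f,
      fun u f g => by ext x; exact (h x).mul_function u f g,
      fun u v e e' => by ext x; exact (h x).swap_sections u v e e',
      fun u v e f => by ext x; exact (h x).swap_section_function u v e f,
      fun u v f g => by ext x; exact (h x).swap_functions u v f g⟩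

theorem IsGradedFunction.at {p : ℕ} {φ : Cochain n F E} (h : 𝒞.IsGradedFunction p φ) (x : M) :
    𝒞.GradedAt x (fun u => φ u x) := (isGradedFunction_iff.1 h).2 x

theorem gradedAt_zero (x : M) : 𝒞.GradedAt x fun _ => 0 := by
  constructor <;> intros <;> simp

namespace GradedAt

variable {x : M} {Φ Ψ : List (Letter n F E) → ℝ}

theorem add (h : 𝒞.GradedAt x Φ) (h' : 𝒞.GradedAt x Ψ) : 𝒞.GradedAt x fun u => Φ u + Ψ u where
  add_section u e e' := by rw [h.add_section, h'.add_section]; ring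
  smul_section u e e' := by rw [h.smul_section, h'.smul_section]; ring
  add_function u e e' := by rw [h.add_function, h'.add_function]; ring
  const_smul_function u e e' := by rw [h.const_smul_function, h'.const_smul_function]; ring
  mul_function u e e' := by rw [h.mul_function, h'.mul_function]; ring
  swap_sections u v e e' := by rw [← h.swap_sections, ← h'.swap_sections]; ring
  swap_section_function u v e e' := by rw [h.swap_section_function, h'.swap_section_function]
  swap_functions u v e e' := by rw [h.swap_functions, h'.swap_functions]

theorem const_mul (h : 𝒞.GradedAt x Φ) (c : ℝ) : 𝒞.GradedAt x fun u => c * Φ u where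
  add_section u e e' := by rw [h.add_section]; ring
  smul_section u e e' := by rw [h.smul_section]; ring
  add_function u e e' := by rw [h.add_function]; ring
  const_smul_function u e e' := by rw [h.const_smul_function]; ring
  mul_function u e e' := by rw [h.mul_function]; ring
  swap_sections u v e e' := by rw [← h.swap_sections]; ring
  swap_section_function u v e e' := by rw [h.swap_section_function]
  swap_functions u v e e' := by rw [h.swap_functions]

theorem apply_section_congr (h : 𝒞.GradedAt x Φ) (u) {e e' : Cₛ^∞⟮𝓡 n; F, E⟯}
    (he : ∀ᶠ y in 𝓝 x, e y = e' y) : Φ (u ++ [Sum.inl e]) = Φ (u ++ [Sum.inl e']) := by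
  obtain ⟨χ, h2, -, h3⟩ := exists_bump (n := n) x he
  have h1 : fsmul χ e = fsmul χ e' := by
    ext y
    rw [fsmul_apply, fsmul_apply]
    by_cases hy : y ∈ tsupport χ
    · rw [show e y = e' y from h3 hy]
    · rw [image_eq_zero_of_notMem_tsupport hy, zero_smul, zero_smul]
  have h4 := h.smul_section u χ e
  rw [h1, h.smul_section, h2.self_of_nhds, one_mul, one_mul] at h4
  exact h4.symm

theorem apply_section_sum (h : 𝒞.GradedAt x Φ) (u) {ι : Type*} (s : Finset ι)
    (e : ι → Cₛ^∞⟮𝓡 n; F, E⟯) :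
    Φ (u ++ [Sum.inl (∑ i ∈ s, e i)]) = ∑ i ∈ s, Φ (u ++ [Sum.inl (e i)]) := by
  classical
  induction s using Finset.induction_on with
  | empty =>
    have := h.add_section u 0 0
    rw [add_zero] at this
    simpa using this
  | insert a s ha ih => rw [Finset.sum_insert ha, Finset.sum_insert ha, h.add_section, ih]

end GradedAt

namespace FrameChart

variable (L : 𝒞.FrameChart)

/-- The coordinates, cut off. -/
def coord (k : Fin n) : C^∞⟮𝓡 n, M; ℝ⟯ :=
  ⟨fun y => L.cut y • L.κ y k, contMDiff_cutoff L.cut _ fun y hy =>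
    (EuclideanSpace.proj k : EuclideanSpace ℝ (Fin n) →L[ℝ] ℝ).contMDiff.contMDiffAt.comp y
      (contMDiffAt_of_mem_maximalAtlas L.hκ (L.le (L.tsupport_subset hy)))⟩

/-- The points near which the cutoff function is one. -/
def Flat (x : M) : Prop := x ∈ L.W ∧ ∀ᶠ y in 𝓝 x, L.cut y = 1

/-- The letters of the frame. -/
def basic : Fin (finrank ℝ F) ⊕ Fin n → Letter n F E :=
  Sum.map L.o.e L.coord

/-- A graded function is determined at a point by its values on the letters of a frame. -/
theorem eq_zero_of_basic {x : M} (hx : L.Flat x) {Φ : List (Letter n F E) → ℝ}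
    (h : 𝒞.GradedAt x Φ) (hΦ : ∀ b : List (Fin (finrank ℝ F) ⊕ Fin n), Φ (b.map L.basic) = 0)
    (u) : Φ u = 0 := by
  obtain ⟨l, hl⟩ : ∃ l, u.length = l := ⟨_, rfl⟩
  induction l using Nat.strong_induction_on generalizing u with
  | _ l ihl =>
  -- Exchanging two letters costs at most a sign and a word with one letter less, which vanishes by
  -- induction.
  have hswap : ∀ u v a b, (u ++ a :: b :: v).length = l → Φ (u ++ a :: b :: v) = 0 →
      Φ (u ++ b :: a :: v) = 0 := by
    intro u v a b hl h0
    rcases a with e | f <;> rcases b with e' | g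
    · have := h.swap_sections u v e e'
      rw [h0, zero_add] at this
      exact this.trans (ihl _ (by rw [← hl]; simp) _ rfl)
    · rw [← h.swap_section_function, h0]
    · rw [h.swap_section_function, h0]
    · rw [h.swap_functions, h0]
  have hmove : ∀ (v u : List (Letter n F E)) a, (u ++ (v ++ [a])).length = l →
      Φ (u ++ (v ++ [a])) = 0 → Φ (u ++ a :: v) = 0 := by
    intro v
    induction v with
    | nil => intro u a _ h0; exact h0
    | cons b v ih =>
      intro u a hl' h0
      refine hswap u v b a (by rw [← hl']; simp +arith) ?_
      have := ih (u ++ [b]) a (by rw [← hl']; simp +arith) (by simpa using h0)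
      simpa using this
  -- Letters outside the frame are replaced one at a time. Moved to the end of the word, a section
  -- expands in the frame, and a function acts through a derivation, which vanishes once it vanishes
  -- on the coordinates.
  have key : ∀ (m : ℕ) (v : List (Letter n F E)) (b : List (Fin (finrank ℝ F) ⊕ Fin n)),
      v.length = m → (v ++ b.map L.basic).length = l → Φ (v ++ b.map L.basic) = 0 := by
    intro m
    induction m with
    | zero =>
      intro v b hv _
      rw [List.length_eq_zero_iff.1 hv]
      exact hΦ b
    | succ m ihm =>
      intro v b hv hlen
      obtain ⟨v, a, rfl⟩ : ∃ v' a, v = v' ++ [a] :=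
        ⟨_, _, (List.dropLast_append_getLast (l := v) (by rintro rfl; simp at hv)).symm⟩
      have hv' : v.length = m := by simpa using hv
      have hbasic : ∀ i, Φ ((v ++ b.map L.basic) ++ [L.basic i]) = 0 := fun i => by
        have := ihm v (b ++ [i]) hv' (by rw [← hlen]; simp +arith)
        simpa using this
      have hlast : Φ (v ++ (b.map L.basic ++ [a])) = 0 := by
        rw [← List.append_assoc]
        rcases a with e | f
        · have he : ∀ᶠ y in 𝓝 x, e y = (∑ i, fsmul (L.comp e i) (L.o.e i)) y := by
            filter_upwards [L.eventually_mem hx.1] with y hy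
            rw [section_sum_apply]
            exact L.expand e hy
          rw [h.apply_section_congr _ he, h.apply_section_sum]
          refine Finset.sum_eq_zero fun i _ => ?_
          rw [h.smul_section]
          exact mul_eq_zero_of_right _ (hbasic (Sum.inl i))
        · refine derivation_eq_zero L.hκ (L.le hx.1) (X := L.coord) ?_
            (δ := fun f => Φ ((v ++ b.map L.basic) ++ [Sum.inr f])) (h.add_function _)
            (h.const_smul_function _) (h.mul_function _) (fun k => hbasic (Sum.inr k)) f
          filter_upwards [hx.2] with y hy k
          change L.cut y • L.κ y k = _
          rw [hy, one_smul]
      have := hmove (b.map L.basic) v a (by rw [← hlen]; simp +arith) hlast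
      simpa using this
  simpa using key u.length u [] rfl (by simpa using hl)

end FrameChart

end CourantAlgebroid
end GradedFunctions
end CourantDirac

namespace CourantDirac

/-! ## The Euler identity -/

section Euler

open Filter Topology Module

variable {n : ℕ} {M : Type uM} [TopologicalSpace M] [ChartedSpace (EuclideanSpace ℝ (Fin n)) M]
  [IsManifold (𝓡 n) ∞ M] [T2Space M]
  {F : Type uF} [NormedAddCommGroup F] [NormedSpace ℝ F] [FiniteDimensional ℝ F]
  {E : M → Type uE} [∀ x, AddCommGroup (E x)] [∀ x, Module ℝ (E x)]
  [∀ x, TopologicalSpace (E x)] [TopologicalSpace (TotalSpace F E)] [FiberBundle F E]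
  [VectorBundle ℝ F E] [ContMDiffVectorBundle ∞ F E (𝓡 n)]
  {𝒞 : CourantAlgebroid n F E}

namespace SpinorBundle

variable {P : SpinorBundle.{uM, uF, uE, w} 𝒞}

/-- Symbols of operators are graded functions. -/
theorem gradedAt_of_mem {p : ℕ} {χ : Cochain n F E} (hχ : ∀ u, wordWeight u ≠ p → χ u = 0)
    {x : M} (hx : x ∈ P.U) {A : P.Op} (hA : A ∈ P.GF (p + 2))
    (hu : ∀ u, wordWeight u = p → P.iterSbr p A u = P.m (χ u)) :
    𝒞.GradedAt x fun u => χ u x where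
  add_section u e e' := by
    by_cases hw : wordWeight u + 1 = p
    · refine m_injective (P := P) (g := χ _ + χ _) ?_ ⟨x, hx⟩
      rw [m_add, ← hu _ (by simpa), ← hu _ (by simpa), ← hu _ (by simpa)]
      simp only [iterSbr_append_singleton, letterOp, c_add, sbr_add_right]; rfl
    · rw [hχ, hχ, hχ] <;> simpa
  smul_section u f e := by
    by_cases hw : wordWeight u + 1 = p
    · refine m_injective (P := P) (g := f * χ _) ?_ ⟨x, hx⟩
      rw [m_mul, ← hu _ (by simpa), ← hu _ (by simpa)]
      simp only [iterSbr_append_singleton]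
      refine sbr_c_fsmul (k := p + 2 - wordWeight u) (by omega) ?_ f e
      rw [iterSbr_mod (q := p + 2) (by omega)]
      exact iterSbr_mem hA u
    · rw [hχ, hχ] <;> simpa
  add_function u f g := by
    by_cases hw : wordWeight u + 2 = p
    · refine m_injective (P := P) (g := χ _ + χ _) ?_ ⟨x, hx⟩
      rw [m_add, ← hu _ (by simpa), ← hu _ (by simpa), ← hu _ (by simpa)]
      simp only [iterSbr_append_singleton, letterOp, m_add, sbr_add_right]; rfl
    · rw [hχ, hχ, hχ] <;> simpa
  const_smul_function u c f := by
    by_cases hw : wordWeight u + 2 = p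
    · refine m_injective (P := P) (g := c • χ _) ?_ ⟨x, hx⟩
      rw [m_smul, ← hu _ (by simpa), ← hu _ (by simpa)]
      simp only [iterSbr_append_singleton, letterOp, m_smul, sbr_smul_right]; rfl
    · rw [hχ, hχ] <;> simpa
  mul_function u f g := by
    by_cases hw : wordWeight u + 2 = p
    · refine m_injective (P := P) (g := f * χ _ + g * χ _) ?_ ⟨x, hx⟩
      rw [m_add, m_mul, m_mul, ← hu _ (by simpa), ← hu _ (by simpa), ← hu _ (by simpa)]
      simp only [iterSbr_append_singleton]
      refine sbr_m_mul ?_ f g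
      rw [iterSbr_mod (q := p + 2) (by omega)]
      have := iterSbr_mem hA u
      rwa [show p + 2 - wordWeight u = 4 by omega] at this
    · rw [hχ, hχ, hχ] <;> simpa
  swap_sections u v e e' := by
    by_cases hw : wordWeight u + 2 + wordWeight v = p
    · refine m_injective (P := P) (f := χ _ + χ _) ?_ ⟨x, hx⟩
      rw [m_add, ← hu _ (by simp; omega), ← hu _ (by simp; omega), ← hu _ (by simp; omega)]
      simp only [iterSbr_append, iterSbr]
      exact (iterSbr_add _ _ _ _).symm.trans (congrArg (P.iterSbr _ · v) (sbr_sections _ _ e e'))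
    · rw [hχ, hχ, hχ] <;> simp <;> omega
  swap_section_function u v e f := by
    by_cases hw : wordWeight u + 3 + wordWeight v = p
    · refine m_injective (P := P) ?_ ⟨x, hx⟩
      rw [← hu _ (by simp; omega), ← hu _ (by simp; omega)]
      simp only [iterSbr_append, iterSbr]
      exact congrArg (P.iterSbr _ · v) (sbr_section_function _ _ e f)
    · rw [hχ, hχ] <;> simp <;> omega
  swap_functions u v f g := by
    by_cases hw : wordWeight u + 4 + wordWeight v = p
    · refine m_injective (P := P) ?_ ⟨x, hx⟩
      rw [← hu _ (by simp; omega), ← hu _ (by simp; omega)]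
      simp only [iterSbr_append, iterSbr]
      exact congrArg (P.iterSbr _ · v) (sbr_functions _ _ f g)
    · rw [hχ, hχ] <;> simp <;> omega

theorem sym_of_mem {p : ℕ} {A : P.Op} {φ : Cochain n F E} (hA : A ∈ P.GF (p + 2))
    (hφ : ∀ u, wordWeight u ≠ p → φ u = 0)
    (h : ∀ u, wordWeight u = p → P.iterSbr (p + 2) A u = P.m (φ u))
    (h0 : ∀ x ∉ P.U, ∀ u, φ u x = 0) : Sym (p + 2) A φ where
  mem := hA
  graded := ⟨p, CourantAlgebroid.isGradedFunction_iff.2 ⟨hφ, fun x => by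
    by_cases hx : x ∈ P.U
    · exact gradedAt_of_mem hφ hx hA fun u hu => by rw [iterSbr_mod (q := p + 2) (by omega), h u hu]
    · simpa only [h0 x hx] using CourantAlgebroid.gradedAt_zero x⟩⟩
  supported u hu := hφ u fun h => hu (by rw [h])
  symbol u hu := h u (by omega)

end SpinorBundle

/-- The product of graded functions at a point. -/
def pointMul : ℕ → (List (Letter n F E) → ℝ) → (List (Letter n F E) → ℝ) →
    List (Letter n F E) → ℝ
  | _, Φ, Ψ, [] => Φ [] * Ψ []
  | q, Φ, Ψ, a :: u =>
    pointMul (q + a.weight) Φ (fun v => Ψ (a :: v)) u +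
      (-1) ^ (q * a.weight) * pointMul q (fun v => Φ (a :: v)) Ψ u

theorem gradedMul_apply (q : ℕ) (φ ψ : Cochain n F E) (u) (x : M) :
    gradedMul q φ ψ u x = pointMul q (fun v => φ v x) (fun v => ψ v x) u := by
  induction u generalizing q φ ψ with
  | nil => rfl
  | cons a u ih =>
    rw [pointMul, ← ih, ← ih, gradedMul]
    change _ + ((-1) ^ _ * _ : C^∞⟮𝓡 n, M; ℝ⟯) x = _
    rcases neg_one_pow_eq_or ℝ (q * a.weight) with h | h <;>
    rcases Nat.even_or_odd (q * a.weight) with h' | h' <;> simp [h'.neg_one_pow]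

theorem pointMul_zero_left (q : ℕ) (Ψ : List (Letter n F E) → ℝ) (u) :
    pointMul q (fun _ => 0) Ψ u = 0 := by
  induction u generalizing q Ψ with
  | nil => simp [pointMul]
  | cons a u ih => rw [pointMul, ih, ih]; simp

theorem pointMul_zero_right (q : ℕ) (Φ : List (Letter n F E) → ℝ) (u) :
    pointMul q Φ (fun _ => 0) u = 0 := by
  induction u generalizing q Φ with
  | nil => simp [pointMul]
  | cons a u ih => rw [pointMul, ih, ih]; simp

theorem pointMul_neg_left (q : ℕ) (Φ Ψ : List (Letter n F E) → ℝ) (u) :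
    pointMul q (fun v => -Φ v) Ψ u = -pointMul q Φ Ψ u := by
  induction u generalizing q Φ Ψ with
  | nil => simp [pointMul]
  | cons a u ih => rw [pointMul, pointMul, ih, ih]; ring

theorem pointMul_const {q : ℕ} (hq : Even q) (Φ Ψ : List (Letter n F E) → ℝ)
    (hΨ : ∀ a v, Ψ (a :: v) = 0) (u) : pointMul q Φ Ψ u = Φ u * Ψ [] := by
  induction u generalizing Φ with
  | nil => rfl
  | cons a u ih =>
    rw [pointMul, ih]
    simp only [hΨ, pointMul_zero_right, (hq.mul_right _).neg_one_pow]
    ring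

namespace CourantAlgebroid

theorem GradedAt.cons {x : M} {Φ : List (Letter n F E) → ℝ} (h : 𝒞.GradedAt x Φ)
    (a : Letter n F E) : 𝒞.GradedAt x (fun u => Φ (a :: u)) where
  add_section u := h.add_section (a :: u)
  smul_section u := h.smul_section (a :: u)
  add_function u := h.add_function (a :: u)
  const_smul_function u := h.const_smul_function (a :: u)
  mul_function u := h.mul_function (a :: u)
  swap_sections u := h.swap_sections (a :: u)
  swap_section_function u := h.swap_section_function (a :: u)
  swap_functions u := h.swap_functions (a :: u)

/-- In the last place a locally constant function is killed by a derivation, and a function can be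
moved there from any place without correction terms. -/
theorem GradedAt.apply_const {x : M} {Φ : List (Letter n F E) → ℝ} (h : 𝒞.GradedAt x Φ)
    {f : C^∞⟮𝓡 n, M; ℝ⟯} {c : ℝ} (hf : ∀ᶠ y in 𝓝 x, f y = c) (u v) :
    Φ (u ++ Sum.inr f :: v) = 0 := by
  induction v generalizing u with
  | nil =>
    obtain ⟨χ, h2, -, h3⟩ := exists_bump (n := n) x hf
    have h1 : Φ (u ++ [Sum.inr 1]) = 0 := by
      have := h.mul_function u 1 1
      rw [mul_one] at this
      have h : (1 : C^∞⟮𝓡 n, M; ℝ⟯) x = 1 := rfl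
      rw [h] at this
      linarith
    have h4 : χ * f = c • χ := by
      ext y
      change χ y * f y = c * χ y
      by_cases hy : y ∈ tsupport χ
      · rw [show f y = c from h3 hy, mul_comm]
      · rw [image_eq_zero_of_notMem_tsupport hy]; simp
    have h5 := h.mul_function u χ f
    rw [h4, h.const_smul_function, h2.self_of_nhds, hf.self_of_nhds] at h5
    linarith
  | cons b v ih =>
    have := ih (u ++ [b])
    rw [List.append_assoc] at this
    rcases b with e | g
    · rw [← h.swap_section_function]; exact this
    · rw [h.swap_functions]; exact this

/-- When the pairing is locally constant the correction term drops out and the letters supercommute.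
The letters of an orthonormal frame are of this kind. -/
theorem GradedAt.swap {x : M} {Φ : List (Letter n F E) → ℝ} (h : 𝒞.GradedAt x Φ)
    (a b : Letter n F E) (v)
    (hab : ∀ e e', a = Sum.inl e → b = Sum.inl e' → ∃ c, ∀ᶠ y in 𝓝 x, 𝒞.inner e e' y = c) :
    Φ (a :: b :: v) = (-1) ^ (a.weight * b.weight) * Φ (b :: a :: v) := by
  rcases a with e | f <;> rcases b with e' | g
  · have h1 := h.swap_sections [] v e e'
    obtain ⟨c, hc⟩ := hab e e' rfl rfl
    have h2 := h.apply_const hc [] v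
    simp only [List.nil_append] at h1 h2
    simp only [Letter.weight, mul_one, pow_one]
    linarith
  · have h1 := h.swap_section_function [] v e g
    simp only [List.nil_append] at h1
    simp [Letter.weight, h1]
  · have h1 := h.swap_section_function [] v e' f
    simp only [List.nil_append] at h1
    simp [Letter.weight, h1]
  · have h1 := h.swap_functions [] v f g
    simp only [List.nil_append] at h1
    simp [Letter.weight, h1, Even.neg_one_pow (show Even 4 by decide)]

namespace FrameChart

variable (L : 𝒞.FrameChart)

/-- The symbol of Clifford multiplication by a section. -/
def sectionSymbol (e : Cₛ^∞⟮𝓡 n; F, E⟯) : Cochain n F E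
  | [Sum.inl e'] => 𝒞.inner e e'
  | _ => 0

/-- The symbol of a derivative in a frame. -/
def derivativeSymbol (k : Fin n) : Cochain n F E
  | [Sum.inr f] => L.dfun k f
  | [Sum.inl e, Sum.inl e'] => 𝒞.inner (L.nabla k e) e'
  | _ => 0

/-- The sections of the frame, cut off. -/
def frameSection (i : Fin (finrank ℝ F)) : Cₛ^∞⟮𝓡 n; F, E⟯ := fsmul L.cut (L.o.e i)

/-- The Euler operator at a point. -/
def euler (x : M) (Φ : List (Letter n F E) → ℝ) (u : List (Letter n F E)) : ℝ :=
  -- This is `∑ ε_i {φ, e_i} e_i + 2 ∑ {φ, x_k} p_k` with the momenta `p_k` represented by the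
  -- symbols of the derivatives. The arguments `3` and `4` are the degrees one and two of `e_i` and
  -- `p_k`, shifted by two; only their parity matters.
  ∑ i, L.o.ε i * pointMul 3 (fun v => Φ (Sum.inl (L.o.e i) :: v))
      (fun v => sectionSymbol (𝒞 := 𝒞) (L.frameSection i) v x) u +
    2 * ∑ k, pointMul 4 (fun v => Φ (Sum.inr (L.coord k) :: v))
      (fun v => L.derivativeSymbol k v x) u

variable {L}

theorem Flat.cut_eq {x : M} (hx : L.Flat x) : L.cut x = 1 := hx.2.self_of_nhds

theorem Flat.inner_eq {x : M} (hx : L.Flat x) (i j) :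
    ∀ᶠ y in 𝓝 x, 𝒞.inner (L.o.e i) (L.o.e j) y = if i = j then L.o.ε i else 0 := by
  filter_upwards [L.eventually_mem hx.1] with y hy
  exact L.o.orth y hy i j

theorem Flat.nabla_eq {x : M} (hx : L.Flat x) (k i) : L.nabla k (L.o.e i) x = 0 := by
  rw [nabla, section_sum_apply]
  refine Finset.sum_eq_zero fun j _ => ?_
  have h : L.comp (L.o.e i) j =ᶠ[𝓝 x] fun _ => L.o.ε j * if i = j then L.o.ε i else 0 := by
    filter_upwards [hx.inner_eq i j] with y hy
    rw [← hy]; rfl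
  rw [fsmul_apply, dfun_apply, pd_congr (L.le hx.1) h, pd_const, mul_zero, zero_smul]

theorem Flat.pd_coord_eq {x : M} (hx : L.Flat x) (k l) :
    L.dfun k (L.coord l) x = if k = l then 1 else 0 := by
  have h : L.coord l =ᶠ[𝓝 x] fun y => L.κ y l := by
    filter_upwards [hx.2] with y hy
    change L.cut y • L.κ y l = _
    rw [hy, one_smul]
  rw [dfun_apply, hx.cut_eq, one_mul, pd_congr (L.le hx.1) h, pd_coord (L.le hx.1)]

/-- **Euler's identity** -/
theorem Flat.euler_eq {x : M} (hx : L.Flat x) {Φ : List (Letter n F E) → ℝ}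
    (h : 𝒞.GradedAt x Φ) (b : List (Fin (finrank ℝ F) ⊕ Fin n)) :
    L.euler x Φ (b.map L.basic) = wordWeight (b.map L.basic) * Φ (b.map L.basic) := by
  induction b generalizing Φ with
  | nil => simp [euler, pointMul, sectionSymbol, derivativeSymbol]
  | cons a b ih =>
    have hsw : ∀ a' v, Φ (L.basic a' :: L.basic a :: v) =
        (-1) ^ ((L.basic a').weight * (L.basic a).weight) * Φ (L.basic a :: L.basic a' :: v) :=
      fun a' v => h.swap _ _ _ fun e e' h1 h2 => by
        rcases a' with i | k
        · rcases a with j | l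
          · cases h1; cases h2
            exact ⟨_, hx.inner_eq i j⟩
          · cases h2
        · cases h1
    set u := b.map L.basic with hu
    -- The bracket with the letter `a` either hits the factor `e_i`, leaving a multiple of `Φ(e_i,
    -- u)`, or hits the coefficient `{Φ, e_i}`; there the letters are exchanged to reach the Euler
    -- operator of `{Φ, a}`.
    have e1 : ∀ i, pointMul 3 (fun v => Φ (Sum.inl (L.o.e i) :: v))
        (fun v => sectionSymbol (𝒞 := 𝒞) (L.frameSection i) v x) (L.basic a :: u) =
        Φ (Sum.inl (L.o.e i) :: u) * sectionSymbol (𝒞 := 𝒞) (L.frameSection i) [L.basic a] x +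
        pointMul 3 (fun v => Φ (L.basic a :: Sum.inl (L.o.e i) :: v))
          (fun v => sectionSymbol (𝒞 := 𝒞) (L.frameSection i) v x) u := fun i => by
      rw [pointMul]
      congr 1
      · rcases a with j | l
        · exact pointMul_const (show Even (3 + 1) by decide) _ _ (fun _ _ => rfl) _
        · exact (pointMul_zero_right _ _ _).trans (mul_zero _).symm
      · have h3 := hsw (Sum.inl i)
        have h4 : (L.basic (Sum.inl i)).weight = 1 := rfl
        have h5 : L.basic (Sum.inl i) = Sum.inl (L.o.e i) := rfl
        rw [h4, one_mul, h5] at h3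
        simp only [h3]
        rcases a with j | l
        · have h6 : (L.basic (Sum.inl j)).weight = 1 := rfl
          simp only [h6, mul_one, pow_one, neg_one_mul, pointMul_neg_left,
            Odd.neg_one_pow (show Odd 3 by decide), neg_neg]
        · have h6 : (L.basic (Sum.inr l)).weight = 2 := rfl
          simp only [h6, even_two.neg_one_pow, one_mul, Even.neg_one_pow (show Even (3 * 2) by decide)]
    have e2 : ∀ k, pointMul 4 (fun v => Φ (Sum.inr (L.coord k) :: v))
        (fun v => L.derivativeSymbol k v x) (L.basic a :: u) =
        Φ (Sum.inr (L.coord k) :: u) * L.derivativeSymbol k [L.basic a] x +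
        pointMul 4 (fun v => Φ (L.basic a :: Sum.inr (L.coord k) :: v))
          (fun v => L.derivativeSymbol k v x) u := fun k => by
      rw [pointMul]
      congr 1
      · rcases a with j | l
        · have h7 : (fun v => L.derivativeSymbol k (L.basic (Sum.inl j) :: v) x) = fun _ => 0 := by
            funext v
            have h0 := hx.nabla_eq k j
            rcases v with _ | ⟨(e | f), _ | ⟨_, _⟩⟩
            · rfl
            · change 𝒞.pairing x (L.nabla k (L.o.e j) x) (e x) = 0
              rw [h0, map_zero, LinearMap.zero_apply]
            all_goals rfl
          rw [h7]
          exact (pointMul_zero_right _ _ _).trans (mul_zero _).symm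
        · exact pointMul_const (show Even (4 + 2) by decide) _ _ (fun _ _ => rfl) _
      · have h3 := hsw (Sum.inr k)
        have h4 : (L.basic (Sum.inr k)).weight = 2 := rfl
        have h5 : L.basic (Sum.inr k) = Sum.inr (L.coord k) := rfl
        rw [h4, h5] at h3
        simp only [h3, (even_two.mul_right _).neg_one_pow, one_mul,
          ((show Even 4 by decide).mul_right _).neg_one_pow]
    have e3 : L.euler x Φ (L.basic a :: u) = L.euler x (fun v => Φ (L.basic a :: v)) u +
        (∑ i, L.o.ε i * (Φ (Sum.inl (L.o.e i) :: u) *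
          sectionSymbol (𝒞 := 𝒞) (L.frameSection i) [L.basic a] x) +
        2 * ∑ k, Φ (Sum.inr (L.coord k) :: u) * L.derivativeSymbol k [L.basic a] x) := by
      simp only [euler, e1, e2, mul_add, Finset.sum_add_distrib]
      ring
    -- The first kind of terms adds up to the weight of `a` times `Φ(a, u)`: orthonormality and `ε²
    -- = 1` select a section with weight one, the coordinates select a function with weight two.
    have e4 : ∑ i, L.o.ε i * (Φ (Sum.inl (L.o.e i) :: u) *
          sectionSymbol (𝒞 := 𝒞) (L.frameSection i) [L.basic a] x) +
        2 * ∑ k, Φ (Sum.inr (L.coord k) :: u) * L.derivativeSymbol k [L.basic a] x =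
        (L.basic a).weight * Φ (L.basic a :: u) := by
      rcases a with j | l
      · have h8 : ∀ i, sectionSymbol (𝒞 := 𝒞) (L.frameSection i) [L.basic (Sum.inl j)] x =
            if i = j then L.o.ε i else 0 := fun i => by
          rw [← (hx.inner_eq i j).self_of_nhds]
          change 𝒞.pairing x (L.cut x • L.o.e i x) (L.o.e j x) = 𝒞.pairing x (L.o.e i x) (L.o.e j x)
          rw [hx.cut_eq, one_smul]
        have h9 : ∀ k, L.derivativeSymbol k [L.basic (Sum.inl j)] x = 0 := fun k => rfl
        simp only [h8, h9, mul_zero, Finset.sum_const_zero, mul_ite, Finset.sum_ite_eq',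
          Finset.mem_univ, if_true, add_zero]
        have h10 : ((L.basic (Sum.inl j)).weight : ℝ) = 1 := Nat.cast_one
        rw [h10, one_mul, mul_left_comm, L.o.ε_mul, mul_one]; rfl
      · have h8 : ∀ i, sectionSymbol (𝒞 := 𝒞) (L.frameSection i) [L.basic (Sum.inr l)] x = 0 :=
          fun i => rfl
        have h9 : ∀ k, L.derivativeSymbol k [L.basic (Sum.inr l)] x = if k = l then 1 else 0 :=
          fun k => hx.pd_coord_eq k l
        simp only [h8, h9, mul_zero, Finset.sum_const_zero, mul_ite, Finset.sum_ite_eq',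
          Finset.mem_univ, if_true, zero_add, mul_one]
        rfl
    rw [List.map_cons, e3, ih (h.cons _), e4, SpinorBundle.wordWeight_cons]
    push_cast
    ring

end FrameChart

end CourantAlgebroid
end Euler
end CourantDirac

namespace CourantDirac

/-! ## Natural operators in a frame -/

section NaturalOperators

open Filter Topology Module

variable {n : ℕ} {M : Type uM} [TopologicalSpace M] [ChartedSpace (EuclideanSpace ℝ (Fin n)) M]
  [IsManifold (𝓡 n) ∞ M] [T2Space M]
  {F : Type uF} [NormedAddCommGroup F] [NormedSpace ℝ F] [FiniteDimensional ℝ F]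
  {E : M → Type uE} [∀ x, AddCommGroup (E x)] [∀ x, Module ℝ (E x)]
  [∀ x, TopologicalSpace (E x)] [TopologicalSpace (TotalSpace F E)] [FiberBundle F E]
  [VectorBundle ℝ F E] [ContMDiffVectorBundle ∞ F E (𝓡 n)]
  {𝒞 : CourantAlgebroid n F E}

open SpinorBundle

theorem SpinorBundle.LocalFrame.coef_D {P : SpinorBundle.{uM, uF, uE, w} 𝒞} (L : P.LocalFrame)
    (k : Fin n) (ψ : P.HalfDensities) {x : M} (hx : x ∈ L.W) :
    L.coef (L.D k ψ) x = L.cut x • pd L.κ k (L.coef ψ) x := by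
  refine L.coef_eq (x := ⟨x, L.fr.le hx⟩) hx ?_
  rw [L.D_coordFrame k ψ ⟨x, L.fr.le hx⟩ hx, ← Complex.coe_smul, map_smul, Complex.coe_smul]

theorem SpinorBundle.iterSbr_sum {P : SpinorBundle.{uM, uF, uE, w} 𝒞} (p : ℕ) {ι : Type*}
    (s : Finset ι) (A : ι → P.Op) (u : List (Letter n F E)) :
    P.iterSbr p (∑ i ∈ s, A i) u = ∑ i ∈ s, P.iterSbr p (A i) u := by
  classical
  induction s using Finset.induction_on with
  | empty => simp
  | insert a s ha ih => rw [Finset.sum_insert ha, Finset.sum_insert ha, iterSbr_add, ih]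

theorem eq_nil_of_wordWeight {u : List (Letter n F E)} (hu : wordWeight u = 0) : u = [] := by
  rcases u with _ | ⟨a, u⟩
  · rfl
  · rw [wordWeight_cons] at hu
    have := weight_pos a
    omega

theorem eq_of_wordWeight_one {u : List (Letter n F E)} (hu : wordWeight u = 1) :
    ∃ e, u = [Sum.inl e] := by
  rcases u with _ | ⟨e | f, u⟩
  · simp at hu
  · exact ⟨e, by
      rw [eq_nil_of_wordWeight (u := u) (by rw [wordWeight_cons, weight_inl] at hu; omega)]⟩
  · rw [wordWeight_cons, weight_inr] at hu
    omega

theorem eq_of_wordWeight_two {u : List (Letter n F E)} (hu : wordWeight u = 2) :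
    (∃ f, u = [Sum.inr f]) ∨ ∃ e e', u = [Sum.inl e, Sum.inl e'] := by
  rcases u with _ | ⟨e | f, u⟩
  · simp at hu
  · obtain ⟨e', rfl⟩ := eq_of_wordWeight_one (u := u)
      (by rw [wordWeight_cons, weight_inl] at hu; omega)
    exact Or.inr ⟨e, e', rfl⟩
  · exact Or.inl ⟨f, by
      rw [eq_nil_of_wordWeight (u := u) (by rw [wordWeight_cons, weight_inr] at hu; omega)]⟩

theorem eq_of_wordWeight_three {u : List (Letter n F E)} (hu : wordWeight u = 3) :
    (∃ e f, u = [Sum.inl e, Sum.inr f]) ∨ (∃ e f, u = [Sum.inr f, Sum.inl e]) ∨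
      ∃ e₁ e₂ e₃, u = [Sum.inl e₁, Sum.inl e₂, Sum.inl e₃] := by
  rcases u with _ | ⟨e | f, u⟩
  · simp at hu
  · rcases eq_of_wordWeight_two (u := u) (by rw [wordWeight_cons, weight_inl] at hu; omega) with
      ⟨f, rfl⟩ | ⟨e', e'', rfl⟩
    · exact Or.inl ⟨e, f, rfl⟩
    · exact Or.inr (Or.inr ⟨e, e', e'', rfl⟩)
  · obtain ⟨e, rfl⟩ := eq_of_wordWeight_one (u := u)
      (by rw [wordWeight_cons, weight_inr] at hu; omega)
    exact Or.inr (Or.inl ⟨e, f, rfl⟩)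

namespace CourantAlgebroid.FrameChart

variable (L : 𝒞.FrameChart)

/-- A frame chart with a constant spinor frame. -/
abbrev toLocalFrame {P : SpinorBundle.{uM, uF, uE, w} 𝒞} (fr : P.SpinorFrame L.o) : P.LocalFrame :=
  ⟨L, fr⟩

/-- Operators which are given by the same formula in all constant frames. -/
abbrev OpFamily := ∀ P : SpinorBundle.{uM, uF, uE, w} 𝒞, P.SpinorFrame L.o → P.Op

/-- The operators are intertwined by constant real linear maps which intertwine the Clifford
multiplications. -/
def Natural (A : OpFamily.{uM, uF, uE, w} L) : Prop :=
  ∀ (P P' : SpinorBundle.{uM, uF, uE, w} 𝒞) (fr : P.SpinorFrame L.o) (fr' : P'.SpinorFrame L.o)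
    (X : (Fin fr.N → ℂ) →ₗ[ℝ] (Fin fr'.N → ℂ)), (∀ i z, X (fr.R.c i z) = fr'.R.c i (X z)) →
    ∀ ψ ψ' x, x ∈ L.W →
      (∀ᶠ y in 𝓝 x, (L.toLocalFrame fr').coef ψ' y = X ((L.toLocalFrame fr).coef ψ y)) →
      (L.toLocalFrame fr').coef (A P' fr' ψ') x = X ((L.toLocalFrame fr).coef (A P fr ψ) x)

variable {L}

theorem Natural.add {A B : OpFamily.{uM, uF, uE, w} L} (hA : L.Natural A) (hB : L.Natural B) :
    L.Natural fun P fr => A P fr + B P fr := fun P P' fr fr' X hX ψ ψ' x hx h => by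
  rw [LinearMap.add_apply, LinearMap.add_apply, LocalFrame.coef_add, LocalFrame.coef_add, map_add,
    hA P P' fr fr' X hX ψ ψ' x hx h, hB P P' fr fr' X hX ψ ψ' x hx h]

theorem Natural.smul {A : OpFamily.{uM, uF, uE, w} L} (hA : L.Natural A) (r : ℝ) :
    L.Natural fun P fr => (r : ℂ) • A P fr := fun P P' fr fr' X hX ψ ψ' x hx h => by
  rw [LinearMap.smul_apply, LinearMap.smul_apply, LocalFrame.coef_smul, LocalFrame.coef_smul,
    Complex.coe_smul, Complex.coe_smul, map_smul, hA P P' fr fr' X hX ψ ψ' x hx h]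

/-- Naturality compares germs of coefficients rather than values, so that it is stable under
composition of differential operators. -/
theorem Natural.mul {A B : OpFamily.{uM, uF, uE, w} L} (hA : L.Natural A) (hB : L.Natural B) :
    L.Natural fun P fr => A P fr * B P fr := fun P P' fr fr' X hX ψ ψ' x hx h => by
  refine hA P P' fr fr' X hX (B P fr ψ) (B P' fr' ψ') x hx ?_
  filter_upwards [eventually_eventually_nhds.2 h, L.eventually_mem hx] with y hy hyW
  exact hB P P' fr fr' X hX ψ ψ' y hyW hy

theorem natural_m (f : C^∞⟮𝓡 n, M; ℝ⟯) :
    L.Natural (fun P _ => P.m f : OpFamily.{uM, uF, uE, w} L) := fun P P' fr fr' X hX ψ ψ' x hx h => by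
  rw [LocalFrame.coef_m _ _ _ hx, LocalFrame.coef_m _ _ _ hx, map_smul, h.self_of_nhds]

theorem natural_c (e : Cₛ^∞⟮𝓡 n; F, E⟯) :
    L.Natural (fun P _ => P.c e : OpFamily.{uM, uF, uE, w} L) := fun P P' fr fr' X hX ψ ψ' x hx h => by
  rw [LocalFrame.coef_c _ _ _ hx, LocalFrame.coef_c _ _ _ hx, map_sum]
  refine Finset.sum_congr rfl fun i _ => ?_
  rw [map_smul, h.self_of_nhds, hX]

/-- A constant real linear map commutes with partial derivatives. -/
theorem natural_D (k : Fin n) :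
    L.Natural (fun _ fr => (L.toLocalFrame fr).D k : OpFamily.{uM, uF, uE, w} L) :=
  fun P P' fr fr' X hX ψ ψ' x hx h => by
  rw [LocalFrame.coef_D _ _ _ hx, LocalFrame.coef_D _ _ _ hx, map_smul, pd_congr (L.le hx) h]
  congr 1
  exact pd_linear L.hκ (LinearMap.toContinuousLinearMap X) (L.le hx)
    ((L.toLocalFrame fr).coef_smooth ψ hx) k

/-- Natural operators with natural transposes. -/
structure Good (i : ℕ) (A A' : OpFamily.{uM, uF, uE, w} L) : Prop where
  mem : ∀ P fr, A P fr ∈ P.GF i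
  mem' : ∀ P fr, A' P fr ∈ P.GF i
  natural : L.Natural A
  natural' : L.Natural A'
  -- The sign of the pairing depends on the bundle. It is split off so that `A'` is given by a
  -- formula independent of the bundle.
  transposed : ∀ P fr, Transposed (A P fr) (((P.sign : ℤ) : ℂ) ^ i • A' P fr)
  transposed' : ∀ P fr, Transposed (A' P fr) (((P.sign : ℤ) : ℂ) ^ i • A P fr)

theorem sign_mul_self (ε : ℤˣ) : (((ε : ℤ) : ℂ)) * ((ε : ℤ) : ℂ) = 1 := by
  rcases Int.units_eq_one_or ε with rfl | rfl <;> simp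

theorem sign_pow_congr (ε : ℤˣ) {i j : ℕ} (h : i % 2 = j % 2) :
    ((ε : ℤ) : ℂ) ^ i = ((ε : ℤ) : ℂ) ^ j := by
  rcases Int.units_eq_one_or ε with rfl | rfl
  · simp
  · push_cast
    rw [neg_one_pow_congr h]

theorem Good.of_index_le {i j : ℕ} {A A' : OpFamily.{uM, uF, uE, w} L} (h : Good i A A')
    (hij : i % 2 = j % 2) (hle : i ≤ j) : Good j A A' :=
  ⟨fun P fr => mem_GF_mod hij hle (h.mem P fr), fun P fr => mem_GF_mod hij hle (h.mem' P fr),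
    h.natural, h.natural', fun P fr => by rw [← sign_pow_congr _ hij]; exact h.transposed P fr,
    fun P fr => by rw [← sign_pow_congr _ hij]; exact h.transposed' P fr⟩

theorem Good.add {i : ℕ} {A A' B B' : OpFamily.{uM, uF, uE, w} L} (hA : Good i A A')
    (hB : Good i B B') : Good i (fun P fr => A P fr + B P fr) (fun P fr => A' P fr + B' P fr) :=
  ⟨fun P fr => add_mem (hA.mem P fr) (hB.mem P fr), fun P fr => add_mem (hA.mem' P fr) (hB.mem' P fr),
    hA.natural.add hB.natural, hA.natural'.add hB.natural', fun P fr => by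
      rw [smul_add]
      exact (hA.transposed P fr).add (hB.transposed P fr) (isLocal_of_mem (hA.mem P fr))
        (isLocal_of_mem (hB.mem P fr)), fun P fr => by
      rw [smul_add]
      exact (hA.transposed' P fr).add (hB.transposed' P fr) (isLocal_of_mem (hA.mem' P fr))
        (isLocal_of_mem (hB.mem' P fr))⟩

theorem Good.smul {i : ℕ} {A A' : OpFamily.{uM, uF, uE, w} L} (hA : Good i A A') (r : ℝ) :
    Good i (fun P fr => (r : ℂ) • A P fr) (fun P fr => (r : ℂ) • A' P fr) :=
  ⟨fun P fr => Submodule.smul_mem _ _ (hA.mem P fr), fun P fr => Submodule.smul_mem _ _ (hA.mem' P fr),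
    hA.natural.smul r, hA.natural'.smul r, fun P fr => by
      rw [smul_comm]; exact (hA.transposed P fr).smul _, fun P fr => by
      rw [smul_comm]; exact (hA.transposed' P fr).smul _⟩

theorem Good.mul {i j : ℕ} {A A' B B' : OpFamily.{uM, uF, uE, w} L} (hA : Good i A A')
    (hB : Good j B B') (hij : 2 ≤ i + j) :
    Good (i + j - 2) (fun P fr => A P fr * B P fr) (fun P fr => B' P fr * A' P fr) :=
  ⟨fun P fr => GF_mul (hA.mem P fr) (hB.mem P fr), fun P fr => by
      rw [add_comm i j]; exact GF_mul (hB.mem' P fr) (hA.mem' P fr),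
    hA.natural.mul hB.natural, hB.natural'.mul hA.natural', fun P fr => by
      have h := (hA.transposed P fr).mul (hB.transposed P fr) (isLocal_of_mem (hB.mem P fr))
        (isLocal_of_mem (Submodule.smul_mem _ _ (hA.mem' P fr)))
      rw [smul_mul_smul_comm, ← pow_add, add_comm j i,
        sign_pow_congr _ (show (i + j) % 2 = (i + j - 2) % 2 by omega)] at h
      exact h, fun P fr => by
      have h := (hB.transposed' P fr).mul (hA.transposed' P fr) (isLocal_of_mem (hA.mem' P fr))
        (isLocal_of_mem (Submodule.smul_mem _ _ (hB.mem P fr)))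
      rw [smul_mul_smul_comm, ← pow_add,
        sign_pow_congr _ (show (i + j) % 2 = (i + j - 2) % 2 by omega)] at h
      exact h⟩

theorem good_m (f : C^∞⟮𝓡 n, M; ℝ⟯) :
    Good 2 (fun P _ => P.m f : OpFamily.{uM, uF, uE, w} L) (fun P _ => P.m f) :=
  ⟨fun _ _ => m_mem f, fun _ _ => m_mem f, natural_m f, natural_m f, fun P fr => by
    rw [pow_two, sign_mul_self, one_smul]; exact transposed_m f, fun P fr => by
    rw [pow_two, sign_mul_self, one_smul]; exact transposed_m f⟩

theorem good_c (e : Cₛ^∞⟮𝓡 n; F, E⟯) :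
    Good 3 (fun P _ => P.c e : OpFamily.{uM, uF, uE, w} L) (fun P _ => P.c e) :=
  ⟨fun _ _ => c_mem e, fun _ _ => c_mem e, natural_c e, natural_c e, fun P fr => by
    rw [pow_succ, pow_two, sign_mul_self, one_mul]; exact transposed_c e, fun P fr => by
    rw [pow_succ, pow_two, sign_mul_self, one_mul]; exact transposed_c e⟩

theorem good_D (k : Fin n) :
    Good 4 (fun _ fr => (L.toLocalFrame fr).D k : OpFamily.{uM, uF, uE, w} L)
      (fun P fr => ((-1 : ℝ) : ℂ) • (L.toLocalFrame fr).D k + ((-1 : ℝ) : ℂ) • P.m (L.dcut k)) :=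
  ⟨fun _ fr => (L.toLocalFrame fr).D_mem k, fun P fr =>
    add_mem (Submodule.smul_mem _ _ ((L.toLocalFrame fr).D_mem k))
      (Submodule.smul_mem _ _ (mem_GF_mod (k := 2) (l := 4) rfl (by omega) (m_mem (P := P) (L.dcut k)))), natural_D k,
    ((natural_D k).smul _).add ((natural_m _).smul _), fun P fr => by
      rw [sign_pow_congr _ (show 4 % 2 = 0 % 2 from rfl), pow_zero, one_smul]
      have := (L.toLocalFrame fr).transposed_D k
      rw [sub_eq_add_neg] at this
      simpa using this, fun P fr => by
      rw [sign_pow_congr _ (show 4 % 2 = 0 % 2 from rfl), pow_zero, one_smul]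
      have h1 := isLocal_of_mem ((L.toLocalFrame fr).D_mem k)
      have h2 := ((L.toLocalFrame fr).transposed_D k).smul ((-1 : ℝ) : ℂ) |>.add
        ((transposed_m (P := P) (L.dcut k)).smul ((-1 : ℝ) : ℂ)) (isLocal_of_mem
          (Submodule.smul_mem _ _ ((L.toLocalFrame fr).D_mem k))) (isLocal_of_mem
          (Submodule.smul_mem _ _ (m_mem _)))
      simpa using h2⟩

theorem good_zero (i : ℕ) : Good i (fun _ _ => 0 : OpFamily.{uM, uF, uE, w} L) (fun _ _ => 0) :=
  ⟨fun _ _ => zero_mem _, fun _ _ => zero_mem _, by simpa using (natural_m (L := L) 0).smul 0,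
    by simpa using (natural_m (L := L) 0).smul 0, fun _ _ => by
      rw [smul_zero]; exact transposed_zero, fun _ _ => by
      rw [smul_zero]; exact transposed_zero⟩

theorem Good.sum {i : ℕ} {ι : Type*} (s : Finset ι) {A A' : ι → OpFamily.{uM, uF, uE, w} L}
    (h : ∀ j ∈ s, Good i (A j) (A' j)) :
    Good i (fun P fr => ∑ j ∈ s, A j P fr) (fun P fr => ∑ j ∈ s, A' j P fr) := by
  classical
  induction s using Finset.induction_on with
  | empty => simpa using good_zero i
  | insert a s ha ih =>
    simp only [Finset.sum_insert ha]
    exact (h a (Finset.mem_insert_self a s)).add (ih fun j hj => h j (Finset.mem_insert_of_mem hj))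

variable {P : SpinorBundle.{uM, uF, uE, w} 𝒞}

theorem sym_c (fr : P.SpinorFrame L.o) (i) :
    Sym 3 (P.c (L.frameSection i)) (sectionSymbol (𝒞 := 𝒞) (L.frameSection i)) := by
  refine sym_of_mem (p := 1) (c_mem _) (fun u hu => ?_) (fun u hu => ?_) (fun x hx u => ?_)
  · unfold sectionSymbol
    split
    · exact absurd rfl hu
    · rfl
  · obtain ⟨e, rfl⟩ := eq_of_wordWeight_one hu
    change P.sbr 3 1 (P.c (L.frameSection i)) (P.c e) = P.m (𝒞.inner _ _)
    simp [SpinorBundle.sbr, ← c_mul_add, Odd.neg_one_pow (show Odd 3 by decide)]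
  · unfold sectionSymbol
    split
    · change 𝒞.pairing x (L.cut x • L.o.e i x) _ = 0
      rw [L.cut_eq_zero fun h => hx (fr.le h), zero_smul, map_zero, LinearMap.zero_apply]
    · rfl

theorem sym_D (fr : P.SpinorFrame L.o) (k) :
    Sym 4 ((L.toLocalFrame fr).D k) (L.derivativeSymbol k) := by
  refine sym_of_mem (p := 2) ((L.toLocalFrame fr).D_mem k) (fun u hu => ?_) (fun u hu => ?_)
    (fun x hx u => ?_)
  · unfold derivativeSymbol
    split
    · exact absurd rfl hu
    · exact absurd rfl hu
    · rfl
  · obtain ⟨f, rfl⟩ | ⟨e, e', rfl⟩ := eq_of_wordWeight_two hu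
    · exact (L.toLocalFrame fr).sbr_D_m k 4 f
    · have h1 := (L.toLocalFrame fr).sbr_D_c k e
      change P.sbr 5 1 (P.sbr 4 1 _ (P.c e)) (P.c e') = P.m (𝒞.inner _ _)
      rw [sbr_mod (p := 4) (q := 1) (p' := 2) (q' := 1) rfl rfl, h1]
      simp [SpinorBundle.sbr, ← c_mul_add, Odd.neg_one_pow (show Odd 5 by decide)]
  · unfold derivativeSymbol
    split
    · rw [dfun_apply, L.cut_eq_zero fun h => hx (fr.le h), zero_mul]
    · change 𝒞.pairing x (L.nabla k _ x) _ = 0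
      rw [L.nabla_of_notMem k _ fun h => hx (fr.le h), map_zero, LinearMap.zero_apply]
    · rfl

/-- Graded functions supported in a frame chart are symbols of natural operators. -/
theorem exists_good (i : ℕ) {φ : Cochain n F E} (hφ : ∃ p, 𝒞.IsGradedFunction p φ)
    (hs : ∀ u, wordWeight u + 2 ≠ i → φ u = 0) (h0 : ∀ x, L.Flat x ∨ ∀ u, φ u x = 0) :
    ∃ A A' : OpFamily.{uM, uF, uE, w} L, Good i A A' ∧ ∀ P fr, Sym i (A P fr) φ := by
  induction i using Nat.strong_induction_on generalizing φ with
  | _ i ih =>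
  obtain hi | rfl | hi : i < 2 ∨ i = 2 ∨ 2 < i := by omega
  · exact ⟨_, _, good_zero i, fun P fr => ⟨zero_mem _, hφ, hs, fun u hu => by omega⟩⟩
  · refine ⟨_, _, good_m (φ []), fun P fr => ⟨m_mem _, hφ, hs, fun u hu => ?_⟩⟩
    rcases u with _ | ⟨a, u⟩
    · rfl
    · rw [wordWeight_cons] at hu
      have := weight_pos a
      omega
  obtain ⟨p, rfl⟩ : ∃ p, i = p + 2 := ⟨i - 2, by omega⟩
  obtain ⟨d, hd⟩ := hφ
  have hcons : ∀ a : Letter n F E, ∃ A A' : OpFamily.{uM, uF, uE, w} L,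
      Good (p + 2 - a.weight) A A' ∧ ∀ P fr, Sym (p + 2 - a.weight) (A P fr) (fun v => φ (a :: v)) :=
    fun a => by
      have h1 := weight_pos a
      have h2 := weight_le a
      exact ih _ (by omega) ⟨_, hd.cons a⟩ (fun u hu => hs _ (by rw [wordWeight_cons]; omega))
        fun x => (h0 x).imp_right fun h u => h _
  choose A A' hA hS using hcons
  -- The right hand side of Euler's identity. The brackets `{φ, a}` have lower degree and are
  -- already symbols of natural operators, so `T` is the symbol of the combination `B` of products.
  let T : Cochain n F E := fun u =>
    ∑ j, L.o.ε j • gradedMul 3 (fun v => φ (Sum.inl (L.o.e j) :: v))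
      (sectionSymbol (𝒞 := 𝒞) (L.frameSection j)) u +
    (2 : ℝ) • ∑ k, gradedMul 4 (fun v => φ (Sum.inr (L.coord k) :: v)) (L.derivativeSymbol k) u
  have hT : ∀ u x, T u x = L.euler x (fun v => φ v x) u := fun u x => by
    change (∑ j, _ : C^∞⟮𝓡 n, M; ℝ⟯) x + 2 * (∑ k, _ : C^∞⟮𝓡 n, M; ℝ⟯) x = _
    rw [function_sum_apply, function_sum_apply, euler]
    simp only [← gradedMul_apply]
    rfl
  let B : OpFamily.{uM, uF, uE, w} L := fun P fr =>
    ∑ j, (L.o.ε j : ℂ) • (A (Sum.inl (L.o.e j)) P fr * P.c (L.frameSection j)) +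
      ((2 : ℝ) : ℂ) • ∑ k, A (Sum.inr (L.coord k)) P fr * (L.toLocalFrame fr).D k
  have hB := (Good.sum Finset.univ fun j _ => (((hA (Sum.inl (L.o.e j))).mul
      (good_c (L.frameSection j)) (by omega)).of_index_le (j := p + 2)
        (by rw [weight_inl]; omega) (by rw [weight_inl]; omega)).smul (L.o.ε j)).add
    ((Good.sum Finset.univ fun k _ => ((hA (Sum.inr (L.coord k))).mul (good_D k)
      (by omega)).of_index_le (j := p + 2)
        (by rw [weight_inr]; omega) (by rw [weight_inr]; omega)).smul 2)
  have hBS : ∀ (P : SpinorBundle.{uM, uF, uE, w} 𝒞) (fr : P.SpinorFrame L.o) u, wordWeight u = p → P.iterSbr (p + 2) (B P fr) u = P.m (T u) := by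
    intro P fr u hu
    rw [iterSbr_add, iterSbr_sum, iterSbr_smul, iterSbr_sum, m_add, m_sum, m_smul, m_sum]
    congr 1
    · refine Finset.sum_congr rfl fun j _ => ?_
      rw [iterSbr_smul, m_smul, ← (hS (Sum.inl (L.o.e j)) P fr).mul (sym_c fr j)
        (by rw [hu, weight_inl]; omega), 
        iterSbr_mod (p := p + 2) (q := p + 2 - Letter.weight (Sum.inl (L.o.e j)) + 3)
          (by rw [weight_inl]; omega)]
    · refine congrArg _ (Finset.sum_congr rfl fun k _ => ?_)
      rw [← (hS (Sum.inr (L.coord k)) P fr).mul (sym_D fr k)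
        (by rw [hu, weight_inr]; omega), 
        iterSbr_mod (p := p + 2) (q := p + 2 - Letter.weight (n := n) (F := F) (E := E) (Sum.inr (L.coord k)) + 4)
          (by rw [weight_inr]; omega)]
  refine ⟨_, _, hB.smul (p : ℝ)⁻¹, fun P fr => ⟨(hB.smul _).mem P fr, ⟨d, hd⟩, hs, fun u hu => ?_⟩⟩
  have hTs : ∀ u, wordWeight u ≠ p → T u = 0 := fun u hu => by
    have h1 : ∀ j, gradedMul 3 (fun v => φ (Sum.inl (L.o.e j) :: v))
        (sectionSymbol (𝒞 := 𝒞) (L.frameSection j)) u = 0 := fun j =>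
      gradedMul_supported (p := p - 1) (q := 1) 3
        (fun u hu => hs _ (by rw [wordWeight_cons, weight_inl]; omega))
        (fun u hu => (sym_c fr j).supported u (by omega)) (by omega)
    have h2 : ∀ k, gradedMul 4 (fun v => φ (Sum.inr (L.coord k) :: v))
        (L.derivativeSymbol k) u = 0 := fun k => by
      by_cases hp : p = 1
      · have : (fun v => φ (Sum.inr (L.coord k) :: v)) = fun _ => 0 := funext fun v =>
          hs _ (by rw [wordWeight_cons, weight_inr]; omega)
        rw [this, gradedMul_zero_left]
      exact gradedMul_supported (p := p - 2) (q := 2) 4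
        (fun u hu => hs _ (by rw [wordWeight_cons, weight_inr]; omega))
        (fun u hu => (sym_D fr k).supported u (by omega)) (by omega)
    simp only [T, h1, h2, smul_zero, Finset.sum_const_zero, add_zero]
  have hp0 : (p : ℝ) ≠ 0 := Nat.cast_ne_zero.2 (by omega)
  -- As a symbol, `T` satisfies the relations of a graded function. At flat points it agrees with `p
  -- φ` on the letters of the frame, hence on all words; elsewhere both vanish.
  have key : T u = (p : ℝ) • φ u := by
    ext x
    change T u x = p * φ u x
    rcases h0 x with hx | hx
    · have h3 : 𝒞.GradedAt x fun u => T u x := gradedAt_of_mem hTs (fr.le hx.1) (hB.mem P fr)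
        fun u hu => by rw [← hBS P fr u hu]; exact iterSbr_mod (by omega) _ _
      have h4 := L.eq_zero_of_basic hx (h3.add ((hd.at x).const_mul (-p))) (fun b => by
        rw [hT, hx.euler_eq (hd.at x)]
        by_cases hw : wordWeight (b.map L.basic) = p
        · rw [hw]; ring
        · rw [hs _ (by omega)]
          change _ * (0 : ℝ) + _ * (0 : ℝ) = 0
          ring) u
      linarith
    · rw [hx, hT, euler]
      simp only [hx, pointMul_zero_left]
      simp
  refine (iterSbr_smul _ _ _ _).trans ?_
  rw [hBS P fr u (by omega), key, m_smul, smul_smul, ← Complex.ofReal_mul, inv_mul_cancel₀ hp0,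
    Complex.ofReal_one, one_smul]

end CourantAlgebroid.FrameChart
end NaturalOperators
end CourantDirac

namespace CourantDirac

/-! ## Gluing of operators -/

section Gluing

open Filter Topology Module

variable {n : ℕ} {M : Type uM} [TopologicalSpace M] [ChartedSpace (EuclideanSpace ℝ (Fin n)) M]
  [IsManifold (𝓡 n) ∞ M] [T2Space M]
  {F : Type uF} [NormedAddCommGroup F] [NormedSpace ℝ F] [FiniteDimensional ℝ F]
  {E : M → Type uE} [∀ x, AddCommGroup (E x)] [∀ x, Module ℝ (E x)]
  [∀ x, TopologicalSpace (E x)] [TopologicalSpace (TotalSpace F E)] [FiberBundle F E]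
  [VectorBundle ℝ F E] [ContMDiffVectorBundle ∞ F E (𝓡 n)]
  {𝒞 : CourantAlgebroid n F E}

open SpinorBundle

namespace SpinorBundle

variable {P : SpinorBundle.{uM, uF, uE, w} 𝒞}

/-- The operators coincide near `x`. -/
def EqNear (x : P.U) (A B : P.Op) : Prop := ∀ᶠ y in 𝓝 x, ∀ ψ v, (A ψ).1 y v = (B ψ).1 y v

theorem EqNear.sbr {x : P.U} {A B : P.Op} (h : EqNear x A B) (p q : ℕ) {C : P.Op}
    (hC : IsLocal C) : EqNear x (P.sbr p q A C) (P.sbr p q B C) := by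
  filter_upwards [h, eventually_eventually_nhds.2 h] with y hy hy' ψ v
  have h1 : (C (A ψ)).1 y v = (C (B ψ)).1 y v := hC.congr (hy'.mono fun z hz => hz ψ) v
  have h2 : ∀ X Y : P.Op, (((-1 : P.Op) ^ (p * q) * (Y * X)) ψ).1 y v =
      (-1 : ℂ) ^ (p * q) • (Y (X ψ)).1 y v := fun X Y => by
    rw [neg_one_pow_eq_smul, LinearMap.smul_apply, smul_val, Module.End.mul_apply]
  rw [SpinorBundle.sbr, SpinorBundle.sbr, LinearMap.sub_apply, LinearMap.sub_apply, sub_val,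
    sub_val, h2, h2, h1, Module.End.mul_apply, Module.End.mul_apply, hy]

theorem eq_of_eqNear {A B : P.Op} (h : ∀ x, EqNear x A B) : A = B :=
  P.ext_op fun ψ x v => (h x).self_of_nhds ψ v

theorem isLocal_letterOp (a : Letter n F E) : IsLocal (P.letterOp a) :=
  isLocal_of_mem (letterOp_mem a)

theorem EqNear.iterSbr {x : P.U} {A B : P.Op} (h : EqNear x A B) (p : ℕ)
    (u : List (Letter n F E)) : EqNear x (P.iterSbr p A u) (P.iterSbr p B u) := by
  induction u generalizing p A B with
  | nil => exact h
  | cons a u ih => exact ih (h.sbr p _ (isLocal_letterOp a)) _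

/-- The filtration is defined by local conditions: commutators with letters, which are local
operators, inherit the coincidence near each point. -/
theorem GF_of_eqNear {k : ℕ} {A : P.Op} (h : ∀ x, ∃ B ∈ P.GF k, EqNear x A B) : A ∈ P.GF k := by
  induction k using Nat.strong_induction_on generalizing A with
  | _ k ih =>
  obtain hk | ⟨k, rfl⟩ : k < 2 ∨ ∃ j, k = j + 2 := by
    by_cases hk : k < 2
    · exact Or.inl hk
    · exact Or.inr ⟨k - 2, by omega⟩
  · have : A = 0 := eq_of_eqNear fun x => by
      obtain ⟨B, hB, hx⟩ := h x
      rwa [eq_zero_of_mem_GF hk hB] at hx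
    rw [this]; exact zero_mem _
  · refine mem_GF_iff.2 ⟨?_, fun W η hη ψ χ hχ x hx v => ?_, fun f => ih k (by omega) fun x => ?_,
      fun e => ih (k + 1) (by omega) fun x => ?_⟩
    · refine P.ext_op fun ψ x v => ?_
      obtain ⟨B, hB, hx⟩ := h x
      have h1 := congrArg (fun T : P.Op => (T ψ).1 x v) (mem_GF_iff.1 hB).1
      simp only [neg_one_pow_eq_smul, LinearMap.smul_apply, smul_val, Module.End.mul_apply,
        γ_val] at h1 ⊢
      rw [hx.self_of_nhds, hx.self_of_nhds, h1]
    · obtain ⟨B, hB, hx'⟩ := h x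
      rw [hx'.self_of_nhds, hx'.self_of_nhds]
      exact (mem_GF_iff.1 hB).2.1 W η hη ψ χ hχ x hx v
    · obtain ⟨B, hB, hx⟩ := h x
      exact ⟨_, (mem_GF_iff.1 hB).2.2.1 f, hx.sbr _ _ (isLocal_letterOp (Sum.inr f))⟩
    · obtain ⟨B, hB, hx⟩ := h x
      exact ⟨_, (mem_GF_iff.1 hB).2.2.2 e, hx.sbr _ _ (isLocal_letterOp (Sum.inl e))⟩

/-- The conclusion allows any finite index set containing all members active at the point, so that
one finite sum serves a whole neighbourhood. -/
theorem exists_locally_finite_sum {ι : Type*} (B : ι → P.Op) (K : ι → Set P.U)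
    (hK : LocallyFinite K) (hB : ∀ j ψ x, x ∉ K j → ∀ v, (B j ψ).1 x v = 0) :
    ∃ A : P.Op, ∀ ψ x v (s : Finset ι), (∀ j, x ∈ K j → j ∈ s) →
      (A ψ).1 x v = ((∑ j ∈ s, B j) ψ).1 x v := by
  classical
  have hsum : ∀ (s : Finset ι) ψ x v, ((∑ j ∈ s, B j) ψ).1 x v = ∑ j ∈ s, (B j ψ).1 x v := by
    intro s ψ x v
    induction s using Finset.induction_on with
    | empty => rfl
    | insert a s ha ih => rw [Finset.sum_insert ha, Finset.sum_insert ha, LinearMap.add_apply,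
        add_val, ih]
  have hfin : ∀ ψ x v (s : Finset ι), (∀ j, x ∈ K j → j ∈ s) →
      ∑ᶠ j, (B j ψ).1 x v = ((∑ j ∈ s, B j) ψ).1 x v := fun ψ x v s hs => by
    rw [hsum]
    refine finsum_eq_sum_of_support_subset _ fun j hj => hs j ?_
    by_contra h
    exact hj (hB j ψ x h v)
  have hex : ∀ x, ∃ s : Finset ι, ∀ᶠ y in 𝓝 x, ∀ j, y ∈ K j → j ∈ s := fun x => by
    obtain ⟨t, ht, hf⟩ := hK x
    refine ⟨hf.toFinset, ?_⟩
    filter_upwards [ht] with y hy j hj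
    exact hf.mem_toFinset.2 ⟨y, hj, hy⟩
  choose s hs using hex
  refine ⟨⟨⟨fun ψ => ⟨fun x v => ∑ᶠ j, (B j ψ).1 x v, fun x T v => ?_, fun κ hκ x hx => ?_⟩,
    fun ψ χ => ?_⟩, fun z ψ => ?_⟩, hfin⟩
  · beta_reduce
    rw [hfin _ _ _ _ (hs x).self_of_nhds, hfin _ _ _ _ (hs x).self_of_nhds]
    exact ((∑ j ∈ s x, B j) ψ).2.1 x T v
  · refine SmoothAt.congr (((∑ j ∈ s x, B j) ψ).2.2 κ hκ x hx) ?_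
    filter_upwards [hs x] with y hy
    exact hfin _ _ _ _ hy
  · refine Subtype.ext (funext fun x => funext fun v => ?_)
    change ∑ᶠ j, (B j (ψ + χ)).1 x v = ∑ᶠ j, (B j ψ).1 x v + ∑ᶠ j, (B j χ).1 x v
    rw [hfin _ _ _ _ (hs x).self_of_nhds, hfin _ _ _ _ (hs x).self_of_nhds,
      hfin _ _ _ _ (hs x).self_of_nhds, map_add, add_val]
  · refine Subtype.ext (funext fun x => funext fun v => ?_)
    change ∑ᶠ j, (B j (z • ψ)).1 x v = z • ∑ᶠ j, (B j ψ).1 x v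
    rw [hfin _ _ _ _ (hs x).self_of_nhds, hfin _ _ _ _ (hs x).self_of_nhds, map_smul, smul_val]

theorem density_congr {κ : OpenPartialHomeomorph M (EuclideanSpace ℝ (Fin n))}
    {ψ ψ' χ χ' : P.HalfDensities} {K : Set M} (hχ : SupportedIn K χ ∨ SupportedIn K ψ)
    (hχ' : SupportedIn K χ' ∨ SupportedIn K ψ')
    (h : ∀ x : P.U, (x : M) ∈ K → ∀ v, ψ.1 x v = ψ'.1 x v ∧ χ.1 x v = χ'.1 x v) (x : M) :
    P.density κ ψ χ x = P.density κ ψ' χ' x := by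
  by_cases hU : x ∈ P.U
  · rw [P.density_eq κ ψ χ ⟨x, hU⟩, P.density_eq κ ψ' χ' ⟨x, hU⟩]
    by_cases hK : x ∈ K
    · rw [(h ⟨x, hU⟩ hK _).1, (h ⟨x, hU⟩ hK _).2]
    · have h0 : ∀ ψ χ : P.HalfDensities, SupportedIn K χ ∨ SupportedIn K ψ →
          P.form ⟨x, hU⟩ (ψ.1 ⟨x, hU⟩ (coordFrame κ x)) (χ.1 ⟨x, hU⟩ (coordFrame κ x)) = 0 := by
        rintro ψ χ (h | h)
        · rw [h ⟨x, hU⟩ hK, map_zero]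
        · rw [h ⟨x, hU⟩ hK, map_zero, LinearMap.zero_apply]
      rw [h0 ψ χ hχ, h0 ψ' χ' hχ']
  · rw [density_of_notMem hU, density_of_notMem hU]

theorem transposed_sum {ι : Type*} (s : Finset ι) {B B' : ι → P.Op}
    (h : ∀ j, Transposed (B j) (B' j)) (hB : ∀ j, IsLocal (B j)) (hB' : ∀ j, IsLocal (B' j)) :
    Transposed (∑ j ∈ s, B j) (∑ j ∈ s, B' j) := by
  classical
  have : Transposed (∑ j ∈ s, B j) (∑ j ∈ s, B' j) ∧ IsLocal (∑ j ∈ s, B j) ∧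
      IsLocal (∑ j ∈ s, B' j) := by
    induction s using Finset.induction_on with
    | empty => exact ⟨transposed_zero, isLocal_zero, isLocal_zero⟩
    | insert a s ha ih =>
      rw [Finset.sum_insert ha, Finset.sum_insert ha]
      exact ⟨(h a).add ih.1 (hB a) ih.2.1, (hB a).add ih.2.1, (hB' a).add ih.2.2⟩
  exact this.1

/-- A compact set meets finitely many members only, so on half-densities supported in it the
operators are finite sums. -/
theorem transposed_of_locally_finite {ι : Type*} {B B' : ι → P.Op} {K : ι → Set P.U}
    (hK : LocallyFinite K) (h : ∀ j, Transposed (B j) (B' j)) (hB : ∀ j, IsLocal (B j))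
    (hB' : ∀ j, IsLocal (B' j)) {A A' : P.Op}
    (hA : ∀ ψ x v (s : Finset ι), (∀ j, x ∈ K j → j ∈ s) →
      (A ψ).1 x v = ((∑ j ∈ s, B j) ψ).1 x v)
    (hA' : ∀ ψ x v (s : Finset ι), (∀ j, x ∈ K j → j ∈ s) →
      (A' ψ).1 x v = ((∑ j ∈ s, B' j) ψ).1 x v) : Transposed A A' := by
  intro κ hκ C hC hCκ hCU ψ χ hψ hχ
  have hc : IsCompact ((↑) ⁻¹' C : Set P.U) :=
    Topology.IsInducing.subtypeVal.isCompact_preimage' hC (by simpa using hCU)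
  have hf := hK.finite_nonempty_inter_compact hc
  have hs : ∀ x : P.U, (x : M) ∈ C → ∀ j, x ∈ K j → j ∈ hf.toFinset := fun x hx j hj =>
    hf.mem_toFinset.2 ⟨x, hj, hx⟩
  have h1 := transposed_sum hf.toFinset h hB hB' κ hκ C hC hCκ hCU ψ χ hψ hχ
  calc _ = _ := ?_
    _ = _ := h1
    _ = _ := ?_
  · congr 1
    funext y
    exact density_congr (Or.inl hχ) (Or.inl hχ) (fun x hx v => ⟨hA ψ x v _ (hs x hx), rfl⟩) _
  · congr 1
    funext y
    exact (density_congr (Or.inr hψ) (Or.inr hψ) (fun x hx v => ⟨rfl, hA' χ x v _ (hs x hx)⟩) _).symm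

theorem mc_mul_mem (h) {i : ℕ} {A : P.Op} (hA : A ∈ P.GF i) : P.mc h * A ∈ P.GF i := by
  have := GF_mul (mem_filt_iff.1 (mc_mem h)) hA
  rwa [zero_add, Nat.add_sub_cancel_left] at this

theorem mul_mc_mem (h) {i : ℕ} {A : P.Op} (hA : A ∈ P.GF i) : A * P.mc h ∈ P.GF i := by
  have := GF_mul hA (mem_filt_iff.1 (mc_mem h))
  rwa [zero_add, Nat.add_sub_cancel] at this

theorem sbr_mc_mul (h) (p : ℕ) (A : P.Op) (a : Letter n F E) :
    P.sbr p a.weight (P.mc h * A) (P.letterOp a) =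
      P.mc h * P.sbr p a.weight A (P.letterOp a) := by
  have h1 : P.letterOp a * P.mc h = P.mc h * P.letterOp a := by
    rcases a with e | f
    · exact (mc_c h e).symm
    · exact (mc_m h f).symm
  rw [SpinorBundle.sbr, SpinorBundle.sbr, neg_one_pow_eq_smul, neg_one_pow_eq_smul, mul_sub,
    mul_smul_comm, mul_assoc, ← mul_assoc (P.letterOp a), h1, mul_assoc]

theorem iterSbr_mc_mul (h) (p : ℕ) (A : P.Op) (u : List (Letter n F E)) :
    P.iterSbr p (P.mc h * A) u = P.mc h * P.iterSbr p A u := by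
  induction u generalizing p A with
  | nil => rfl
  | cons a u ih => rw [iterSbr, iterSbr, sbr_mc_mul, ih]

/-- Both bundles are framed over the same chart, orthonormal frame and cutoff, as comparison by
constant matrices requires. -/
theorem exists_frameChart₂ (P P' : SpinorBundle.{uM, uF, uE, w} 𝒞) {x₀ : M} (h : x₀ ∈ P.U)
    (h' : x₀ ∈ P'.U) {O : Opens M} (hO : x₀ ∈ O) : ∃ L : 𝒞.FrameChart, L.W ≤ O ∧ L.Flat x₀ ∧
      Nonempty (P.SpinorFrame L.o) ∧ Nonempty (P'.SpinorFrame L.o) := by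
  obtain ⟨W₁, o, hx₁, ⟨fr⟩⟩ := P.exists_spinorFrame ⟨x₀, h⟩
  obtain ⟨W, hW, hx, ⟨fr'⟩⟩ := P'.exists_spinorFrame_restrict o ⟨x₀, h'⟩ hx₁
  let W' : Opens M := W ⊓ (O ⊓ ⟨(chartAt (EuclideanSpace ℝ (Fin n)) x₀).source,
    (chartAt (EuclideanSpace ℝ (Fin n)) x₀).open_source⟩)
  have hx' : x₀ ∈ W' := ⟨hx, hO, mem_chart_source _ _⟩
  obtain ⟨χ, h1, h2, h3⟩ := exists_bump (n := n) x₀ (W'.isOpen.mem_nhds hx')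
  exact ⟨⟨chartAt (EuclideanSpace ℝ (Fin n)) x₀, IsManifold.chart_mem_maximalAtlas _, W',
    (o.restrict hW).restrict inf_le_left, inf_le_right.trans inf_le_right, χ, h2, h3⟩,
    inf_le_right.trans inf_le_left, ⟨hx', h1⟩, ⟨(fr.restrict hW).restrict inf_le_left⟩,
    ⟨fr'.restrict inf_le_left⟩⟩

variable (P) in
theorem exists_frameChart (x₀ : P.U) :
    ∃ L : 𝒞.FrameChart, L.Flat x₀ ∧ Nonempty (P.SpinorFrame L.o) := by
  obtain ⟨L, -, hL, hfr, -⟩ := exists_frameChart₂ P P x₀.2 x₀.2 (O := ⊤) trivial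
  exact ⟨L, hL, hfr⟩

end SpinorBundle

theorem CourantAlgebroid.IsGradedFunction.mul_left {p : ℕ} {φ : Cochain n F E}
    (hφ : 𝒞.IsGradedFunction p φ) (f : C^∞⟮𝓡 n, M; ℝ⟯) :
    𝒞.IsGradedFunction p fun u => f * φ u :=
  𝒞.isGradedFunction_iff.2 ⟨fun u hu => by rw [hφ.supported u hu, mul_zero],
    fun x => (hφ.at x).const_mul (f x)⟩

theorem CourantAlgebroid.FrameChart.isOpen_flat (L : 𝒞.FrameChart) : IsOpen {x | L.Flat x} :=
  L.W.isOpen.inter isOpen_setOfPred_eventually_nhds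

theorem CourantAlgebroid.FrameChart.exists_good_of_flat (L : 𝒞.FrameChart) {p : ℕ}
    {φ : Cochain n F E} (hφ : 𝒞.IsGradedFunction p φ) {χ : C^∞⟮𝓡 n, M; ℝ⟯}
    (hχ : tsupport χ ⊆ {x | L.Flat x}) :
    ∃ A A' : OpFamily.{uM, uF, uE, w} L, Good (p + 2) A A' ∧
      ∀ P fr, Sym (p + 2) (A P fr) fun u => χ * φ u :=
  exists_good (p + 2) ⟨p, hφ.mul_left χ⟩
    (fun u hu => by rw [hφ.supported u (by omega), mul_zero]) fun x => by
      by_cases hx : x ∈ tsupport χ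
      · exact Or.inl (hχ hx)
      · refine Or.inr fun u => ?_
        change χ x * φ u x = 0
        rw [image_eq_zero_of_notMem_tsupport hx, zero_mul]

/-! ### Global operators by a partition of unity. -/

variable [SecondCountableTopology M]

/-- Every graded function is the symbol of an operator with a formal transpose. -/
theorem SpinorBundle.exists_operator (P : SpinorBundle.{uM, uF, uE, w} 𝒞) {p : ℕ}
    {φ : Cochain n F E} (hφ : 𝒞.IsGradedFunction p φ) :
    ∃ A A' : P.Op, P.HasSymbol p A φ ∧ A' ∈ P.GF (p + 2) ∧ Transposed A A' ∧
      Transposed A' A := by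
  choose L hL fr using P.exists_frameChart
  replace fr := fun x => (fr x).some
  have hbump := fun x : P.U => exists_bump (n := n) (x : M) ((L x).isOpen_flat.mem_nhds (hL x))
  choose χ hχ1 hχc hχs using hbump
  have hgood := fun x => (L x).exists_good_of_flat (hφ := hφ) (hχs x)
  choose A A' hA hS using hgood
  have : LocallyCompactSpace P.U := ChartedSpace.locallyCompactSpace (EuclideanSpace ℝ (Fin n)) P.U
  -- The partition is subordinate to the sets where the cutoffs `χ x` are one, so the local symbols
  -- `χ φ` recombine to `φ`.
  obtain ⟨ρ, hρ⟩ := SmoothPartitionOfUnity.exists_isSubordinate (𝓡 n) (s := (Set.univ : Set P.U))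
    isClosed_univ (fun x => {y : P.U | ∀ᶠ z : P.U in 𝓝 y, χ x z = 1})
    (fun x => isOpen_setOfPred_eventually_nhds) (fun x _ => Set.mem_iUnion.2 ⟨x, val_eventually (hχ1 x)⟩)
  let r : P.U → C^∞⟮𝓡 n, P.U; 𝓘(ℝ, ℂ), ℂ⟯ := fun j =>
    ⟨fun x => (ρ j x : ℂ), Complex.ofRealCLM.contMDiff.comp (ρ j).contMDiff⟩
  let K : P.U → Set P.U := fun j => tsupport (ρ j)
  have hK : LocallyFinite K := ρ.locallyFinite.closure
  -- Cutting off on the left becomes cutting off on the right in the transpose.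
  let B : P.U → P.Op := fun j => P.mc (r j) * A j P (fr j)
  let B' : P.U → P.Op := fun j => (((P.sign : ℤ) : ℂ) ^ (p + 2) • A' j P (fr j)) * P.mc (r j)
  have hBm : ∀ j, B j ∈ P.GF (p + 2) := fun j => mc_mul_mem _ ((hA j).mem _ _)
  have hA'm : ∀ j, ((P.sign : ℤ) : ℂ) ^ (p + 2) • A' j P (fr j) ∈ P.GF (p + 2) := fun j =>
    Submodule.smul_mem _ _ ((hA j).mem' _ _)
  have hBm' : ∀ j, B' j ∈ P.GF (p + 2) := fun j => mul_mc_mem _ (hA'm j)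
  have hr : ∀ j x, x ∉ K j → r j x = 0 := fun j x hx => by
    change ((ρ j x : ℝ) : ℂ) = 0
    rw [image_eq_zero_of_notMem_tsupport hx, Complex.ofReal_zero]
  obtain ⟨T, hT⟩ := exists_locally_finite_sum B K hK fun j ψ x hx v => by
    change r j x • _ = _
    rw [hr j x hx, zero_smul]
  obtain ⟨T', hT'⟩ := exists_locally_finite_sum B' K hK fun j ψ x hx v => by
    refine isLocal_of_mem (hA'm j) (P.mc (r j) ψ) x ?_ v
    filter_upwards [(isClosed_tsupport (ρ j)).isOpen_compl.mem_nhds hx] with y hy v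
    rw [mc_val, hr j y hy, zero_smul]
  have hnear : ∀ x : P.U, ∃ s : Finset P.U, ∀ᶠ y in 𝓝 x, ∀ j, y ∈ K j → j ∈ s := fun x => by
    obtain ⟨t, ht, hf⟩ := hK x
    refine ⟨hf.toFinset, ?_⟩
    filter_upwards [ht] with y hy j hj
    exact hf.mem_toFinset.2 ⟨y, hj, hy⟩
  refine ⟨T, T', ⟨mem_filt_iff.2 (GF_of_eqNear fun x => ?_), hφ, fun u hu =>
    eq_of_eqNear fun x => ?_⟩, GF_of_eqNear fun x => ?_,
    transposed_of_locally_finite hK (fun j => ?_) (fun j => isLocal_of_mem (hBm j))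
      (fun j => isLocal_of_mem (hBm' j)) hT hT',
    transposed_of_locally_finite hK (fun j => ?_) (fun j => isLocal_of_mem (hBm' j))
      (fun j => isLocal_of_mem (hBm j)) hT' hT⟩
  · obtain ⟨s, hs⟩ := hnear x
    exact ⟨∑ j ∈ s, B j, sum_mem fun j _ => hBm j, hs.mono fun y hy ψ v => hT ψ y v s hy⟩
  · obtain ⟨s, hs⟩ := hnear x
    have h1 : EqNear x T (∑ j ∈ s, B j) := hs.mono fun y hy ψ v => hT ψ y v s hy
    filter_upwards [h1.iterSbr p u, hs] with y hy hys ψ v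
    rw [hy, iterSbr_sum]
    have h2 : ∀ j, P.iterSbr p (B j) u = P.mc (r j) * P.m (χ j * φ u) := fun j => by
      rw [iterSbr_mc_mul, ← (hS j P (fr j)).symbol u (by omega), iterSbr_mod (q := p + 2) (by omega)]
    have h3 : ∀ j, (P.iterSbr p (B j) u ψ).1 y v = (ρ j y) • φ u y • ψ.1 y v := fun j => by
      rw [h2, Module.End.mul_apply, mc_val, m_val]
      change ((ρ j y : ℝ) : ℂ) • (χ j y * φ u y) • _ = _
      by_cases hj : y ∈ K j
      · rw [(hρ j hj : ∀ᶠ z : P.U in 𝓝 y, χ j z = 1).self_of_nhds, one_mul, Complex.coe_smul]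
      · rw [image_eq_zero_of_notMem_tsupport (f := ρ j) hj, Complex.ofReal_zero, zero_smul, zero_smul]
    have h4 : ∀ s : Finset P.U, ((∑ j ∈ s, P.iterSbr p (B j) u) ψ).1 y v =
        (∑ j ∈ s, ρ j y) • φ u y • ψ.1 y v := by
      classical
      intro s
      induction s using Finset.induction_on with
      | empty => simp
      | insert a s ha ih => rw [Finset.sum_insert ha, Finset.sum_insert ha, LinearMap.add_apply,
          add_val, ih, h3, add_smul]
    have h5 : ∑ j ∈ s, ρ j y = 1 := by
      rw [← ρ.sum_eq_one (Set.mem_univ y)]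
      refine (finsum_eq_sum_of_support_subset _ fun j hj => hys j (subset_tsupport _ hj)).symm
    rw [h4, h5, one_smul, m_val]
  · obtain ⟨s, hs⟩ := hnear x
    exact ⟨∑ j ∈ s, B' j, sum_mem fun j _ => hBm' j, hs.mono fun y hy ψ v => hT' ψ y v s hy⟩
  · exact (transposed_mc (r j)).mul ((hA j).transposed P (fr j)) (isLocal_of_mem ((hA j).mem _ _))
      (isLocal_mc _)
  · have h1 := ((hA j).transposed' P (fr j)).smul (((P.sign : ℤ) : ℂ) ^ (p + 2))
    rw [smul_smul, ← mul_pow, CourantAlgebroid.FrameChart.sign_mul_self, one_pow, one_smul] at h1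
    exact h1.mul (transposed_mc (r j)) (isLocal_mc _) (isLocal_of_mem ((hA j).mem _ _))

end Gluing
end CourantDirac

namespace CourantDirac

/-! ## Existence of spinor bundles -/

section SpinorExistence

open Filter Topology Module

variable {n : ℕ} {M : Type uM} [TopologicalSpace M] [ChartedSpace (EuclideanSpace ℝ (Fin n)) M]
  [IsManifold (𝓡 n) ∞ M] [T2Space M]
  {F : Type uF} [NormedAddCommGroup F] [NormedSpace ℝ F] [FiniteDimensional ℝ F]
  {E : M → Type uE} [∀ x, AddCommGroup (E x)] [∀ x, Module ℝ (E x)]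
  [∀ x, TopologicalSpace (E x)] [TopologicalSpace (TotalSpace F E)] [FiberBundle F E]
  [VectorBundle ℝ F E] [ContMDiffVectorBundle ∞ F E (𝓡 n)]
  {𝒞 : CourantAlgebroid n F E}

open SpinorBundle

namespace CourantAlgebroid.OrthoFrame

variable {W : Opens M} (o : 𝒞.OrthoFrame W) {V : Type w} [NormedAddCommGroup V] [NormedSpace ℂ V]

theorem contMDiffAt_trivial_section {s : W → V} {x : W} :
    ContMDiffAt (𝓡 n) ((𝓡 n).prod 𝓘(ℝ, V)) ∞
      (fun y => TotalSpace.mk' V (E := fun _ : W => V) y (s y)) x ↔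
      ContMDiffAt (𝓡 n) 𝓘(ℝ, V) ∞ s x :=
  Bundle.contMDiffAt_section (IB := 𝓡 n) (F := V) (E := Bundle.Trivial W V) (s := s) (n := ∞) x

variable (R : CliffRep o.ε V)

/-- The Clifford multiplication on the trivial bundle. -/
def trivialCliff (x : M) : E x →ₗ[ℝ] V →ₗ[ℂ] V :=
  ∑ i, LinearMap.smulRight (o.ε i • (𝒞.pairing x).flip (o.e i x)) (R.c i)

theorem trivialCliff_apply (x : M) (a : E x) (s : V) :
    o.trivialCliff R x a s = ∑ i, (o.ε i * 𝒞.pairing x a (o.e i x)) • R.c i s := by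
  simp [trivialCliff]

/-- Symmetrizing the double sum leaves the anticommutators, which are diagonal. -/
theorem sum_mul_sum_eq {ι : Type*} [Fintype ι] [DecidableEq ι] {ε : ι → ℝ} {V : Type*}
    [AddCommGroup V] [Module ℂ V] (R : CliffRep ε V) (t : ι → ℝ) (s : V) :
    ∑ i, t i • R.c i (∑ j, t j • R.c j s) = ((∑ i, t i * t i * ε i) / 2 : ℝ) • s := by
  have h1 : ∀ i, R.c i (∑ j, t j • R.c j s) = ∑ j, t j • R.c i (R.c j s) := fun i => by
    rw [map_sum]
    exact Finset.sum_congr rfl fun j _ => map_real_smul _ _ _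
  have h2 : ∀ i j, R.c i (R.c j s) + R.c j (R.c i s) = if i = j then ε i • s else 0 := by
    intro i j
    split_ifs with h
    · subst h
      rw [R.c_sq, Complex.coe_smul, ← add_smul, add_halves]
    · rw [R.c_c i j h, neg_add_cancel]
  have h3 : ∑ i, ∑ j, (t i * t j) • R.c i (R.c j s) =
      ∑ i, ∑ j, (t i * t j) • R.c j (R.c i s) := by
    rw [Finset.sum_comm]
    exact Finset.sum_congr rfl fun i _ => Finset.sum_congr rfl fun j _ => by rw [mul_comm]
  have h4 : ∑ i, t i • R.c i (∑ j, t j • R.c j s) = ∑ i, ∑ j, (t i * t j) • R.c i (R.c j s) := by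
    simp only [h1, Finset.smul_sum, smul_smul]
  have h5 : (2 : ℝ) • ∑ i, ∑ j, (t i * t j) • R.c i (R.c j s) = (∑ i, t i * t i * ε i) • s := by
    rw [two_smul]
    nth_rewrite 2 [h3]
    simp only [← Finset.sum_add_distrib, ← smul_add, h2, smul_ite, smul_zero, smul_smul,
      Finset.sum_ite_eq, Finset.mem_univ, if_true, Finset.sum_smul]
  rw [h4, div_eq_inv_mul, mul_smul, ← h5, inv_smul_smul₀ two_ne_zero]

theorem trivialCliff_sq {x : M} (hx : x ∈ W) (a : E x) (s : V) :
    o.trivialCliff R x a (o.trivialCliff R x a s) = ((𝒞.pairing x a a / 2 : ℝ) : ℂ) • s := by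
  rw [trivialCliff_apply, trivialCliff_apply, sum_mul_sum_eq, Complex.coe_smul]
  congr 2
  conv_rhs => rw [o.expand hx a]
  simp only [map_sum, map_smul, LinearMap.sum_apply, LinearMap.smul_apply, o.orth x hx, smul_eq_mul,
    mul_ite, mul_zero, Finset.sum_ite_eq', Finset.mem_univ, if_true]
  exact Finset.sum_congr rfl fun i _ => by ring

theorem trivialCliff_frame {x : M} (hx : x ∈ W) (i) (s : V) :
    o.trivialCliff R x (o.e i x) s = R.c i s := by
  rw [trivialCliff_apply]
  simp only [o.orth x hx, mul_ite, mul_zero, o.ε_mul, ite_smul, zero_smul, one_smul,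
    Finset.sum_ite_eq, Finset.mem_univ, if_true]

variable [FiniteDimensional ℂ V] [Nontrivial V]

/-- The trivial spinor bundle with the fibre of an irreducible representation. -/
def spinorBundle (hR : R.Irr) (B : V →ₗ[ℂ] V →ₗ[ℂ] ℂ) (hB : B.Nondegenerate)
    (hc : ∀ i s t, B (R.c i s) t = B s (R.c i t)) (κ : ℤˣ)
    (hκ : ∀ s t, B (R.γ s) (R.γ t) = ((κ : ℤ) : ℂ) * B s t) : SpinorBundle.{uM, uF, uE, w} 𝒞 :=
  have : FiniteDimensional ℝ V := FiniteDimensional.complexToReal V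
  { U := W
    V := V
    S := fun _ => V
    instTot := inferInstanceAs (TopologicalSpace (TotalSpace V (Bundle.Trivial W V)))
    instFB := inferInstanceAs (FiberBundle V (Bundle.Trivial W V))
    instVB := inferInstanceAs (VectorBundle ℝ V (Bundle.Trivial W V))
    instSmooth := inferInstanceAs (ContMDiffVectorBundle ∞ V (Bundle.Trivial W V) (𝓡 n))
    smooth_I := fun s x hs => by
      rw [contMDiffAt_trivial_section] at hs ⊢
      exact (LinearMap.toContinuousLinearMap ((Complex.I • LinearMap.id : V →ₗ[ℂ] V).restrictScalars
        ℝ)).contMDiff.contMDiffAt.comp x hs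
    cliff := fun x => o.trivialCliff R x
    cliff_sq := fun x a s => o.trivialCliff_sq R x.2 a s
    smooth_cliff := fun e s x hs => by
      rw [contMDiffAt_trivial_section] at hs ⊢
      simp only [trivialCliff_apply]
      refine contMDiffAt_finsetSum fun i _ => ?_
      have h1 := ((o.ε i • 𝒞.inner e (o.e i)).contMDiff.comp (contMDiff_subtype_val (U := W))) x
      have h2 : ContMDiffAt (𝓡 n) 𝓘(ℝ, V) ∞ (fun y => R.c i (s y)) x :=
        (LinearMap.toContinuousLinearMap ((R.c i).restrictScalars
          ℝ)).contMDiff.contMDiffAt.comp x hs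
      exact h1.smul h2
    parity := fun _ => R.γ
    parity_sq := fun _ => R.γ_sq
    parity_cliff := fun x a s => by
      simp only [trivialCliff_apply, map_sum, map_real_smul, R.γ_c, smul_neg, Finset.sum_neg_distrib]
    smooth_parity := fun s x hs => by
      rw [contMDiffAt_trivial_section] at hs ⊢
      exact (LinearMap.toContinuousLinearMap (R.γ.restrictScalars ℝ)).contMDiff.contMDiffAt.comp x hs
    nontrivial := fun _ => inferInstance
    irreducible := fun x W' h1 h2 => hR W' h1 fun i s hs => by
      rw [← o.trivialCliff_frame R x.2]; exact h2 _ s hs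
    form := fun _ => B
    form_nondegenerate := fun _ => hB
    smooth_form := fun s t x hs ht => by
      rw [contMDiffAt_trivial_section] at hs ht
      let T : V →L[ℝ] V →L[ℝ] ℂ := LinearMap.toContinuousLinearMap
        ((LinearMap.toContinuousLinearMap (𝕜 := ℝ) (E := V) (F' := ℂ)).toLinearMap ∘ₗ
          (LinearMap.restrictScalars₁₂ ℝ ℝ B))
      exact (T.contMDiff.contMDiffAt.comp x hs).clm_apply ht
    sign := 1
    form_cliff := fun x a s t => by
      simp only [trivialCliff_apply, map_sum, LinearMap.sum_apply, map_real_smul,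
        LinearMap.smul_apply, hc, Units.val_one, Int.cast_one, one_mul]
    formParity := κ
    form_parity := fun _ => hκ }

end CourantAlgebroid.OrthoFrame

variable (𝒞) in
theorem CourantAlgebroid.exists_spinorBundle (x : M) :
    ∃ P : SpinorBundle.{uM, uF, uE, w} 𝒞, x ∈ P.U := by
  obtain ⟨W, hx, ⟨o⟩⟩ := 𝒞.exists_orthoFrame x
  obtain ⟨N, R₀, hR₀, hnt⟩ := CliffRep.exists_irr _ o.ε
  -- The model fibre is lifted to the universe of the bundle.
  let e : (Fin N → ℂ) ≃ₗ[ℂ] ULift.{w} (Fin N → ℂ) := ULift.moduleEquiv.symm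
  have : Nontrivial (ULift.{w} (Fin N → ℂ)) := e.symm.toEquiv.nontrivial
  have : FiniteDimensional ℂ (ULift.{w} (Fin N → ℂ)) := e.finiteDimensional
  obtain ⟨B, hB, hc, κ, hκ⟩ := CliffRep.exists_form o.ε_mul (hR₀.conj e)
  exact ⟨o.spinorBundle (R₀.conj e) (hR₀.conj e) B hB hc κ hκ, hx⟩

end SpinorExistence
end CourantDirac

namespace CourantDirac

/-! ## Quantization -/

section Quantization

open Filter Topology Module

variable {n : ℕ} {M : Type uM} [TopologicalSpace M] [ChartedSpace (EuclideanSpace ℝ (Fin n)) M]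
  [IsManifold (𝓡 n) ∞ M] [T2Space M] [SecondCountableTopology M]
  {F : Type uF} [NormedAddCommGroup F] [NormedSpace ℝ F] [FiniteDimensional ℝ F]
  {E : M → Type uE} [∀ x, AddCommGroup (E x)] [∀ x, Module ℝ (E x)]
  [∀ x, TopologicalSpace (E x)] [TopologicalSpace (TotalSpace F E)] [FiberBundle F E]
  [VectorBundle ℝ F E] [ContMDiffVectorBundle ∞ F E (𝓡 n)]
  {𝒞 : CourantAlgebroid n F E}

open SpinorBundle

theorem SpinorBundle.HasSymbol.iterSbr_mul {P : SpinorBundle.{uM, uF, uE, w} 𝒞} {p q : ℕ}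
    {A B : P.Op} {φ ψ : Cochain n F E} (hA : P.HasSymbol p A φ) (hB : P.HasSymbol q B ψ)
    {u : List (Letter n F E)} (hu : wordWeight u = p + q) :
    P.iterSbr (p + q) (A * B) u = P.m (gradedMul q φ ψ u) := by
  have h := (Sym.of_hasSymbol hA).mul (Sym.of_hasSymbol hB) (u := u) (by omega)
  rw [gradedMul_mod (q := q + 2) (q' := q) (by omega)] at h
  rw [← h, iterSbr_mod (q := p + 2 + (q + 2)) (by omega)]

theorem SpinorBundle.HasSymbol.iterSbr_sbr {P : SpinorBundle.{uM, uF, uE, w} 𝒞} {p q r : ℕ}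
    (hr : p + q = r + 2) {A B : P.Op} {φ ψ : Cochain n F E} (hA : P.HasSymbol p A φ)
    (hB : P.HasSymbol q B ψ) {u : List (Letter n F E)} (hu : wordWeight u = r) :
    P.iterSbr r (P.sbr p q A B) u = P.m (𝒞.poisson q φ ψ u) := by
  have h := (Sym.of_hasSymbol hA).sbr (Sym.of_hasSymbol hB) (u := u) (by omega)
  rw [poisson_mod (𝒞 := 𝒞) (q := q + 2) (q' := q) (by omega)] at h
  rw [← h, iterSbr_mod (q := p + 2 + (q + 2)) (by omega),
    sbr_mod (p := p) (q := q) (p' := p + 2) (q' := q + 2) (by omega) (by omega)]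

theorem SpinorBundle.mul_mem_filt {P : SpinorBundle.{uM, uF, uE, w} 𝒞} {p q : ℕ} {A B : P.Op}
    (hA : A ∈ P.Filt p) (hB : B ∈ P.Filt q) : A * B ∈ P.Filt (p + q) := by
  have h := GF_mul (mem_filt_iff.1 hA) (mem_filt_iff.1 hB)
  rw [show p + 2 + (q + 2) - 2 = p + q + 2 by omega] at h
  exact mem_filt_iff.2 h

theorem SpinorBundle.sbr_mem_filt {P : SpinorBundle.{uM, uF, uE, w} 𝒞} {p q r : ℕ}
    (hr : p + q = r + 2) {A B : P.Op}
    (hA : A ∈ P.Filt p) (hB : B ∈ P.Filt q) : P.sbr p q A B ∈ P.Filt r := by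
  have h := GF_sbr (mem_filt_iff.1 hA) (mem_filt_iff.1 hB)
  rw [hr] at h
  exact mem_filt_iff.2 h

namespace CourantAlgebroid.IsGradedFunction

/-- The recursions for products and Poisson brackets do not display the exchange relations. They are
obtained by quantization: the families are symbols of products and supercommutators, and symbols
satisfy the relations by `gradedAt_of_mem`. -/
theorem of_operators {p : ℕ} {φ : Cochain n F E} (hφ : ∀ u, wordWeight u ≠ p → φ u = 0)
    (h : ∀ P : SpinorBundle.{uM, uF, uE, 0} 𝒞, ∃ A ∈ P.Filt p,
      ∀ u, wordWeight u = p → P.iterSbr p A u = P.m (φ u)) : 𝒞.IsGradedFunction p φ :=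
  𝒞.isGradedFunction_iff.2 ⟨hφ, fun x => by
    obtain ⟨P, hx⟩ := 𝒞.exists_spinorBundle x
    obtain ⟨A, hA, hu⟩ := h P
    exact gradedAt_of_mem hφ hx (mem_filt_iff.1 hA) hu⟩

theorem mul {p q : ℕ} {φ ψ : Cochain n F E} (hφ : 𝒞.IsGradedFunction p φ)
    (hψ : 𝒞.IsGradedFunction q ψ) : 𝒞.IsGradedFunction (p + q) (gradedMul q φ ψ) :=
  of_operators (fun _ hu => gradedMul_supported q hφ.supported hψ.supported hu) fun P => by
    obtain ⟨A, -, hA, -⟩ := P.exists_operator hφ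
    obtain ⟨B, -, hB, -⟩ := P.exists_operator hψ
    exact ⟨A * B, mul_mem_filt hA.1 hB.1, fun u hu => hA.iterSbr_mul hB hu⟩

theorem poisson {p q r : ℕ} (hr : p + q = r + 2) {φ ψ : Cochain n F E}
    (hφ : 𝒞.IsGradedFunction p φ) (hψ : 𝒞.IsGradedFunction q ψ) :
    𝒞.IsGradedFunction r (𝒞.poisson q φ ψ) :=
  of_operators (fun _ hu => poisson_supported q hφ hψ (by omega)) fun P => by
    obtain ⟨A, -, hA, -⟩ := P.exists_operator hφ
    obtain ⟨B, -, hB, -⟩ := P.exists_operator hψ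
    exact ⟨P.sbr p q A B, sbr_mem_filt hr hA.1 hB.1, fun u hu => hA.iterSbr_sbr hr hB hu⟩

end CourantAlgebroid.IsGradedFunction

theorem SpinorBundle.isQuantization (P : SpinorBundle.{uM, uF, uE, w} 𝒞) : P.IsQuantization where
  order_zero A := by
    rw [mem_filt_zero_iff]
    exact exists_congr fun h => ⟨fun hA ψ x v => by rw [hA, mc_val],
      fun hA => P.ext_op fun ψ x v => by rw [hA, mc_val]⟩
  order_one e := mem_filt_iff.2 (c_mem e)
  increasing p A hA := mem_filt_iff.2 (GF_le _ (mem_filt_iff.1 hA))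
  mul_mem p q A hA B hB := mul_mem_filt hA hB
  sbr_mem p q r hr A hA B hB := sbr_mem_filt hr hA hB
  sbr_eq_zero p q h A hA B hB := sbr_eq_zero_of_low h (mem_filt_iff.1 hA) (mem_filt_iff.1 hB)
  symbol_surjective p φ hφ := have ⟨A, _, hA, _⟩ := P.exists_operator hφ; ⟨A, hA⟩
  symbol_injective p A hA h := by
    have h1 := mem_GF_of_symbol_eq_zero (mem_filt_iff.1 hA) h
    exact ⟨fun hp => eq_zero_of_mem_GF hp h1, fun r hr => mem_filt_iff.2 (hr ▸ h1)⟩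
  symbol_mul p q A B φ ψ hA hB :=
    ⟨mul_mem_filt hA.1 hB.1, hA.2.1.mul hB.2.1, fun u hu => hA.iterSbr_mul hB hu⟩
  symbol_sbr p q r A B φ ψ hr hA hB :=
    ⟨sbr_mem_filt hr hA.1 hB.1, hA.2.1.poisson hr hB.2.1, fun u hu => hA.iterSbr_sbr hr hB hu⟩

end Quantization
end CourantDirac

namespace CourantDirac

/-! ## The cubic function of a Courant algebroid -/

section Theta

open Filter Topology Module

variable {n : ℕ} {M : Type uM} [TopologicalSpace M] [ChartedSpace (EuclideanSpace ℝ (Fin n)) M]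
  [IsManifold (𝓡 n) ∞ M] [T2Space M]
  {F : Type uF} [NormedAddCommGroup F] [NormedSpace ℝ F] [FiniteDimensional ℝ F]
  {E : M → Type uE} [∀ x, AddCommGroup (E x)] [∀ x, Module ℝ (E x)]
  [∀ x, TopologicalSpace (E x)] [TopologicalSpace (TotalSpace F E)] [FiberBundle F E]
  [VectorBundle ℝ F E] [ContMDiffVectorBundle ∞ F E (𝓡 n)]
  {𝒞 : CourantAlgebroid n F E}

open SpinorBundle

namespace CourantAlgebroid

theorem mdifferentiableAt (f : C^∞⟮𝓡 n, M; ℝ⟯) (x : M) : MDifferentiableAt (𝓡 n) 𝓘(ℝ, ℝ) f x :=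
  (f.contMDiff x).mdifferentiableAt (by simp)

theorem lie_add_section (e e' : Cₛ^∞⟮𝓡 n; F, E⟯) (f) : 𝒞.lie (e + e') f = 𝒞.lie e f + 𝒞.lie e' f := by
  ext x
  change mvfderiv (𝓡 n) f x (𝒞.anchor x (e x + e' x)) = _
  rw [map_add, map_add]; rfl

theorem lie_fsmul (f : C^∞⟮𝓡 n, M; ℝ⟯) (e : Cₛ^∞⟮𝓡 n; F, E⟯) (g) :
    𝒞.lie (fsmul f e) g = f * 𝒞.lie e g := by
  ext x
  change mvfderiv (𝓡 n) g x (𝒞.anchor x (f x • e x)) = _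
  rw [map_smul, map_smul]; rfl

theorem lie_add (e : Cₛ^∞⟮𝓡 n; F, E⟯) (f g) : 𝒞.lie e (f + g) = 𝒞.lie e f + 𝒞.lie e g := by
  ext x
  change mvfderiv (𝓡 n) (⇑f + ⇑g) x _ = _
  rw [mvfderiv_add (mdifferentiableAt f x) (mdifferentiableAt g x)]; rfl

theorem lie_mul (e : Cₛ^∞⟮𝓡 n; F, E⟯) (f g) :
    𝒞.lie e (f * g) = f * 𝒞.lie e g + g * 𝒞.lie e f := by
  ext x
  change mvfderiv (𝓡 n) (⇑f * ⇑g) x _ = _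
  rw [mvfderiv_mul (mdifferentiableAt f x) (mdifferentiableAt g x)]; rfl

theorem lie_smul (e : Cₛ^∞⟮𝓡 n; F, E⟯) (c : ℝ) (f) : 𝒞.lie e (c • f) = c • 𝒞.lie e f := by
  ext x
  change mvfderiv (𝓡 n) ((fun _ => c) * ⇑f) x _ = _
  rw [mvfderiv_mul mdifferentiableAt_const (mdifferentiableAt f x), mvfderiv_const, smul_zero,
    add_zero]
  rfl

theorem lie_inner (e₁ e₂ e₃ : Cₛ^∞⟮𝓡 n; F, E⟯) : 𝒞.lie e₁ (𝒞.inner e₂ e₃) =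
    𝒞.inner (𝒞.bracket e₁ e₂) e₃ + 𝒞.inner e₂ (𝒞.bracket e₁ e₃) := by
  ext x; exact 𝒞.invariance e₁ e₂ e₃ x

theorem lie_inner' (e₁ e₂ e₃ : Cₛ^∞⟮𝓡 n; F, E⟯) : 𝒞.lie e₃ (𝒞.inner e₁ e₂) =
    𝒞.inner (𝒞.bracket e₁ e₂) e₃ + 𝒞.inner (𝒞.bracket e₂ e₁) e₃ := by
  ext x
  refine (𝒞.symmetric_part e₁ e₂ e₃ x).symm.trans ?_
  rw [map_add]; rfl

theorem inner_add_left (e e' e'' : Cₛ^∞⟮𝓡 n; F, E⟯) :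
    𝒞.inner (e + e') e'' = 𝒞.inner e e'' + 𝒞.inner e' e'' := by
  ext x
  change 𝒞.pairing x (e x + e' x) _ = _
  rw [map_add]; rfl

theorem inner_add_right (e e' e'' : Cₛ^∞⟮𝓡 n; F, E⟯) :
    𝒞.inner e (e' + e'') = 𝒞.inner e e' + 𝒞.inner e e'' := by
  ext x
  exact map_add (𝒞.pairing x (e x)) _ _

theorem inner_fsmul_right (f : C^∞⟮𝓡 n, M; ℝ⟯) (e e' : Cₛ^∞⟮𝓡 n; F, E⟯) :
    𝒞.inner e (fsmul f e') = f * 𝒞.inner e e' := by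
  ext x
  exact map_smul (𝒞.pairing x (e x)) _ _

theorem inner_comm (e e' : Cₛ^∞⟮𝓡 n; F, E⟯) : 𝒞.inner e e' = 𝒞.inner e' e := by
  ext x; exact 𝒞.pairing_symm x _ _

theorem theta_supported (u : List (Letter n F E)) (hu : wordWeight u ≠ 3) : 𝒞.theta u = 0 := by
  unfold theta
  split
  · exact absurd rfl hu
  · exact absurd rfl hu
  · exact absurd rfl hu
  · rfl

variable (𝒞) in
-- Exchange of the last two sections is the invariance of the pairing, exchange of the first two is
-- the formula for the symmetric part of the bracket.
theorem theta_isGraded : 𝒞.IsGradedFunction 3 𝒞.theta where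
  supported := 𝒞.theta_supported
  add_section u e e' := by
    by_cases hu : wordWeight u = 2
    · obtain ⟨f, rfl⟩ | ⟨a, b, rfl⟩ := eq_of_wordWeight_two hu
      · exact 𝒞.lie_add_section e e' f
      · exact 𝒞.inner_add_right _ e e'
    · rw [theta_supported, theta_supported, theta_supported, add_zero] <;> simpa
  smul_section u f e := by
    by_cases hu : wordWeight u = 2
    · obtain ⟨g, rfl⟩ | ⟨a, b, rfl⟩ := eq_of_wordWeight_two hu
      · exact 𝒞.lie_fsmul f e g
      · exact 𝒞.inner_fsmul_right f _ e
    · rw [theta_supported, theta_supported, mul_zero] <;> simpa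
  add_function u f g := by
    by_cases hu : wordWeight u = 1
    · obtain ⟨e, rfl⟩ := eq_of_wordWeight_one hu
      exact 𝒞.lie_add e f g
    · rw [theta_supported, theta_supported, theta_supported, add_zero] <;> simpa
  const_smul_function u c f := by
    by_cases hu : wordWeight u = 1
    · obtain ⟨e, rfl⟩ := eq_of_wordWeight_one hu
      exact 𝒞.lie_smul e c f
    · rw [theta_supported, theta_supported, smul_zero] <;> simpa
  mul_function u f g := by
    by_cases hu : wordWeight u = 1
    · obtain ⟨e, rfl⟩ := eq_of_wordWeight_one hu
      exact 𝒞.lie_mul e f g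
    · rw [theta_supported, theta_supported, theta_supported, mul_zero, mul_zero, add_zero] <;> simpa
  swap_sections u v e e' := by
    by_cases hu : wordWeight u + wordWeight v = 1
    · obtain ⟨h1, h2⟩ | ⟨h1, h2⟩ : wordWeight u = 1 ∧ wordWeight v = 0 ∨
          wordWeight u = 0 ∧ wordWeight v = 1 := by omega
      · obtain ⟨a, rfl⟩ := eq_of_wordWeight_one h1
        obtain rfl := eq_nil_of_wordWeight h2
        change 𝒞.inner _ _ + 𝒞.inner _ _ = 𝒞.lie _ _
        rw [lie_inner, 𝒞.inner_comm e]
      · obtain ⟨a, rfl⟩ := eq_of_wordWeight_one h2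
        obtain rfl := eq_nil_of_wordWeight h1
        exact (𝒞.lie_inner' e e' a).symm
    · rw [theta_supported, theta_supported, theta_supported, add_zero] <;>
        (simp only [wordWeight_append, wordWeight_cons, weight_inl, weight_inr]; omega)
  swap_section_function u v e f := by
    by_cases hu : wordWeight u + wordWeight v = 0
    · obtain rfl := eq_nil_of_wordWeight (u := u) (by omega)
      obtain rfl := eq_nil_of_wordWeight (u := v) (by omega)
      rfl
    · rw [theta_supported, theta_supported] <;>
        (simp only [wordWeight_append, wordWeight_cons, weight_inl, weight_inr]; omega)
  swap_functions u v f g := by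
    rw [theta_supported, theta_supported] <;>
      (simp only [wordWeight_append, wordWeight_cons, weight_inr]; omega)

theorem lie_eq_zero_of_eq_zero {e : Cₛ^∞⟮𝓡 n; F, E⟯} {x : M} (h : e x = 0) (f) :
    𝒞.lie e f x = 0 := by
  change mvfderiv (𝓡 n) f x (𝒞.anchor x (e x)) = 0
  rw [h, map_zero, map_zero]

theorem bracket_fsmul (e e' : Cₛ^∞⟮𝓡 n; F, E⟯) (f) :
    𝒞.bracket e (fsmul f e') = fsmul f (𝒞.bracket e e') + fsmul (𝒞.lie e f) e' := by
  ext x; exact 𝒞.leibniz e e' f x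

/-- The Jacobi identity for `e`, `e'` and `f e₃`, expanded by the Leibniz rule, gives the relation
as the coefficient of `e₃`, which may be chosen nonzero at the point. In a zero fibre both sides
vanish. -/
theorem lie_bracket (e e' : Cₛ^∞⟮𝓡 n; F, E⟯) (f) :
    𝒞.lie (𝒞.bracket e e') f = 𝒞.lie e (𝒞.lie e' f) - 𝒞.lie e' (𝒞.lie e f) := by
  ext x
  change 𝒞.lie (𝒞.bracket e e') f x = 𝒞.lie e (𝒞.lie e' f) x - 𝒞.lie e' (𝒞.lie e f) x
  by_cases h : ∀ a : E x, a = 0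
  · rw [lie_eq_zero_of_eq_zero (h _), lie_eq_zero_of_eq_zero (h _), lie_eq_zero_of_eq_zero (h _),
      sub_zero]
  push Not at h
  obtain ⟨a, ha⟩ := h
  obtain ⟨e₃, rfl⟩ := exists_global_section (n := n) (F := F) x a
  have h1 := 𝒞.jacobi e e' (fsmul f e₃)
  simp only [bracket_fsmul, map_add] at h1
  have h2 := congrArg (fun s : Cₛ^∞⟮𝓡 n; F, E⟯ => s x) h1
  have h3 := congrArg (fun s : Cₛ^∞⟮𝓡 n; F, E⟯ => f x • s x) (𝒞.jacobi e e' e₃)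
  have hf : ∀ (g : C^∞⟮𝓡 n, M; ℝ⟯) (s : Cₛ^∞⟮𝓡 n; F, E⟯), fsmul g s x = g x • s x :=
    fun _ _ => rfl
  simp only [ContMDiffSection.coe_add, Pi.add_apply, smul_add, hf] at h2 h3
  rw [h3] at h2
  have h4 : (𝒞.lie (𝒞.bracket e e') f x - (𝒞.lie e (𝒞.lie e' f) x - 𝒞.lie e' (𝒞.lie e f) x)) •
      e₃ x = 0 := by
    rw [sub_smul, sub_smul, ← sub_eq_zero.2 h2.symm]
    abel
  exact sub_eq_zero.1 ((smul_eq_zero.1 h4).resolve_right ha)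

variable (𝒞) in
/-- The section `ρ* df`. -/
def codiff (f : C^∞⟮𝓡 n, M; ℝ⟯) : Cₛ^∞⟮𝓡 n; F, E⟯ := 𝒞.sharp fun u => 𝒞.theta (Sum.inr f :: u)

theorem inner_codiff (f) (e : Cₛ^∞⟮𝓡 n; F, E⟯) : 𝒞.inner (𝒞.codiff f) e = 𝒞.lie e f :=
  (𝒞.inner_sharp (𝒞.theta_isGraded.cons (Sum.inr f)) e).symm

theorem codiff_inner (e e' : Cₛ^∞⟮𝓡 n; F, E⟯) :
    𝒞.codiff (𝒞.inner e e') = 𝒞.bracket e e' + 𝒞.bracket e' e :=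
  𝒞.eq_of_inner_eq fun a => by rw [inner_codiff, lie_inner', inner_add_left]

theorem codiff_mul (f g) : 𝒞.codiff (f * g) = fsmul f (𝒞.codiff g) + fsmul g (𝒞.codiff f) :=
  𝒞.eq_of_inner_eq fun a => by
    rw [inner_codiff, lie_mul, inner_add_left, 𝒞.inner_comm, 𝒞.inner_comm (fsmul _ _),
      inner_fsmul_right, inner_fsmul_right, 𝒞.inner_comm a, 𝒞.inner_comm a, inner_codiff,
      inner_codiff]

theorem inner_fsmul_left (f : C^∞⟮𝓡 n, M; ℝ⟯) (e e' : Cₛ^∞⟮𝓡 n; F, E⟯) :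
    𝒞.inner (fsmul f e) e' = f * 𝒞.inner e e' := by
  rw [inner_comm, inner_fsmul_right, inner_comm]

/-- `ρ* d⟨e, e'⟩` is `[e, e'] + [e', e]`, and the anchor maps the two summands to opposite
commutators. -/
theorem lie_codiff_inner (e e' : Cₛ^∞⟮𝓡 n; F, E⟯) (f) : 𝒞.lie (𝒞.codiff (𝒞.inner e e')) f = 0 := by
  rw [codiff_inner, lie_add_section, lie_bracket, lie_bracket]
  ring

/-- This is `ρ ρ* = 0`. The case of differentials of pairings is `lie_codiff_inner`; replacing `e`
by `g e` there isolates `⟨e, e'⟩` times the desired expression, and nondegeneracy makes the factor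
nonzero at the point. -/
theorem inner_codiff_codiff (f g) : 𝒞.inner (𝒞.codiff f) (𝒞.codiff g) = 0 := by
  rw [inner_codiff]
  ext x
  change 𝒞.lie (𝒞.codiff g) f x = 0
  by_cases h : ∀ a : E x, a = 0
  · exact lie_eq_zero_of_eq_zero (h _) _
  push Not at h
  obtain ⟨a, ha⟩ := h
  have hb : ∃ b, 𝒞.pairing x a b ≠ 0 := by
    by_contra! hb
    exact ha ((𝒞.pairing_nondegenerate x).1 a hb)
  obtain ⟨b, hb⟩ := hb
  obtain ⟨e, rfl⟩ := exists_global_section (n := n) (F := F) x a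
  obtain ⟨e', rfl⟩ := exists_global_section (n := n) (F := F) x b
  have h1 := 𝒞.lie_codiff_inner (fsmul g e) e' f
  rw [inner_fsmul_left, codiff_mul, lie_add_section, lie_fsmul, lie_fsmul, lie_codiff_inner,
    mul_zero, zero_add] at h1
  have h2 := congrArg (fun s : C^∞⟮𝓡 n, M; ℝ⟯ => s x) h1
  exact (mul_eq_zero.1 h2).resolve_left hb

theorem sharp_theta : 𝒞.sharp 𝒞.theta = 0 := 𝒞.sharp_eq_zero fun _ => rfl

theorem sharp_theta_inl (e : Cₛ^∞⟮𝓡 n; F, E⟯) :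
    𝒞.sharp (fun v => 𝒞.theta (Sum.inl e :: v)) = 0 := 𝒞.sharp_eq_zero fun _ => rfl

theorem sharp_theta_inr (f : C^∞⟮𝓡 n, M; ℝ⟯) :
    𝒞.sharp (fun v => 𝒞.theta (Sum.inr f :: v)) = 𝒞.codiff f := rfl

theorem sharp_theta_inl_inl (e e' : Cₛ^∞⟮𝓡 n; F, E⟯) :
    𝒞.sharp (fun v => 𝒞.theta (Sum.inl e :: Sum.inl e' :: v)) = 𝒞.bracket e e' :=
  𝒞.sharp_eq fun _ => rfl

theorem sharp_theta_inr_right (f : C^∞⟮𝓡 n, M; ℝ⟯) (a : Letter n F E) :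
    𝒞.sharp (fun v => 𝒞.theta (a :: Sum.inr f :: v)) = 0 :=
  𝒞.sharp_eq_zero fun _ => by cases a <;> rfl

theorem sharp_theta_three (a b c : Letter n F E) :
    𝒞.sharp (fun v => 𝒞.theta (a :: b :: c :: v)) = 0 :=
  𝒞.sharp_eq_zero fun _ => 𝒞.theta_supported _ (by
    have := weight_pos a; have := weight_pos b; have := weight_pos c
    simp only [wordWeight_cons, weight_inl]; omega)

theorem theta_inl_inl_inl (e₁ e₂ e₃ : Cₛ^∞⟮𝓡 n; F, E⟯) :
    𝒞.theta [Sum.inl e₁, Sum.inl e₂, Sum.inl e₃] = 𝒞.inner (𝒞.bracket e₁ e₂) e₃ := rfl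

theorem theta_inl_inr (e : Cₛ^∞⟮𝓡 n; F, E⟯) (f) : 𝒞.theta [Sum.inl e, Sum.inr f] = 𝒞.lie e f := rfl

theorem theta_nil : 𝒞.theta [] = 0 := rfl

theorem theta_single (a) : 𝒞.theta [a] = 0 := by cases a <;> rfl

theorem theta_inl_inl (e e' : Cₛ^∞⟮𝓡 n; F, E⟯) : 𝒞.theta [Sum.inl e, Sum.inl e'] = 0 := rfl

theorem theta_inr_inr (f g : C^∞⟮𝓡 n, M; ℝ⟯) (v) : 𝒞.theta (Sum.inr f :: Sum.inr g :: v) = 0 := by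
  cases v <;> rfl

theorem theta_inr_three (f : C^∞⟮𝓡 n, M; ℝ⟯) (a b v) : 𝒞.theta (a :: b :: Sum.inr f :: v) = 0 := by
  rcases a with a | a <;> rcases b with b | b <;> rfl

theorem theta_four (a b c d v) : 𝒞.theta (a :: b :: c :: d :: v) = 0 := by
  rcases a with a | a <;> rcases b with b | b <;> rcases c with c | c <;> rfl

variable [SecondCountableTopology M]

variable (𝒞) in
-- Being graded of degree four, the bracket has to be evaluated on three kinds of words only. Two
-- functions give `ρ ρ* = 0`, two sections and a function give the homomorphism property of the
-- anchor, four sections give the Jacobi identity.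
theorem poisson_theta_theta : 𝒞.poisson 3 𝒞.theta 𝒞.theta = 0 := by
  have hG := 𝒞.theta_isGraded.poisson (p := 3) (q := 3) (r := 4) rfl 𝒞.theta_isGraded
  have h1 : ∀ f g, 𝒞.poisson 3 𝒞.theta 𝒞.theta [Sum.inr f, Sum.inr g] = 0 := fun f g => by
    simp only [poisson, weight_inr, theta_nil, theta_single, theta_inr_inr, theta_inr_three,
      sharp_theta, sharp_theta_inr, inner_zero_left, inner_zero_right, inner_codiff_codiff]
    ring
  have h2 : ∀ e e' f, 𝒞.poisson 3 𝒞.theta 𝒞.theta [Sum.inl e, Sum.inl e', Sum.inr f] = 0 :=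
      fun e e' f => by
    simp only [poisson, weight_inr, weight_inl, theta_nil, theta_single, theta_inl_inl,
      theta_inr_inr, theta_inl_inr, theta_inr_three, theta_four, sharp_theta, sharp_theta_inl,
      sharp_theta_inr, sharp_theta_inl_inl, sharp_theta_inr_right, inner_zero_left,
      inner_zero_right, inner_codiff, 𝒞.inner_comm (𝒞.bracket _ _) (𝒞.codiff _), lie_bracket]
    ring
  have h3 : ∀ e₁ e₂ e₃ e₄, 𝒞.poisson 3 𝒞.theta 𝒞.theta
      [Sum.inl e₁, Sum.inl e₂, Sum.inl e₃, Sum.inl e₄] = 0 := fun e₁ e₂ e₃ e₄ => by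
    have k1 := 𝒞.lie_inner e₁ (𝒞.bracket e₂ e₃) e₄
    have k2 := 𝒞.lie_inner e₂ (𝒞.bracket e₁ e₃) e₄
    have k3 := 𝒞.lie_inner e₃ (𝒞.bracket e₁ e₂) e₄
    have k4 := 𝒞.lie_inner' (𝒞.bracket e₁ e₂) e₃ e₄
    -- The Jacobi identity enters here; the other ingredients are invariance and the symmetric part
    -- of the bracket.
    rw [𝒞.jacobi, inner_add_left] at k1
    simp only [poisson, weight_inl, theta_nil, theta_single, theta_inl_inl, theta_inl_inr,
      theta_inl_inl_inl, theta_inr_three, theta_four, sharp_theta, sharp_theta_inl,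
      sharp_theta_inl_inl, sharp_theta_three, inner_zero_left, inner_zero_right,
      𝒞.inner_comm (𝒞.bracket e₂ _), 𝒞.inner_comm (𝒞.bracket e₃ e₄)] at k1 k2 k3 k4 ⊢
    linear_combination 2 * k4 - 2 * k3 + 2 * k2 - 2 * k1
  funext u
  by_cases hu : wordWeight u = 4
  · have h4 : ∀ e e' f, 𝒞.poisson 3 𝒞.theta 𝒞.theta [Sum.inl e, Sum.inr f, Sum.inl e'] = 0 :=
      fun e e' f => (hG.swap_section_function [Sum.inl e] [] e' f).symm.trans (h2 e e' f)
    have h5 : ∀ e e' f, 𝒞.poisson 3 𝒞.theta 𝒞.theta [Sum.inr f, Sum.inl e, Sum.inl e'] = 0 :=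
      fun e e' f => (hG.swap_section_function [] [Sum.inl e'] e f).symm.trans (h4 e e' f)
    rcases u with _ | ⟨e | f, u⟩
    · simp at hu
    · obtain ⟨e', f, rfl⟩ | ⟨e', f, rfl⟩ | ⟨e₂, e₃, e₄, rfl⟩ := eq_of_wordWeight_three (u := u)
        (by rw [wordWeight_cons, weight_inl] at hu; omega)
      · exact h2 e e' f
      · exact h4 e e' f
      · exact h3 e e₂ e₃ e₄
    · obtain ⟨g, rfl⟩ | ⟨e, e', rfl⟩ := eq_of_wordWeight_two (u := u)
        (by rw [wordWeight_cons, weight_inr] at hu; omega)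
      · exact h1 f g
      · exact h5 e e' f
  · exact hG.supported u hu

end CourantAlgebroid

end Theta
end CourantDirac

namespace CourantDirac

/-! ## The Dirac operator -/

section DiracOperator

open Filter Topology Module

variable {n : ℕ} {M : Type uM} [TopologicalSpace M] [ChartedSpace (EuclideanSpace ℝ (Fin n)) M]
  [IsManifold (𝓡 n) ∞ M] [T2Space M] [SecondCountableTopology M]
  {F : Type uF} [NormedAddCommGroup F] [NormedSpace ℝ F] [FiniteDimensional ℝ F]
  {E : M → Type uE} [∀ x, AddCommGroup (E x)] [∀ x, Module ℝ (E x)]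
  [∀ x, TopologicalSpace (E x)] [TopologicalSpace (TotalSpace F E)] [FiberBundle F E]
  [VectorBundle ℝ F E] [ContMDiffVectorBundle ∞ F E (𝓡 n)]
  {𝒞 : CourantAlgebroid n F E}

open SpinorBundle

namespace SpinorBundle

variable {P : SpinorBundle.{uM, uF, uE, w} 𝒞}

theorem transposed_letterOp (a : Letter n F E) :
    Transposed (P.letterOp a) (((P.sign : ℤ) : ℂ) ^ a.weight • P.letterOp a) := by
  rcases a with e | f
  · rw [weight_inl, pow_one]; exact transposed_c e
  · rw [weight_inr, pow_two, CourantAlgebroid.FrameChart.sign_mul_self, one_smul]; exact transposed_m f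

/-- Transposition reverses the two products. Restoring their order costs minus the sign of the
supercommutator, and each section contributes the sign of the pairing. -/
theorem Transposed.sbr_letterOp {A A' : P.Op} (h : Transposed A A') (hA : IsLocal A)
    (hA' : IsLocal A') (p : ℕ) (a : Letter n F E) :
    Transposed (P.sbr p a.weight A (P.letterOp a))
      ((-(-1) ^ (p * a.weight) * ((P.sign : ℤ) : ℂ) ^ a.weight) •
        P.sbr p a.weight A' (P.letterOp a)) := by
  have ha := isLocal_letterOp (P := P) a
  have hz : ∀ (z : ℂ) {B : P.Op}, IsLocal B → IsLocal (z • B) := fun z B hB ψ x hx v => by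
    rw [LinearMap.smul_apply, smul_val, hB ψ x hx v, smul_zero]
  have h1 := h.mul (transposed_letterOp a) ha hA'
  have h2 := ((transposed_letterOp a).mul h hA (hz _ ha)).smul (-(-1) ^ (p * a.weight))
  have h3 := h1.add h2 (hA.mul ha) (hz _ (ha.mul hA))
  have e1 : (-1 : ℂ) ^ (p * a.weight) * (-1) ^ (p * a.weight) = 1 := by
    rw [← mul_pow]; simp
  convert h3 using 1
  · rw [SpinorBundle.sbr, neg_one_pow_eq_smul, neg_smul, sub_eq_add_neg]
  · rw [SpinorBundle.sbr, neg_one_pow_eq_smul, smul_sub, smul_smul, smul_mul_assoc,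
      mul_smul_comm, smul_smul, sub_eq_neg_add, ← neg_smul]
    congr 2
    linear_combination ((P.sign : ℤ) : ℂ) ^ a.weight * e1

theorem eq_of_transposed {Z Z' : P.Op} (hZ : Z ∈ P.GF 2) (hZ' : Z' ∈ P.GF 2)
    (h : Transposed Z Z') : Z = Z' := by
  obtain ⟨f, rfl⟩ := (mem_filt_zero_iff Z).1 (mem_filt_iff.2 hZ)
  obtain ⟨f', rfl⟩ := (mem_filt_zero_iff Z').1 (mem_filt_iff.2 hZ')
  exact eq_of_transposed_mc h

theorem eq_zero_of_transposed_neg {Z : P.Op} (hZ : Z ∈ P.GF 2)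
    (h : Transposed Z ((-1 : ℂ) • Z)) : Z = 0 := by
  have h1 := eq_of_transposed hZ (Submodule.smul_mem _ _ hZ) h
  have h2 : (2 : ℂ) • Z = 0 := by rw [two_smul]; nth_rewrite 2 [h1]; simp
  exact (smul_eq_zero.1 h2).resolve_left two_ne_zero

variable (P) in
/-- The operator is skew for the pairing of half-densities, in the graded sense. -/
def Skew (A : P.Op) : Prop := Transposed A ((-((P.sign : ℤ) : ℂ)) • A)

theorem Skew.sub {A B : P.Op} (hA : P.Skew A) (hB : P.Skew B) (lA : IsLocal A) (lB : IsLocal B) :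
    P.Skew (A - B) := by
  have h := hA.add (hB.smul (-1)) lA
    (fun ψ x hx v => by rw [LinearMap.smul_apply, smul_val, lB ψ x hx v, smul_zero])
  rw [Skew, sub_eq_add_neg, ← neg_one_smul ℂ B, smul_add, smul_comm _ (-1 : ℂ)]
  exact h

/-- There are no skew operators of order one. -/
theorem Skew.eq_zero {X : P.Op} (hX : P.Skew X) (h : X ∈ P.GF 3) : X = 0 := by
  refine eq_zero_of_filt_one (mem_filt_iff.2 h) fun e => ?_
  -- `[X, c(e)]` is multiplication by a function, and the signs of the transposition multiply to
  -- `-1`. Multiplications are their own transposes, so it vanishes.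
  refine eq_zero_of_transposed_neg ((mem_GF_iff.1 h).2.2.2 e) ?_
  have h1 := Transposed.sbr_letterOp hX (isLocal_of_mem h)
    (isLocal_of_mem (Submodule.smul_mem _ _ h)) 1 (Sum.inl e)
  rw [weight_inl, sbr_smul_left, smul_smul] at h1
  have := CourantAlgebroid.FrameChart.sign_mul_self P.sign
  rw [show -(-1 : ℂ) ^ (1 * 1) * ((P.sign : ℤ) : ℂ) ^ 1 * -((P.sign : ℤ) : ℂ) = -1 by
    linear_combination -this] at h1
  exact h1

/-- With equal symbols in degree three the difference has order one, and there are no nonzero skew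
operators of this order. -/
theorem Skew.ext {A B : P.Op} (hA : P.Skew A) (hB : P.Skew B) (mA : A ∈ P.GF 5) (mB : B ∈ P.GF 5)
    (h : ∀ u, wordWeight u = 3 → P.iterSbr 3 A u = P.iterSbr 3 B u) : A = B :=
  sub_eq_zero.1 ((hA.sub hB (isLocal_of_mem mA) (isLocal_of_mem mB)).eq_zero
    (mem_GF_of_symbol_eq_zero (sub_mem mA mB) fun u hu => by
      rw [iterSbr_sub, h u hu, sub_self]))

/-- On every kind of word of weight three the signs multiply to `-ε`. The iterated commutators are
multiplications, so this says that the graded transpose `-ε A'` has the symbol of `A`. -/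
theorem transposed_iterSbr {A A' : P.Op} (mA : A ∈ P.GF 5) (mA' : A' ∈ P.GF 5)
    (h : Transposed A A') {u : List (Letter n F E)} (hu : wordWeight u = 3) :
    Transposed (P.iterSbr 3 A u) ((-((P.sign : ℤ) : ℂ)) • P.iterSbr 3 A' u) := by
  have hε := CourantAlgebroid.FrameChart.sign_mul_self P.sign
  have step : ∀ {i : ℕ} {B B' : P.Op}, B ∈ P.GF i → B' ∈ P.GF i → ∀ {z : ℂ},
      Transposed B (z • B') → ∀ p (a : Letter n F E), i % 2 = p % 2 →
      P.sbr p a.weight B (P.letterOp a) ∈ P.GF (i - a.weight) ∧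
      P.sbr p a.weight B' (P.letterOp a) ∈ P.GF (i - a.weight) ∧
      Transposed (P.sbr p a.weight B (P.letterOp a))
        ((-(-1) ^ (p * a.weight) * ((P.sign : ℤ) : ℂ) ^ a.weight * z) •
          P.sbr p a.weight B' (P.letterOp a)) := fun {i B B'} hB hB' z hz p a hi => by
    refine ⟨?_, ?_, ?_⟩
    · rw [sbr_mod (p' := i) (q' := a.weight) hi.symm rfl]; exact letter_sbr_mem hB a
    · rw [sbr_mod (p' := i) (q' := a.weight) hi.symm rfl]; exact letter_sbr_mem hB' a
    · have := hz.sbr_letterOp (isLocal_of_mem hB)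
        (isLocal_of_mem (Submodule.smul_mem _ _ hB')) p a
      rwa [sbr_smul_left, smul_smul] at this
  have conv : ∀ {B B' : P.Op} {z z' : ℂ}, Transposed B (z • B') → z = z' →
      Transposed B (z' • B') := fun h e => e ▸ h
  have h0 : Transposed A ((1 : ℂ) • A') := by rwa [one_smul]
  rcases eq_of_wordWeight_three hu with ⟨e, f, rfl⟩ | ⟨e, f, rfl⟩ | ⟨e₁, e₂, e₃, rfl⟩
  · obtain ⟨a1, a2, a3⟩ := step mA mA' h0 3 (Sum.inl e) rfl
    obtain ⟨-, -, b3⟩ := step a1 a2 a3 4 (Sum.inr f) rfl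
    refine conv b3 ?_
    simp only [weight_inl, weight_inr]
    linear_combination -((P.sign : ℤ) : ℂ) * hε
  · obtain ⟨a1, a2, a3⟩ := step mA mA' h0 3 (Sum.inr f) rfl
    obtain ⟨-, -, b3⟩ := step a1 a2 a3 5 (Sum.inl e) (by simp)
    refine conv b3 ?_
    simp only [weight_inl, weight_inr]
    linear_combination -((P.sign : ℤ) : ℂ) * hε
  · obtain ⟨a1, a2, a3⟩ := step mA mA' h0 3 (Sum.inl e₁) rfl
    obtain ⟨b1, b2, b3⟩ := step a1 a2 a3 4 (Sum.inl e₂) rfl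
    obtain ⟨-, -, c3⟩ := step b1 b2 b3 5 (Sum.inl e₃) (by simp)
    refine conv c3 ?_
    simp only [weight_inl]
    linear_combination -((P.sign : ℤ) : ℂ) * hε

/-- An operator of order three differs from minus its graded transpose by lower order. -/
theorem exists_skew {A A' : P.Op} (mA : A ∈ P.GF 5) (mA' : A' ∈ P.GF 5)
    (h : Transposed A A') (h' : Transposed A' A) :
    P.Skew ((1 / 2 : ℂ) • (A + (-((P.sign : ℤ) : ℂ)) • A')) ∧
      ∀ u, wordWeight u = 3 → P.iterSbr 3 ((1 / 2 : ℂ) • (A + (-((P.sign : ℤ) : ℂ)) • A')) u =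
        P.iterSbr 3 A u := by
  have hε := CourantAlgebroid.FrameChart.sign_mul_self P.sign
  refine ⟨?_, fun u hu => ?_⟩
  · have h1 := (h.add (h'.smul (-((P.sign : ℤ) : ℂ))) (isLocal_of_mem mA)
      (isLocal_of_mem (Submodule.smul_mem _ _ mA'))).smul (1 / 2)
    rw [Skew]
    convert h1 using 1
    rw [smul_comm, smul_add, smul_smul, neg_mul_neg, hε, one_smul, add_comm]
  · have hm : ∀ {B : P.Op}, B ∈ P.GF 5 → P.iterSbr 3 B u ∈ P.GF 2 := fun {B} hB => by
      have := iterSbr_mem hB u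
      rwa [hu, iterSbr_mod (p := 5) (q := 3) rfl] at this
    rw [iterSbr_smul, iterSbr_add, iterSbr_smul, ← eq_of_transposed (hm mA)
      (Submodule.smul_mem _ _ (hm mA')) (transposed_iterSbr mA mA' h hu), ← two_smul ℂ, smul_smul]
    norm_num

variable (P) in
theorem exists_dirac : ∃ D : P.Op, P.HasSymbol 3 D 𝒞.theta ∧ P.Skew D := by
  obtain ⟨A, A', hA, hA', h, h'⟩ := P.exists_operator 𝒞.theta_isGraded
  have mA : A ∈ P.GF 5 := mem_filt_iff.1 hA.1
  obtain ⟨h1, h2⟩ := exists_skew mA hA' h h'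
  exact ⟨_, ⟨mem_filt_iff.2 (Submodule.smul_mem _ _ (add_mem mA (Submodule.smul_mem _ _ hA'))),
    hA.2.1, fun u hu => by rw [h2 u hu, hA.2.2 u hu]⟩, h1⟩

variable (P) in
/-- The canonical generating Dirac operator. -/
def dirac : P.Op := P.exists_dirac.choose

variable (P) in
theorem dirac_hasSymbol : P.HasSymbol 3 P.dirac 𝒞.theta := P.exists_dirac.choose_spec.1

variable (P) in
theorem dirac_skew : P.Skew P.dirac := P.exists_dirac.choose_spec.2

variable (P) in
theorem dirac_mem : P.dirac ∈ P.GF 5 := mem_filt_iff.1 P.dirac_hasSymbol.1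

theorem sbr_even (p q : ℕ) (h : Even (p * q)) (A B : P.Op) : P.sbr p q A B = A * B - B * A := by
  rw [sbr, h.neg_one_pow, one_mul]

theorem sbr_odd (p q : ℕ) (h : Odd (p * q)) (A B : P.Op) : P.sbr p q A B = A * B + B * A := by
  rw [sbr, h.neg_one_pow, neg_one_mul, sub_neg_eq_add]

/-- The defining identities are the symbol relation on words of weight three, rewritten by
`Sym.eq_c` as identities between Clifford multiplications where the last letter is a section. -/
theorem isGeneratingDirac {D : P.Op} (h : P.HasSymbol 3 D 𝒞.theta) (hs : P.Skew D) :
    P.IsGeneratingDirac D where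
  odd := by
    have := (mem_GF_iff.1 (mem_filt_iff.1 h.1)).1
    rw [HasParity] at this ⊢
    rw [this]; simp [pow_succ]
  commutant W η hη ψ χ hχ x hx v := by
    rw [(mem_GF_iff.1 (mem_filt_iff.1 h.1)).2.1 W η hη ψ χ hχ x hx v]; norm_num [pow_succ]
  dirac_type f := by
    refine ⟨𝒞.codiff f, 𝒞.inner_codiff f, ?_⟩
    have := ((Sym.of_hasSymbol h).cons (Sum.inr f)).eq_c
    rwa [weight_inr, sbr_even 5 2 (by decide)] at this
  derived_bracket e₁ e₂ := by
    have := (((Sym.of_hasSymbol h).cons (Sum.inl e₁)).cons (Sum.inl e₂)).eq_c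
    rw [weight_inl, weight_inl, sbr_odd 5 1 (by decide), sbr_even 4 1 (by decide)] at this
    exact this.trans (congrArg P.c (𝒞.sharp_eq fun e => rfl))
  derived_anchor e f := by
    have := h.2.2 [Sum.inl e, Sum.inr f] rfl
    rw [iterSbr, iterSbr, iterSbr, weight_inl, weight_inr, sbr_odd 3 1 (by decide),
      sbr_even 4 2 (by decide)] at this
    exact this
  skew := (hasFormalTranspose_iff _ _).2 hs

/-- The converse of `isGeneratingDirac`; it reduces uniqueness of the Dirac operator to `Skew.ext`.
-/
theorem IsGeneratingDirac.hasSymbol {D : P.Op} (h : P.IsGeneratingDirac D) :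
    P.HasSymbol 3 D 𝒞.theta := by
  have hf : ∀ f, D * P.m f - P.m f * D = P.c (𝒞.codiff f) := fun f => by
    obtain ⟨α, h1, h2⟩ := h.dirac_type f
    rw [h2, 𝒞.eq_of_inner_eq (α := α) (β := 𝒞.codiff f) fun e => by rw [h1, 𝒞.inner_codiff]]
  have hp : P.HasParity 3 D := by
    have := h.odd
    rw [HasParity] at this ⊢
    rw [this]; simp [pow_succ]
  have hc : P.CommutesWithCommutant 3 D := fun W η hη ψ χ hχ x hx v => by
    rw [h.commutant W η hη ψ χ hχ x hx v]; norm_num [pow_succ]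
  refine ⟨mem_filt_iff.2 (mem_GF_iff.2 ⟨hp, hc, fun f => ?_, fun e => mem_GF_iff.2 ⟨?_, ?_,
    fun f => ?_, fun e' => ?_⟩⟩), 𝒞.theta_isGraded, fun u hu => ?_⟩
  · rw [sbr_even 3 0 (by decide), hf]; exact c_mem _
  · have := hp.sbr (c_parity e)
    rw [HasParity] at this ⊢
    rw [this]; simp [pow_succ]
  · intro W η hη ψ χ hχ x hx v
    rw [hc.sbr (c_commutes e) W η hη ψ χ hχ x hx v]; norm_num [pow_succ]
  · rw [sbr_odd 3 1 (by decide), sbr_even 2 0 (by decide), h.derived_anchor]; exact m_mem _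
  · rw [sbr_odd 3 1 (by decide), sbr_even 2 1 (by decide), h.derived_bracket]; exact c_mem _
  · rcases eq_of_wordWeight_three hu with ⟨e, f, rfl⟩ | ⟨e, f, rfl⟩ | ⟨e₁, e₂, e₃, rfl⟩
    · rw [iterSbr, iterSbr, iterSbr, weight_inl, weight_inr, sbr_odd 3 1 (by decide),
        sbr_even 4 2 (by decide)]
      exact h.derived_anchor e f
    · rw [iterSbr, iterSbr, iterSbr, weight_inl, weight_inr, sbr_even 3 2 (by decide),
        sbr_odd 5 1 (by decide)]
      refine (congrArg (fun T => T * P.c e + P.c e * T) (hf f)).trans ?_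
      rw [c_mul_add, 𝒞.inner_codiff]; rfl
    · rw [iterSbr, iterSbr, iterSbr, iterSbr, weight_inl, weight_inl, weight_inl,
        sbr_odd 3 1 (by decide), sbr_even 4 1 (by decide), sbr_odd 5 1 (by decide)]
      refine (congrArg (fun T => T * P.c e₃ + P.c e₃ * T) (h.derived_bracket e₁ e₂)).trans ?_
      rw [c_mul_add]; rfl

theorem dirac_unique {D : P.Op} (h : P.HasSymbol 3 D 𝒞.theta) (hs : P.Skew D) : D = P.dirac :=
  hs.ext P.dirac_skew (mem_filt_iff.1 h.1) P.dirac_mem fun u hu => by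
    rw [h.2.2 u hu, P.dirac_hasSymbol.2.2 u hu]

variable (P) in
-- `2 D² = [D, D]` has symbol `{θ, θ} = 0`, so `D²` has order two, and it is its own transpose
-- because `(-ε)² = 1`. Then `[D², f]` is a function equal to minus its transpose and `[D², c(e)]`
-- is skew of order one. Both vanish, and Schur's lemma applies.
theorem exists_dirac_sq : ∃ h, P.dirac * P.dirac = P.mc h := by
  have h1 := P.isQuantization.symbol_sbr 3 3 4 _ _ _ _ rfl P.dirac_hasSymbol P.dirac_hasSymbol
  have h2 : P.sbr 3 3 P.dirac P.dirac ∈ P.GF 4 :=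
    mem_GF_of_symbol_eq_zero (mem_filt_iff.1 h1.1) fun u hu => by
      rw [h1.2.2 u hu, 𝒞.poisson_theta_theta]; exact m_zero (P := P)
  rw [sbr_odd 3 3 (by decide), ← two_smul ℂ] at h2
  set Q := P.dirac * P.dirac with hQ
  have hQ4 : Q ∈ P.GF 4 := by
    have := Submodule.smul_mem _ (1 / 2 : ℂ) h2
    rwa [smul_smul, one_div_mul_cancel two_ne_zero, one_smul] at this
  have lD := isLocal_of_mem P.dirac_mem
  have hT : Transposed Q Q := by
    have := Transposed.mul P.dirac_skew P.dirac_skew lD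
      (isLocal_of_mem (Submodule.smul_mem _ _ P.dirac_mem))
    rwa [smul_mul_smul_comm, neg_mul_neg, CourantAlgebroid.FrameChart.sign_mul_self, one_smul] at this
  have lQ := isLocal_of_mem hQ4
  refine exists_scalar (fun f => ?_) (fun e => ?_) ?_
  · have h3 := hT.sbr_letterOp lQ lQ 4 (Sum.inr f)
    have h4 := letter_sbr_mem hQ4 (Sum.inr f)
    rw [weight_inr] at h3 h4
    have := eq_zero_of_transposed_neg h4 (by
      convert h3 using 2
      rw [pow_two ((P.sign : ℤ) : ℂ), CourantAlgebroid.FrameChart.sign_mul_self]; norm_num)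
    rw [sbr_even 4 2 (by decide)] at this
    exact sub_eq_zero.1 this
  · have h3 := hT.sbr_letterOp lQ lQ 4 (Sum.inl e)
    have h4 := letter_sbr_mem hQ4 (Sum.inl e)
    rw [weight_inl] at h3 h4
    have := Skew.eq_zero (by
      rw [Skew]
      convert h3 using 2
      norm_num) h4
    rw [sbr_even 4 1 (by decide)] at this
    exact sub_eq_zero.1 this
  · have := (mem_GF_iff.1 hQ4).1
    rw [HasParity, even_two.neg_one_pow, one_mul] at this
    exact this.symm

/-- Multiplying by a cutoff on both sides localizes an operator and keeps it skew. Moving the right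
factor to the left changes it by an operator of order one, invisible to the symbol of degree three.
-/
theorem iterSbr_m_conj {A : P.Op} (hA : A ∈ P.GF 5) (g : C^∞⟮𝓡 n, M; ℝ⟯)
    {u : List (Letter n F E)} (hu : wordWeight u = 3) :
    P.iterSbr 3 (P.m g * A * P.m g) u = P.m g * (P.m g * P.iterSbr 3 A u) := by
  obtain ⟨k, hk⟩ := (mem_filt_zero_iff (P.m g)).1 (mem_filt_iff.2 (m_mem g))
  have h1 : P.m g * A * P.m g = P.m g * (P.m g * A) + P.m g * P.sbr 3 0 A (P.m g) := by
    rw [sbr_even 3 0 (by decide)]; noncomm_ring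
  have h2 : P.m g * P.sbr 3 0 A (P.m g) ∈ P.GF 3 := m_mul_mem g ((mem_GF_iff.1 hA).2.2.1 g)
  rw [h1, iterSbr_add, iterSbr_eq_zero h2 (by omega), add_zero, hk, iterSbr_mc_mul, iterSbr_mc_mul]

theorem Skew.m_conj {A : P.Op} (h : P.Skew A) (mA : A ∈ P.GF 5) (g : C^∞⟮𝓡 n, M; ℝ⟯) :
    P.Skew (P.m g * A * P.m g) := by
  have h1 := ((transposed_m g).mul h (isLocal_of_mem mA) (isLocal_m g)).mul (transposed_m g)
    (isLocal_m g) ((isLocal_of_mem (Submodule.smul_mem _ _ mA)).mul (isLocal_m g))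
  rw [Skew]
  convert h1 using 1
  rw [smul_mul_assoc, mul_smul_comm, mul_assoc]

theorem m_conj_eq {A : P.Op} (hA : IsLocal A) {g : C^∞⟮𝓡 n, M; ℝ⟯} {x : P.U}
    (hg : ∀ᶠ y in 𝓝 (x : M), g y = 1) (ψ : P.HalfDensities) (v) :
    ((P.m g * A * P.m g) ψ).1 x v = (A ψ).1 x v := by
  rw [Module.End.mul_apply, Module.End.mul_apply, m_val, hg.self_of_nhds, one_smul]
  refine hA.congr ?_ v
  filter_upwards [val_eventually hg] with y hy v
  rw [m_val, hy, one_smul]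

end SpinorBundle

open SpinorBundle in
/-- In a frame chart, the canonical Dirac operator is natural. -/
theorem CourantAlgebroid.FrameChart.dirac_natural (L : 𝒞.FrameChart) {x : M} (hx : L.Flat x)
    (P P' : SpinorBundle.{uM, uF, uE, w} 𝒞) (fr : P.SpinorFrame L.o) (fr' : P'.SpinorFrame L.o)
    (X : (Fin fr.N → ℂ) →ₗ[ℝ] (Fin fr'.N → ℂ)) (hX : ∀ i z, X (fr.R.c i z) = fr'.R.c i (X z))
    {ψ ψ'} (h : ∀ᶠ y in 𝓝 x,
      (L.toLocalFrame fr').coef ψ' y = X ((L.toLocalFrame fr).coef ψ y)) :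
    (L.toLocalFrame fr').coef (P'.dirac ψ') x = X ((L.toLocalFrame fr).coef (P.dirac ψ) x) := by
  obtain ⟨χ, h1, -, h2⟩ := exists_bump (n := n) x (L.isOpen_flat.mem_nhds hx)
  -- `g` is supported where `χ` is one, so `g² χ θ = g² θ`.
  obtain ⟨g, h3, -, h4⟩ := exists_bump (n := n) x
    ((isOpen_setOfPred_eventually_nhds (p := fun y => χ y = 1)).mem_nhds h1)
  obtain ⟨A, A', hA, hS⟩ := L.exists_good_of_flat.{uM, uF, uE, w} 𝒞.theta_isGraded h2
  -- The transpose of `A` is `ε A'`, so its skew part is half of `A - ε · ε A'`. The two signs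
  -- cancel and the formula no longer involves the bundle.
  let B : OpFamily.{uM, uF, uE, w} L := fun P fr =>
    ((1 / 2 : ℝ) : ℂ) • (A P fr + ((-1 : ℝ) : ℂ) • A' P fr)
  have hB : L.Natural B := (hA.natural.add (hA.natural'.smul (-1))).smul (1 / 2)
  have key : ∀ (P : SpinorBundle.{uM, uF, uE, w} 𝒞) (fr : P.SpinorFrame L.o) ψ,
      (L.toLocalFrame fr).coef (P.dirac ψ) x = (L.toLocalFrame fr).coef (B P fr ψ) x := by
    intro P fr ψ
    have hε := sign_mul_self P.sign
    have h5 : ((P.sign : ℤ) : ℂ) ^ 5 = ((P.sign : ℤ) : ℂ) := by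
      rw [sign_pow_congr P.sign (i := 5) (j := 1) rfl, pow_one]
    have hm : A P fr ∈ P.GF 5 := hA.mem P fr
    have hm' : ((P.sign : ℤ) : ℂ) • A' P fr ∈ P.GF 5 := Submodule.smul_mem _ _ (hA.mem' P fr)
    have ht := hA.transposed P fr
    have ht' := (hA.transposed' P fr).smul ((P.sign : ℤ) : ℂ)
    rw [h5] at ht ht'
    rw [smul_smul, hε, one_smul] at ht'
    obtain ⟨hs, hsym⟩ := exists_skew hm hm' ht ht'
    have hBe : (1 / 2 : ℂ) • (A P fr + (-((P.sign : ℤ) : ℂ)) • ((P.sign : ℤ) : ℂ) • A' P fr) =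
        B P fr := by
      simp only [B]
      rw [smul_smul, neg_mul, hε]
      norm_num
    rw [hBe] at hs hsym
    have hBm : B P fr ∈ P.GF 5 :=
      Submodule.smul_mem _ _ (add_mem hm (Submodule.smul_mem _ _ (hA.mem' P fr)))
    have hc : ∀ {T : P.Op}, T ∈ P.GF 5 → P.m g * T * P.m g ∈ P.GF 5 := fun {T} hT =>
      GF_mul (j := 2) (m_mul_mem g hT) (m_mem g)
    -- `g D g` and `g B g` are skew with the same symbol, hence equal. Near `x`, where `g` is one,
    -- they act as `D` and `B`.
    have heq := (P.dirac_skew.m_conj P.dirac_mem g).ext (hs.m_conj hBm g) (hc P.dirac_mem) (hc hBm)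
      fun u hu => by
        rw [iterSbr_m_conj P.dirac_mem g hu, iterSbr_m_conj hBm g hu, P.dirac_hasSymbol.2.2 u hu,
          hsym u hu]
        have := (hS P fr).symbol u (by omega)
        rw [iterSbr_mod (p := 3 + 2) (q := 3) rfl] at this
        rw [this, ← m_mul, ← m_mul, ← m_mul, ← m_mul]
        congr 1
        ext y
        change g y * (g y * 𝒞.theta u y) = g y * (g y * (χ y * 𝒞.theta u y))
        by_cases hy : y ∈ tsupport g
        · rw [(h4 hy).self_of_nhds, one_mul]
        · rw [image_eq_zero_of_notMem_tsupport hy, zero_mul, zero_mul]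
    refine (LocalFrame.coef_eq (L := L.toLocalFrame fr) (x := ⟨x, fr.le hx.1⟩) hx.1 ?_)
    rw [LocalFrame.G_coef _ _ _ hx.1, ← m_conj_eq (isLocal_of_mem hBm) h3,
      ← m_conj_eq (isLocal_of_mem P.dirac_mem) h3, heq]
  rw [key, key]
  exact hB P P' fr fr' X hX ψ ψ' x hx.1 h

end DiracOperator
end CourantDirac

namespace CourantDirac

/-! ## Local isomorphisms of spinor bundles -/

section LocalIsomorphisms

open Filter Topology Module

variable {n : ℕ} {M : Type uM} [TopologicalSpace M] [ChartedSpace (EuclideanSpace ℝ (Fin n)) M]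
  [IsManifold (𝓡 n) ∞ M] [T2Space M] [SecondCountableTopology M]
  {F : Type uF} [NormedAddCommGroup F] [NormedSpace ℝ F] [FiniteDimensional ℝ F]
  {E : M → Type uE} [∀ x, AddCommGroup (E x)] [∀ x, Module ℝ (E x)]
  [∀ x, TopologicalSpace (E x)] [TopologicalSpace (TotalSpace F E)] [FiberBundle F E]
  [VectorBundle ℝ F E] [ContMDiffVectorBundle ∞ F E (𝓡 n)]
  {𝒞 : CourantAlgebroid n F E}

open SpinorBundle

/-- A change of basis multiplies both determinants by the same square, so one basis decides. -/
theorem gram_det_eq {V : Type*} [AddCommGroup V] [Module ℂ V] {β β' : V →ₗ[ℂ] V →ₗ[ℂ] ℂ} {N N' : ℕ}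
    (b : Basis (Fin N) ℂ V) (b' : Basis (Fin N') ℂ V)
    (h : (Matrix.of fun i j => β (b i) (b j)).det = (Matrix.of fun i j => β' (b i) (b j)).det) :
    (Matrix.of fun i j => β (b' i) (b' j)).det = (Matrix.of fun i j => β' (b' i) (b' j)).det := by
  obtain rfl : N = N' := by
    simpa using (finrank_eq_card_basis b).symm.trans (finrank_eq_card_basis b')
  have key : ∀ β : V →ₗ[ℂ] V →ₗ[ℂ] ℂ, (Matrix.of fun i j => β (b' i) (b' j)).det =
      (b.toMatrix b').det * (Matrix.of fun i j => β (b i) (b j)).det * (b.toMatrix b').det :=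
    fun β => by
      have h1 : ∀ c : Basis (Fin N) ℂ V,
          (Matrix.of fun i j => β (c i) (c j)) = LinearMap.BilinForm.toMatrix c β := fun c => by
        ext i j; simp
      rw [h1, h1, ← LinearMap.BilinForm.toMatrix_mul_basis_toMatrix b b' β, Matrix.det_mul,
        Matrix.det_mul, Matrix.det_transpose]
  rw [key, key, h]

theorem gram_det_ne_zero {V : Type*} [AddCommGroup V] [Module ℂ V] {β : V →ₗ[ℂ] V →ₗ[ℂ] ℂ}
    (hβ : β.Nondegenerate) {N : ℕ} (b : Basis (Fin N) ℂ V) :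
    (Matrix.of fun i j => β (b i) (b j)).det ≠ 0 := by
  have h1 : (Matrix.of fun i j => β (b i) (b j)) = LinearMap.BilinForm.toMatrix b β := by
    ext i j; simp
  rw [h1]
  exact (LinearMap.BilinForm.nondegenerate_iff_det_ne_zero b).1 hβ

theorem gram_det_smul {V V' : Type*} [AddCommGroup V] [Module ℂ V] [AddCommGroup V'] [Module ℂ V']
    (β : V' →ₗ[ℂ] V' →ₗ[ℂ] ℂ) {N : ℕ} (b : Fin N → V) {T T' : V →ₗ[ℂ] V'} {t : ℂ}
    (h : ∀ z, T' z = t • T z) : (Matrix.of fun i j => β (T' (b i)) (T' (b j))).det =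
      t ^ (2 * N) * (Matrix.of fun i j => β (T (b i)) (T (b j))).det := by
  have : (Matrix.of fun i j => β (T' (b i)) (T' (b j))) =
      (t ^ 2) • (Matrix.of fun i j => β (T (b i)) (T (b j))) := by
    ext i j
    simp only [Matrix.of_apply, Matrix.smul_apply, h, map_smul, LinearMap.smul_apply, smul_eq_mul]
    ring
  rw [this, Matrix.det_smul, Fintype.card_fin, pow_mul]

namespace SpinorBundle

variable {P P' : SpinorBundle.{uM, uF, uE, w} 𝒞}

namespace SpinorFrame

variable {W : Opens M} {o : 𝒞.OrthoFrame W} (fr : P.SpinorFrame o) (fr' : P'.SpinorFrame o)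

theorem pos : 0 < fr.N := by
  have := fr.nontrivial
  by_contra h
  have h0 : fr.N = 0 := by omega
  obtain ⟨a, b, hab⟩ := this.exists_pair_ne
  exact hab (funext fun i => absurd i.2 (by omega))

/-- The basis of a fibre given by a frame. -/
def basis (x : P.U) (hx : (x : M) ∈ W) : Basis (Fin fr.N) ℂ (P.S x) :=
  (Pi.basisFun ℂ (Fin fr.N)).map (fr.coeff x hx).symm

theorem basis_apply (x : P.U) (hx : (x : M) ∈ W) (i) :
    fr.basis x hx i = fr.G x (Pi.single i 1) := by
  rw [basis, Basis.map_apply, Pi.basisFun_apply]; rfl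

/-- The Gram determinant of the constant pairing in a frame. -/
def gram : ℂ := (Matrix.of fun i j => fr.B (Pi.single i 1) (Pi.single j 1)).det

theorem gram_eq (x : P.U) (hx : (x : M) ∈ W) :
    (Matrix.of fun i j => P.form x (fr.basis x hx i) (fr.basis x hx j)).det = fr.gram := by
  simp only [basis_apply, fr.form x hx, gram]

theorem gram_ne_zero {x : M} (hx : x ∈ W) : fr.gram ≠ 0 := by
  rw [← fr.gram_eq ⟨x, fr.le hx⟩ hx]
  exact gram_det_ne_zero (P.form_nondegenerate _) _

/-- Scaling an intertwiner by `t` multiplies the Gram determinant by `t^{2N}`, which takes every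
nonzero complex value. -/
theorem exists_normalized_intertwiner {x : M} (hx : x ∈ W) :
    ∃ X : (Fin fr.N → ℂ) →ₗ[ℂ] (Fin fr'.N → ℂ), (∀ i z, X (fr.R.c i z) = fr'.R.c i (X z)) ∧
      (∃ τ : ℤˣ, ∀ z, X (fr.R.γ z) = ((τ : ℤ) : ℂ) • fr'.R.γ (X z)) ∧
      (Matrix.of fun i j => fr'.B (X (Pi.single i 1)) (X (Pi.single j 1))).det = fr.gram := by
  have := fr.nontrivial
  have := fr'.nontrivial
  obtain ⟨X, h0, hX, τ, hτ⟩ := CliffRep.exists_intertwiner o.ε_mul fr.R fr'.R (RingHom.id ℂ)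
  have hb : Function.Bijective X := CliffRep.bijective_of_ne_zero fr.irr fr'.irr X h0 hX _
    (by rcases Int.units_eq_one_or τ with rfl | rfl <;> simp) hτ
  have hd : (Matrix.of fun i j => fr'.B (X (Pi.single i 1)) (X (Pi.single j 1))).det ≠ 0 := by
    have := gram_det_ne_zero (P'.form_nondegenerate ⟨x, fr'.le hx⟩)
      ((Pi.basisFun ℂ (Fin fr.N)).map ((LinearEquiv.ofBijective X hb).trans
        (fr'.coeff ⟨x, fr'.le hx⟩ hx).symm))
    have he : ∀ i, (Pi.basisFun ℂ (Fin fr.N)).map ((LinearEquiv.ofBijective X hb).trans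
        (fr'.coeff ⟨x, fr'.le hx⟩ hx).symm) i = fr'.G ⟨x, fr'.le hx⟩ (X (Pi.single i 1)) :=
      fun i => by rw [Basis.map_apply, Pi.basisFun_apply]; rfl
    simpa only [he, fr'.form ⟨x, fr'.le hx⟩ hx] using this
  obtain ⟨t, ht⟩ := IsAlgClosed.exists_pow_nat_eq
    (fr.gram / (Matrix.of fun i j => fr'.B (X (Pi.single i 1)) (X (Pi.single j 1))).det)
    (n := 2 * fr.N) (by have := fr.pos; omega)
  refine ⟨t • X, fun i z => ?_, ⟨τ, fun z => ?_⟩, ?_⟩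
  · rw [LinearMap.smul_apply, LinearMap.smul_apply, hX, map_smul]
  · rw [LinearMap.smul_apply, LinearMap.smul_apply, hτ, map_smul, smul_comm]
  · rw [gram_det_smul fr'.B (fun i => Pi.single i 1) (T := X) (t := t) fun z => rfl, ht,
      div_mul_cancel₀ _ hd]

theorem coeff_cliff (x : P.U) (hx : (x : M) ∈ W) (a : E x) (z) :
    P.cliff x a (fr.G x z) =
      fr.G x (∑ i, (o.ε i * 𝒞.pairing x a (o.e i x)) • fr.R.c i z) := by
  conv_lhs => rw [o.expand hx a]
  rw [map_sum, LinearMap.sum_apply, map_sum]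
  refine Finset.sum_congr rfl fun i _ => ?_
  rw [map_smul, LinearMap.smul_apply, fr.cliff x hx, map_real_smul]

end SpinorFrame

theorem exists_localIso {x₀ : M} (h : x₀ ∈ P.U) (h' : x₀ ∈ P'.U) :
    ∃ (W : Opens M) (g : _), x₀ ∈ W ∧ SpinorBundle.IsLocalIso P P' W g := by
  classical
  obtain ⟨L, -, hL, ⟨fr⟩, ⟨fr'⟩⟩ := exists_frameChart₂ P P' h h' (O := ⊤) trivial
  obtain ⟨X, hX, ⟨τ, hτ⟩, hgram⟩ := fr.exists_normalized_intertwiner fr' hL.1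
  let g : ∀ (x : M) (h : x ∈ P.U) (h' : x ∈ P'.U), P.S ⟨x, h⟩ →ₗ[ℂ] P'.S ⟨x, h'⟩ := fun x h h' =>
    if hx : x ∈ L.W then fr'.G ⟨x, h'⟩ ∘ₗ X ∘ₗ (fr.coeff ⟨x, h⟩ hx).toLinearMap else 0
  have hg : ∀ x h h', x ∈ L.W → ∀ z, g x h h' (fr.G ⟨x, h⟩ z) = fr'.G ⟨x, h'⟩ (X z) :=
    fun x h h' hx z => by simp [g, hx]
  refine ⟨L.W, g, hL.1, fr.le, fr'.le, fun s s' hs x hx hsx => ?_, fun x hx a s => ?_,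
    ⟨τ, fun x hx s => ?_⟩, fun x hx N b => ?_⟩
  · let U : M → Fin fr.N → ℂ := fun y =>
      if hy : y ∈ L.W then fr.coeff ⟨y, fr.le hy⟩ hy (s ⟨y, fr.le hy⟩) else 0
    have hU : ∀ y (hy : y ∈ L.W), fr.G ⟨y, fr.le hy⟩ (U y) = s ⟨y, fr.le hy⟩ := fun y hy => by
      simp [U, hy]
    have h1 : ContMDiffAt (𝓡 n) 𝓘(ℝ, Fin fr.N → ℂ) ∞ U x :=
      (contMDiffAt_subtype_iff (U := P.U) (x := ⟨x, fr.le hx⟩)).1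
        (fr.coefficients_smooth hx hsx ((val_eventually (L.W.isOpen.mem_nhds hx)).mono
          fun y hy => hU y hy))
    have h2 : ContMDiffAt (𝓡 n) 𝓘(ℝ, Fin fr'.N → ℂ) ∞ (fun y => X (U y)) x :=
      (LinearMap.toContinuousLinearMap (X.restrictScalars ℝ)).contMDiff.contMDiffAt.comp x h1
    have h3 := fr'.smooth_apply (x := ⟨x, fr'.le hx⟩) hx
      ((contMDiffAt_subtype_iff (U := P'.U) (x := ⟨x, fr'.le hx⟩)).2 h2)
    refine h3.congr_of_eventuallyEq ?_
    filter_upwards [val_eventually (x := ⟨x, fr'.le hx⟩) (L.W.isOpen.mem_nhds hx)] with y hy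
    have := hs y hy
    rw [← hU y hy, hg y _ _ hy] at this
    exact congrArg (TotalSpace.mk' P'.V y) this
  · obtain ⟨z, rfl⟩ := (fr.bijective ⟨x, fr.le hx⟩ hx).2 s
    rw [fr.coeff_cliff ⟨x, fr.le hx⟩ hx, hg _ _ _ hx, hg _ _ _ hx,
      fr'.coeff_cliff ⟨x, fr'.le hx⟩ hx, map_sum]
    congr 1
    refine Finset.sum_congr rfl fun i _ => ?_
    rw [map_real_smul, hX]
  · obtain ⟨z, rfl⟩ := (fr.bijective ⟨x, fr.le hx⟩ hx).2 s
    rw [fr.parity ⟨x, fr.le hx⟩ hx, hg _ _ _ hx, hg _ _ _ hx, hτ, map_smul,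
      fr'.parity ⟨x, fr'.le hx⟩ hx]
  · refine gram_det_eq (β := (P'.form ⟨x, fr'.le hx⟩).compl₁₂ (g x (fr.le hx) (fr'.le hx))
      (g x (fr.le hx) (fr'.le hx))) (fr.basis ⟨x, fr.le hx⟩ hx) b ?_
    rw [fr.gram_eq ⟨x, fr.le hx⟩ hx, ← hgram]
    simp only [LinearMap.compl₁₂_apply, fr.basis_apply, hg _ _ _ hx,
      fr'.form ⟨x, fr'.le hx⟩ hx]

theorem coef_mc {L : 𝒞.FrameChart} (fr : P.SpinorFrame L.o) (h) (ψ : P.HalfDensities) {x : M}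
    (hx : x ∈ L.W) : (L.toLocalFrame fr).coef (P.mc h ψ) x =
      h ⟨x, fr.le hx⟩ • (L.toLocalFrame fr).coef ψ x := by
  refine LocalFrame.coef_eq (L := L.toLocalFrame fr) (x := ⟨x, fr.le hx⟩) hx ?_
  rw [map_smul, LocalFrame.G_coef _ _ ⟨x, fr.le hx⟩ hx, mc_val]

theorem exists_constant_coef {L : 𝒞.FrameChart} (fr : P.SpinorFrame L.o) {x : M} (hx : x ∈ L.W)
    (z : Fin fr.N → ℂ) : ∃ ψ, ∀ᶠ y in 𝓝 x, (L.toLocalFrame fr).coef ψ y = z := by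
  obtain ⟨Ψ, hΨ⟩ := fr.exists_halfDensities L.hκ ⟨x, fr.le hx⟩ (L.le hx) hx
  obtain ⟨O, hO, hOU, h⟩ := eventually_of_eventually_val hΨ
  refine ⟨Ψ z, ?_⟩
  filter_upwards [O.isOpen.mem_nhds hO, L.W.isOpen.mem_nhds hx] with y hy hyW
  exact LocalFrame.coef_eq (L := L.toLocalFrame fr) (x := ⟨y, fr.le hyW⟩) hyW
    (h ⟨y, fr.le hyW⟩ hy z).symm

/-- The squares of the Dirac operators are compared by semilinear maps. -/
theorem dirac_sq_eq {f f'} (hf : P.dirac * P.dirac = P.mc f) (hf' : P'.dirac * P'.dirac = P'.mc f')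
    (σ : ℂ →+* ℂ) (hσ : ∀ r : ℝ, σ r = r) {x : M} (h : x ∈ P.U) (h' : x ∈ P'.U) :
    f' ⟨x, h'⟩ = σ (f ⟨x, h⟩) := by
  obtain ⟨L, -, hL, ⟨fr⟩, ⟨fr'⟩⟩ := exists_frameChart₂ P P' h h' (O := ⊤) trivial
  have := fr.nontrivial
  have := fr'.nontrivial
  -- Regarded as a real linear map, `X` passes through the Dirac operators twice by naturality,
  -- whereas the scalar `f` passes through `X` as `σ f`. A constant spinor with nonzero image
  -- separates the two.
  obtain ⟨X, h0, hX, -⟩ := CliffRep.exists_intertwiner L.o.ε_mul fr.R fr'.R σ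
  let Y : (Fin fr.N → ℂ) →ₗ[ℝ] (Fin fr'.N → ℂ) :=
    { toFun := X
      map_add' := map_add X
      map_smul' := fun r z => by
        rw [← Complex.coe_smul, X.map_smulₛₗ, hσ, Complex.coe_smul]; rfl }
  obtain ⟨z, hz⟩ : ∃ z, X z ≠ 0 := by
    by_contra! h
    exact h0 (LinearMap.ext h)
  obtain ⟨ψ, hψ⟩ := exists_constant_coef fr hL.1 z
  obtain ⟨ψ', hψ'⟩ := exists_constant_coef fr' hL.1 (X z)
  have h1 : ∀ᶠ y in 𝓝 x, (L.toLocalFrame fr').coef ψ' y = Y ((L.toLocalFrame fr).coef ψ y) := by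
    filter_upwards [hψ, hψ'] with y hy hy'
    rw [hy, hy']; rfl
  have h2 : ∀ᶠ y in 𝓝 x, (L.toLocalFrame fr').coef (P'.dirac ψ') y =
      Y ((L.toLocalFrame fr).coef (P.dirac ψ) y) := by
    filter_upwards [eventually_eventually_nhds.2 h1, L.isOpen_flat.mem_nhds hL] with y hy hyL
    exact L.dirac_natural hyL P P' fr fr' Y hX hy
  have h3 := L.dirac_natural hL P P' fr fr' Y hX h2
  rw [← Module.End.mul_apply, ← Module.End.mul_apply, hf, hf', coef_mc _ _ _ hL.1,
    coef_mc _ _ _ hL.1, hψ.self_of_nhds, hψ'.self_of_nhds] at h3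
  have h4 : f' ⟨x, h'⟩ • X z = σ (f ⟨x, h⟩) • X z := h3.trans (X.map_smulₛₗ _ _)
  exact smul_left_injective _ hz h4

variable (𝒞) in
-- In `dirac_sq_eq`, complex conjugation on one bundle shows that the scalar is real, and the
-- identity shows that it does not depend on the bundle. Spinor bundles exist near every point, so
-- the scalars define a function on `M`.
theorem exists_dirac_sq_eq_m : ∃ f : C^∞⟮𝓡 n, M; ℝ⟯,
    ∀ P : SpinorBundle.{uM, uF, uE, w} 𝒞, P.dirac * P.dirac = P.m f := by
  choose f hf using fun P : SpinorBundle.{uM, uF, uE, w} 𝒞 => P.exists_dirac_sq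
  choose Q hQ using 𝒞.exists_spinorBundle
  let F₀ : M → ℝ := fun x => (f (Q x) ⟨x, hQ x⟩).re
  have key : ∀ (P : SpinorBundle.{uM, uF, uE, w} 𝒞) (x : P.U), f P x = F₀ x := fun P x => by
    have h1 := dirac_sq_eq (hf P) (hf P) (starRingEnd ℂ) Complex.conj_ofReal x.2 x.2
    have h2 := dirac_sq_eq (hf P) (hf (Q x)) (RingHom.id ℂ) (fun _ => rfl) x.2 (hQ x)
    simp only [F₀, h2, RingHom.id_apply]
    exact (Complex.conj_eq_iff_re.1 h1.symm).symm
  have hs : ContMDiff (𝓡 n) 𝓘(ℝ, ℝ) ∞ F₀ := fun x => by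
    refine (contMDiffAt_subtype_iff (U := (Q x).U) (x := ⟨x, hQ x⟩)).1 ?_
    refine ((Complex.reCLM.contMDiff.comp (f (Q x)).contMDiff) ⟨x, hQ x⟩).congr_of_eventuallyEq
      (Eventually.of_forall fun y => ?_)
    change F₀ y = (f (Q x) y).re
    rw [key, Complex.ofReal_re]
  refine ⟨⟨F₀, hs⟩, fun P => ?_⟩
  rw [hf]
  refine P.ext_op fun ψ x v => ?_
  rw [mc_val, key, Complex.coe_smul]
  rfl

/-- In constant frames the isomorphism is a family of intertwiners `T y`. By Schur's lemma `T y` is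
a multiple `t` of `T x`, preservation of Gram determinants gives `t^{2N} = 1`, and continuity forces
`t = 1` near `x`. The isomorphism is therefore a constant matrix there, and `dirac_natural` applies.
-/
theorem IsLocalIso.dirac_apply {W : Opens M}
    {g : ∀ (x : M) (h : x ∈ P.U) (h' : x ∈ P'.U), P.S ⟨x, h⟩ →ₗ[ℂ] P'.S ⟨x, h'⟩}
    (hg : IsLocalIso P P' W g) {ψ : P.HalfDensities} {ψ' : P'.HalfDensities}
    (hψ : ∀ x (h : x ∈ P.U) (h' : x ∈ P'.U), x ∈ W → ∀ v,
      ψ'.1 ⟨x, h'⟩ v = g x h h' (ψ.1 ⟨x, h⟩ v))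
    {x : M} (h : x ∈ P.U) (h' : x ∈ P'.U) (hx : x ∈ W) (v) :
    (P'.dirac ψ').1 ⟨x, h'⟩ v = g x h h' ((P.dirac ψ).1 ⟨x, h⟩ v) := by
  classical
  obtain ⟨L, hLW, hL, ⟨fr⟩, ⟨fr'⟩⟩ := exists_frameChart₂ P P' h h' hx
  have := fr.nontrivial
  let T : M → (Fin fr.N → ℂ) →ₗ[ℂ] (Fin fr'.N → ℂ) := fun y => if hy : y ∈ L.W then
    (fr'.coeff ⟨y, fr'.le hy⟩ hy).toLinearMap ∘ₗ g y (fr.le hy) (fr'.le hy) ∘ₗ fr.G ⟨y, fr.le hy⟩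
    else 0
  have hT : ∀ y (hy : y ∈ L.W) z, fr'.G ⟨y, fr'.le hy⟩ (T y z) =
      g y (fr.le hy) (fr'.le hy) (fr.G ⟨y, fr.le hy⟩ z) := fun y hy z => by simp [T, hy]
  have hTc : ∀ y ∈ L.W, ∀ i z, T y (fr.R.c i z) = fr'.R.c i (T y z) := fun y hy i z => by
    refine (fr'.bijective ⟨y, fr'.le hy⟩ hy).1 ?_
    rw [hT y hy, ← fr.cliff ⟨y, fr.le hy⟩ hy, hg.cliff y (hLW hy), ← hT y hy,
      fr'.cliff ⟨y, fr'.le hy⟩ hy]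
  obtain ⟨τ, hτ⟩ := hg.parity
  have hTγ : ∀ y ∈ L.W, ∀ z, T y (fr.R.γ z) = ((τ : ℤ) : ℂ) • fr'.R.γ (T y z) := fun y hy z => by
    refine (fr'.bijective ⟨y, fr'.le hy⟩ hy).1 ?_
    rw [hT y hy, ← fr.parity ⟨y, fr.le hy⟩ hy, hτ y (hLW hy), ← hT y hy,
      fr'.parity ⟨y, fr'.le hy⟩ hy, map_smul]
  have hgram : ∀ y ∈ L.W, (Matrix.of fun i j =>
      fr'.B (T y (Pi.single i 1)) (T y (Pi.single j 1))).det = fr.gram := fun y hy => by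
    have := hg.gram y (hLW hy) fr.N (fr.basis ⟨y, fr.le hy⟩ hy)
    rw [fr.gram_eq ⟨y, fr.le hy⟩ hy] at this
    rw [← this]
    simp only [fr.basis_apply, ← hT y hy, fr'.form ⟨y, fr'.le hy⟩ hy]
  have hne : fr.gram ≠ 0 := fr.gram_ne_zero hL.1
  have hT0 : T x ≠ 0 := fun h0 => hne <| by
    rw [← hgram x hL.1]
    simp only [h0, LinearMap.zero_apply, map_zero]
    exact Matrix.det_eq_zero_of_row_eq_zero ⟨0, fr.pos⟩ fun _ => rfl
  have hτ0 : ((τ : ℤ) : ℂ) ≠ 0 := by rcases Int.units_eq_one_or τ with rfl | rfl <;> simp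
  have hb : Function.Bijective (T x) := CliffRep.bijective_of_ne_zero fr.irr fr'.irr (T x) hT0
    (hTc x hL.1) _ hτ0 (hTγ x hL.1)
  let e₀ := LinearEquiv.ofBijective (T x) hb
  have hscal : ∀ y ∈ L.W, ∃ t : ℂ, t ^ (2 * fr.N) = 1 ∧ ∀ z, T y z = t • T x z := fun y hy => by
    have hin : ∀ w, T x (e₀.symm w) = w := e₀.apply_symm_apply
    obtain ⟨t, ht⟩ := CliffRep.schur fr.irr (e₀.symm.toLinearMap ∘ₗ T y)
      (fun i z => hb.1 (by
        simp only [LinearMap.comp_apply, LinearEquiv.coe_coe, hin, hTc x hL.1, hTc y hy]))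
      (fun z => hb.1 (by
        simp only [LinearMap.comp_apply, LinearEquiv.coe_coe, hin, hTγ x hL.1, hTγ y hy]))
    have ht' : ∀ z, T y z = t • T x z := fun z => by
      rw [← map_smul, ← ht z, LinearMap.comp_apply, LinearEquiv.coe_coe, hin]
    refine ⟨t, ?_, ht'⟩
    have := gram_det_smul fr'.B (fun i : Fin fr.N => (Pi.single i 1 : Fin fr.N → ℂ)) ht'
    rw [hgram y hy, hgram x hL.1] at this
    exact mul_right_cancel₀ hne (this.symm.trans (one_mul _).symm)
  have hcont : ∀ z, ContinuousAt (fun y => T y z) x := fun z => by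
    have h1 : P'.SmoothAt (fun y : P'.U => if hy : (y : M) ∈ W then
        g y (hg.left hy) y.2 (fr.G ⟨y, hg.left hy⟩ z) else 0) ⟨x, h'⟩ :=
      hg.smooth (fun y => fr.G y z) _ (fun y hy => by simp only [hy, dite_true]) x hx
        (fr.smooth z ⟨x, h⟩ hL.1)
    have h2 := fr'.coefficients_smooth (x := ⟨x, h'⟩) hL.1 h1 (u := fun y => T y z) <| by
      filter_upwards [val_eventually (x := ⟨x, h'⟩) (L.W.isOpen.mem_nhds hL.1)] with y hy
      rw [dif_pos (hLW hy)]
      exact hT y hy z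
    exact ((contMDiffAt_subtype_iff (U := P'.U) (x := ⟨x, h'⟩)).1 h2).continuousAt
  obtain ⟨z, hz⟩ : ∃ z, T x z ≠ 0 := by
    by_contra! h
    exact hT0 (LinearMap.ext h)
  obtain ⟨j, hj⟩ := Function.ne_iff.1 hz
  have hq : ContinuousAt (fun y => T y z j / T x z j) x :=
    (((continuous_apply j).continuousAt).comp (hcont z)).div_const _
  -- The roots of unity other than one form a finite, hence closed, set, which a continuous ratio
  -- with value one at `x` avoids near `x`.
  have hfin : {t : ℂ | t ^ (2 * fr.N) = 1 ∧ t ≠ 1}.Finite := by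
    refine ((Polynomial.nthRoots (2 * fr.N) (1 : ℂ)).toFinset.finite_toSet).subset fun t ht => ?_
    have := fr.pos
    simpa [Polynomial.mem_nthRoots (show 0 < 2 * fr.N by omega)] using ht.1
  have hev : ∀ᶠ y in 𝓝 x, ∀ w, T y w = T x w := by
    have h1 : {t : ℂ | t ^ (2 * fr.N) = 1 ∧ t ≠ 1}ᶜ ∈ 𝓝 (T x z j / T x z j) := by
      refine hfin.isClosed.isOpen_compl.mem_nhds fun h => h.2 (div_self hj)
    filter_upwards [hq.eventually h1, L.W.isOpen.mem_nhds hL.1] with y hy hyW w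
    obtain ⟨t, ht, hty⟩ := hscal y hyW
    have : T y z j / T x z j = t := by
      rw [hty, Pi.smul_apply, smul_eq_mul, mul_div_cancel_right₀ _ hj]
    rw [this] at hy
    rw [hty, show t = 1 from of_not_not fun h1 => hy ⟨ht, h1⟩, one_smul]
  have hcoef : ∀ᶠ y in 𝓝 x, (L.toLocalFrame fr').coef ψ' y =
      (T x).restrictScalars ℝ ((L.toLocalFrame fr).coef ψ y) := by
    filter_upwards [hev, L.W.isOpen.mem_nhds hL.1] with y hy hyW
    refine LocalFrame.coef_eq (L := L.toLocalFrame fr') (x := ⟨y, fr'.le hyW⟩) hyW ?_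
    rw [hψ y (fr.le hyW) (fr'.le hyW) (hLW hyW), LinearMap.restrictScalars_apply, ← hy,
      hT y hyW, LocalFrame.G_coef (L := L.toLocalFrame fr) _ ⟨y, fr.le hyW⟩ hyW]
  have hD := L.dirac_natural hL P P' fr fr' ((T x).restrictScalars ℝ) (hTc x hL.1) hcoef
  have hD' : (P'.dirac ψ').1 ⟨x, h'⟩ (coordFrame L.κ x) =
      g x h h' ((P.dirac ψ).1 ⟨x, h⟩ (coordFrame L.κ x)) := by
    rw [← LocalFrame.G_coef (L := L.toLocalFrame fr') _ ⟨x, h'⟩ hL.1, hD,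
      LinearMap.restrictScalars_apply, hT x hL.1,
      LocalFrame.G_coef (L := L.toLocalFrame fr) _ ⟨x, h⟩ hL.1]
  obtain ⟨A, rfl, -⟩ := exists_map_coordFrame L.hκ (L.le hL.1) v
  rw [(P'.dirac ψ').2.1, (P.dirac ψ).2.1, hD', map_smul]

end SpinorBundle
end LocalIsomorphisms
end CourantDirac

end

/-- Every Courant algebroid has a canonical generating Dirac operator on half-densities of
spinors; its square is a scalar function, its derived brackets are the bracket and the anchor, and
it quantizes the cubic function of the associated dg symplectic manifold. -/
theorem mainTheorem5 {n : ℕ} {M : Type uM} [TopologicalSpace M]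
    [ChartedSpace (EuclideanSpace ℝ (Fin n)) M] [IsManifold (𝓡 n) ∞ M]
    [T2Space M] [SecondCountableTopology M]
    {F : Type uF} [NormedAddCommGroup F] [NormedSpace ℝ F] [FiniteDimensional ℝ F]
    {E : M → Type uE} [∀ x, AddCommGroup (E x)] [∀ x, Module ℝ (E x)]
    [∀ x, TopologicalSpace (E x)] [TopologicalSpace (TotalSpace F E)] [FiberBundle F E]
    [VectorBundle ℝ F E] [ContMDiffVectorBundle ∞ F E (𝓡 n)]
    (𝒞 : CourantAlgebroid n F E) :
    -- the associated dg symplectic manifold: a cubic function `θ` with `{θ, θ} = 0`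
    𝒞.IsGradedFunction 3 𝒞.theta ∧ 𝒞.poisson 3 𝒞.theta 𝒞.theta = 0 ∧
    -- spinor bundles exist locally and are locally isomorphic
    (∀ x : M, ∃ P : SpinorBundle.{uM, uF, uE, w} 𝒞, x ∈ P.U) ∧
    (∀ (P P' : SpinorBundle.{uM, uF, uE, w} 𝒞) (x : M), x ∈ P.U → x ∈ P'.U →
      ∃ (W : Opens M) (g : _), x ∈ W ∧ SpinorBundle.IsLocalIso P P' W g) ∧
    -- on every spinor bundle the operators form a quantization of the graded Poisson algebra
    (∀ P : SpinorBundle.{uM, uF, uE, w} 𝒞, P.IsQuantization) ∧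
    -- and there is a canonical generating Dirac operator
    ∃ D : ∀ P : SpinorBundle.{uM, uF, uE, w} 𝒞, P.Op,
      (∀ P : SpinorBundle.{uM, uF, uE, w} 𝒞,
        P.IsGeneratingDirac (D P) ∧ ∀ D' : P.Op, P.IsGeneratingDirac D' → D' = D P) ∧
      (∀ P : SpinorBundle.{uM, uF, uE, w} 𝒞, P.HasSymbol 3 (D P) 𝒞.theta) ∧
      (∃ f : C^∞⟮𝓡 n, M; ℝ⟯, ∀ P : SpinorBundle.{uM, uF, uE, w} 𝒞, D P * D P = P.m f) ∧
      (∀ (P P' : SpinorBundle.{uM, uF, uE, w} 𝒞) W g, SpinorBundle.IsLocalIso P P' W g →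
        ∀ (ψ : P.HalfDensities) (ψ' : P'.HalfDensities),
          (∀ x (h : x ∈ P.U) (h' : x ∈ P'.U), x ∈ W → ∀ v,
            ψ'.1 ⟨x, h'⟩ v = g x h h' (ψ.1 ⟨x, h⟩ v)) →
          ∀ x (h : x ∈ P.U) (h' : x ∈ P'.U), x ∈ W → ∀ v,
            (D P' ψ').1 ⟨x, h'⟩ v = g x h h' ((D P ψ).1 ⟨x, h⟩ v)) := by
  refine ⟨𝒞.theta_isGraded, 𝒞.poisson_theta_theta, 𝒞.exists_spinorBundle,
    fun P P' x h h' => SpinorBundle.exists_localIso h h', SpinorBundle.isQuantization,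
    SpinorBundle.dirac, fun P => ⟨SpinorBundle.isGeneratingDirac P.dirac_hasSymbol P.dirac_skew,
      fun D' hD' => SpinorBundle.dirac_unique hD'.hasSymbol
        ((SpinorBundle.hasFormalTranspose_iff _ _).1 hD'.skew)⟩,
    SpinorBundle.dirac_hasSymbol, SpinorBundle.exists_dirac_sq_eq_m 𝒞,
    fun P P' W g hg ψ ψ' hψ x h h' hx v => hg.dirac_apply hψ h h' hx v⟩
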